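/- **Proposition.** Fix $n\ge 1$, a field $\mathbb K$ with $\operatorname{char}\mathbb K\ne 2$, and the following data. *Root data.* Let $I=\{1,\dots,n\}$, with parity $p(n)=\bar 1$ and $p(i)=\bar 0$ for $i<n$. Let $A=(a_{ij})$ be the matrix with $a_{ii}=2$, $a_{n,n-1}=-2$, $a_{i,j}=-1$ for all other pairs with $|i-j|=1$, and $a_{ij}=0$ otherwise; let $D=\operatorname{diag}(s_1,\dots,s_n)=\operatorname{diag}(2,\dots,2,1)$. Put $Q^+=\bigoplus_{i\in I}\mathbb Z_{\ge0}\alpha_i$, with the symmetric bilinear form $(\alpha_i,\alpha_j)=s_ia_{ij}$ and the additive extension of $p(\alpha_i)=p(i)$. Choose an orientation of the diagram $1-2-\cdots-n$ and let $d_{ij}$ be the number of arrows from $i$ to $j$ (so $d_{ij}+d_{ji}=1$ if $|i-j|=1$, and $d_{ij}=0$ otherwise). Let $Q_{ii}(u,v)=0$, let $Q_{ij}(u,v)=(-1)^{d_{ij}}(u^{2/s_i}-v^{2/s_j})$ if $|i-j|=1$, and $Q_{ij}(u,v)=1$ if $|i-j|>1$. *The algebra.* For $\nu\in Q^+$ of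 height $d$ let $I^\nu$ be the set of words $\mathbf i=(i_1,\dots,i_d)\in I^d$ with $\alpha_{i_1}+\dots+\alpha_{i_d}=\nu$, and let $s_r\cdot\mathbf i$ be $\mathbf i$ with its $r$-th and $(r+1)$-st letters exchanged. The spin quiver Hecke algebra $\mathcal H^-(\nu)$ is the unital $\mathbb K$-algebra with generators $e(\mathbf i)$ ($\mathbf i\in I^\nu$), $y_1,\dots,y_d$, $\tau_1,\dots,\tau_{d-1}$ and relations $$e(\mathbf i)e(\mathbf j)=\delta_{\mathbf i\mathbf j}e(\mathbf i),\quad \sum_{\mathbf i}e(\mathbf i)=1,\quad y_re(\mathbf i)=e(\mathbf i)y_r,\quad \tau_re(\mathbf i)=e(s_r\cdot\mathbf i)\tau_r,$$ $$y_ry_se(\mathbf i)=(-1)^{p(i_r)p(i_s)}y_sy_re(\mathbf i)\ (r\ne s),\qquad \tau_ry_se(\mathbf i)=(-1)^{p(i_r)p(i_{r+1})p(i_s)}y_s\tau_re(\mathbf i)\ (s\ne r,r+1),$$ $$\tau_r\tau_se(\mathbf i)=(-1)^{p(i_r)p(i_{r+1})p(i_s)p(i_{s+1})}\tau_s\tau_re(\mathbf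 i)\ (|r-s|>1),$$ $$\tau_ry_{r+1}e(\mathbf i)=\big((-1)^{p(i_r)p(i_{r+1})}y_r\tau_r+\delta_{i_r,i_{r+1}}\big)e(\mathbf i),\qquad y_{r+1}\tau_re(\mathbf i)=\big((-1)^{p(i_r)p(i_{r+1})}\tau_ry_r+\delta_{i_r,i_{r+1}}\big)e(\mathbf i),$$ $$\tau_r^2e(\mathbf i)=Q_{i_r,i_{r+1}}(y_r,y_{r+1})e(\mathbf i),\qquad (\tau_{r+1}\tau_r\tau_{r+1}-\tau_r\tau_{r+1}\tau_r)e(\mathbf i)=R\,e(\mathbf i),$$ where, with $Q=Q_{i_r,i_{r+1}}$, $$R=\begin{cases}\dfrac{Q(y_{r+2},y_{r+1})-Q(y_r,y_{r+1})}{y_{r+2}-y_r}&\text{if } i_r=i_{r+2}\ne n,\\[2mm](-1)^{p(i_{r+1})}(y_{r+2}-y_r)\dfrac{Q(y_{r+2},y_{r+1})-Q(y_r,y_{r+1})}{y_{r+2}^2-y_r^2}&\text{if } i_r=i_{r+2}=n,\\[2mm]0&\text{otherwise;}\end{cases}$$ the two quotients are the constant $(-1)^{d_{i_r,i_{r+1}}}$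 if $|i_r-i_{r+1}|=1$, and $0$ otherwise. It is $\mathbb Z\times\mathbb Z/2\mathbb Z$-graded, with $e(\mathbf i)$ of degree $(0,\bar0)$, $y_re(\mathbf i)$ of degree $((\alpha_{i_r},\alpha_{i_r}),p(i_r))$ and $\tau_re(\mathbf i)$ of degree $(-(\alpha_{i_r},\alpha_{i_{r+1}}),p(i_r)p(i_{r+1}))$. *Modules.* $\mathrm{Rep}^-(\nu)$ denotes the finite-dimensional $\mathbb Z\times\mathbb Z/2\mathbb Z$-graded left $\mathcal H^-(\nu)$-modules. For $M\in\mathrm{Rep}^-(\nu)$ with components $M_{\varepsilon}[k]$, put $\dim^-_qM=\sum_{k\in\mathbb Z}(\dim M_{\bar0}[k]-\dim M_{\bar1}[k])q^k$, and likewise for its graded subspaces, and $$\mathrm{ch}^-_qM=\sum_{\mathbf i\in I^\nu}\big(\dim^-_qe(\mathbf i)M\big)\,\mathbf i\in\mathcal F,$$ where $\mathcal F$ is the $\mathbb Q(q)$-vector space whose basis is the set of all words in $I$. For $M\in\mathrm{Rep}^-(\mu)$ and $N\in\mathrm{Rep}^-(\nu)$ let $$M\circ N=\mathcal H^-(\mu+\nu)1_{\mu,\nu}\otimes_{\mathcal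 H^-(\mu)\otimes\mathcal H^-(\nu)}(M\boxtimes N),\qquad 1_{\mu,\nu}=\sum_{\mathbf i\in I^\mu,\,\mathbf j\in I^\nu}e(\mathbf i\mathbf j).$$ Here $\mathcal H^-(\mu)\otimes\mathcal H^-(\nu)$ is the tensor product of superalgebras; it maps to $\mathcal H^-(\mu+\nu)$ by concatenation of words and by shifting the indices of the generators of $\mathcal H^-(\nu)$ by the height of $\mu$, with identity sent to $1_{\mu,\nu}$. It acts on $M\boxtimes N=M\otimes_{\mathbb K}N$ by $(a\otimes b)(m\otimes v)=(-1)^{p(b)p(m)}am\otimes bv$ for homogeneous $b$, $m$. The degree of $h\otimes(m\otimes v)$ is the sum of the degrees of $h$, $m$ and $v$. *Quantum shuffle product.* Let $\diamond:\mathcal F\times\mathcal F\to\mathcal F$ be the bilinear product with $\emptyset\diamond x=x\diamond\emptyset=x$ and $$(xi)\diamond(yj)=(x\diamond(yj))\,i+(-1)^{p(xi)p(j)}q^{-(|xi|,\alpha_j)}\,((xi)\diamond y)\,j$$ for words $x,y$ and $i,j\in I$, where $|i_1\cdots i_d|=\alpha_{i_1}+\dots+\alpha_{i_d}$ and $p(x)=p(|x|)$.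 Then for all $\mu,\nu\in Q^+$, $M\in\mathrm{Rep}^-(\mu)$ and $N\in\mathrm{Rep}^-(\nu)$, the module $M\circ N$ belongs to $\mathrm{Rep}^-(\mu+\nu)$, and $$\mathrm{ch}^-_q(M\circ N)=\mathrm{ch}^-_q(N)\diamond\mathrm{ch}^-_q(M).$$ -/

import Mathlib

open scoped TensorProduct

noncomputable section

namespace SpinHecke

/-! Root data of type `osp(1|2n)`: the index set is `I = {1, …, n}`, modelled by `Fin n`
(so the node `n` is the element with `i.val + 1 = n`), and the node `n` is the only odd one. -/

/-- The parity `p(i)`. -/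
def par {n : ℕ} (i : Fin n) : ZMod 2 := if i.val + 1 = n then 1 else 0

/-- The node `i` and the node `j` are joined in the Dynkin diagram `1 - 2 - ⋯ - n`. -/
def Adjacent {n : ℕ} (i j : Fin n) : Prop := i.val + 1 = j.val ∨ j.val + 1 = i.val

instance {n : ℕ} (i j : Fin n) : Decidable (Adjacent i j) := by
  unfold Adjacent; infer_instance

/-- The generalized Cartan matrix `A`: `2` on the diagonal, `a_{n,n-1} = -2`, all other
entries next to the diagonal `-1`, and `0` elsewhere. -/
def cartan {n : ℕ} (i j : Fin n) : ℤ :=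
  if i = j then 2
  else if Adjacent i j then (if i.val + 1 = n then -2 else -1)
  else 0

/-- The diagonal matrix `D = diag(2, …, 2, 1)`. -/
def symm {n : ℕ} (i : Fin n) : ℕ := if i.val + 1 = n then 1 else 2

/-- `(α_i, α_j)`, the entries of `B = DA`. -/
def form {n : ℕ} (i j : Fin n) : ℤ := symm i * cartan i j

/-- The form `(α_i, α_j)` is symmetric. -/
theorem form_comm {n : ℕ} (i j : Fin n) : form i j = form j i := by
  unfold form cartan symm Adjacent
  have h1 := i.isLt
  have h2 := j.isLt
  by_cases h : i = j
  · subst h; rfl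
  · have h' : ¬ j = i := fun e => h e.symm
    have h3 : i.val ≠ j.val := fun e => h (Fin.ext e)
    simp only [h, h', if_false]
    split_ifs <;> omega

/-- The sign `(-1)^a` for `a ∈ ℤ/2ℤ`. -/
def sgn (a : ZMod 2) : ℤ := (-1) ^ a.val

/-- An orientation of the Dynkin diagram: `d i j` is the number `d_{ij}` of arrows from `i` to
`j`.  There is one arrow, in one of the two directions, between adjacent nodes, and there is no
other arrow. -/
structure Orientation (n : ℕ) where
  d : Fin n → Fin n → ℕ
  d_add : ∀ i j, d i j + d j i = if Adjacent i j then 1 else 0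

/-! The positive part `Q⁺` of the root lattice is the free commutative monoid on the simple roots
`α_i`, `i ∈ I`; it is modelled by `Multiset (Fin n)`, the element `∑ c_i α_i` being the multiset in
which `i` has multiplicity `c_i`.  The height of `ν` is `ν.card`. -/

/-- `I^ν`: the words `(i_1, …, i_d)` in `I` with `α_{i_1} + ⋯ + α_{i_d} = ν`. -/
def Word {n : ℕ} (ν : Multiset (Fin n)) : Type :=
  {w : Fin ν.card → Fin n // Finset.univ.val.map w = ν}

instance {n : ℕ} (ν : Multiset (Fin n)) : DecidableEq (Word ν) := by
  unfold Word; infer_instance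

instance {n : ℕ} (ν : Multiset (Fin n)) : Fintype (Word ν) := by
  unfold Word; infer_instance

/-- The position `r` in `{1, …, d}`, for `r` in `{1, …, d - 1}`. -/
def lo {d : ℕ} (r : Fin (d - 1)) : Fin d := ⟨r.val, by omega⟩

/-- The position `r + 1` in `{1, …, d}`, for `r` in `{1, …, d - 1}`. -/
def hi {d : ℕ} (r : Fin (d - 1)) : Fin d := ⟨r.val + 1, by omega⟩

/-- `s_r · 𝐢`: the word `𝐢` with the letters in the places `r` and `r + 1` exchanged. -/
def Word.swap {n : ℕ} {ν : Multiset (Fin n)} (r : Fin (ν.card - 1)) (w : Word ν) : Word ν :=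
  ⟨w.1 ∘ Equiv.swap (lo r) (hi r), by
    have h := congrArg (fun s => Multiset.map w.1 (Finset.val s))
      (Finset.map_univ_equiv (Equiv.swap (lo r) (hi r)))
    simp only [Finset.map_val, Multiset.map_map] at h
    exact h.trans w.2⟩

/-- The concatenation `𝐢𝐣` of words. -/
def Word.concat {n : ℕ} {μ ν : Multiset (Fin n)} (v : Word μ) (w : Word ν) : Word (μ + ν) :=
  ⟨fun k => Fin.append v.1 w.1 (Fin.cast (Multiset.card_add μ ν) k), by
    have h : ∀ (d : ℕ) (hd : d = μ.card + ν.card),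
        (Finset.univ : Finset (Fin d)).val.map
          (fun k => Fin.append v.1 w.1 (Fin.cast hd k)) = μ + ν := by
      rintro d rfl
      have h1 : (Finset.univ : Finset (Fin (μ.card + ν.card))).val.map (Fin.append v.1 w.1)
          = Finset.univ.val.map v.1 + Finset.univ.val.map w.1 := by
        simp only [Fin.univ_val_map, List.ofFn_fin_append, ← Multiset.coe_add]
      rw [v.2, w.2] at h1
      exact h1
    exact h _ _⟩

/-- The underlying list of letters of an element of `I^ν`. -/
def Word.toList {n : ℕ} {ν : Multiset (Fin n)} (w : Word ν) : List (Fin n) := List.ofFn w.1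

/-! ### The spin quiver Hecke algebra -/

/-- The generators of `H⁻(ν)`. -/
inductive Gen {n : ℕ} (ν : Multiset (Fin n)) : Type
  | e (w : Word ν)
  | y (r : Fin ν.card)
  | tau (r : Fin (ν.card - 1))

/-- The skew polynomial `Q_{ij}(u, v)`, evaluated at elements `u`, `v` of a `K`-algebra: `0` for
`i = j`, `(-1)^{d_{ij}} (u^{2/s_i} - v^{2/s_j})` for adjacent `i`, `j`, and `1` for distinct `i`, `j`
that are not adjacent. -/
def qPoly {n : ℕ} (o : Orientation n) (i j : Fin n) {A : Type*} [Ring A] (u v : A) : A :=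
  if i = j then 0
  else if Adjacent i j then (-1) ^ o.d i j * (u ^ (2 / symm i) - v ^ (2 / symm j))
  else 1

/-- The value of the quotient `(Q_{ij}(u', v) - Q_{ij}(u, v)) / (u' - u)` for `i ≠ n`, and of the
quotient `(Q_{ij}(u', v) - Q_{ij}(u, v)) / (u'^2 - u^2)` for `i = n`; both are constants. -/
def qQuot {n : ℕ} (o : Orientation n) (i j : Fin n) {A : Type*} [Ring A] : A :=
  if Adjacent i j then (-1) ^ o.d i j else 0

theorem qQuot_even {n : ℕ} (o : Orientation n) (i j : Fin n) (hi : i.val + 1 ≠ n)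
    {A : Type*} [Ring A] (u u' v : A) :
    qPoly o i j u' v - qPoly o i j u v = qQuot o i j * (u' - u) := by
  unfold qPoly qQuot symm Adjacent
  by_cases h : i = j
  · subst h; simp
  · by_cases h2 : i.val + 1 = j.val ∨ j.val + 1 = i.val
    · simp only [h, h2, hi, if_true, if_false, ← mul_sub]; norm_num
    · simp [h, h2]

theorem qQuot_odd {n : ℕ} (o : Orientation n) (i j : Fin n) (hi : i.val + 1 = n)
    {A : Type*} [Ring A] (u u' v : A) :
    qPoly o i j u' v - qPoly o i j u v = qQuot o i j * (u' ^ 2 - u ^ 2) := by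
  have h3 : symm i = 1 := by simp [symm, hi]
  unfold qPoly qQuot
  rw [h3]
  by_cases h : i = j
  · subst h; simp [Adjacent]
  · by_cases h2 : Adjacent i j
    · simp only [h, h2, if_true, if_false, ← mul_sub]; norm_num
    · simp [h, h2]

/-- The right-hand side of the braid relation for the letters `i = i_r`, `j = i_{r+1}`,
`k = i_{r+2}`, evaluated at `u = y_r`, `w = y_{r+2}`. -/
def braidTerm {n : ℕ} (o : Orientation n) (i j k : Fin n) {A : Type*} [Ring A] (u w : A) : A :=
  if i = k then
    if i.val + 1 ≠ n then qQuot o i j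
    else sgn (par j) • ((w - u) * qQuot o i j)
  else 0

/-- The defining relations of `H⁻(ν)`. -/
inductive Rel (K : Type*) [Field K] {n : ℕ} (o : Orientation n) (ν : Multiset (Fin n)) :
    FreeAlgebra K (Gen ν) → FreeAlgebra K (Gen ν) → Prop
  | e_mul (i j : Word ν) : Rel K o ν
      (FreeAlgebra.ι K (.e i) * FreeAlgebra.ι K (.e j))
      (if i = j then FreeAlgebra.ι K (.e i) else 0)
  | e_sum : Rel K o ν (∑ i : Word ν, FreeAlgebra.ι K (.e i)) 1
  | y_e (r : Fin ν.card) (i : Word ν) : Rel K o ν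
      (FreeAlgebra.ι K (.y r) * FreeAlgebra.ι K (.e i))
      (FreeAlgebra.ι K (.e i) * FreeAlgebra.ι K (.y r))
  | tau_e (r : Fin (ν.card - 1)) (i : Word ν) : Rel K o ν
      (FreeAlgebra.ι K (.tau r) * FreeAlgebra.ι K (.e i))
      (FreeAlgebra.ι K (.e (i.swap r)) * FreeAlgebra.ι K (.tau r))
  | y_y (r s : Fin ν.card) (i : Word ν) (h : r ≠ s) : Rel K o ν
      (FreeAlgebra.ι K (.y r) * FreeAlgebra.ι K (.y s) * FreeAlgebra.ι K (.e i))
      (sgn (par (i.1 r) * par (i.1 s)) •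
        (FreeAlgebra.ι K (.y s) * FreeAlgebra.ι K (.y r) * FreeAlgebra.ι K (.e i)))
  | tau_y (r : Fin (ν.card - 1)) (s : Fin ν.card) (i : Word ν) (h : s ≠ lo r) (h' : s ≠ hi r) :
      Rel K o ν
      (FreeAlgebra.ι K (.tau r) * FreeAlgebra.ι K (.y s) * FreeAlgebra.ι K (.e i))
      (sgn (par (i.1 (lo r)) * par (i.1 (hi r)) * par (i.1 s)) •
        (FreeAlgebra.ι K (.y s) * FreeAlgebra.ι K (.tau r) * FreeAlgebra.ι K (.e i)))
  | tau_tau (r s : Fin (ν.card - 1)) (i : Word ν) (h : r.val + 1 < s.val ∨ s.val + 1 < r.val) :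
      Rel K o ν
      (FreeAlgebra.ι K (.tau r) * FreeAlgebra.ι K (.tau s) * FreeAlgebra.ι K (.e i))
      (sgn (par (i.1 (lo r)) * par (i.1 (hi r)) * par (i.1 (lo s)) * par (i.1 (hi s))) •
        (FreeAlgebra.ι K (.tau s) * FreeAlgebra.ι K (.tau r) * FreeAlgebra.ι K (.e i)))
  | tau_y_hi (r : Fin (ν.card - 1)) (i : Word ν) : Rel K o ν
      (FreeAlgebra.ι K (.tau r) * FreeAlgebra.ι K (.y (hi r)) * FreeAlgebra.ι K (.e i))
      ((sgn (par (i.1 (lo r)) * par (i.1 (hi r))) •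
          (FreeAlgebra.ι K (.y (lo r)) * FreeAlgebra.ι K (.tau r))
        + if i.1 (lo r) = i.1 (hi r) then 1 else 0) * FreeAlgebra.ι K (.e i))
  | y_hi_tau (r : Fin (ν.card - 1)) (i : Word ν) : Rel K o ν
      (FreeAlgebra.ι K (.y (hi r)) * FreeAlgebra.ι K (.tau r) * FreeAlgebra.ι K (.e i))
      ((sgn (par (i.1 (lo r)) * par (i.1 (hi r))) •
          (FreeAlgebra.ι K (.tau r) * FreeAlgebra.ι K (.y (lo r)))
        + if i.1 (lo r) = i.1 (hi r) then 1 else 0) * FreeAlgebra.ι K (.e i))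
  | tau_sq (r : Fin (ν.card - 1)) (i : Word ν) : Rel K o ν
      (FreeAlgebra.ι K (.tau r) * FreeAlgebra.ι K (.tau r) * FreeAlgebra.ι K (.e i))
      (qPoly o (i.1 (lo r)) (i.1 (hi r))
          (FreeAlgebra.ι K (.y (lo r))) (FreeAlgebra.ι K (.y (hi r)))
        * FreeAlgebra.ι K (.e i))
  | braid (r s : Fin (ν.card - 1)) (h : r.val + 1 = s.val) (i : Word ν) : Rel K o ν
      ((FreeAlgebra.ι K (.tau s) * FreeAlgebra.ι K (.tau r) * FreeAlgebra.ι K (.tau s)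
          - FreeAlgebra.ι K (.tau r) * FreeAlgebra.ι K (.tau s) * FreeAlgebra.ι K (.tau r))
        * FreeAlgebra.ι K (.e i))
      (braidTerm o (i.1 (lo r)) (i.1 (hi r)) (i.1 (hi s))
          (FreeAlgebra.ι K (.y (lo r))) (FreeAlgebra.ι K (.y (hi s)))
        * FreeAlgebra.ι K (.e i))

/-- The spin quiver Hecke algebra `H⁻(ν)`. -/
def Alg (K : Type*) [Field K] {n : ℕ} (o : Orientation n) (ν : Multiset (Fin n)) : Type _ :=
  RingQuot (Rel K o ν)

instance (K : Type*) [Field K] {n : ℕ} (o : Orientation n) (ν : Multiset (Fin n)) :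
    Ring (Alg K o ν) := inferInstanceAs (Ring (RingQuot (Rel K o ν)))

instance (K : Type*) [Field K] {n : ℕ} (o : Orientation n) (ν : Multiset (Fin n)) :
    Algebra K (Alg K o ν) := inferInstanceAs (Algebra K (RingQuot (Rel K o ν)))

/-- The projection of the free algebra on the generators to `H⁻(ν)`. -/
def Alg.mk (K : Type*) [Field K] {n : ℕ} (o : Orientation n) (ν : Multiset (Fin n)) :
    FreeAlgebra K (Gen ν) →ₐ[K] Alg K o ν := RingQuot.mkAlgHom K (Rel K o ν)

theorem Alg.mk_rel {K : Type*} [Field K] {n : ℕ} {o : Orientation n} {ν : Multiset (Fin n)}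
    {x x' : FreeAlgebra K (Gen ν)} (h : Rel K o ν x x') : Alg.mk K o ν x = Alg.mk K o ν x' :=
  RingQuot.mkAlgHom_rel K h

/-- The universal property of `H⁻(ν)`. -/
def Alg.lift {K : Type*} [Field K] {n : ℕ} {o : Orientation n} {ν : Multiset (Fin n)}
    {B : Type*} [Ring B] [Algebra K B] (f : FreeAlgebra K (Gen ν) →ₐ[K] B)
    (hf : ∀ ⦃x x'⦄, Rel K o ν x x' → f x = f x') : Alg K o ν →ₐ[K] B :=
  RingQuot.liftAlgHom K ⟨f, hf⟩

theorem Alg.lift_mk {K : Type*} [Field K] {n : ℕ} {o : Orientation n} {ν : Multiset (Fin n)}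
    {B : Type*} [Ring B] [Algebra K B] (f : FreeAlgebra K (Gen ν) →ₐ[K] B)
    (hf : ∀ ⦃x x'⦄, Rel K o ν x x' → f x = f x') (x : FreeAlgebra K (Gen ν)) :
    Alg.lift f hf (Alg.mk K o ν x) = f x :=
  RingQuot.liftAlgHom_mkAlgHom_apply K f hf x

/-- The generator `e(𝐢)`. -/
def e (K : Type*) [Field K] {n : ℕ} (o : Orientation n) {ν : Multiset (Fin n)} (w : Word ν) :
    Alg K o ν := Alg.mk K o ν (FreeAlgebra.ι K (.e w))

/-- The generator `y_r`. -/
def y (K : Type*) [Field K] {n : ℕ} (o : Orientation n) {ν : Multiset (Fin n)} (r : Fin ν.card) :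
    Alg K o ν := Alg.mk K o ν (FreeAlgebra.ι K (.y r))

/-- The generator `τ_r`. -/
def tau (K : Type*) [Field K] {n : ℕ} (o : Orientation n) {ν : Multiset (Fin n)}
    (r : Fin (ν.card - 1)) :
    Alg K o ν := Alg.mk K o ν (FreeAlgebra.ι K (.tau r))

/-- Products of the homogeneous generators `e(𝐢)`, `y_r e(𝐢)`, `τ_r e(𝐢)`, with their degrees in
`ℤ × ℤ/2ℤ`. -/
inductive IsMonomial (K : Type*) [Field K] {n : ℕ} (o : Orientation n) (ν : Multiset (Fin n)) :
    Alg K o ν → ℤ × ZMod 2 → Prop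
  | e (i : Word ν) : IsMonomial K o ν (e K o i) (0, 0)
  | y (r : Fin ν.card) (i : Word ν) :
      IsMonomial K o ν (y K o r * SpinHecke.e K o i) (form (i.1 r) (i.1 r), par (i.1 r))
  | tau (r : Fin (ν.card - 1)) (i : Word ν) :
      IsMonomial K o ν (tau K o r * SpinHecke.e K o i)
        (-form (i.1 (lo r)) (i.1 (hi r)), par (i.1 (lo r)) * par (i.1 (hi r)))
  | mul {a b : Alg K o ν} {g h : ℤ × ZMod 2} :
      IsMonomial K o ν a g → IsMonomial K o ν b h → IsMonomial K o ν (a * b) (g + h)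

/-- The homogeneous component of degree `g ∈ ℤ × ℤ/2ℤ` of `H⁻(ν)`. -/
def component (K : Type*) [Field K] {n : ℕ} (o : Orientation n) (ν : Multiset (Fin n))
    (g : ℤ × ZMod 2) : Submodule K (Alg K o ν) :=
  Submodule.span K {a | IsMonomial K o ν a g}

/-- `ℳ` is a `ℤ × ℤ/2ℤ`-grading of the left `H⁻(ν)`-module `M`. -/
structure IsGradedModule {K : Type*} [Field K] {n : ℕ} (o : Orientation n) (ν : Multiset (Fin n))
    {M : Type*} [AddCommGroup M] [Module K M] [Module (Alg K o ν) M]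
    (ℳ : ℤ × ZMod 2 → Submodule K M) : Prop where
  isInternal : DirectSum.IsInternal ℳ
  smul_mem : ∀ (g h : ℤ × ZMod 2) (a : Alg K o ν) (m : M),
    a ∈ component K o ν g → m ∈ ℳ h → a • m ∈ ℳ (g + h)

/-! ### The quantum shuffle product -/

/-- The underlying `ℚ(q)`-vector space of the free associative algebra on `I`, with the set of
words as a basis. -/
abbrev Shuffle (n : ℕ) : Type := List (Fin n) →₀ RatFunc ℚ

/-- The parity `p(x)` of a word. -/
def wpar {n : ℕ} (x : List (Fin n)) : ZMod 2 := (x.map par).sum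

/-- `(|x|, α_j)` for a word `x`. -/
def wform {n : ℕ} (x : List (Fin n)) (j : Fin n) : ℤ := (x.map fun i => form i j).sum

/-- Right concatenation of a letter to all words, extended linearly. -/
def snoc {n : ℕ} (f : Shuffle n) (i : Fin n) : Shuffle n := Finsupp.mapDomain (fun w => w ++ [i]) f

/-- The scalar `(-1)^{p(x) p(j)} q^{-(|x|, α_j)}`. -/
def shuffleCoeff {n : ℕ} (x : List (Fin n)) (j : Fin n) : RatFunc ℚ :=
  (sgn (wpar x * par j) : RatFunc ℚ) * (RatFunc.X : RatFunc ℚ) ^ (-wform x j)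

/-- The quantum shuffle product of two words that are given in reversed order. -/
def shuffleRev {n : ℕ} : List (Fin n) → List (Fin n) → Shuffle n
  | [], y => Finsupp.single y.reverse 1
  | i :: x, [] => Finsupp.single (i :: x).reverse 1
  | i :: x, j :: y =>
      snoc (shuffleRev x (j :: y)) i
        + shuffleCoeff (i :: x).reverse j • snoc (shuffleRev (i :: x) y) j
  termination_by x y => x.length + y.length

/-- The quantum shuffle product of two words. -/
def wordShuffle {n : ℕ} (x y : List (Fin n)) : Shuffle n := shuffleRev x.reverse y.reverse

theorem nil_wordShuffle {n : ℕ} (y : List (Fin n)) : wordShuffle [] y = Finsupp.single y 1 := by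
  simp [wordShuffle, shuffleRev]

theorem wordShuffle_nil {n : ℕ} (x : List (Fin n)) : wordShuffle x [] = Finsupp.single x 1 := by
  unfold wordShuffle
  rcases h : x.reverse with _ | ⟨i, z⟩
  · have : x = [] := by simpa using h
    subst this; simp [shuffleRev]
  · have : x = (i :: z).reverse := by rw [← h, List.reverse_reverse]
    subst this; simp [shuffleRev]

/-- The recursion `(xi) ⋄ (yj) = (x ⋄ (yj)) i + (-1)^{p(xi) p(j)} q^{-(|xi|, |j|)} ((xi) ⋄ y) j`
that defines the quantum shuffle product of words. -/
theorem wordShuffle_snoc {n : ℕ} (x y : List (Fin n)) (i j : Fin n) :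
    wordShuffle (x ++ [i]) (y ++ [j]) =
      snoc (wordShuffle x (y ++ [j])) i
        + shuffleCoeff (x ++ [i]) j • snoc (wordShuffle (x ++ [i]) y) j := by
  simp [wordShuffle, shuffleRev]

/-- The quantum shuffle product `f ⋄ g`, the bilinear extension of the product of words. -/
def shuffle {n : ℕ} (f g : Shuffle n) : Shuffle n :=
  f.sum fun x a => g.sum fun y b => (a * b) • wordShuffle x y

/-! ### Characters -/

/-- The `q`-super dimension `∑_k (dim V_0[k] - dim V_1[k]) q^k` of a subspace `V` of a finite
dimensional space with grading `ℳ`, where `V_ε[k]` is the intersection of `V` with the component of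
degree `(k, ε)`. -/
def qdim {K : Type*} [Field K] {M : Type*} [AddCommGroup M] [Module K M]
    (ℳ : ℤ × ZMod 2 → Submodule K M) (V : Submodule K M) : RatFunc ℚ :=
  ∑ᶠ k : ℤ, (((Module.finrank K (V ⊓ ℳ (k, 0) : Submodule K M) : ℤ)
      - (Module.finrank K (V ⊓ ℳ (k, 1) : Submodule K M) : ℤ) : ℤ) : RatFunc ℚ)
    * (RatFunc.X : RatFunc ℚ) ^ k

/-- The graded character `∑_{𝐢 ∈ I^ν} (dim_q e(𝐢) M) 𝐢` of a finite dimensional graded module. -/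
def character {K : Type*} [Field K] {n : ℕ} (o : Orientation n) (ν : Multiset (Fin n))
    {M : Type*} [AddCommGroup M] [Module K M] [Module (Alg K o ν) M]
    [IsScalarTower K (Alg K o ν) M] (ℳ : ℤ × ZMod 2 → Submodule K M) : Shuffle n :=
  ∑ i : Word ν,
    Finsupp.single i.toList (qdim ℳ (LinearMap.range (Algebra.lsmul K K M (e K o i))))

/-! ### Consequences of the defining relations, and the embeddings of blocks -/

theorem map_qPoly {n : ℕ} (o : Orientation n) (i j : Fin n) {A B : Type*} [Ring A] [Ring B]
    (f : A →+* B) (u v : A) : f (qPoly o i j u v) = qPoly o i j (f u) (f v) := by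
  unfold qPoly; split_ifs <;> simp

theorem map_qQuot {n : ℕ} (o : Orientation n) (i j : Fin n) {A B : Type*} [Ring A] [Ring B]
    (f : A →+* B) : f (qQuot o i j) = qQuot o i j := by
  unfold qQuot; split_ifs <;> simp

theorem map_braidTerm {n : ℕ} (o : Orientation n) (i j k : Fin n) {A B : Type*} [Ring A] [Ring B]
    (f : A →+* B) (u w : A) : f (braidTerm o i j k u w) = braidTerm o i j k (f u) (f w) := by
  unfold braidTerm; split_ifs <;> simp [map_qQuot]

section relations

variable (K : Type*) [Field K] {n : ℕ} (o : Orientation n) {ν : Multiset (Fin n)}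

theorem e_mul_e (i j : Word ν) : e K o i * e K o j = if i = j then e K o i else 0 := by
  have h := Alg.mk_rel (Rel.e_mul (K := K) (o := o) i j)
  rw [map_mul] at h
  refine h.trans ?_
  split_ifs
  · rfl
  · exact map_zero _

theorem sum_e : ∑ i : Word ν, e K o i = 1 := by
  have h := Alg.mk_rel (Rel.e_sum (K := K) (o := o) (ν := ν))
  rwa [map_sum, map_one] at h

theorem y_mul_e (r : Fin ν.card) (i : Word ν) : y K o r * e K o i = e K o i * y K o r := by
  have h := Alg.mk_rel (Rel.y_e (K := K) (o := o) r i)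
  rwa [map_mul, map_mul] at h

theorem tau_mul_e (r : Fin (ν.card - 1)) (i : Word ν) :
    tau K o r * e K o i = e K o (i.swap r) * tau K o r := by
  have h := Alg.mk_rel (Rel.tau_e (K := K) (o := o) r i)
  rwa [map_mul, map_mul] at h

theorem y_mul_y (r s : Fin ν.card) (i : Word ν) (hrs : r ≠ s) :
    y K o r * y K o s * e K o i
      = sgn (par (i.1 r) * par (i.1 s)) • (y K o s * y K o r * e K o i) := by
  have h := Alg.mk_rel (Rel.y_y (K := K) (o := o) r s i hrs)
  simp only [map_mul, map_zsmul] at h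
  exact h

theorem tau_mul_y (r : Fin (ν.card - 1)) (s : Fin ν.card) (i : Word ν)
    (h1 : s ≠ lo r) (h2 : s ≠ hi r) :
    tau K o r * y K o s * e K o i
      = sgn (par (i.1 (lo r)) * par (i.1 (hi r)) * par (i.1 s)) •
        (y K o s * tau K o r * e K o i) := by
  have h := Alg.mk_rel (Rel.tau_y (K := K) (o := o) r s i h1 h2)
  simp only [map_mul, map_zsmul] at h
  exact h

theorem tau_mul_tau (r s : Fin (ν.card - 1)) (i : Word ν)
    (h1 : r.val + 1 < s.val ∨ s.val + 1 < r.val) :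
    tau K o r * tau K o s * e K o i
      = sgn (par (i.1 (lo r)) * par (i.1 (hi r)) * par (i.1 (lo s)) * par (i.1 (hi s))) •
        (tau K o s * tau K o r * e K o i) := by
  have h := Alg.mk_rel (Rel.tau_tau (K := K) (o := o) r s i h1)
  simp only [map_mul, map_zsmul] at h
  exact h

theorem tau_mul_y_hi (r : Fin (ν.card - 1)) (i : Word ν) :
    tau K o r * y K o (hi r) * e K o i
      = (sgn (par (i.1 (lo r)) * par (i.1 (hi r))) • (y K o (lo r) * tau K o r)
        + if i.1 (lo r) = i.1 (hi r) then 1 else 0) * e K o i := by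
  have h := Alg.mk_rel (Rel.tau_y_hi (K := K) (o := o) r i)
  simp only [map_mul, map_zsmul, map_add, apply_ite (Alg.mk K o ν), map_one, map_zero] at h
  exact h

theorem y_hi_mul_tau (r : Fin (ν.card - 1)) (i : Word ν) :
    y K o (hi r) * tau K o r * e K o i
      = (sgn (par (i.1 (lo r)) * par (i.1 (hi r))) • (tau K o r * y K o (lo r))
        + if i.1 (lo r) = i.1 (hi r) then 1 else 0) * e K o i := by
  have h := Alg.mk_rel (Rel.y_hi_tau (K := K) (o := o) r i)
  simp only [map_mul, map_zsmul, map_add, apply_ite (Alg.mk K o ν), map_one, map_zero] at h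
  exact h

theorem tau_sq (r : Fin (ν.card - 1)) (i : Word ν) :
    tau K o r * tau K o r * e K o i
      = qPoly o (i.1 (lo r)) (i.1 (hi r)) (y K o (lo r)) (y K o (hi r)) * e K o i := by
  have h := Alg.mk_rel (Rel.tau_sq (K := K) (o := o) r i)
  simp only [map_mul] at h
  refine h.trans ?_
  congr 1
  exact map_qPoly o _ _ (Alg.mk K o ν).toRingHom _ _

theorem braid (r s : Fin (ν.card - 1)) (hrs : r.val + 1 = s.val) (i : Word ν) :
    (tau K o s * tau K o r * tau K o s - tau K o r * tau K o s * tau K o r) * e K o i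
      = braidTerm o (i.1 (lo r)) (i.1 (hi r)) (i.1 (hi s)) (y K o (lo r)) (y K o (hi s))
        * e K o i := by
  have h := Alg.mk_rel (Rel.braid (K := K) (o := o) r s hrs i)
  simp only [map_mul, map_sub] at h
  refine h.trans ?_
  congr 1
  exact map_braidTerm o _ _ _ (Alg.mk K o ν).toRingHom _ _

end relations

theorem Word.swap_swap {n : ℕ} {ν : Multiset (Fin n)} (r : Fin (ν.card - 1)) (w : Word ν) :
    (w.swap r).swap r = w := by
  apply Subtype.ext
  funext k
  simp [Word.swap]

/-- A corner `pAp` of a `K`-algebra `A` is a `K`-algebra with identity `p`. -/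
instance cornerAlgebra {K : Type*} [Field K] {A : Type*} [Ring A] [Algebra K A] {p : A}
    (hp : IsIdempotentElem p) : Algebra K hp.Corner :=
  RingHom.toAlgebra'
    { toFun := fun k => ⟨k • p, k • p, by
        simp only [mul_smul_comm, smul_mul_assoc, hp.eq]⟩
      map_one' := Subtype.ext (one_smul K p)
      map_mul' := fun a b => Subtype.ext (by
        change (a * b) • p = (a • p) * (b • p)
        rw [smul_mul_smul_comm, hp.eq])
      map_zero' := Subtype.ext (zero_smul K p)
      map_add' := fun a b => Subtype.ext (add_smul a b p) }
    (fun k x => Subtype.ext (by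
      have hx := (Subsemigroup.mem_corner_iff hp).mp x.2
      change (k • p) * x.1 = x.1 * (k • p)
      rw [smul_mul_assoc, mul_smul_comm, hx.1, hx.2]))

/-- The inclusion of the corner `pAp` in `A`. -/
def cornerIncl (K : Type*) [Field K] {A : Type*} [Ring A] [Algebra K A] {p : A}
    (hp : IsIdempotentElem p) : hp.Corner →ₙₐ[K] A where
  toFun x := x.1
  map_smul' k x := by
    rw [Algebra.smul_def]
    have hx := (Subsemigroup.mem_corner_iff hp).mp x.2
    change (k • p) * x.1 = k • x.1
    rw [smul_mul_assoc, hx.1]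
  map_zero' := rfl
  map_add' _ _ := rfl
  map_mul' _ _ := rfl

theorem neg_one_pow_mul_of_hom {A B : Type*} [Ring A] [Ring B] (f : A →ₙ+* B) (d : ℕ) (z : B)
    (h1 : f 1 * z = z) : f ((-1) ^ d) * z = (-1) ^ d * z := by
  rcases Nat.even_or_odd d with hd | hd
  · rw [hd.neg_one_pow, hd.neg_one_pow, h1, one_mul]
  · rw [hd.neg_one_pow, hd.neg_one_pow, map_neg, neg_mul, neg_mul, h1, one_mul]

theorem qQuot_mul_of_hom {n : ℕ} (o : Orientation n) (i j : Fin n) {A B : Type*} [Ring A] [Ring B]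
    (f : A →ₙ+* B) (z : B) (h1 : f 1 * z = z) :
    f (qQuot o i j) * z = qQuot o i j * z := by
  unfold qQuot
  split_ifs
  · exact neg_one_pow_mul_of_hom f _ z h1
  · simp

theorem qPoly_mul_of_hom {n : ℕ} (o : Orientation n) (i j : Fin n) {A B : Type*} [Ring A] [Ring B]
    (f : A →ₙ+* B) (z : B) (h1 : f 1 * z = z) (u v : A) (u' v' : B)
    (hu : f u * z = u' * z) (hv : f v * z = v' * z)
    (huu : f u * (u' * z) = u' * (u' * z)) (hvv : f v * (v' * z) = v' * (v' * z)) :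
    f (qPoly o i j u v) * z = qPoly o i j u' v' * z := by
  have key : ∀ (w : A) (w' : B) (k : Fin n), f w * z = w' * z → f w * (w' * z) = w' * (w' * z) →
      f (w ^ (2 / symm k)) * z = w' ^ (2 / symm k) * z := by
    intro w w' k h2 h3
    have hk : 2 / symm k = 1 ∨ 2 / symm k = 2 := by
      unfold symm; split_ifs <;> simp
    rcases hk with hk | hk
    · rw [hk, pow_one, pow_one, h2]
    · rw [hk, pow_two, pow_two, map_mul, mul_assoc, mul_assoc, h2, h3]
  unfold qPoly
  split_ifs
  · simp
  · have h4 : f (u ^ (2 / symm i) - v ^ (2 / symm j)) * z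
        = (u' ^ (2 / symm i) - v' ^ (2 / symm j)) * z := by
      rw [map_sub, sub_mul, sub_mul, key u u' i hu huu, key v v' j hv hvv]
    rcases Nat.even_or_odd (o.d i j) with hd | hd
    · rw [hd.neg_one_pow, hd.neg_one_pow, one_mul, one_mul, h4]
    · rw [hd.neg_one_pow, hd.neg_one_pow, neg_mul, neg_mul, one_mul, one_mul, map_neg, neg_mul,
        neg_mul, h4]
  · rw [h1, one_mul]

theorem braidTerm_mul_of_hom {n : ℕ} (o : Orientation n) (i j k : Fin n) {A B : Type*} [Ring A]
    [Ring B] (f : A →ₙ+* B) (z : B) (h1 : f 1 * z = z) (u w : A) (u' w' : B)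
    (hu : f u * z = u' * z) (hw : f w * z = w' * z) :
    f (braidTerm o i j k u w) * z = braidTerm o i j k u' w' * z := by
  unfold braidTerm
  split_ifs
  · exact qQuot_mul_of_hom o i j f z h1
  · rw [map_zsmul, smul_mul_assoc, smul_mul_assoc]
    congr 1
    unfold qQuot
    split_ifs
    · rcases Nat.even_or_odd (o.d i j) with hd | hd
      · rw [hd.neg_one_pow, hd.neg_one_pow, mul_one, mul_one, map_sub, sub_mul, sub_mul, hu, hw]
      · rw [hd.neg_one_pow, hd.neg_one_pow, mul_neg, mul_neg, mul_one, mul_one, map_neg, neg_mul,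
          neg_mul, map_sub, sub_mul, sub_mul, hu, hw]
    · simp
  · simp

/-- Data that place a block of words `𝐢 ∈ I^κ` in the places `c + 1, …, c + d` of words in `I^ν`,
the remaining letters being given by an element of `J`. -/
structure Block {n : ℕ} (κ ν : Multiset (Fin n)) (J : Type) where
  c : ℕ
  hc : c + κ.card ≤ ν.card
  ins : Word κ → J → Word ν
  ins_inj : ∀ i j i' j', ins i j = ins i' j' → i = i' ∧ j = j'
  letter : ∀ i j (r : Fin κ.card), (ins i j).1 ⟨c + r.val, by omega⟩ = i.1 r
  ins_swap : ∀ i j (r : Fin (κ.card - 1)),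
    ins (i.swap r) j = (ins i j).swap ⟨c + r.val, by omega⟩

namespace Block

/-- The place `c + r`. -/
def yi {n : ℕ} {κ ν : Multiset (Fin n)} {J : Type} (b : Block κ ν J)
    (r : Fin κ.card) : Fin ν.card := ⟨b.c + r.val, by have := b.hc; omega⟩

/-- The place `c + r`. -/
def ti {n : ℕ} {κ ν : Multiset (Fin n)} {J : Type} (b : Block κ ν J)
    (r : Fin (κ.card - 1)) : Fin (ν.card - 1) := ⟨b.c + r.val, by have := b.hc; omega⟩

theorem lo_ti {n : ℕ} {κ ν : Multiset (Fin n)} {J : Type} (b : Block κ ν J)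
    (r : Fin (κ.card - 1)) : lo (b.ti r) = b.yi (lo r) := rfl

theorem hi_ti {n : ℕ} {κ ν : Multiset (Fin n)} {J : Type} (b : Block κ ν J)
    (r : Fin (κ.card - 1)) : hi (b.ti r) = b.yi (hi r) := rfl

variable (K : Type*) [Field K] {n : ℕ} (o : Orientation n) {κ ν : Multiset (Fin n)} {J : Type}
  [Fintype J] (b : Block κ ν J)

/-- `∑_j e(𝐢, j)` -/
def E (i : Word κ) : Alg K o ν := ∑ j : J, e K o (b.ins i j)

/-- `∑_{𝐢, j} e(𝐢, j)` -/
def P : Alg K o ν := ∑ i : Word κ, b.E K o i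

theorem E_mul_E (i i' : Word κ) : b.E K o i * b.E K o i' = if i = i' then b.E K o i else 0 := by
  classical
  unfold E
  rw [Finset.sum_mul_sum]
  simp only [e_mul_e]
  split_ifs with h
  · subst h
    refine Finset.sum_congr rfl fun j _ => ?_
    rw [Finset.sum_eq_single j]
    · simp
    · intro j' _ hj'
      rw [if_neg]
      intro hh
      exact hj' (b.ins_inj _ _ _ _ hh).2.symm
    · simp
  · refine Finset.sum_eq_zero fun j _ => Finset.sum_eq_zero fun j' _ => ?_
    rw [if_neg]
    intro hh
    exact h (b.ins_inj _ _ _ _ hh).1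

theorem P_mul_E (i : Word κ) : b.P K o * b.E K o i = b.E K o i := by
  unfold P
  rw [Finset.sum_mul]
  simp [E_mul_E]

theorem E_mul_P (i : Word κ) : b.E K o i * b.P K o = b.E K o i := by
  unfold P
  rw [Finset.mul_sum]
  simp [E_mul_E]

theorem P_mul_P : b.P K o * b.P K o = b.P K o := by
  have h : b.P K o * b.P K o = ∑ i : Word κ, b.E K o i * b.P K o := Finset.sum_mul _ _ _
  rw [h]
  simp only [E_mul_P]
  rfl

theorem y_mul_E (r : Fin ν.card) (i : Word κ) : y K o r * b.E K o i = b.E K o i * y K o r := by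
  unfold E
  simp only [Finset.mul_sum, Finset.sum_mul, y_mul_e]

theorem tau_mul_E (r : Fin (κ.card - 1)) (i : Word κ) :
    tau K o (b.ti r) * b.E K o i = b.E K o (i.swap r) * tau K o (b.ti r) := by
  unfold E
  simp only [Finset.mul_sum, Finset.sum_mul, tau_mul_e, b.ins_swap]
  rfl

theorem P_mul_y (r : Fin ν.card) : b.P K o * y K o r = y K o r * b.P K o := by
  unfold P
  rw [Finset.mul_sum, Finset.sum_mul]
  exact Finset.sum_congr rfl fun i _ => (b.y_mul_E K o r i).symm

theorem P_mul_tau (r : Fin (κ.card - 1)) :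
    b.P K o * tau K o (b.ti r) = tau K o (b.ti r) * b.P K o := by
  unfold P
  rw [Finset.mul_sum, Finset.sum_mul]
  simp only [tau_mul_E]
  exact (Equiv.sum_comp (Function.Involutive.toPerm _ (Word.swap_swap r))
    (fun i => b.E K o i * tau K o (b.ti r))).symm

theorem ext_E (i : Word κ) (x x' : Alg K o ν)
    (h : ∀ j, x * e K o (b.ins i j) = x' * e K o (b.ins i j)) :
    x * b.E K o i = x' * b.E K o i := by
  unfold E
  simp only [Finset.mul_sum, h]

theorem idem : IsIdempotentElem (b.P K o) := b.P_mul_P K o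

/-- The images of the generators in the corner. -/
def gen : Gen κ → (b.idem K o).Corner
  | .e i => ⟨b.E K o i, b.E K o i, by simp only [P_mul_E, E_mul_P]⟩
  | .y r => ⟨y K o (b.yi r) * b.P K o, y K o (b.yi r), by simp only [P_mul_y]; rw [mul_assoc, P_mul_P]⟩
  | .tau r => ⟨tau K o (b.ti r) * b.P K o, tau K o (b.ti r), by
      simp only [P_mul_tau]; rw [mul_assoc, P_mul_P]⟩

theorem incl_one : cornerIncl K (b.idem K o) 1 = b.P K o := rfl

theorem incl_gen_e (i : Word κ) : cornerIncl K (b.idem K o) (b.gen K o (.e i)) = b.E K o i := rfl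

theorem incl_gen_y (r : Fin κ.card) :
    cornerIncl K (b.idem K o) (b.gen K o (.y r)) = y K o (b.yi r) * b.P K o := rfl

theorem incl_gen_tau (r : Fin (κ.card - 1)) :
    cornerIncl K (b.idem K o) (b.gen K o (.tau r)) = tau K o (b.ti r) * b.P K o := rfl

theorem letter_yi {n : ℕ} {κ ν : Multiset (Fin n)} {J : Type} (b : Block κ ν J)
    (r : Fin κ.card) (i : Word κ) (j : J) : (b.ins i j).1 (b.yi r) = i.1 r := b.letter i j r

theorem yi_inj {n : ℕ} {κ ν : Multiset (Fin n)} {J : Type} (b : Block κ ν J)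
    {r s : Fin κ.card} (h : b.yi r = b.yi s) : r = s := by
  have := congrArg Fin.val h
  simp only [yi] at this
  exact Fin.ext (by omega)

theorem P_mul_P_assoc (x : Alg K o ν) : b.P K o * (b.P K o * x) = b.P K o * x := by
  rw [← mul_assoc, P_mul_P]

theorem P_mul_y_assoc (r : Fin ν.card) (x : Alg K o ν) :
    b.P K o * (y K o r * x) = y K o r * (b.P K o * x) := by
  rw [← mul_assoc, P_mul_y, mul_assoc]

theorem P_mul_tau_assoc (r : Fin (κ.card - 1)) (x : Alg K o ν) :
    b.P K o * (tau K o (b.ti r) * x) = tau K o (b.ti r) * (b.P K o * x) := by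
  rw [← mul_assoc, P_mul_tau, mul_assoc]

theorem gen_rel ⦃x x' : FreeAlgebra K (Gen κ)⦄ (h : Rel K o κ x x') :
    FreeAlgebra.lift K (b.gen K o) x = FreeAlgebra.lift K (b.gen K o) x' := by
  have inj : Function.Injective (cornerIncl K (b.idem K o)) := fun _ _ h => Subtype.ext h
  apply inj
  cases h with
  | e_mul i j =>
    simp only [map_mul, FreeAlgebra.lift_ι_apply, incl_gen_e, E_mul_E]
    split_ifs <;> simp [incl_gen_e]
  | e_sum => simp only [map_sum, map_one, FreeAlgebra.lift_ι_apply, incl_gen_e, incl_one]; rfl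
  | y_e r i =>
    simp only [map_mul, FreeAlgebra.lift_ι_apply, incl_gen_e, incl_gen_y, mul_assoc, P_mul_E]
    rw [y_mul_E, ← P_mul_y, ← mul_assoc, E_mul_P]
  | tau_e r i =>
    simp only [map_mul, FreeAlgebra.lift_ι_apply, incl_gen_e, incl_gen_tau, mul_assoc, P_mul_E]
    rw [tau_mul_E, ← P_mul_tau, ← mul_assoc, E_mul_P]
  | y_y r s i hrs =>
    simp only [map_mul, map_zsmul, FreeAlgebra.lift_ι_apply, incl_gen_e, incl_gen_y, mul_assoc,
      P_mul_E, P_mul_y_assoc]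
    simp only [← mul_assoc, ← smul_mul_assoc]
    refine b.ext_E K o i _ _ fun j => ?_
    rw [y_mul_y K o _ _ _ (fun hh => hrs (b.yi_inj hh)), letter_yi, letter_yi]
    simp only [smul_mul_assoc]
  | tau_y r s i h1 h2 =>
    simp only [map_mul, map_zsmul, FreeAlgebra.lift_ι_apply, incl_gen_e, incl_gen_y, incl_gen_tau,
      mul_assoc, P_mul_E, P_mul_y_assoc, P_mul_tau_assoc]
    simp only [← mul_assoc, ← smul_mul_assoc]
    refine b.ext_E K o i _ _ fun j => ?_
    rw [tau_mul_y K o _ _ _ (fun hh => h1 (b.yi_inj hh))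
      (fun hh => h2 (b.yi_inj hh)), lo_ti, hi_ti, letter_yi, letter_yi, letter_yi]
    simp only [smul_mul_assoc]
  | tau_tau r s i h1 =>
    simp only [map_mul, map_zsmul, FreeAlgebra.lift_ι_apply, incl_gen_e, incl_gen_tau,
      mul_assoc, P_mul_E, P_mul_tau_assoc]
    simp only [← mul_assoc, ← smul_mul_assoc]
    refine b.ext_E K o i _ _ fun j => ?_
    rw [tau_mul_tau K o _ _ _ (by simp only [ti]; omega), lo_ti, hi_ti, lo_ti,
      hi_ti, letter_yi, letter_yi, letter_yi, letter_yi]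
    simp only [smul_mul_assoc]
  | tau_y_hi r i =>
    simp only [map_mul, map_add, map_zsmul, FreeAlgebra.lift_ι_apply, incl_gen_e, incl_gen_y,
      incl_gen_tau, mul_assoc, add_mul, smul_mul_assoc, P_mul_E, P_mul_y_assoc, P_mul_tau_assoc]
    have h1 : cornerIncl K (b.idem K o) (FreeAlgebra.lift K (b.gen K o)
          (if i.1 (lo r) = i.1 (hi r) then 1 else 0)) * b.E K o i
        = (if i.1 (lo r) = i.1 (hi r) then 1 else 0) * b.E K o i := by
      split_ifs
      · rw [map_one, incl_one, P_mul_E, one_mul]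
      · simp
    rw [h1]
    simp only [← mul_assoc, ← smul_mul_assoc, ← add_mul]
    refine b.ext_E K o i _ _ fun j => ?_
    rw [← hi_ti, tau_mul_y_hi, lo_ti, hi_ti, letter_yi, letter_yi]
    simp only [smul_mul_assoc]
  | y_hi_tau r i =>
    simp only [map_mul, map_add, map_zsmul, FreeAlgebra.lift_ι_apply, incl_gen_e, incl_gen_y,
      incl_gen_tau, mul_assoc, add_mul, smul_mul_assoc, P_mul_E, P_mul_y_assoc, P_mul_tau_assoc]
    have h1 : cornerIncl K (b.idem K o) (FreeAlgebra.lift K (b.gen K o)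
          (if i.1 (lo r) = i.1 (hi r) then 1 else 0)) * b.E K o i
        = (if i.1 (lo r) = i.1 (hi r) then 1 else 0) * b.E K o i := by
      split_ifs
      · rw [map_one, incl_one, P_mul_E, one_mul]
      · simp
    rw [h1]
    simp only [← mul_assoc, ← smul_mul_assoc, ← add_mul]
    refine b.ext_E K o i _ _ fun j => ?_
    rw [← hi_ti, y_hi_mul_tau, lo_ti, hi_ti, letter_yi, letter_yi]
    simp only [smul_mul_assoc]
  | tau_sq r i =>
    have h1 := map_qPoly o (i.1 (lo r)) (i.1 (hi r)) (B := (b.idem K o).Corner)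
      (FreeAlgebra.lift K (b.gen K o) : FreeAlgebra K (Gen κ) →ₐ[K] (b.idem K o).Corner).toRingHom
      (FreeAlgebra.ι K (Gen.y (lo r))) (FreeAlgebra.ι K (Gen.y (hi r)))
    simp only [AlgHom.toRingHom_eq_coe, RingHom.coe_coe, FreeAlgebra.lift_ι_apply] at h1
    simp only [map_mul, h1, FreeAlgebra.lift_ι_apply, incl_gen_e, incl_gen_tau,
      mul_assoc, P_mul_E, P_mul_tau_assoc]
    have h2 := qPoly_mul_of_hom o (i.1 (lo r)) (i.1 (hi r))
      ((cornerIncl K (b.idem K o) : _ →ₙ+* Alg K o ν)) (b.E K o i) (b.P_mul_E K o i)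
      (b.gen K o (.y (lo r))) (b.gen K o (.y (hi r))) (y K o (b.yi (lo r))) (y K o (b.yi (hi r)))
      (by
        change (y K o (b.yi (lo r)) * b.P K o) * _ = _
        rw [mul_assoc, P_mul_E])
      (by
        change (y K o (b.yi (hi r)) * b.P K o) * _ = _
        rw [mul_assoc, P_mul_E])
      (by
        change (y K o (b.yi (lo r)) * b.P K o) * _ = _
        rw [mul_assoc, P_mul_y_assoc, P_mul_E])
      (by
        change (y K o (b.yi (hi r)) * b.P K o) * _ = _
        rw [mul_assoc, P_mul_y_assoc, P_mul_E])
    refine Eq.trans ?_ h2.symm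
    rw [← mul_assoc]
    refine b.ext_E K o i _ _ fun j => ?_
    rw [tau_sq, lo_ti, hi_ti, letter_yi, letter_yi]
  | braid r s h i =>
    have h1 := map_braidTerm o (i.1 (lo r)) (i.1 (hi r)) (i.1 (hi s))
      (B := (b.idem K o).Corner)
      (FreeAlgebra.lift K (b.gen K o) : FreeAlgebra K (Gen κ) →ₐ[K] (b.idem K o).Corner).toRingHom
      (FreeAlgebra.ι K (Gen.y (lo r))) (FreeAlgebra.ι K (Gen.y (hi s)))
    simp only [AlgHom.toRingHom_eq_coe, RingHom.coe_coe, FreeAlgebra.lift_ι_apply] at h1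
    simp only [map_mul, map_sub, h1, FreeAlgebra.lift_ι_apply, incl_gen_e, incl_gen_tau,
      mul_assoc, sub_mul, P_mul_E, P_mul_tau_assoc]
    have h2 := braidTerm_mul_of_hom o (i.1 (lo r)) (i.1 (hi r)) (i.1 (hi s))
      ((cornerIncl K (b.idem K o) : _ →ₙ+* Alg K o ν)) (b.E K o i) (b.P_mul_E K o i)
      (b.gen K o (.y (lo r))) (b.gen K o (.y (hi s))) (y K o (b.yi (lo r))) (y K o (b.yi (hi s)))
      (by
        change (y K o (b.yi (lo r)) * b.P K o) * _ = _
        rw [mul_assoc, P_mul_E])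
      (by
        change (y K o (b.yi (hi s)) * b.P K o) * _ = _
        rw [mul_assoc, P_mul_E])
    refine Eq.trans ?_ h2.symm
    simp only [← mul_assoc, ← sub_mul]
    refine b.ext_E K o i _ _ fun j => ?_
    rw [braid K o (b.ti r) (b.ti s) (by simp only [ti]; omega), lo_ti, hi_ti, hi_ti, letter_yi,
      letter_yi, letter_yi]

/-- The homomorphism of `K`-algebras, not preserving identities, that sends `e(𝐢)` to
`∑_j e(𝐢, j)`, `y_r` to `y_{c + r} P` and `τ_r` to `τ_{c + r} P`, where `P = ∑_{𝐢, j} e(𝐢, j)` is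
the image of the identity. -/
def hom : Alg K o κ →ₙₐ[K] Alg K o ν :=
  (cornerIncl K (b.idem K o)).comp
    (Alg.lift (FreeAlgebra.lift K (b.gen K o)) (b.gen_rel K o) :
      Alg K o κ →ₐ[K] (b.idem K o).Corner).toNonUnitalAlgHom

theorem hom_apply (x : FreeAlgebra K (Gen κ)) :
    b.hom K o (Alg.mk K o κ x)
      = cornerIncl K (b.idem K o) (FreeAlgebra.lift K (b.gen K o) x) := by
  change cornerIncl K (b.idem K o) (Alg.lift _ (b.gen_rel K o) _) = _
  rw [Alg.lift_mk]

theorem hom_e (i : Word κ) : b.hom K o (e K o i) = ∑ j : J, e K o (b.ins i j) := by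
  rw [e, hom_apply, FreeAlgebra.lift_ι_apply]; rfl

theorem hom_y (r : Fin κ.card) : b.hom K o (y K o r) = y K o (b.yi r) * b.P K o := by
  rw [y, hom_apply, FreeAlgebra.lift_ι_apply]; rfl

theorem hom_tau (r : Fin (κ.card - 1)) :
    b.hom K o (tau K o r) = tau K o (b.ti r) * b.P K o := by
  rw [tau, hom_apply, FreeAlgebra.lift_ι_apply]; rfl

theorem hom_mul_P (x : Alg K o κ) : b.hom K o x * b.P K o = b.hom K o x := by
  change cornerIncl K (b.idem K o) _ * cornerIncl K (b.idem K o) 1 = _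
  rw [← map_mul, mul_one]
  rfl

end Block

/-! ### Induction -/

section concat

variable {n : ℕ} {μ ν : Multiset (Fin n)}

theorem Word.concat_left (v : Word μ) (w : Word ν) (k : Fin (μ + ν).card) (h : k.val < μ.card) :
    (v.concat w).1 k = v.1 ⟨k.val, h⟩ := by
  have hk : Fin.cast (Multiset.card_add μ ν) k = Fin.castAdd ν.card ⟨k.val, h⟩ := rfl
  change Fin.append v.1 w.1 (Fin.cast (Multiset.card_add μ ν) k) = _
  rw [hk, Fin.append_left]

theorem Word.concat_right (v : Word μ) (w : Word ν) (k : Fin (μ + ν).card)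
    (h : μ.card ≤ k.val) (h' : k.val - μ.card < ν.card) :
    (v.concat w).1 k = w.1 ⟨k.val - μ.card, h'⟩ := by
  have hk : Fin.cast (Multiset.card_add μ ν) k = Fin.natAdd μ.card ⟨k.val - μ.card, h'⟩ := by
    apply Fin.ext
    simp only [Fin.val_cast, Fin.val_natAdd]
    omega
  change Fin.append v.1 w.1 (Fin.cast (Multiset.card_add μ ν) k) = _
  rw [hk, Fin.append_right]

theorem Word.concat_inj (v v' : Word μ) (w w' : Word ν) (h : v.concat w = v'.concat w') :
    v = v' ∧ w = w' := by
  have hc := Multiset.card_add μ ν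
  have hk : ∀ k, (v.concat w).1 k = (v'.concat w').1 k := fun k => by rw [h]
  constructor
  · apply Subtype.ext
    funext r
    have h1 := hk ⟨r.val, by omega⟩
    rwa [concat_left _ _ _ r.isLt, concat_left _ _ _ r.isLt] at h1
  · apply Subtype.ext
    funext r
    have h1 := hk ⟨μ.card + r.val, by omega⟩
    rw [concat_right _ _ _ (by simp) (by simp), concat_right _ _ _ (by simp) (by simp)] at h1
    simpa using h1

theorem Word.concat_left_eq (v : Word μ) (w : Word ν) (k : Fin (μ + ν).card) (s : Fin μ.card)
    (h : k.val = s.val) : (v.concat w).1 k = v.1 s := by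
  rw [concat_left v w k (h ▸ s.isLt)]
  exact congrArg v.1 (Fin.ext h)

theorem Word.concat_right_eq (v : Word μ) (w : Word ν) (k : Fin (μ + ν).card) (s : Fin ν.card)
    (h : k.val = μ.card + s.val) : (v.concat w).1 k = w.1 s := by
  rw [concat_right v w k (by omega) (by omega)]
  exact congrArg w.1 (Fin.ext (by simp only [h]; omega))

theorem Word.swap_apply (r : Fin (ν.card - 1)) (w : Word ν) (k : Fin ν.card) :
    (w.swap r).1 k = if k.val = r.val then w.1 (hi r)
      else if k.val = r.val + 1 then w.1 (lo r) else w.1 k := by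
  change w.1 (Equiv.swap (lo r) (hi r) k) = _
  rw [Equiv.swap_apply_def]
  simp only [Fin.ext_iff, lo, hi]
  split_ifs <;> rfl

/-- The first letters of a concatenation. -/
def leftBlock (μ ν : Multiset (Fin n)) : Block μ (μ + ν) (Word ν) where
  c := 0
  hc := by rw [Multiset.card_add]; omega
  ins i j := i.concat j
  ins_inj i j i' j' h := Word.concat_inj _ _ _ _ h
  letter i j r := Word.concat_left_eq _ _ _ _ (Nat.zero_add _)
  ins_swap i j r := by
    apply Subtype.ext
    funext k
    have hr := r.isLt
    have hk2 := lt_of_lt_of_eq k.isLt (Multiset.card_add μ ν)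
    rw [Word.swap_apply]
    by_cases hk : k.val < μ.card
    · rw [Word.concat_left_eq _ _ k ⟨k.val, hk⟩ rfl, Word.swap_apply,
        Word.concat_left_eq _ _ k ⟨k.val, hk⟩ rfl,
        Word.concat_left_eq _ _ (hi _) (hi r) (by simp only [hi]; omega),
        Word.concat_left_eq _ _ (lo _) (lo r) (by simp only [lo]; omega)]
      simp only [Nat.zero_add]
    · rw [if_neg (by simp only []; omega), if_neg (by simp only []; omega),
        Word.concat_right _ _ _ (by omega) (by omega), Word.concat_right _ _ _ (by omega) (by omega)]

/-- The last letters of a concatenation. -/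
def rightBlock (μ ν : Multiset (Fin n)) : Block ν (μ + ν) (Word μ) where
  c := μ.card
  hc := by rw [Multiset.card_add]
  ins i j := j.concat i
  ins_inj i j i' j' h := (Word.concat_inj _ _ _ _ h).symm
  letter i j r := Word.concat_right_eq _ _ _ _ rfl
  ins_swap i j r := by
    apply Subtype.ext
    funext k
    have hr := r.isLt
    have hk2 := lt_of_lt_of_eq k.isLt (Multiset.card_add μ ν)
    rw [Word.swap_apply]
    by_cases hk : k.val < μ.card
    · rw [if_neg (by simp only []; omega), if_neg (by simp only []; omega),
        Word.concat_left _ _ _ hk, Word.concat_left _ _ _ hk]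
    · have hk3 : k.val - μ.card < ν.card := by omega
      rw [Word.concat_right_eq _ _ k ⟨k.val - μ.card, hk3⟩ (by simp only []; omega),
        Word.swap_apply,
        Word.concat_right_eq _ _ k ⟨k.val - μ.card, hk3⟩ (by simp only []; omega),
        Word.concat_right_eq _ _ (hi _) (hi r) (by simp only [hi]; omega),
        Word.concat_right_eq _ _ (lo _) (lo r) (by simp only [lo])]
      have e1 : (k.val - μ.card = r.val) ↔ (k.val = μ.card + r.val) := by omega
      have e2 : (k.val - μ.card = r.val + 1) ↔ (k.val = μ.card + r.val + 1) := by omega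
      simp only [e1, e2]

end concat

section induction

variable (K : Type*) [Field K] {n : ℕ} (o : Orientation n) (μ ν : Multiset (Fin n))

/-- The idempotent `1_{μ,ν} = ∑ e(𝐢𝐣)`, the sum over `𝐢 ∈ I^μ` and `𝐣 ∈ I^ν`. -/
def idemp : Alg K o (μ + ν) := ∑ i : Word μ, ∑ j : Word ν, e K o (i.concat j)

/-- The restriction of the natural embedding `H⁻(μ) ⊗ H⁻(ν) → H⁻(μ + ν)` to `H⁻(μ)`; it sends
`e(𝐢)` to `∑_𝐣 e(𝐢𝐣)`, `y_r` to `y_r 1_{μ,ν}` and `τ_r` to `τ_r 1_{μ,ν}`. -/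
def embLeft : Alg K o μ →ₙₐ[K] Alg K o (μ + ν) := (leftBlock μ ν).hom K o

/-- The restriction of the natural embedding `H⁻(μ) ⊗ H⁻(ν) → H⁻(μ + ν)` to `H⁻(ν)`; it sends
`e(𝐣)` to `∑_𝐢 e(𝐢𝐣)`, `y_r` to `y_{a+r} 1_{μ,ν}` and `τ_r` to `τ_{a+r} 1_{μ,ν}`, where `a` is the
height of `μ`. -/
def embRight : Alg K o ν →ₙₐ[K] Alg K o (μ + ν) := (rightBlock μ ν).hom K o

theorem leftBlock_P : (leftBlock μ ν).P K o = idemp K o μ ν := rfl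

theorem rightBlock_P : (rightBlock μ ν).P K o = idemp K o μ ν := Finset.sum_comm

theorem embLeft_e (i : Word μ) : embLeft K o μ ν (e K o i) = ∑ j : Word ν, e K o (i.concat j) :=
  (leftBlock μ ν).hom_e K o i

theorem embLeft_y (r : Fin μ.card) : embLeft K o μ ν (y K o r) =
    y K o ⟨r.val, by rw [Multiset.card_add]; omega⟩ * idemp K o μ ν := by
  rw [embLeft, Block.hom_y, leftBlock_P]
  congr 2
  exact Fin.ext (Nat.zero_add _)

theorem embLeft_tau (r : Fin (μ.card - 1)) : embLeft K o μ ν (tau K o r) =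
    tau K o ⟨r.val, by rw [Multiset.card_add]; omega⟩ * idemp K o μ ν := by
  rw [embLeft, Block.hom_tau, leftBlock_P]
  congr 2
  exact Fin.ext (Nat.zero_add _)

theorem embRight_e (j : Word ν) : embRight K o μ ν (e K o j) = ∑ i : Word μ, e K o (i.concat j) :=
  (rightBlock μ ν).hom_e K o j

theorem embRight_y (r : Fin ν.card) : embRight K o μ ν (y K o r) =
    y K o ⟨μ.card + r.val, by rw [Multiset.card_add]; omega⟩ * idemp K o μ ν := by
  rw [embRight, Block.hom_y, rightBlock_P]
  rfl

theorem embRight_tau (r : Fin (ν.card - 1)) : embRight K o μ ν (tau K o r) =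
    tau K o ⟨μ.card + r.val, by rw [Multiset.card_add]; omega⟩ * idemp K o μ ν := by
  rw [embRight, Block.hom_tau, rightBlock_P]
  rfl

/-- The left ideal `H⁻(μ + ν) 1_{μ,ν}`. -/
abbrev leftIdeal : Ideal (Alg K o (μ + ν)) := Ideal.span {idemp K o μ ν}

/-- The natural embedding `H⁻(μ) ⊗ H⁻(ν) → H⁻(μ + ν)` on `a ⊗ b`. -/
def emb (a : Alg K o μ) (b : Alg K o ν) : Alg K o (μ + ν) :=
  embLeft K o μ ν a * embRight K o μ ν b

/-- Right multiplication by the image of `a ⊗ b` on `H⁻(μ + ν) 1_{μ,ν}`. -/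
def rightMul (h : leftIdeal K o μ ν) (a : Alg K o μ) (b : Alg K o ν) : leftIdeal K o μ ν :=
  ⟨h.1 * emb K o μ ν a b, by
    have h1 : embRight K o μ ν b * idemp K o μ ν = embRight K o μ ν b := by
      rw [← rightBlock_P]; exact (rightBlock μ ν).hom_mul_P K o b
    unfold emb
    rw [← h1, ← mul_assoc, ← mul_assoc]
    exact Ideal.mul_mem_left _ _ (Ideal.subset_span rfl)⟩

variable {M : Type*} [AddCommGroup M] [Module K M] [Module (Alg K o μ) M]
  [IsScalarTower K (Alg K o μ) M]
  {N : Type*} [AddCommGroup N] [Module K N] [Module (Alg K o ν) N]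
  [IsScalarTower K (Alg K o ν) N]

/-- The submodule of `H⁻(μ + ν) 1_{μ,ν} ⊗ (M ⊗ N)` (tensor products over `K`) generated by the
elements `h (a ⊗ b) ⊗ (m ⊗ n) - h ⊗ (a ⊗ b) (m ⊗ n)`, where `b` and `m` are homogeneous and
`(a ⊗ b) (m ⊗ n) = (-1)^{p(b) p(m)} a m ⊗ b n` is the action on `M ⊠ N` of the tensor product
`H⁻(μ) ⊗ H⁻(ν)` of superalgebras. -/
def balanced (ℳ : ℤ × ZMod 2 → Submodule K M) (N : Type*) [AddCommGroup N] [Module K N]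
    [Module (Alg K o ν) N] :
    Submodule (Alg K o (μ + ν)) (leftIdeal K o μ ν ⊗[K] (M ⊗[K] N)) :=
  Submodule.span _ {x | ∃ (g g' : ℤ × ZMod 2) (h : leftIdeal K o μ ν) (a : Alg K o μ)
    (b : Alg K o ν) (m : M) (v : N), b ∈ component K o ν g ∧ m ∈ ℳ g' ∧
    x = rightMul K o μ ν h a b ⊗ₜ[K] (m ⊗ₜ[K] v)
      - sgn (g.2 * g'.2) • (h ⊗ₜ[K] ((a • m) ⊗ₜ[K] (b • v)))}

/-- The induced module `M ∘ N = H⁻(μ + ν) 1_{μ,ν} ⊗_{H⁻(μ) ⊗ H⁻(ν)} (M ⊠ N)`. -/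
abbrev Ind (ℳ : ℤ × ZMod 2 → Submodule K M) (N : Type*) [AddCommGroup N] [Module K N]
    [Module (Alg K o ν) N] : Type _ :=
  (leftIdeal K o μ ν ⊗[K] (M ⊗[K] N)) ⧸ balanced K o μ ν ℳ N

/-- The grading of `M ∘ N`: the degree of `h ⊗ (m ⊗ v)` is the sum of the degrees of the
homogeneous elements `h`, `m` and `v`. -/
def indGrading (ℳ : ℤ × ZMod 2 → Submodule K M) (𝒩 : ℤ × ZMod 2 → Submodule K N)
    (g : ℤ × ZMod 2) : Submodule K (Ind K o μ ν ℳ N) :=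
  Submodule.span K {x | ∃ (g₁ g₂ g₃ : ℤ × ZMod 2) (h : leftIdeal K o μ ν) (m : M) (v : N),
    g₁ + g₂ + g₃ = g ∧ h.1 ∈ component K o (μ + ν) g₁ ∧ m ∈ ℳ g₂ ∧ v ∈ 𝒩 g₃ ∧
    x = (balanced K o μ ν ℳ N).mkQ (h ⊗ₜ[K] (m ⊗ₜ[K] v))}

end induction

end SpinHecke

end

noncomputable section

namespace SpinHecke

/-! ### Clifford elements and the local operators of the generic representation -/

/-! The heart of the matter is that the left ideal `H⁻(μ + ν) 1_{μ,ν}` is a free right module over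
the superalgebra `H⁻(μ) ⊗ H⁻(ν)`. A basis consists of the elements `ρ_c 1_{μ,ν}`, where `c` runs
over the arrangements of two colours on the places (`Rearr (blockColour μ ν)`, which stands for the
minimal coset representatives) and `ρ_c` is the product of the `τ_r` along a chosen reduced word of
`c`. Hence `M ∘ N` is, as a vector space, a direct sum of copies of `M ⊗ N` indexed by `c`
(`foldEquiv`). For homogeneous weight vectors `m`, `v` with words `𝐢`, `𝐣`, the vector `ρ_c ⊗ (m ⊗
v)` is again a homogeneous weight vector. Its word is the shuffle of `𝐢` and `𝐣` that `c`
prescribes, and `ρ_c` contributes a factor `(-1)^{p(i) p(j)} q^{-(α_i, α_j)}` for each letter `j` of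
`𝐣` that stands before a letter `i` of `𝐢` (`tauDeg_word`). The recursion for `⋄` produces the same
shuffles with the same factors when the word of `N` is the first argument (`wordShuffle_eq_sum`),
which explains the order of the factors in the formula.

Spanning (`IsArrStable.arrLevel`, `IsArrStable.mem_iSup_of_mul`): let `X` be a subspace stable under
the `e(𝐢)`, the `y_r`, and those `τ_r` that exchange equal colours of a monotone colouring. Then the
sum of all `ρ_c X` is a left ideal. The proof is an induction on the number of inversions of `c`:
moving `y` past `τ`, reducing `τ_r²`, and the right-hand side of the braid relation only produce
terms with fewer inversions, so a reduced word may be replaced by another one modulo such terms.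
With distinct colours at all places this shows that the ordered monomials `ρ_c y^γ e(𝐢)` span
(`span_pbw`). With two colours it shows that the `ρ_c (a ⊗ b)` span the left ideal
(`arrMap_surjective`).

Independence (`linearIndependent_tauProd_mul`): the algebra acts on a space with one copy of an
algebra `E` for each arrangement of the strands. Here `s_l` are independent indeterminates, and `E`
contains pairwise anticommuting elements `c_l`, `D_l` with squares `s_l`, `-s_l`. The generator
`y_r` acts by `c_l` or `s_l` when an odd or an even strand `l` is at the place `r`, and `τ_r` acts
like a divided difference: one part fixes the arrangement and another one exchanges two strands. The
elements `D_l` supply the signs of the exchanging part. Along a reduced word from the identity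
arrangement a product of `τ_r` has a leading term at its end, with a coefficient that can be
cancelled (`tauProd_single`), so products with distinct ends are independent. The monomials in the
`y_r` are separated by applying them to the vacuum of a Jordan–Wigner module
(`linearIndependent_opYProd`).

The images under `(c, a ⊗ b) ↦ ρ_c (a ⊗ b)` of the spanning ordered monomials are, up to sign,
independent elements of this kind; this gives freeness (`arrMap_injective`).

Two further points need care. That the components of `H⁻(ν)` are independent, so that degrees are
well defined, follows from a representation on shifted copies of the algebra that records degrees
(`shiftRep`). The signs of the superalgebra action on `M ⊗ N` are carried by the parity involution
of `M` (`superAct`). -/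

theorem mul_mul_of_anticomm {E : Type*} [Ring E] {x y : E} (h : x * y = -(y * x)) (z : E) :
    x * (y * z) = -(y * (x * z)) := by rw [← mul_assoc, h, neg_mul, mul_assoc]

theorem mul_mul_of_sq {Z E : Type*} [Field Z] [Ring E] [Algebra Z E] {x : E} {s : Z}
    (h : x * x = s • (1 : E)) (z : E) : x * (x * z) = s • z := by
  rw [← mul_assoc, h, smul_mul_assoc, one_mul]

/-- Two families of pairwise anticommuting elements with squares `s_l` and `-s_l`, for generic
scalars `s_l`. -/
structure IsClifford {Z E : Type*} [Field Z] [Ring E] [Algebra Z E] {Λ : Type*}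
    (s : Λ → Z) (c D : Λ → E) : Prop where
  c_sq : ∀ l, c l * c l = s l • (1 : E)
  D_sq : ∀ l, D l * D l = (-s l) • (1 : E)
  c_c : ∀ l m, l ≠ m → c l * c m = -(c m * c l)
  D_D : ∀ l m, l ≠ m → D l * D m = -(D m * D l)
  D_c : ∀ l m, D l * c m = -(c m * D l)
  sub_ne : ∀ l m, l ≠ m → s m - s l ≠ 0
  add_ne : ∀ l m, l ≠ m → s m + s l ≠ 0

theorem sgn_zero : sgn 0 = 1 := rfl

theorem sgn_one : sgn 1 = -1 := rfl

theorem zmod_two_cases (a : ZMod 2) : a = 0 ∨ a = 1 := by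
  revert a; decide

theorem sgn_add (a b : ZMod 2) : sgn (a + b) = sgn a * sgn b := by
  revert a b; decide

theorem zmod_two_mul_self (a : ZMod 2) : a * a = a := by
  revert a; decide

theorem par_of_even {n : ℕ} {i : Fin n} (h : i.val + 1 ≠ n) : par i = 0 := if_neg h

/-- There is only one odd node, so two odd letters are equal. Thus a crossing is odd only if it
crosses two letters `n`. -/
theorem par_mul_par_of_ne {n : ℕ} {i j : Fin n} (h : i ≠ j) : par i * par j = 0 := by
  unfold par
  split_ifs with h1 h2
  · exact absurd (Fin.ext (by omega)) h
  all_goals simp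

section local_operators

variable {Z E : Type*} [Field Z] [Ring E] [Algebra Z E] {Λ : Type*} {n : ℕ}

/-- The operator by which `y_r` acts when the strand `l` is at the place `r`. -/
def opY (k : Λ → Fin n) (s : Λ → Z) (c : Λ → E) (l : Λ) : E :=
  if (k l).val + 1 = n then c l else algebraMap Z E (s l)

/-- The coefficient with which `τ_r` fixes the strands `l`, `m` at the places `r`, `r + 1`. -/
def opB (k : Λ → Fin n) (s : Λ → Z) (c : Λ → E) (l m : Λ) : E :=
  if k l = k m then (s m - s l)⁻¹ • (if (k l).val + 1 = n then c m - c l else 1) else 0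

/-- The values of `Q_{ij}` on strands with different letters. -/
def qScalar (o : Orientation n) (k : Λ → Fin n) (s : Λ → Z) (l m : Λ) : Z :=
  if Adjacent (k l) (k m) then (-1) ^ o.d (k l) (k m) * (s l - s m) else 1

/-- The coefficient with which `τ_r` exchanges the strands `l`, `m` at the places `r`, `r + 1`. -/
def opS (o : Orientation n) (k : Λ → Fin n) (s : Λ → Z) (D : Λ → E) (l m : Λ) : E :=
  if k l = k m then (s m - s l)⁻¹ • (if (k l).val + 1 = n then D m - D l else 1)
  else algebraMap Z E (if k l < k m then 1 else qScalar o k s l m)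

variable {o : Orientation n} {k : Λ → Fin n} {s : Λ → Z} {c D : Λ → E}

theorem opB_of_ne {l m : Λ} (h : k l ≠ k m) : opB k s c l m = 0 := if_neg h

theorem opB_of_odd {l m : Λ} (h : k l = k m) (h' : (k l).val + 1 = n) :
    opB k s c l m = (s m - s l)⁻¹ • (c m - c l) := by rw [opB, if_pos h, if_pos h']

theorem opB_of_even {l m : Λ} (h : k l = k m) (h' : (k l).val + 1 ≠ n) :
    opB k s c l m = algebraMap Z E (s m - s l)⁻¹ := by
  rw [opB, if_pos h, if_neg h', Algebra.algebraMap_eq_smul_one]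

theorem opS_of_ne {l m : Λ} (h : k l ≠ k m) :
    opS o k s D l m = algebraMap Z E (if k l < k m then 1 else qScalar o k s l m) := if_neg h

theorem opS_of_odd {l m : Λ} (h : k l = k m) (h' : (k l).val + 1 = n) :
    opS o k s D l m = (s m - s l)⁻¹ • (D m - D l) := by rw [opS, if_pos h, if_pos h']

theorem opS_of_even {l m : Λ} (h : k l = k m) (h' : (k l).val + 1 ≠ n) :
    opS o k s D l m = algebraMap Z E (s m - s l)⁻¹ := by
  rw [opS, if_pos h, if_neg h', Algebra.algebraMap_eq_smul_one]

theorem exists_opS_eq (o : Orientation n) (s : Λ → Z) (D : Λ → E) {l m : Λ} (h : k l ≠ k m) :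
    ∃ z : Z, opS o k s D l m = z • 1 :=
  ⟨_, by rw [opS_of_ne h, Algebra.algebraMap_eq_smul_one]⟩

theorem opY_of_odd {l : Λ} (h' : (k l).val + 1 = n) : opY k s c l = c l := if_pos h'

theorem opY_of_even {l : Λ} (h' : (k l).val + 1 ≠ n) : opY k s c l = algebraMap Z E (s l) :=
  if_neg h'

/-- Exchanging the strands changes the sign of `s l - s m`, and also that of the prefactor, because
exactly one of `d_{ij}`, `d_{ji}` is `1`. -/
theorem qScalar_comm (l m : Λ) : qScalar o k s l m = qScalar o k s m l := by
  have hd := o.d_add (k l) (k m)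
  have ha : Adjacent (k l) (k m) ↔ Adjacent (k m) (k l) := by unfold Adjacent; tauto
  unfold qScalar
  by_cases h : Adjacent (k l) (k m)
  · rw [if_pos h, if_pos (ha.1 h)]
    rw [if_pos h] at hd
    have : (o.d (k l) (k m) = 0 ∧ o.d (k m) (k l) = 1) ∨
      (o.d (k l) (k m) = 1 ∧ o.d (k m) (k l) = 0) := by omega
    rcases this with ⟨h1, h2⟩ | ⟨h1, h2⟩ <;> rw [h1, h2] <;> ring
  · rw [if_neg h, if_neg (fun h' => h (ha.2 h'))]

theorem qScalar_ne_zero (hC : IsClifford s c D) {l m : Λ} (h : l ≠ m) :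
    qScalar o k s l m ≠ 0 := by
  unfold qScalar
  split_ifs
  · refine mul_ne_zero (pow_ne_zero _ (by simp)) (hC.sub_ne m l h.symm)
  · exact one_ne_zero

/-- A common form of the two cases of a sign. -/
theorem sgn_par_smul {A : Type*} [AddCommGroup A] (i j : Fin n) (x : A) :
    sgn (par i * par j) • x = if i.val + 1 = n ∧ j.val + 1 = n then -x else x := by
  by_cases hi : i.val + 1 = n <;> by_cases hj : j.val + 1 = n <;>
    simp [par, hi, hj, sgn_zero, sgn_one]

theorem opY_mul_opY (hC : IsClifford s c D) {l m : Λ} (h : l ≠ m) :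
    opY k s c l * opY k s c m
      = sgn (par (k l) * par (k m)) • (opY k s c m * opY k s c l) := by
  rw [sgn_par_smul]
  by_cases h1 : (k l).val + 1 = n <;> by_cases h2 : (k m).val + 1 = n
  · rw [opY_of_odd h1, opY_of_odd h2, if_pos ⟨h1, h2⟩, hC.c_c l m h]
  · rw [opY_of_even h2, if_neg (fun h => h2 h.2), Algebra.commutes]
  · rw [opY_of_even h1, if_neg (fun h => h1 h.1), Algebra.commutes]
  · rw [opY_of_even h1, if_neg (fun h => h1 h.1), Algebra.commutes]

/-- An element is odd, resp. even, if it anticommutes, resp. commutes, with `c l`. -/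
theorem sub_smul_anticomm {z : Z} {x x' w : E} (h : x * w = -(w * x)) (h' : x' * w = -(w * x')) :
    (z • (x - x')) * w = -(w * (z • (x - x'))) := by
  rw [smul_mul_assoc, mul_smul_comm, sub_mul, mul_sub, h, h', ← smul_neg]
  congr 1
  abel

/-- No condition on `j` is needed, since each `D` anticommutes with every `c`, also with the one of
the same strand. The exchanging part of `τ_r` therefore contributes only signs, and the corrections
`δ` in the relations come from `opB`. -/
theorem opS_mul_opY (hC : IsClifford s c D) (l m j : Λ) :
    opS o k s D l m * opY k s c j
      = sgn (par (k l) * par (k m) * par (k j)) • (opY k s c j * opS o k s D l m) := by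
  by_cases h : k l = k m
  · rw [← h, zmod_two_mul_self, sgn_par_smul]
    by_cases h1 : (k l).val + 1 = n
    · rw [opS_of_odd h h1]
      by_cases h2 : (k j).val + 1 = n
      · rw [if_pos ⟨h1, h2⟩, opY_of_odd h2, sub_smul_anticomm (hC.D_c _ _) (hC.D_c _ _)]
      · rw [if_neg (fun h => h2 h.2), opY_of_even h2, Algebra.commutes]
    · rw [opS_of_even h h1, if_neg (fun h => h1 h.1), Algebra.commutes]
  · rw [par_mul_par_of_ne h, zero_mul, sgn_zero, one_smul, opS_of_ne h, Algebra.commutes]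

theorem opB_mul_opY (hC : IsClifford s c D) {l m j : Λ} (hl : j ≠ l) (hm : j ≠ m) :
    opB k s c l m * opY k s c j
      = sgn (par (k l) * par (k m) * par (k j)) • (opY k s c j * opB k s c l m) := by
  by_cases h : k l = k m
  · rw [← h, zmod_two_mul_self, sgn_par_smul]
    by_cases h1 : (k l).val + 1 = n
    · rw [opB_of_odd h h1]
      by_cases h2 : (k j).val + 1 = n
      · rw [if_pos ⟨h1, h2⟩, opY_of_odd h2,
          sub_smul_anticomm (hC.c_c _ _ hm.symm) (hC.c_c _ _ hl.symm)]
      · rw [if_neg (fun h => h2 h.2), opY_of_even h2, Algebra.commutes]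
    · rw [opB_of_even h h1, if_neg (fun h => h1 h.1), Algebra.commutes]
  · rw [opB_of_ne h, zero_mul, mul_zero, smul_zero]

/-- In the odd case the mixed products cancel in `(c m - c l) c m + c l (c m - c l)`, which leaves
`s m - s l`; the denominator turns this into the correction `1`. -/
theorem opB_mul_opY_right (hC : IsClifford s c D) {l m : Λ} (hlm : l ≠ m) :
    opB k s c l m * opY k s c m
      = sgn (par (k l) * par (k m)) • (opY k s c l * opB k s c l m)
        + if k l = k m then 1 else 0 := by
  have hne := hC.sub_ne l m hlm
  by_cases h : k l = k m
  · rw [sgn_par_smul, if_pos h, ← h]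
    by_cases h1 : (k l).val + 1 = n
    · rw [if_pos ⟨h1, h1⟩, opB_of_odd h h1, opY_of_odd h1, opY_of_odd (h ▸ h1)]
      simp only [smul_mul_assoc, mul_smul_comm, sub_mul, mul_sub, hC.c_sq]
      match_scalars
      · field_simp
        ring
      · ring
    · rw [if_neg (fun h => h1 h.1), opB_of_even h h1, opY_of_even h1, opY_of_even (h ▸ h1),
        ← map_mul, ← map_mul, ← map_one (algebraMap Z E), ← map_add]
      congr 1
      field_simp
      ring
  · rw [opB_of_ne h, if_neg h]; simp

theorem opY_mul_opB_right (hC : IsClifford s c D) {l m : Λ} (hlm : l ≠ m) :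
    opY k s c m * opB k s c l m
      = sgn (par (k l) * par (k m)) • (opB k s c l m * opY k s c l)
        + if k l = k m then 1 else 0 := by
  have hne := hC.sub_ne l m hlm
  by_cases h : k l = k m
  · rw [sgn_par_smul, if_pos h, ← h]
    by_cases h1 : (k l).val + 1 = n
    · rw [if_pos ⟨h1, h1⟩, opB_of_odd h h1, opY_of_odd h1, opY_of_odd (h ▸ h1)]
      simp only [smul_mul_assoc, mul_smul_comm, sub_mul, mul_sub, hC.c_sq]
      match_scalars
      · field_simp
        ring
      · ring
    · rw [if_neg (fun h => h1 h.1), opB_of_even h h1, opY_of_even h1, opY_of_even (h ▸ h1),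
        ← map_mul, ← map_mul, ← map_one (algebraMap Z E), ← map_add]
      congr 1
      field_simp
      ring
  · rw [opB_of_ne h, if_neg h]; simp

/-- A coefficient of `τ_r` is central, or a multiple of a difference of Clifford elements. -/
theorem supercomm_aux {l m l' m' : Λ} {u v u' v' x x' : E} {z z' w w' : Z}
    (hx : x = if k l = k m then z • (if (k l).val + 1 = n then u - v else 1) else algebraMap Z E w)
    (hx' : x' = if k l' = k m' then z' • (if (k l').val + 1 = n then u' - v' else 1)
      else algebraMap Z E w')
    (h1 : u * u' = -(u' * u)) (h2 : u * v' = -(v' * u)) (h3 : v * u' = -(u' * v))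
    (h4 : v * v' = -(v' * v)) :
    x * x' = sgn (par (k l) * par (k m) * par (k l') * par (k m')) • (x' * x) := by
  by_cases h : k l = k m
  · by_cases h' : k l' = k m'
    · rw [← h, ← h', zmod_two_mul_self, mul_assoc, zmod_two_mul_self, sgn_par_smul, hx, hx',
        if_pos h, if_pos h']
      by_cases ho : (k l).val + 1 = n
      · by_cases ho' : (k l').val + 1 = n
        · rw [if_pos ho, if_pos ho', if_pos ⟨ho, ho'⟩]
          refine sub_smul_anticomm ?_ ?_
          · rw [mul_smul_comm, smul_mul_assoc, mul_sub, sub_mul, h1, h2, ← smul_neg]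
            congr 1; abel
          · rw [mul_smul_comm, smul_mul_assoc, mul_sub, sub_mul, h3, h4, ← smul_neg]
            congr 1; abel
        · rw [if_neg ho', if_neg (fun h : _ ∧ _ => ho' h.2), ← Algebra.algebraMap_eq_smul_one,
            Algebra.commutes]
      · rw [if_neg ho, if_neg (fun h : _ ∧ _ => ho h.1), ← Algebra.algebraMap_eq_smul_one,
            Algebra.commutes]
    · rw [mul_assoc (par (k l) * par (k m)), par_mul_par_of_ne h', mul_zero, sgn_zero, one_smul,
        hx', if_neg h', Algebra.commutes]
  · rw [par_mul_par_of_ne h, zero_mul, zero_mul, sgn_zero, one_smul, hx, if_neg h,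
      Algebra.commutes]

theorem opB_eq (l m : Λ) : opB k s c l m =
    if k l = k m then (s m - s l)⁻¹ • (if (k l).val + 1 = n then c m - c l else 1)
      else algebraMap Z E 0 := by rw [map_zero]; rfl

section supercomm

variable (hC : IsClifford s c D) {l m l' m' : Λ} (h1 : l ≠ l') (h2 : l ≠ m') (h3 : m ≠ l')
  (h4 : m ≠ m')
include hC h1 h2 h3 h4

theorem opB_mul_opB : opB k s c l m * opB k s c l' m' =
    sgn (par (k l) * par (k m) * par (k l') * par (k m')) •
      (opB k s c l' m' * opB k s c l m) :=
  supercomm_aux (opB_eq l m) (opB_eq l' m') (hC.c_c _ _ h4) (hC.c_c _ _ h3) (hC.c_c _ _ h2)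
    (hC.c_c _ _ h1)

theorem opB_mul_opS : opB k s c l m * opS o k s D l' m' =
    sgn (par (k l) * par (k m) * par (k l') * par (k m')) •
      (opS o k s D l' m' * opB k s c l m) :=
  supercomm_aux (opB_eq l m) rfl (by rw [hC.D_c, neg_neg]) (by rw [hC.D_c, neg_neg])
    (by rw [hC.D_c, neg_neg]) (by rw [hC.D_c, neg_neg])

theorem opS_mul_opB : opS o k s D l m * opB k s c l' m' =
    sgn (par (k l) * par (k m) * par (k l') * par (k m')) •
      (opB k s c l' m' * opS o k s D l m) :=
  supercomm_aux rfl (opB_eq l' m') (hC.D_c _ _) (hC.D_c _ _) (hC.D_c _ _) (hC.D_c _ _)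

theorem opS_mul_opS : opS o k s D l m * opS o k s D l' m' =
    sgn (par (k l) * par (k m) * par (k l') * par (k m')) •
      (opS o k s D l' m' * opS o k s D l m) :=
  supercomm_aux rfl rfl (hC.D_D _ _ h4) (hC.D_D _ _ h3) (hC.D_D _ _ h2) (hC.D_D _ _ h1)

end supercomm

/-- The exponent `2 / s_i` is `2` for an odd letter and `1` for an even one, so in both cases the
power of `Y_l` is the scalar `s l`. -/
theorem qPoly_opY (hC : IsClifford s c D) {l m : Λ} (h : k l ≠ k m) :
    qPoly o (k l) (k m) (opY k s c l) (opY k s c m) = algebraMap Z E (qScalar o k s l m) := by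
  have key : ∀ l, opY k s c l ^ (2 / symm (k l)) = algebraMap Z E (s l) := by
    intro l
    by_cases h1 : (k l).val + 1 = n
    · rw [opY_of_odd h1, symm, if_pos h1, Nat.div_one, pow_two, hC.c_sq,
        Algebra.algebraMap_eq_smul_one]
    · rw [opY_of_even h1, symm, if_neg h1, Nat.div_self (by norm_num), pow_one]
  unfold qPoly qScalar
  rw [if_neg h, key, key]
  split_ifs <;> simp

/-- This is the coefficient of `τ_r²` on the unchanged arrangement. For equal odd letters `(c m - c
l)²` is `s m + s l` and `(D m - D l)²` is `-(s m + s l)`; the opposite squares of `c` and `D` are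
what makes `τ_r²` vanish there. -/
theorem op_sq (hC : IsClifford s c D) {l m : Λ} (hlm : l ≠ m) :
    opB k s c l m * opB k s c l m + opS o k s D m l * opS o k s D l m
      = qPoly o (k l) (k m) (opY k s c l) (opY k s c m) := by
  have h1 := hC.sub_ne l m hlm
  have h2 := hC.sub_ne m l hlm.symm
  by_cases h : k l = k m
  · rw [qPoly, if_pos h]
    by_cases ho : (k l).val + 1 = n
    · rw [opB_of_odd h ho, opS_of_odd h ho, opS_of_odd h.symm (h ▸ ho)]
      have h3 := hC.c_c m l hlm.symm
      have h4 := hC.D_D m l hlm.symm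
      simp only [smul_mul_assoc, mul_smul_comm, sub_mul, mul_sub, hC.c_sq, hC.D_sq, h3, h4]
      match_scalars <;> field_simp <;> ring
    · rw [opB_of_even h ho, opS_of_even h ho, opS_of_even h.symm (h ▸ ho), ← map_mul, ← map_mul,
        ← map_add, ← map_zero (algebraMap Z E)]
      congr 1
      field_simp
      ring
  · rw [qPoly_opY hC h, opB_of_ne h, opS_of_ne h, opS_of_ne (fun e => h e.symm), zero_mul, zero_add,
      ← map_mul]
    congr 1
    rcases lt_or_gt_of_ne h with h3 | h3
    · rw [if_pos h3, if_neg (not_lt_of_gt h3), mul_one, qScalar_comm]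
    · rw [if_pos h3, if_neg (not_lt_of_gt h3), one_mul]

/-- This is the coefficient of `τ_r²` on the exchanged arrangement. For equal odd letters `opB` is
symmetric in the two strands and anticommutes with `opS`; for equal even letters it is antisymmetric
and central. -/
theorem op_cross (hC : IsClifford s c D) {l m : Λ} (hlm : l ≠ m) :
    opS o k s D l m * opB k s c l m + opB k s c m l * opS o k s D l m = 0 := by
  have h1 := hC.sub_ne l m hlm
  have h2 := hC.sub_ne m l hlm.symm
  by_cases h : k l = k m
  · by_cases ho : (k l).val + 1 = n
    · rw [opB_of_odd h ho, opS_of_odd h ho, opB_of_odd h.symm (h ▸ ho)]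
      simp only [smul_mul_assoc, mul_smul_comm, sub_mul, mul_sub, hC.D_c]
      match_scalars <;> field_simp <;> ring
    · rw [opB_of_even h ho, opS_of_even h ho, opB_of_even h.symm (h ▸ ho), ← map_mul, ← map_mul,
        ← map_add, ← map_zero (algebraMap Z E)]
      congr 1
      field_simp
      ring
  · rw [opB_of_ne h, opB_of_ne (fun e => h e.symm), mul_zero, zero_mul, add_zero]

/-- The product of `opS` with its mirror image `opS m l` is a nonzero scalar. For equal odd letters
it is `-(s m + s l) / (s m - s l)²`, and this is where `s m + s l ≠ 0` enters. -/
theorem opS_mul_left_injective (hC : IsClifford s c D) {l m : Λ} (hlm : l ≠ m) {x : E}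
    (hx : opS o k s D l m * x = 0) : x = 0 := by
  have key : ∃ z : Z, z ≠ 0 ∧ opS o k s D m l * opS o k s D l m = algebraMap Z E z := by
    have h0 := op_sq (o := o) (k := k) hC hlm
    have h1 := hC.sub_ne l m hlm
    have h2 := hC.add_ne l m hlm
    by_cases h : k l = k m
    · rw [qPoly, if_pos h] at h0
      by_cases ho : (k l).val + 1 = n
      · refine ⟨-((s m + s l) * (s m - s l)⁻¹ * (s m - s l)⁻¹), ?_, ?_⟩
        · exact neg_ne_zero.2 (mul_ne_zero (mul_ne_zero h2 (inv_ne_zero h1)) (inv_ne_zero h1))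
        · rw [eq_neg_of_add_eq_zero_right h0, opB_of_odd h ho, map_neg, neg_inj]
          have h3 := hC.c_c m l hlm.symm
          simp only [smul_mul_assoc, mul_smul_comm, sub_mul, mul_sub, hC.c_sq, h3,
            Algebra.algebraMap_eq_smul_one]
          match_scalars <;> ring
      · refine ⟨-((s m - s l)⁻¹ * (s m - s l)⁻¹), ?_, ?_⟩
        · exact neg_ne_zero.2 (mul_ne_zero (inv_ne_zero h1) (inv_ne_zero h1))
        · rw [eq_neg_of_add_eq_zero_right h0, opB_of_even h ho, map_neg, map_mul]
    · refine ⟨qScalar o k s l m, qScalar_ne_zero hC hlm, ?_⟩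
      rw [← qPoly_opY hC h, ← h0, opB_of_ne h, zero_mul, zero_add]
  obtain ⟨z, hz, h⟩ := key
  have h3 : algebraMap Z E z * x = 0 := by rw [← h, mul_assoc, hx, mul_zero]
  rw [← one_mul x, ← map_one (algebraMap Z E), ← inv_mul_cancel₀ hz, map_mul, mul_assoc, h3,
    mul_zero]


/-! ### The braid relation: one identity for each of the six arrangements of three strands. -/

section braid

variable (hC : IsClifford s c D) {a b e : Λ} (h12 : a ≠ b) (h13 : a ≠ e) (h23 : b ≠ e)
include hC h12 h13 h23

/-- In the odd cases all products are brought to a normal form in which each `c` stands to the left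
of each `D` and both kinds are sorted by strand in the order `a`, `b`, `e`. What remains are
identities between rational functions of `s a`, `s b`, `s e`, one for each Clifford monomial. -/
theorem braid_id_odd (h : k a = k b) (h' : k b = k e) (ho : (k a).val + 1 = n) :
    opB k s c b e * (opB k s c a b * opB k s c b e) + opS o k s D e b * (opB k s c a e * opS o k s D b e)
      = opB k s c a b * (opB k s c b e * opB k s c a b) + opS o k s D b a * (opB k s c a e * opS o k s D a b) := by
  have c21 := hC.c_c b a h12.symm
  have c31 := hC.c_c e a h13.symm
  have c32 := hC.c_c e b h23.symm
  have d21 := hC.D_D b a h12.symm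
  have d31 := hC.D_D e a h13.symm
  have d32 := hC.D_D e b h23.symm
  have n12 := hC.sub_ne a b h12
  have n13 := hC.sub_ne a e h13
  have n23 := hC.sub_ne b e h23
  have ho2 : (k b).val + 1 = n := h ▸ ho
  have ho3 : (k e).val + 1 = n := h' ▸ ho2
  simp only [opB_of_odd h ho, opB_of_odd h.symm ho2, opB_of_odd h' ho2, opB_of_odd h'.symm ho3,
    opB_of_odd (h.trans h') ho, opS_of_odd h ho, opS_of_odd h.symm ho2, opS_of_odd h' ho2,
    opS_of_odd h'.symm ho3, opS_of_odd (h.trans h') ho]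
  have n21 := hC.sub_ne b a h12.symm
  have n32 := hC.sub_ne e b h23.symm
  simp only [smul_mul_assoc, mul_smul_comm, mul_sub, sub_mul, smul_sub, smul_smul, mul_assoc,
    hC.c_sq, hC.D_sq, hC.D_c, c21, c31, c32, d21, d31, d32, mul_mul_of_anticomm c21,
    mul_mul_of_anticomm c31, mul_mul_of_anticomm c32, mul_mul_of_anticomm d21,
    mul_mul_of_anticomm d31, mul_mul_of_anticomm d32, fun l m => mul_mul_of_anticomm (hC.D_c l m),
    fun l => mul_mul_of_sq (hC.c_sq l), fun l => mul_mul_of_sq (hC.D_sq l),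
    mul_neg, neg_mul, smul_neg, neg_neg, mul_one]
  match_scalars <;> field_simp <;> ring

theorem braid_id_even (h : k a = k b) (h' : k b = k e) (ho : (k a).val + 1 ≠ n) :
    opB k s c b e * (opB k s c a b * opB k s c b e) + opS o k s D e b * (opB k s c a e * opS o k s D b e)
      = opB k s c a b * (opB k s c b e * opB k s c a b) + opS o k s D b a * (opB k s c a e * opS o k s D a b) := by
  have n12 := hC.sub_ne a b h12
  have n13 := hC.sub_ne a e h13
  have n23 := hC.sub_ne b e h23
  have n21 := hC.sub_ne b a h12.symm
  have n32 := hC.sub_ne e b h23.symm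
  have ho2 : (k b).val + 1 ≠ n := h ▸ ho
  have ho3 : (k e).val + 1 ≠ n := h' ▸ ho2
  simp only [opB_of_even h ho, opB_of_even h.symm ho2, opB_of_even h' ho2, opB_of_even h'.symm ho3,
    opB_of_even (h.trans h') ho, opS_of_even h ho, opS_of_even h.symm ho2, opS_of_even h' ho2,
    opS_of_even h'.symm ho3, opS_of_even (h.trans h') ho, ← map_mul, ← map_add]
  congr 1
  field_simp
  ring

theorem braid_lo_odd (h : k a = k b) (h' : k b = k e) (ho : (k a).val + 1 = n) :
    opB k s c a e * (opS o k s D a b * opB k s c b e)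
      = opS o k s D a b * (opB k s c b e * opB k s c a b) + opB k s c b a * (opB k s c a e * opS o k s D a b) := by
  have c21 := hC.c_c b a h12.symm
  have c31 := hC.c_c e a h13.symm
  have c32 := hC.c_c e b h23.symm
  have d21 := hC.D_D b a h12.symm
  have d31 := hC.D_D e a h13.symm
  have d32 := hC.D_D e b h23.symm
  have n12 := hC.sub_ne a b h12
  have n13 := hC.sub_ne a e h13
  have n23 := hC.sub_ne b e h23
  have ho2 : (k b).val + 1 = n := h ▸ ho
  have ho3 : (k e).val + 1 = n := h' ▸ ho2
  simp only [opB_of_odd h ho, opB_of_odd h.symm ho2, opB_of_odd h' ho2, opB_of_odd h'.symm ho3,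
    opB_of_odd (h.trans h') ho, opS_of_odd h ho, opS_of_odd h.symm ho2, opS_of_odd h' ho2,
    opS_of_odd h'.symm ho3, opS_of_odd (h.trans h') ho]
  have n21 := hC.sub_ne b a h12.symm
  have n32 := hC.sub_ne e b h23.symm
  simp only [smul_mul_assoc, mul_smul_comm, mul_sub, sub_mul, smul_sub, smul_smul, mul_assoc,
    hC.c_sq, hC.D_sq, hC.D_c, c21, c31, c32, d21, d31, d32, mul_mul_of_anticomm c21,
    mul_mul_of_anticomm c31, mul_mul_of_anticomm c32, mul_mul_of_anticomm d21,
    mul_mul_of_anticomm d31, mul_mul_of_anticomm d32, fun l m => mul_mul_of_anticomm (hC.D_c l m),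
    fun l => mul_mul_of_sq (hC.c_sq l), fun l => mul_mul_of_sq (hC.D_sq l),
    mul_neg, neg_mul, smul_neg, neg_neg, mul_one]
  match_scalars <;> field_simp <;> ring

theorem braid_lo_even (h : k a = k b) (h' : k b = k e) (ho : (k a).val + 1 ≠ n) :
    opB k s c a e * (opS o k s D a b * opB k s c b e)
      = opS o k s D a b * (opB k s c b e * opB k s c a b) + opB k s c b a * (opB k s c a e * opS o k s D a b) := by
  have n12 := hC.sub_ne a b h12
  have n13 := hC.sub_ne a e h13
  have n23 := hC.sub_ne b e h23
  have n21 := hC.sub_ne b a h12.symm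
  have n32 := hC.sub_ne e b h23.symm
  have ho2 : (k b).val + 1 ≠ n := h ▸ ho
  have ho3 : (k e).val + 1 ≠ n := h' ▸ ho2
  simp only [opB_of_even h ho, opB_of_even h.symm ho2, opB_of_even h' ho2, opB_of_even h'.symm ho3,
    opB_of_even (h.trans h') ho, opS_of_even h ho, opS_of_even h.symm ho2, opS_of_even h' ho2,
    opS_of_even h'.symm ho3, opS_of_even (h.trans h') ho, ← map_mul, ← map_add]
  congr 1
  field_simp
  ring

/-- If the three letters are not all equal, each term either contains an `opB` between different
letters, and vanishes, or all its factors but at most one are scalars. The same applies to the four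
lemmas of this shape below. -/
theorem braid_lo :
    opB k s c a e * (opS o k s D a b * opB k s c b e)
      = opS o k s D a b * (opB k s c b e * opB k s c a b) + opB k s c b a * (opB k s c a e * opS o k s D a b) := by
  by_cases h : k a = k b
  · by_cases h' : k b = k e
    · by_cases ho : (k a).val + 1 = n
      · exact braid_lo_odd hC h12 h13 h23 h h' ho
      · exact braid_lo_even hC h12 h13 h23 h h' ho
    · have h1 : k a ≠ k e := h ▸ h'
      obtain ⟨z, hz⟩ := exists_opS_eq o s D h1
      obtain ⟨z', hz'⟩ := exists_opS_eq o s D h'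
      simp only [opB_of_ne h', opB_of_ne (Ne.symm h'), opB_of_ne h1, hz, hz', mul_zero, zero_mul,
        add_zero, zero_add, smul_mul_assoc, mul_smul_comm, one_mul, mul_one, smul_zero, smul_comm z z']
  · obtain ⟨z, hz⟩ := exists_opS_eq o s D h
    by_cases h' : k b = k e
    · have h1 : k a ≠ k e := h' ▸ h
      obtain ⟨z', hz'⟩ := exists_opS_eq o s D h1
      simp only [opB_of_ne h, opB_of_ne (Ne.symm h), opB_of_ne h1, hz, hz', mul_zero, zero_mul,
        add_zero, zero_add, smul_mul_assoc, mul_smul_comm, one_mul, mul_one, smul_zero, smul_comm z z']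
    · obtain ⟨z', hz'⟩ := exists_opS_eq o s D h'
      simp only [opB_of_ne h, opB_of_ne (Ne.symm h), opB_of_ne h', opB_of_ne (Ne.symm h'), hz, hz',
        mul_zero, zero_mul, add_zero, zero_add, smul_mul_assoc, mul_smul_comm, one_mul, mul_one,
        smul_zero, smul_comm z z']

theorem braid_hi_odd (h : k a = k b) (h' : k b = k e) (ho : (k a).val + 1 = n) :
    opS o k s D b e * (opB k s c a b * opB k s c b e) + opB k s c e b * (opB k s c a e * opS o k s D b e)
      = opB k s c a e * (opS o k s D b e * opB k s c a b) := by
  have c21 := hC.c_c b a h12.symm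
  have c31 := hC.c_c e a h13.symm
  have c32 := hC.c_c e b h23.symm
  have d21 := hC.D_D b a h12.symm
  have d31 := hC.D_D e a h13.symm
  have d32 := hC.D_D e b h23.symm
  have n12 := hC.sub_ne a b h12
  have n13 := hC.sub_ne a e h13
  have n23 := hC.sub_ne b e h23
  have ho2 : (k b).val + 1 = n := h ▸ ho
  have ho3 : (k e).val + 1 = n := h' ▸ ho2
  simp only [opB_of_odd h ho, opB_of_odd h.symm ho2, opB_of_odd h' ho2, opB_of_odd h'.symm ho3,
    opB_of_odd (h.trans h') ho, opS_of_odd h ho, opS_of_odd h.symm ho2, opS_of_odd h' ho2,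
    opS_of_odd h'.symm ho3, opS_of_odd (h.trans h') ho]
  have n21 := hC.sub_ne b a h12.symm
  have n32 := hC.sub_ne e b h23.symm
  simp only [smul_mul_assoc, mul_smul_comm, mul_sub, sub_mul, smul_sub, smul_smul, mul_assoc,
    hC.c_sq, hC.D_sq, hC.D_c, c21, c31, c32, d21, d31, d32, mul_mul_of_anticomm c21,
    mul_mul_of_anticomm c31, mul_mul_of_anticomm c32, mul_mul_of_anticomm d21,
    mul_mul_of_anticomm d31, mul_mul_of_anticomm d32, fun l m => mul_mul_of_anticomm (hC.D_c l m),
    fun l => mul_mul_of_sq (hC.c_sq l), fun l => mul_mul_of_sq (hC.D_sq l),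
    mul_neg, neg_mul, smul_neg, neg_neg, mul_one]
  match_scalars <;> field_simp <;> ring

theorem braid_hi_even (h : k a = k b) (h' : k b = k e) (ho : (k a).val + 1 ≠ n) :
    opS o k s D b e * (opB k s c a b * opB k s c b e) + opB k s c e b * (opB k s c a e * opS o k s D b e)
      = opB k s c a e * (opS o k s D b e * opB k s c a b) := by
  have n12 := hC.sub_ne a b h12
  have n13 := hC.sub_ne a e h13
  have n23 := hC.sub_ne b e h23
  have n21 := hC.sub_ne b a h12.symm
  have n32 := hC.sub_ne e b h23.symm
  have ho2 : (k b).val + 1 ≠ n := h ▸ ho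
  have ho3 : (k e).val + 1 ≠ n := h' ▸ ho2
  simp only [opB_of_even h ho, opB_of_even h.symm ho2, opB_of_even h' ho2, opB_of_even h'.symm ho3,
    opB_of_even (h.trans h') ho, opS_of_even h ho, opS_of_even h.symm ho2, opS_of_even h' ho2,
    opS_of_even h'.symm ho3, opS_of_even (h.trans h') ho, ← map_mul, ← map_add]
  congr 1
  field_simp
  ring

theorem braid_hi :
    opS o k s D b e * (opB k s c a b * opB k s c b e) + opB k s c e b * (opB k s c a e * opS o k s D b e)
      = opB k s c a e * (opS o k s D b e * opB k s c a b) := by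
  by_cases h : k a = k b
  · by_cases h' : k b = k e
    · by_cases ho : (k a).val + 1 = n
      · exact braid_hi_odd hC h12 h13 h23 h h' ho
      · exact braid_hi_even hC h12 h13 h23 h h' ho
    · have h1 : k a ≠ k e := h ▸ h'
      obtain ⟨z, hz⟩ := exists_opS_eq o s D h1
      obtain ⟨z', hz'⟩ := exists_opS_eq o s D h'
      simp only [opB_of_ne h', opB_of_ne (Ne.symm h'), opB_of_ne h1, hz, hz', mul_zero, zero_mul,
        add_zero, zero_add, smul_mul_assoc, mul_smul_comm, one_mul, mul_one, smul_zero, smul_comm z z']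
  · obtain ⟨z, hz⟩ := exists_opS_eq o s D h
    by_cases h' : k b = k e
    · have h1 : k a ≠ k e := h' ▸ h
      obtain ⟨z', hz'⟩ := exists_opS_eq o s D h1
      simp only [opB_of_ne h, opB_of_ne (Ne.symm h), opB_of_ne h1, hz, hz', mul_zero, zero_mul,
        add_zero, zero_add, smul_mul_assoc, mul_smul_comm, one_mul, mul_one, smul_zero, smul_comm z z']
    · obtain ⟨z', hz'⟩ := exists_opS_eq o s D h'
      simp only [opB_of_ne h, opB_of_ne (Ne.symm h), opB_of_ne h', opB_of_ne (Ne.symm h'), hz, hz',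
        mul_zero, zero_mul, add_zero, zero_add, smul_mul_assoc, mul_smul_comm, one_mul, mul_one,
        smul_zero, smul_comm z z']

theorem braid_hi_lo_odd (h : k a = k b) (h' : k b = k e) (ho : (k a).val + 1 = n) :
    opB k s c a b * (opS o k s D a e * opS o k s D b e) = opS o k s D a e * (opS o k s D b e * opB k s c a b) := by
  have c21 := hC.c_c b a h12.symm
  have c31 := hC.c_c e a h13.symm
  have c32 := hC.c_c e b h23.symm
  have d21 := hC.D_D b a h12.symm
  have d31 := hC.D_D e a h13.symm
  have d32 := hC.D_D e b h23.symm
  have n12 := hC.sub_ne a b h12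
  have n13 := hC.sub_ne a e h13
  have n23 := hC.sub_ne b e h23
  have ho2 : (k b).val + 1 = n := h ▸ ho
  have ho3 : (k e).val + 1 = n := h' ▸ ho2
  simp only [opB_of_odd h ho, opB_of_odd h.symm ho2, opB_of_odd h' ho2, opB_of_odd h'.symm ho3,
    opB_of_odd (h.trans h') ho, opS_of_odd h ho, opS_of_odd h.symm ho2, opS_of_odd h' ho2,
    opS_of_odd h'.symm ho3, opS_of_odd (h.trans h') ho]
  have n21 := hC.sub_ne b a h12.symm
  have n32 := hC.sub_ne e b h23.symm
  simp only [smul_mul_assoc, mul_smul_comm, mul_sub, sub_mul, smul_sub, smul_smul, mul_assoc,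
    hC.c_sq, hC.D_sq, hC.D_c, c21, c31, c32, d21, d31, d32, mul_mul_of_anticomm c21,
    mul_mul_of_anticomm c31, mul_mul_of_anticomm c32, mul_mul_of_anticomm d21,
    mul_mul_of_anticomm d31, mul_mul_of_anticomm d32, fun l m => mul_mul_of_anticomm (hC.D_c l m),
    fun l => mul_mul_of_sq (hC.c_sq l), fun l => mul_mul_of_sq (hC.D_sq l),
    mul_neg, neg_mul, smul_neg, neg_neg, mul_one]
  match_scalars <;> field_simp

theorem braid_hi_lo_even (h : k a = k b) (h' : k b = k e) (ho : (k a).val + 1 ≠ n) :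
    opB k s c a b * (opS o k s D a e * opS o k s D b e) = opS o k s D a e * (opS o k s D b e * opB k s c a b) := by
  have n12 := hC.sub_ne a b h12
  have n13 := hC.sub_ne a e h13
  have n23 := hC.sub_ne b e h23
  have n21 := hC.sub_ne b a h12.symm
  have n32 := hC.sub_ne e b h23.symm
  have ho2 : (k b).val + 1 ≠ n := h ▸ ho
  have ho3 : (k e).val + 1 ≠ n := h' ▸ ho2
  simp only [opB_of_even h ho, opB_of_even h.symm ho2, opB_of_even h' ho2, opB_of_even h'.symm ho3,
    opB_of_even (h.trans h') ho, opS_of_even h ho, opS_of_even h.symm ho2, opS_of_even h' ho2,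
    opS_of_even h'.symm ho3, opS_of_even (h.trans h') ho, ← map_mul, ← map_add]
  congr 1
  field_simp

theorem braid_hi_lo :
    opB k s c a b * (opS o k s D a e * opS o k s D b e) = opS o k s D a e * (opS o k s D b e * opB k s c a b) := by
  by_cases h : k a = k b
  · by_cases h' : k b = k e
    · by_cases ho : (k a).val + 1 = n
      · exact braid_hi_lo_odd hC h12 h13 h23 h h' ho
      · exact braid_hi_lo_even hC h12 h13 h23 h h' ho
    · have h1 : k a ≠ k e := h ▸ h'
      obtain ⟨z, hz⟩ := exists_opS_eq o s D h1
      obtain ⟨z', hz'⟩ := exists_opS_eq o s D h'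
      simp only [opB_of_ne h', opB_of_ne (Ne.symm h'), opB_of_ne h1, hz, hz', mul_zero, zero_mul,
        add_zero, zero_add, smul_mul_assoc, mul_smul_comm, one_mul, mul_one, smul_zero, smul_comm z z']
  · obtain ⟨z, hz⟩ := exists_opS_eq o s D h
    by_cases h' : k b = k e
    · have h1 : k a ≠ k e := h' ▸ h
      obtain ⟨z', hz'⟩ := exists_opS_eq o s D h1
      simp only [opB_of_ne h, opB_of_ne (Ne.symm h), opB_of_ne h1, hz, hz', mul_zero, zero_mul,
        add_zero, zero_add, smul_mul_assoc, mul_smul_comm, one_mul, mul_one, smul_zero, smul_comm z z']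
    · obtain ⟨z', hz'⟩ := exists_opS_eq o s D h'
      simp only [opB_of_ne h, opB_of_ne (Ne.symm h), opB_of_ne h', opB_of_ne (Ne.symm h'), hz, hz',
        mul_zero, zero_mul, add_zero, zero_add, smul_mul_assoc, mul_smul_comm, one_mul, mul_one,
        smul_zero, smul_comm z z']

theorem braid_lo_hi_odd (h : k a = k b) (h' : k b = k e) (ho : (k a).val + 1 = n) :
    opS o k s D a e * (opS o k s D a b * opB k s c b e) = opB k s c b e * (opS o k s D a e * opS o k s D a b) := by
  have c21 := hC.c_c b a h12.symm
  have c31 := hC.c_c e a h13.symm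
  have c32 := hC.c_c e b h23.symm
  have d21 := hC.D_D b a h12.symm
  have d31 := hC.D_D e a h13.symm
  have d32 := hC.D_D e b h23.symm
  have n12 := hC.sub_ne a b h12
  have n13 := hC.sub_ne a e h13
  have n23 := hC.sub_ne b e h23
  have ho2 : (k b).val + 1 = n := h ▸ ho
  have ho3 : (k e).val + 1 = n := h' ▸ ho2
  simp only [opB_of_odd h ho, opB_of_odd h.symm ho2, opB_of_odd h' ho2, opB_of_odd h'.symm ho3,
    opB_of_odd (h.trans h') ho, opS_of_odd h ho, opS_of_odd h.symm ho2, opS_of_odd h' ho2,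
    opS_of_odd h'.symm ho3, opS_of_odd (h.trans h') ho]
  have n21 := hC.sub_ne b a h12.symm
  have n32 := hC.sub_ne e b h23.symm
  simp only [smul_mul_assoc, mul_smul_comm, mul_sub, sub_mul, smul_sub, smul_smul, mul_assoc,
    hC.c_sq, hC.D_sq, hC.D_c, c21, c31, c32, d21, d31, d32, mul_mul_of_anticomm c21,
    mul_mul_of_anticomm c31, mul_mul_of_anticomm c32, mul_mul_of_anticomm d21,
    mul_mul_of_anticomm d31, mul_mul_of_anticomm d32, fun l m => mul_mul_of_anticomm (hC.D_c l m),
    fun l => mul_mul_of_sq (hC.c_sq l), fun l => mul_mul_of_sq (hC.D_sq l),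
    mul_neg, neg_mul, smul_neg, neg_neg, mul_one]
  match_scalars <;> field_simp

theorem braid_lo_hi_even (h : k a = k b) (h' : k b = k e) (ho : (k a).val + 1 ≠ n) :
    opS o k s D a e * (opS o k s D a b * opB k s c b e) = opB k s c b e * (opS o k s D a e * opS o k s D a b) := by
  have n12 := hC.sub_ne a b h12
  have n13 := hC.sub_ne a e h13
  have n23 := hC.sub_ne b e h23
  have n21 := hC.sub_ne b a h12.symm
  have n32 := hC.sub_ne e b h23.symm
  have ho2 : (k b).val + 1 ≠ n := h ▸ ho
  have ho3 : (k e).val + 1 ≠ n := h' ▸ ho2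
  simp only [opB_of_even h ho, opB_of_even h.symm ho2, opB_of_even h' ho2, opB_of_even h'.symm ho3,
    opB_of_even (h.trans h') ho, opS_of_even h ho, opS_of_even h.symm ho2, opS_of_even h' ho2,
    opS_of_even h'.symm ho3, opS_of_even (h.trans h') ho, ← map_mul, ← map_add]
  congr 1
  field_simp

theorem braid_lo_hi :
    opS o k s D a e * (opS o k s D a b * opB k s c b e) = opB k s c b e * (opS o k s D a e * opS o k s D a b) := by
  by_cases h : k a = k b
  · by_cases h' : k b = k e
    · by_cases ho : (k a).val + 1 = n
      · exact braid_lo_hi_odd hC h12 h13 h23 h h' ho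
      · exact braid_lo_hi_even hC h12 h13 h23 h h' ho
    · have h1 : k a ≠ k e := h ▸ h'
      obtain ⟨z, hz⟩ := exists_opS_eq o s D h1
      obtain ⟨z', hz'⟩ := exists_opS_eq o s D h'
      simp only [opB_of_ne h', opB_of_ne (Ne.symm h'), opB_of_ne h1, hz, hz', mul_zero, zero_mul,
        add_zero, zero_add, smul_mul_assoc, mul_smul_comm, one_mul, mul_one, smul_zero, smul_comm z z']
  · obtain ⟨z, hz⟩ := exists_opS_eq o s D h
    by_cases h' : k b = k e
    · have h1 : k a ≠ k e := h' ▸ h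
      obtain ⟨z', hz'⟩ := exists_opS_eq o s D h1
      simp only [opB_of_ne h, opB_of_ne (Ne.symm h), opB_of_ne h1, hz, hz', mul_zero, zero_mul,
        add_zero, zero_add, smul_mul_assoc, mul_smul_comm, one_mul, mul_one, smul_zero, smul_comm z z']
    · obtain ⟨z', hz'⟩ := exists_opS_eq o s D h'
      simp only [opB_of_ne h, opB_of_ne (Ne.symm h), opB_of_ne h', opB_of_ne (Ne.symm h'), hz, hz',
        mul_zero, zero_mul, add_zero, zero_add, smul_mul_assoc, mul_smul_comm, one_mul, mul_one,
        smul_zero, smul_comm z z']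

theorem braid_top_odd (h : k a = k b) (h' : k b = k e) (ho : (k a).val + 1 = n) :
    opS o k s D a b * (opS o k s D a e * opS o k s D b e) = opS o k s D b e * (opS o k s D a e * opS o k s D a b) := by
  have c21 := hC.c_c b a h12.symm
  have c31 := hC.c_c e a h13.symm
  have c32 := hC.c_c e b h23.symm
  have d21 := hC.D_D b a h12.symm
  have d31 := hC.D_D e a h13.symm
  have d32 := hC.D_D e b h23.symm
  have n12 := hC.sub_ne a b h12
  have n13 := hC.sub_ne a e h13
  have n23 := hC.sub_ne b e h23
  have ho2 : (k b).val + 1 = n := h ▸ ho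
  have ho3 : (k e).val + 1 = n := h' ▸ ho2
  simp only [opB_of_odd h ho, opB_of_odd h.symm ho2, opB_of_odd h' ho2, opB_of_odd h'.symm ho3,
    opB_of_odd (h.trans h') ho, opS_of_odd h ho, opS_of_odd h.symm ho2, opS_of_odd h' ho2,
    opS_of_odd h'.symm ho3, opS_of_odd (h.trans h') ho]
  have n21 := hC.sub_ne b a h12.symm
  have n32 := hC.sub_ne e b h23.symm
  simp only [smul_mul_assoc, mul_smul_comm, mul_sub, sub_mul, smul_sub, smul_smul, mul_assoc,
    hC.c_sq, hC.D_sq, hC.D_c, c21, c31, c32, d21, d31, d32, mul_mul_of_anticomm c21,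
    mul_mul_of_anticomm c31, mul_mul_of_anticomm c32, mul_mul_of_anticomm d21,
    mul_mul_of_anticomm d31, mul_mul_of_anticomm d32, fun l m => mul_mul_of_anticomm (hC.D_c l m),
    fun l => mul_mul_of_sq (hC.c_sq l), fun l => mul_mul_of_sq (hC.D_sq l),
    mul_neg, neg_mul, smul_neg, neg_neg, mul_one]
  match_scalars <;> field_simp <;> ring

theorem braid_top_even (h : k a = k b) (h' : k b = k e) (ho : (k a).val + 1 ≠ n) :
    opS o k s D a b * (opS o k s D a e * opS o k s D b e) = opS o k s D b e * (opS o k s D a e * opS o k s D a b) := by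
  have n12 := hC.sub_ne a b h12
  have n13 := hC.sub_ne a e h13
  have n23 := hC.sub_ne b e h23
  have n21 := hC.sub_ne b a h12.symm
  have n32 := hC.sub_ne e b h23.symm
  have ho2 : (k b).val + 1 ≠ n := h ▸ ho
  have ho3 : (k e).val + 1 ≠ n := h' ▸ ho2
  simp only [opB_of_even h ho, opB_of_even h.symm ho2, opB_of_even h' ho2, opB_of_even h'.symm ho3,
    opB_of_even (h.trans h') ho, opS_of_even h ho, opS_of_even h.symm ho2, opS_of_even h' ho2,
    opS_of_even h'.symm ho3, opS_of_even (h.trans h') ho, ← map_mul, ← map_add]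
  congr 1
  field_simp

theorem braid_top :
    opS o k s D a b * (opS o k s D a e * opS o k s D b e) = opS o k s D b e * (opS o k s D a e * opS o k s D a b) := by
  by_cases h : k a = k b
  · by_cases h' : k b = k e
    · by_cases ho : (k a).val + 1 = n
      · exact braid_top_odd hC h12 h13 h23 h h' ho
      · exact braid_top_even hC h12 h13 h23 h h' ho
    · have h1 : k a ≠ k e := h ▸ h'
      obtain ⟨z, hz⟩ := exists_opS_eq o s D h1
      obtain ⟨z', hz'⟩ := exists_opS_eq o s D h'
      simp only [opB_of_ne h', opB_of_ne (Ne.symm h'), opB_of_ne h1, hz, hz', mul_zero, zero_mul,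
        add_zero, zero_add, smul_mul_assoc, mul_smul_comm, one_mul, mul_one, smul_zero, smul_comm z z']
  · obtain ⟨z, hz⟩ := exists_opS_eq o s D h
    by_cases h' : k b = k e
    · have h1 : k a ≠ k e := h' ▸ h
      obtain ⟨z', hz'⟩ := exists_opS_eq o s D h1
      simp only [opB_of_ne h, opB_of_ne (Ne.symm h), opB_of_ne h1, hz, hz', mul_zero, zero_mul,
        add_zero, zero_add, smul_mul_assoc, mul_smul_comm, one_mul, mul_one, smul_zero, smul_comm z z']
    · obtain ⟨z', hz'⟩ := exists_opS_eq o s D h'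
      simp only [opB_of_ne h, opB_of_ne (Ne.symm h), opB_of_ne h', opB_of_ne (Ne.symm h'), hz, hz',
        mul_zero, zero_mul, add_zero, zero_add, smul_mul_assoc, mul_smul_comm, one_mul, mul_one,
        smul_zero, smul_comm z z']

/-- The right-hand side of the braid relation only occurs on the unchanged arrangement. If `k a = k
e` is adjacent to `k b`, the difference of `qScalar` at `b`, `e` and at `a`, `b` is `±(s e - s a)`,
which cancels the denominator of `opB` at `a`, `e`. -/
theorem braid_id :
    opB k s c b e * (opB k s c a b * opB k s c b e) + opS o k s D e b * (opB k s c a e * opS o k s D b e)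
      = ( opB k s c a b * (opB k s c b e * opB k s c a b) + opS o k s D b a * (opB k s c a e * opS o k s D a b))
        + braidTerm o (k a) (k b) (k e) (opY k s c a) (opY k s c e) := by
  by_cases h13' : k a = k e
  · by_cases h : k a = k b
    · have h' : k b = k e := h.symm.trans h13'
      have hR : braidTerm o (k a) (k b) (k e) (opY k s c a) (opY k s c e) = 0 := by
        simp [braidTerm, qQuot, Adjacent, h]
      rw [hR, add_zero]
      by_cases ho : (k a).val + 1 = n
      · exact braid_id_odd hC h12 h13 h23 h h' ho
      · exact braid_id_even hC h12 h13 h23 h h' ho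
    · have h' : k b ≠ k e := h13' ▸ Ne.symm h
      have hS : ∀ l m, l ≠ m → k l ≠ k m → opS o k s D m l * (opB k s c a e * opS o k s D l m)
          = qScalar o k s l m • opB k s c a e := by
        intro l m h1 h2
        have h3 := op_sq (o := o) (k := k) hC h1
        rw [qPoly_opY hC h2, opB_of_ne h2, zero_mul, zero_add] at h3
        obtain ⟨z, hz⟩ := exists_opS_eq o s D h2
        rw [hz, mul_smul_comm, mul_one, Algebra.algebraMap_eq_smul_one] at h3
        rw [hz, mul_smul_comm, mul_one, mul_smul_comm, ← smul_mul_assoc, h3, smul_mul_assoc,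
          one_mul]
      rw [opB_of_ne h, opB_of_ne h', hS b e h23 h', hS a b h12 h]
      simp only [zero_mul, zero_add]
      have n13 := hC.sub_ne a e h13
      have hd := o.d_add (k a) (k b)
      unfold qScalar braidTerm qQuot
      rw [if_pos h13', ← h13']
      by_cases ha : Adjacent (k a) (k b)
      · have ha' : Adjacent (k b) (k a) := Or.symm ha
        rw [if_pos ha] at hd
        have hsgn : (-1 : Z) ^ o.d (k b) (k a) = -(-1) ^ o.d (k a) (k b) := by
          have : (o.d (k a) (k b) = 0 ∧ o.d (k b) (k a) = 1) ∨
            (o.d (k a) (k b) = 1 ∧ o.d (k b) (k a) = 0) := by omega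
          rcases this with ⟨h1, h2⟩ | ⟨h1, h2⟩ <;> rw [h1, h2] <;> norm_num
        have hpow : (-1 : E) ^ o.d (k a) (k b) = (-1 : Z) ^ o.d (k a) (k b) • (1 : E) := by
          rw [← Algebra.algebraMap_eq_smul_one, map_pow, map_neg, map_one]
        rw [if_pos ha, if_pos ha', if_pos ha, hsgn, hpow]
        by_cases ho : (k a).val + 1 = n
        · have hb : (k b).val + 1 ≠ n := fun e => h (Fin.ext (by omega))
          rw [if_neg (not_not.2 ho), par_of_even hb, sgn_zero, one_smul, opB_of_odd h13' ho,
            opY_of_odd ho, opY_of_odd (h13' ▸ ho)]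
          simp only [mul_smul_comm, mul_one]
          match_scalars <;> field_simp <;> ring
        · rw [if_pos ho, opB_of_even h13' ho, Algebra.algebraMap_eq_smul_one]
          match_scalars
          field_simp
          ring
      · have ha' : ¬ Adjacent (k b) (k a) := fun e => ha (Or.symm e)
        simp [ha, ha']
  · rw [braidTerm, if_neg h13', add_zero, opB_of_ne h13']
    by_cases h : k a = k b
    · have h' : k b ≠ k e := h ▸ h13'
      simp only [opB_of_ne h', mul_zero, zero_mul, add_zero]
    · simp only [opB_of_ne h, mul_zero, zero_mul, add_zero]

end braid

end local_operators

/-! ### The generic representation -/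

/-- The word `𝐢 ∘ w`. -/
def Word.rearrange {n : ℕ} {ν : Multiset (Fin n)} (k : Word ν) (w : Equiv.Perm (Fin ν.card)) :
    Word ν :=
  ⟨k.1 ∘ w, by
    have h := congrArg (fun s => Multiset.map k.1 (Finset.val s)) (Finset.map_univ_equiv w)
    simp only [Finset.map_val, Multiset.map_map] at h
    exact h.trans k.2⟩

section generic

variable {Z : Type*} [Field Z] {K : Type*} [Field K] {E : Type*} [Ring E] [Algebra Z E]
  [Algebra K E] {n : ℕ} {ν : Multiset (Fin n)}

/-- The space of the generic representation: one copy of `E` for each arrangement of the strands. -/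
abbrev GenericSpace (E : Type*) [Ring E] {n : ℕ} (ν : Multiset (Fin n)) : Type _ :=
  Equiv.Perm (Fin ν.card) →₀ E

/-- The transposition of the places `r` and `r + 1`. -/
abbrev adjSwap {d : ℕ} (r : Fin (d - 1)) : Equiv.Perm (Fin d) := Equiv.swap (lo r) (hi r)

theorem lo_ne_hi {d : ℕ} (r : Fin (d - 1)) : lo r ≠ hi r := by
  simp [lo, hi]

variable (K) (o : Orientation n) (k : Word ν) (s : Fin ν.card → Z) (c D : Fin ν.card → E)

def actE (i : Word ν) : Module.End K (GenericSpace E ν) :=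
  Finsupp.lsum K fun w : Equiv.Perm (Fin ν.card) =>
    if k.1 ∘ w = i.1 then Finsupp.lsingle w else 0

def actY (r : Fin ν.card) : Module.End K (GenericSpace E ν) :=
  Finsupp.lsum K fun w => Finsupp.lsingle w ∘ₗ LinearMap.mulLeft K (opY k.1 s c (w r))

/-- The exchange changes only the index `w`; the vector in `E` is not permuted, and `s`, `c`, `D`
stay attached to the strands. So each defining relation becomes a family of identities between
coefficients in `E`. -/
def actTau (r : Fin (ν.card - 1)) : Module.End K (GenericSpace E ν) :=
  Finsupp.lsum K fun w =>
    Finsupp.lsingle w ∘ₗ LinearMap.mulLeft K (opB k.1 s c (w (lo r)) (w (hi r)))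
    + Finsupp.lsingle (w * adjSwap r) ∘ₗ LinearMap.mulLeft K (opS o k.1 s D (w (lo r)) (w (hi r)))

variable {K o k s c D}

theorem actE_single (i : Word ν) (w : Equiv.Perm (Fin ν.card)) (x : E) :
    actE K k i (Finsupp.single w x) = if k.1 ∘ w = i.1 then Finsupp.single w x else 0 := by
  rw [actE, Finsupp.lsum_single]
  split_ifs <;> rfl

theorem actY_single (r : Fin ν.card) (w : Equiv.Perm (Fin ν.card)) (x : E) :
    actY K k s c r (Finsupp.single w x) = Finsupp.single w (opY k.1 s c (w r) * x) := by
  rw [actY, Finsupp.lsum_single]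
  rfl

theorem actTau_single (r : Fin (ν.card - 1)) (w : Equiv.Perm (Fin ν.card)) (x : E) :
    actTau K o k s c D r (Finsupp.single w x)
      = Finsupp.single w (opB k.1 s c (w (lo r)) (w (hi r)) * x)
        + Finsupp.single (w * adjSwap r) (opS o k.1 s D (w (lo r)) (w (hi r)) * x) := by
  rw [actTau, Finsupp.lsum_single]
  rfl

theorem zsmul_single (a : ℤ) (w : Equiv.Perm (Fin ν.card)) (x : E) :
    a • (Finsupp.single w x : GenericSpace E ν) = Finsupp.single w (a • x) := by
  rw [Finsupp.smul_single]

theorem pow_actY_single (r : Fin ν.card) (w : Equiv.Perm (Fin ν.card)) (x : E) (j : ℕ) :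
    (actY K k s c r ^ j) (Finsupp.single w x) = Finsupp.single w (opY k.1 s c (w r) ^ j * x) := by
  induction j with
  | zero => simp
  | succ j ih => rw [pow_succ', Module.End.mul_apply, ih, actY_single, pow_succ', mul_assoc]

theorem neg_one_pow_apply {V : Type*} [AddCommGroup V] [Module K V] (j : ℕ) (v : V) :
    ((-1 : Module.End K V) ^ j) v = (-1 : ℤ) ^ j • v := by
  rcases Nat.even_or_odd j with h | h
  · simp [h.neg_one_pow]
  · simp [h.neg_one_pow]

theorem neg_one_pow_mul_eq (j : ℕ) (x : E) : (-1) ^ j * x = (-1 : ℤ) ^ j • x := by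
  rcases Nat.even_or_odd j with h | h
  · simp [h.neg_one_pow]
  · simp [h.neg_one_pow]

theorem qPoly_actY_single (i j : Fin n) (r t : Fin ν.card) (w : Equiv.Perm (Fin ν.card)) (x : E) :
    qPoly o i j (actY K k s c r) (actY K k s c t) (Finsupp.single w x)
      = Finsupp.single w (qPoly o i j (opY k.1 s c (w r)) (opY k.1 s c (w t)) * x) := by
  unfold qPoly
  split_ifs
  · simp
  · rw [Module.End.mul_apply, LinearMap.sub_apply, pow_actY_single, pow_actY_single,
      neg_one_pow_apply, ← Finsupp.single_sub, zsmul_single, mul_assoc, neg_one_pow_mul_eq, sub_mul]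
  · simp

theorem braidTerm_actY_single (i j l : Fin n) (r t : Fin ν.card) (w : Equiv.Perm (Fin ν.card))
    (x : E) :
    braidTerm o i j l (actY K k s c r) (actY K k s c t) (Finsupp.single w x)
      = Finsupp.single w (braidTerm o i j l (opY k.1 s c (w r)) (opY k.1 s c (w t)) * x) := by
  unfold braidTerm qQuot
  split_ifs
  · rw [neg_one_pow_apply, neg_one_pow_mul_eq, zsmul_single]
  · simp
  · rw [LinearMap.smul_apply, Module.End.mul_apply, neg_one_pow_apply, map_zsmul,
      LinearMap.sub_apply, actY_single, actY_single, ← Finsupp.single_sub, zsmul_single,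
      zsmul_single, smul_mul_assoc, mul_assoc, neg_one_pow_mul_eq, mul_smul_comm, sub_mul]
  · simp
  · simp

theorem comp_mul_adjSwap_eq_iff (i : Word ν) (r : Fin (ν.card - 1)) (w : Equiv.Perm (Fin ν.card)) :
    k.1 ∘ ⇑(w * adjSwap r) = (i.swap r).1 ↔ k.1 ∘ w = i.1 := by
  have h : ∀ v : Fin ν.card → Fin n, v ∘ adjSwap r ∘ adjSwap r = v := by
    intro v; funext x; simp
  constructor
  · intro h1
    have h2 := congrArg (· ∘ adjSwap r) h1
    simp only [Word.swap, Equiv.Perm.coe_mul, Function.comp_assoc] at h2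
    rw [h, ← Function.comp_assoc k.1, h] at h2
    exact h2
  · intro h1
    rw [Equiv.Perm.coe_mul, ← Function.comp_assoc, h1]
    rfl

theorem adjSwap_lo {d : ℕ} (r : Fin (d - 1)) : adjSwap r (lo r) = hi r := Equiv.swap_apply_left _ _

theorem adjSwap_hi {d : ℕ} (r : Fin (d - 1)) : adjSwap r (hi r) = lo r := Equiv.swap_apply_right _ _

theorem adjSwap_of_ne {d : ℕ} {r : Fin (d - 1)} {x : Fin d} (h : x ≠ lo r) (h' : x ≠ hi r) :
    adjSwap r x = x := Equiv.swap_apply_of_ne_of_ne h h'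

theorem adjSwap_comm {d : ℕ} {r t : Fin (d - 1)} (h : r.val + 1 < t.val ∨ t.val + 1 < r.val) :
    adjSwap r * adjSwap t = adjSwap t * adjSwap r := by
  refine Equiv.Perm.Disjoint.commute ?_
  rw [Equiv.Perm.disjoint_iff_disjoint_support]
  rw [Equiv.Perm.support_swap (lo_ne_hi r), Equiv.Perm.support_swap (lo_ne_hi t)]
  simp only [Finset.disjoint_insert_left, Finset.disjoint_singleton_left, Finset.mem_insert,
    Finset.mem_singleton, lo, hi, Fin.mk.injEq]
  omega

theorem adjSwap_braid {d : ℕ} {r t : Fin (d - 1)} (h : r.val + 1 = t.val) :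
    adjSwap r * adjSwap t * adjSwap r = adjSwap t * adjSwap r * adjSwap t := by
  have h1 : hi r = lo t := Fin.ext h
  have h2 : lo r ≠ hi t := by simp only [lo, hi, ne_eq, Fin.mk.injEq]; omega
  have h3 : hi r ≠ hi t := by simp only [hi, ne_eq, Fin.mk.injEq]; omega
  unfold adjSwap
  rw [← h1]
  have h4 := lo_ne_hi r
  ext x
  simp only [Equiv.Perm.mul_apply, Equiv.swap_apply_def]
  split_ifs <;> simp_all

/-- The images of the generators in the generic representation. -/
def genericGen (K : Type*) [Field K] [Algebra K E] (o : Orientation n) (k : Word ν)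
    (s : Fin ν.card → Z) (c D : Fin ν.card → E) : Gen ν → Module.End K (GenericSpace E ν)
  | .e i => actE K k i
  | .y r => actY K k s c r
  | .tau r => actTau K o k s c D r

theorem genericGen_rel (hC : IsClifford s c D) ⦃x x' : FreeAlgebra K (Gen ν)⦄
    (h : Rel K o ν x x') :
    FreeAlgebra.lift K (genericGen K o k s c D) x
      = FreeAlgebra.lift K (genericGen K o k s c D) x' := by
  refine Finsupp.lhom_ext fun w z => ?_
  have hE : ∀ i, FreeAlgebra.lift K (genericGen K o k s c D) (FreeAlgebra.ι K (.e i))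
      = actE K k i := fun i => FreeAlgebra.lift_ι_apply _ _
  have hY : ∀ i, FreeAlgebra.lift K (genericGen K o k s c D) (FreeAlgebra.ι K (.y i))
      = actY K k s c i := fun i => FreeAlgebra.lift_ι_apply _ _
  have hT : ∀ i, FreeAlgebra.lift K (genericGen K o k s c D) (FreeAlgebra.ι K (.tau i))
      = actTau K o k s c D i := fun i => FreeAlgebra.lift_ι_apply _ _
  have hw' : ∀ {x y}, x ≠ y → w x ≠ w y := fun h h' => h (w.injective h')
  cases h with
  | e_mul i j =>
    rw [map_mul, apply_ite (FreeAlgebra.lift K (genericGen K o k s c D)), map_zero, hE, hE,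
      Module.End.mul_apply, actE_single]
    split_ifs with h1 h2 h2
    · rw [h2, actE_single, if_pos h1]
    · rw [actE_single, if_neg (fun h3 => h2 (Subtype.ext (h3.symm.trans h1)))]; rfl
    · subst h2; rw [map_zero, actE_single, if_neg h1]
    · rw [map_zero]; rfl
  | e_sum =>
    rw [map_sum, map_one, LinearMap.sum_apply]
    refine (Finset.sum_eq_single (k.rearrange w) (fun i _ hi => ?_) ?_).trans ?_
    · rw [hE, actE_single, if_neg (fun h => hi (Subtype.ext h.symm))]
    · intro h
      exact absurd (Finset.mem_univ _) h
    · rw [hE, actE_single, if_pos (show k.1 ∘ w = (k.rearrange w).1 from rfl)]; rfl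
  | y_e r i =>
    simp only [map_mul, hE, hY, Module.End.mul_apply, actE_single, actY_single,
      apply_ite (actY K k s c r), map_zero]
  | tau_e r i =>
    simp only [map_mul, hE, hT, Module.End.mul_apply, actE_single, actTau_single, map_add,
      apply_ite (actTau K o k s c D r), map_zero, comp_mul_adjSwap_eq_iff]
    -- The part of `τ_r` that fixes `w` does not exchange the letters as `τ_r e(𝐢) = e(s_r 𝐢) τ_r`
    -- demands. It does no harm, because `opB` is nonzero only if the two letters are equal, and
    -- then both words agree.
    have hB : (if k.1 ∘ w = (i.swap r).1 then
          (Finsupp.single w (opB k.1 s c (w (lo r)) (w (hi r)) * z) : GenericSpace E ν) else 0)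
        = if k.1 ∘ w = i.1 then
          (Finsupp.single w (opB k.1 s c (w (lo r)) (w (hi r)) * z) : GenericSpace E ν) else 0 := by
      by_cases hk : k.1 (w (lo r)) = k.1 (w (hi r))
      · have h1 : k.1 ∘ ⇑(w * adjSwap r) = k.1 ∘ w := by
          funext x
          rw [Function.comp_apply, Function.comp_apply, Equiv.Perm.mul_apply]
          by_cases hx : x = lo r
          · rw [hx, adjSwap_lo, hk]
          · by_cases hx' : x = hi r
            · rw [hx', adjSwap_hi, hk]
            · rw [adjSwap_of_ne hx hx']
        have h2 := comp_mul_adjSwap_eq_iff (k := k) i r w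
        rw [h1] at h2
        simp only [h2]
      · rw [opB_of_ne hk]; simp
    rw [hB]
    split_ifs <;> simp
  | y_y r t i hrt =>
    simp only [map_mul, map_zsmul, hE, hY, Module.End.mul_apply, actE_single, LinearMap.smul_apply]
    split_ifs with hk
    · simp only [actY_single, ← hk, zsmul_single, ← mul_assoc]
      rw [opY_mul_opY hC (hw' hrt), smul_mul_assoc]
      rfl
    · simp
  | tau_y r t i h1 h2 =>
    simp only [map_mul, map_zsmul, hE, hY, hT, Module.End.mul_apply, actE_single,
      LinearMap.smul_apply]
    split_ifs with hk
    · have h3 : (w * adjSwap r) t = w t := by rw [Equiv.Perm.mul_apply, adjSwap_of_ne h1 h2]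
      simp only [actY_single, actTau_single, map_add, smul_add, zsmul_single, h3, ← mul_assoc, ← hk,
        Function.comp_apply]
      rw [opB_mul_opY hC (hw' h1) (hw' h2),
        opS_mul_opY hC, smul_mul_assoc, smul_mul_assoc]
    · simp
  | tau_tau r t i h =>
    simp only [map_mul, map_zsmul, hE, hT, Module.End.mul_apply, actE_single, LinearMap.smul_apply]
    split_ifs with hk
    · have e1 : lo t ≠ lo r := by simp only [lo, ne_eq, Fin.mk.injEq]; omega
      have e2 : lo t ≠ hi r := by simp only [lo, hi, ne_eq, Fin.mk.injEq]; omega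
      have e3 : hi t ≠ lo r := by simp only [lo, hi, ne_eq, Fin.mk.injEq]; omega
      have e4 : hi t ≠ hi r := by simp only [hi, ne_eq, Fin.mk.injEq]; omega
      simp only [actTau_single, map_add, smul_add, zsmul_single, ← mul_assoc, ← hk,
        Function.comp_apply, Equiv.Perm.mul_apply, adjSwap_of_ne e1 e2, adjSwap_of_ne e3 e4,
        adjSwap_of_ne e1.symm e3.symm, adjSwap_of_ne e2.symm e4.symm]
      rw [mul_assoc w, mul_assoc w, adjSwap_comm h,
        opB_mul_opB hC (hw' e1.symm) (hw' e3.symm) (hw' e2.symm) (hw' e4.symm),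
        opB_mul_opS hC (hw' e1.symm) (hw' e3.symm) (hw' e2.symm) (hw' e4.symm),
        opS_mul_opB hC (hw' e1.symm) (hw' e3.symm) (hw' e2.symm) (hw' e4.symm),
        opS_mul_opS hC (hw' e1.symm) (hw' e3.symm) (hw' e2.symm) (hw' e4.symm)]
      simp only [smul_mul_assoc]
      abel
    · simp
  | tau_y_hi r i =>
    simp only [map_mul, map_add, map_zsmul, hE, hY, hT, Module.End.mul_apply, actE_single,
      LinearMap.add_apply, LinearMap.smul_apply]
    by_cases hk : k.1 ∘ w = i.1
    · have hl := hw' (lo_ne_hi r)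
      have hδ : (FreeAlgebra.lift K (genericGen K o k s c D)
            (if i.1 (lo r) = i.1 (hi r) then 1 else 0)) (Finsupp.single w z)
          = Finsupp.single w ((if k.1 (w (lo r)) = k.1 (w (hi r)) then 1 else 0) * z) := by
        simp only [← hk, Function.comp_apply]
        split_ifs
        · rw [map_one, one_mul]; rfl
        · simp
      have h3 : (w * adjSwap r) (lo r) = w (hi r) := by rw [Equiv.Perm.mul_apply, adjSwap_lo]
      simp only [if_pos hk]
      rw [hδ]
      simp only [actY_single, actTau_single, map_add, smul_add, zsmul_single, h3, ← mul_assoc, ← hk,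
        Function.comp_apply]
      rw [opB_mul_opY_right hC hl, opS_mul_opY hC, mul_assoc (par _), zmod_two_mul_self, add_mul,
        Finsupp.single_add, smul_mul_assoc, smul_mul_assoc]
      abel
    · simp only [if_neg hk, map_zero, smul_zero, add_zero]
  | y_hi_tau r i =>
    simp only [map_mul, map_add, map_zsmul, hE, hY, hT, Module.End.mul_apply, actE_single,
      LinearMap.add_apply, LinearMap.smul_apply]
    by_cases hk : k.1 ∘ w = i.1
    · have hl := hw' (lo_ne_hi r)
      have hδ : (FreeAlgebra.lift K (genericGen K o k s c D)
            (if i.1 (lo r) = i.1 (hi r) then 1 else 0)) (Finsupp.single w z)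
          = Finsupp.single w ((if k.1 (w (lo r)) = k.1 (w (hi r)) then 1 else 0) * z) := by
        simp only [← hk, Function.comp_apply]
        split_ifs
        · rw [map_one, one_mul]; rfl
        · simp
      have h3 : (w * adjSwap r) (hi r) = w (lo r) := by rw [Equiv.Perm.mul_apply, adjSwap_hi]
      simp only [if_pos hk]
      rw [hδ]
      simp only [actY_single, actTau_single, map_add, smul_add, zsmul_single, h3, ← mul_assoc, ← hk,
        Function.comp_apply]
      have hS := opS_mul_opY (o := o) (k := k.1) hC (w (lo r)) (w (hi r)) (w (lo r))
      rw [mul_right_comm, zmod_two_mul_self] at hS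
      rw [opY_mul_opB_right hC hl, hS, add_mul,
        Finsupp.single_add, smul_mul_assoc, smul_mul_assoc, smul_smul, ← sgn_add, CharTwo.add_self_eq_zero,
        sgn_zero, one_smul]
      abel
    · simp only [if_neg hk, map_zero, smul_zero, add_zero]
  | tau_sq r i =>
    have hq := map_qPoly o (i.1 (lo r)) (i.1 (hi r))
      (B := Module.End K (GenericSpace E ν)) (FreeAlgebra.lift K (genericGen K o k s c D) :
        FreeAlgebra K (Gen ν) →ₐ[K] Module.End K (GenericSpace E ν)).toRingHom
      (FreeAlgebra.ι K (Gen.y (lo r))) (FreeAlgebra.ι K (Gen.y (hi r)))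
    simp only [AlgHom.toRingHom_eq_coe, RingHom.coe_coe, hY] at hq
    simp only [map_mul, hE, hT, hq, Module.End.mul_apply, actE_single]
    split_ifs with hk
    · have hl := hw' (lo_ne_hi r)
      simp only [qPoly_actY_single, actTau_single, map_add, ← hk, Function.comp_apply,
        Equiv.Perm.mul_apply, adjSwap_lo, adjSwap_hi]
      rw [← op_sq hC hl, mul_assoc w, Equiv.swap_mul_self, mul_one]
      -- The two contributions of `τ_r²` to the exchanged arrangement cancel; their sum, written as
      -- zero, is subtracted from the goal.
      have h0 : (Finsupp.single (w * adjSwap r) ((opS o k.1 s D (w (lo r)) (w (hi r))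
          * opB k.1 s c (w (lo r)) (w (hi r)) + opB k.1 s c (w (hi r)) (w (lo r))
          * opS o k.1 s D (w (lo r)) (w (hi r))) * z) : GenericSpace E ν) = 0 := by
        rw [op_cross hC hl, zero_mul, Finsupp.single_zero]
      rw [add_mul, Finsupp.single_add] at h0 ⊢
      simp only [mul_assoc] at h0 ⊢
      refine sub_eq_zero.1 (Eq.trans ?_ h0)
      abel
    · simp
  | braid r t h i =>
    have hq := map_braidTerm o (i.1 (lo r)) (i.1 (hi r)) (i.1 (hi t))
      (B := Module.End K (GenericSpace E ν)) (FreeAlgebra.lift K (genericGen K o k s c D) :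
        FreeAlgebra K (Gen ν) →ₐ[K] Module.End K (GenericSpace E ν)).toRingHom
      (FreeAlgebra.ι K (Gen.y (lo r))) (FreeAlgebra.ι K (Gen.y (hi t)))
    simp only [AlgHom.toRingHom_eq_coe, RingHom.coe_coe, hY] at hq
    simp only [map_mul, map_sub, hE, hT, hq, Module.End.mul_apply, LinearMap.sub_apply, actE_single]
    split_ifs with hk
    · have h1 : lo t = hi r := Fin.ext h.symm
      have h2 : lo r ≠ hi t := by simp only [lo, hi, ne_eq, Fin.mk.injEq]; omega
      have h3 : hi r ≠ hi t := by simp only [hi, ne_eq, Fin.mk.injEq]; omega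
      have h4 := lo_ne_hi r
      have r1 := adjSwap_of_ne h2.symm h3.symm
      have r2 : adjSwap t (lo r) = lo r := adjSwap_of_ne (h1 ▸ h4) h2
      have r3 : adjSwap t (hi r) = hi t := h1 ▸ adjSwap_lo t
      have r4 : adjSwap t (hi t) = hi r := h1 ▸ adjSwap_hi t
      simp only [braidTerm_actY_single, actTau_single, map_add, ← hk, Function.comp_apply, h1,
        Equiv.Perm.mul_apply, adjSwap_lo, adjSwap_hi, r1, r2, r3, r4]
      have sq1 : ∀ u : Equiv.Perm (Fin ν.card), u * adjSwap r * adjSwap r = u := fun u => by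
        rw [mul_assoc, Equiv.swap_mul_self, mul_one]
      have sq2 : ∀ u : Equiv.Perm (Fin ν.card), u * adjSwap t * adjSwap t = u := fun u => by
        rw [mul_assoc, Equiv.swap_mul_self, mul_one]
      have hbr : w * adjSwap t * adjSwap r * adjSwap t = w * adjSwap r * adjSwap t * adjSwap r := by
        rw [mul_assoc, mul_assoc, ← mul_assoc (adjSwap t), ← adjSwap_braid h]
        simp only [mul_assoc]
      rw [sq1, sq2, hbr]
      -- The two triple products of `τ` are compared arrangement by arrangement; each of the six
      -- identities settles one of them.
      have i1 := congrArg (fun x => (Finsupp.single w (x * z) : GenericSpace E ν))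
        (braid_id (o := o) (k := k.1) hC (hw' h4) (hw' h2) (hw' h3))
      have i2 := congrArg (fun x => (Finsupp.single (w * adjSwap r) (x * z) : GenericSpace E ν))
        (braid_lo (o := o) (k := k.1) hC (hw' h4) (hw' h2) (hw' h3))
      have i3 := congrArg (fun x => (Finsupp.single (w * adjSwap t) (x * z) : GenericSpace E ν))
        (braid_hi (o := o) (k := k.1) hC (hw' h4) (hw' h2) (hw' h3))
      have i4 := congrArg (fun x => (Finsupp.single (w * adjSwap t * adjSwap r) (x * z) :
        GenericSpace E ν)) (braid_hi_lo (o := o) (k := k.1) hC (hw' h4) (hw' h2) (hw' h3))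
      have i5 := congrArg (fun x => (Finsupp.single (w * adjSwap r * adjSwap t) (x * z) :
        GenericSpace E ν)) (braid_lo_hi (o := o) (k := k.1) hC (hw' h4) (hw' h2) (hw' h3))
      have i6 := congrArg (fun x => (Finsupp.single (w * adjSwap r * adjSwap t * adjSwap r) (x * z) :
        GenericSpace E ν)) (braid_top (o := o) (k := k.1) hC (hw' h4) (hw' h2) (hw' h3))
      simp only [add_mul, Finsupp.single_add, mul_assoc] at i1 i2 i3 i4 i5 i6 ⊢
      linear_combination (norm := abel) i1 + i2 + i3 + i4 + i5 + i6
    · simp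

end generic

/-! ### Inversions and canonical words of arrangements -/

section arrangements

variable {d : ℕ} {α : Type*}

theorem lo_lt_hi (r : Fin (d - 1)) : lo r < hi r := Fin.mk_lt_mk.2 (Nat.lt_succ_self _)

/-- The sum of `f (c x) (c y)` over the pairs of places `x < y`. -/
def pairSum {G : Type*} [AddCommMonoid G] (f : α → α → G) (c : Fin d → α) : G :=
  ∑ p ∈ (Finset.univ : Finset (Fin d × Fin d)).filter (fun p => p.1 < p.2), f (c p.1) (c p.2)

theorem adjSwap_lt_adjSwap {r : Fin (d - 1)} {x y : Fin d} (h : x < y)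
    (hne : (x, y) ≠ (lo r, hi r)) : adjSwap r x < adjSwap r y := by
  rw [ne_eq, Prod.mk.injEq, Fin.ext_iff, Fin.ext_iff] at hne
  rw [Fin.lt_def] at h ⊢
  simp only [adjSwap, Equiv.swap_apply_def, lo, hi, Fin.ext_iff] at *
  split_ifs <;> (try simp only []) <;> omega

/-- The transposition permutes the pairs `x < y` other than `(lo r, hi r)`, so the two sums differ
in a single term. The missing terms are added on both sides because `G` need not have subtraction.
-/
theorem pairSum_swap {G : Type*} [AddCommMonoid G] (f : α → α → G) (c : Fin d → α)
    (r : Fin (d - 1)) :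
    pairSum f (c ∘ adjSwap r) + f (c (lo r)) (c (hi r))
      = pairSum f c + f (c (hi r)) (c (lo r)) := by
  have hmem : (lo r, hi r) ∈ (Finset.univ : Finset (Fin d × Fin d)).filter
      (fun p => p.1 < p.2) := by simp [lo_lt_hi]
  unfold pairSum
  rw [← Finset.add_sum_erase _ _ hmem, ← Finset.add_sum_erase _ _ hmem]
  have h : ∑ p ∈ ((Finset.univ : Finset (Fin d × Fin d)).filter (fun p => p.1 < p.2)).erase
      (lo r, hi r), f ((c ∘ adjSwap r) p.1) ((c ∘ adjSwap r) p.2)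
      = ∑ p ∈ ((Finset.univ : Finset (Fin d × Fin d)).filter (fun p => p.1 < p.2)).erase
      (lo r, hi r), f (c p.1) (c p.2) := by
    have hmaps : ∀ p ∈ ((Finset.univ : Finset (Fin d × Fin d)).filter (fun p => p.1 < p.2)).erase
        (lo r, hi r), (adjSwap r p.1, adjSwap r p.2) ∈
        ((Finset.univ : Finset (Fin d × Fin d)).filter (fun p => p.1 < p.2)).erase
        (lo r, hi r) := by
      intro p hp
      rw [Finset.mem_erase, Finset.mem_filter] at hp ⊢
      refine ⟨?_, Finset.mem_univ _, adjSwap_lt_adjSwap hp.2.2 hp.1⟩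
      intro h
      rw [Prod.mk.injEq, Equiv.swap_apply_eq_iff, Equiv.swap_apply_left, Equiv.swap_apply_eq_iff,
        Equiv.swap_apply_right] at h
      have := hp.2.2
      rw [h.1, h.2] at this
      exact lt_asymm this (lo_lt_hi r)
    refine Finset.sum_nbij' (fun p => (adjSwap r p.1, adjSwap r p.2))
      (fun p => (adjSwap r p.1, adjSwap r p.2)) hmaps hmaps ?_ ?_ ?_
    · intro p _; simp
    · intro p _; simp
    · intro p _; rfl
  rw [h]
  simp only [Function.comp_apply, adjSwap_lo, adjSwap_hi]
  abel

variable [LinearOrder α]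

/-- The number of inversions. -/
def inv (c : Fin d → α) : ℕ := pairSum (fun a b => if b < a then 1 else 0) c

theorem inv_swap_of_lt {c : Fin d → α} {r : Fin (d - 1)} (h : c (lo r) < c (hi r)) :
    inv (c ∘ adjSwap r) = inv c + 1 := by
  have := pairSum_swap (fun a b => if b < a then 1 else 0) c r
  rw [if_neg (not_lt_of_gt h), if_pos h, add_zero] at this
  exact this

theorem inv_swap_of_gt {c : Fin d → α} {r : Fin (d - 1)} (h : c (hi r) < c (lo r)) :
    inv (c ∘ adjSwap r) + 1 = inv c := by
  have := pairSum_swap (fun a b => if b < a then 1 else 0) c r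
  rw [if_neg (not_lt_of_gt h), if_pos h, add_zero] at this
  exact this

theorem inv_swap_le (c : Fin d → α) (r : Fin (d - 1)) : inv (c ∘ adjSwap r) ≤ inv c + 1 := by
  rcases lt_trichotomy (c (lo r)) (c (hi r)) with h | h | h
  · exact (inv_swap_of_lt h).le
  · have : c ∘ adjSwap r = c := by
      funext x
      by_cases hx : x = lo r
      · rw [hx, Function.comp_apply, adjSwap_lo, h]
      · by_cases hx' : x = hi r
        · rw [hx', Function.comp_apply, adjSwap_hi, h]
        · rw [Function.comp_apply, adjSwap_of_ne hx hx']
    rw [this]; exact Nat.le_succ _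
  · have := inv_swap_of_gt h; omega

theorem monotone_of_le_hi {c : Fin d → α} (h : ∀ r, c (lo r) ≤ c (hi r)) : Monotone c := by
  have key : ∀ j : ℕ, ∀ x y : Fin d, x.val + j = y.val → c x ≤ c y := by
    intro j
    induction j with
    | zero => intro x y hxy; rw [Fin.ext (a := x) (b := y) (by omega)]
    | succ j ih =>
      intro x y hxy
      have hy := y.isLt
      exact (ih x ⟨y.val - 1, by omega⟩ (by simp only []; omega)).trans
        (le_of_le_of_eq (h ⟨y.val - 1, by omega⟩)
          (congrArg c (Fin.ext (by simp only [hi]; omega))))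
  intro x y hxy
  exact key (y.val - x.val) x y (by have : x.val ≤ y.val := hxy; omega)

/-- A rearrangement of `c₀`. -/
def Rearr (c₀ : Fin d → α) : Type _ :=
  {c : Fin d → α // Finset.univ.val.map c = Finset.univ.val.map c₀}

instance [Fintype α] (c₀ : Fin d → α) : Fintype (Rearr c₀) := by
  unfold Rearr; infer_instance

theorem map_univ_comp_perm (c : Fin d → α) (w : Equiv.Perm (Fin d)) :
    Finset.univ.val.map (c ∘ w) = Finset.univ.val.map c := by
  have h := congrArg (fun s => Multiset.map c (Finset.val s)) (Finset.map_univ_equiv w)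
  simp only [Finset.map_val, Multiset.map_map] at h
  exact h

/-- The exchange of two adjacent places. -/
def Rearr.swap {c₀ : Fin d → α} (c : Rearr c₀) (r : Fin (d - 1)) : Rearr c₀ :=
  ⟨c.1 ∘ adjSwap r, (map_univ_comp_perm _ _).trans c.2⟩

theorem comp_adjSwap_adjSwap {β : Type*} (c : Fin d → β) (r : Fin (d - 1)) :
    (c ∘ adjSwap r) ∘ adjSwap r = c := by
  funext x; simp

theorem eq_of_monotone_of_map_eq {c c' : Fin d → α} (h : Monotone c) (h' : Monotone c')
    (he : Finset.univ.val.map c = Finset.univ.val.map c') : c = c' := by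
  rw [Fin.univ_val_map, Fin.univ_val_map, Multiset.coe_eq_coe] at he
  exact List.ofFn_injective (he.eq_of_sortedLE h.sortedLE_ofFn h'.sortedLE_ofFn)

open Classical in
/-- A canonical reduced word that leads to an arrangement from its monotone rearrangement. -/
def word (c : Fin d → α) : List (Fin (d - 1)) :=
  if h : ∃ r, c (hi r) < c (lo r) then h.choose :: word (c ∘ adjSwap h.choose) else []
  termination_by inv c
  decreasing_by have := inv_swap_of_gt h.choose_spec; omega

theorem word_of_monotone {c : Fin d → α} (h : Monotone c) : word c = [] := by
  rw [word, dif_neg]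
  rintro ⟨r, hr⟩
  exact not_lt_of_ge (h (lo_lt_hi r).le) hr

/-- This hides the choice of a descent in the recursion of `word`: some descent comes first, and
later arguments have to cope with any of them. -/
theorem monotone_or_word (c : Fin d → α) : Monotone c ∨ ∃ r, c (hi r) < c (lo r) ∧
    word c = r :: word (c ∘ adjSwap r) := by
  by_cases h : ∃ r, c (hi r) < c (lo r)
  · refine Or.inr ⟨h.choose, h.choose_spec, ?_⟩
    rw [word, dif_pos h]
  · push Not at h
    exact Or.inl (monotone_of_le_hi h)

/-- Induction along canonical words. -/
theorem word_induction {c₀ : Fin d → α} (h₀ : Monotone c₀) {p : Rearr c₀ → Prop}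
    (base : p ⟨c₀, rfl⟩)
    (step : ∀ (c : Rearr c₀) (r), c.1 (hi r) < c.1 (lo r) → word c.1 = r :: word (c.swap r).1 →
      p (c.swap r) → p c) (c : Rearr c₀) : p c := by
  induction hl : inv c.1 using Nat.strong_induction_on generalizing c with
  | _ l ih =>
    rcases monotone_or_word c.1 with hm | ⟨r, hr, hw⟩
    · have : c = ⟨c₀, rfl⟩ := Subtype.ext (eq_of_monotone_of_map_eq hm h₀ c.2)
      rw [this]; exact base
    · have h1 := inv_swap_of_gt hr
      exact step c r hr hw (ih (inv (c.1 ∘ adjSwap r)) (by omega) (c.swap r) rfl)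

/-- The arrangement of the strands that a word of transpositions leads to. -/
def permOf : List (Fin (d - 1)) → Equiv.Perm (Fin d)
  | [] => 1
  | r :: L => permOf L * adjSwap r

/-- The order is reversed because the first letter of a word belongs to the leftmost `τ`, which acts
last, while arrangements are multiplied on the right by the transpositions of places. -/
theorem permOf_append (L L' : List (Fin (d - 1))) : permOf (L ++ L') = permOf L' * permOf L := by
  induction L with
  | nil => rw [List.nil_append, permOf, mul_one]
  | cons r L ih => rw [List.cons_append, permOf, permOf, ih, mul_assoc]

theorem comp_permOf_word {c₀ : Fin d → α} (h₀ : Monotone c₀) (c : Rearr c₀) :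
    c₀ ∘ permOf (word c.1) = c.1 := by
  refine word_induction h₀ (p := fun c => c₀ ∘ permOf (word c.1) = c.1) ?_ ?_ c
  · rw [word_of_monotone h₀]; rfl
  · intro c r _ hw ih
    rw [hw, permOf, Equiv.Perm.coe_mul, ← Function.comp_assoc, ih]
    exact comp_adjSwap_adjSwap _ _

/-- Each transposition of the word exchanges an increasing pair, when one starts from `w`. -/
def IsAscending (w : Equiv.Perm (Fin d)) : List (Fin (d - 1)) → Prop
  | [] => True
  | r :: L => IsAscending w L ∧ (w * permOf L) (lo r) < (w * permOf L) (hi r)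

theorem IsAscending.append {w : Equiv.Perm (Fin d)} {L L' : List (Fin (d - 1))}
    (h' : IsAscending w L') (h : IsAscending (w * permOf L') L) : IsAscending w (L ++ L') := by
  induction L with
  | nil => exact h'
  | cons r L ih =>
    refine ⟨ih h.1, ?_⟩
    change (w * permOf (L ++ L')) (lo r) < (w * permOf (L ++ L')) (hi r)
    rw [permOf_append, ← mul_assoc]
    exact h.2

/-- A non-ascending exchange of strands would, as `c₀` is monotone, also be non-ascending for the
colours, contrary to the choice of a descent. The permutation `w` may be any element of the
stabilizer of `c₀`, so that words inside the blocks can be performed first. -/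
theorem isAscending_word {c₀ : Fin d → α} (h₀ : Monotone c₀) {w : Equiv.Perm (Fin d)}
    (hw : c₀ ∘ w = c₀) (c : Rearr c₀) : IsAscending w (word c.1) := by
  refine word_induction h₀ (p := fun c => IsAscending w (word c.1)) ?_ ?_ c
  · rw [word_of_monotone h₀]; trivial
  · intro c r hr hwd ih
    rw [hwd]
    refine ⟨ih, ?_⟩
    by_contra hcon
    have h1 := h₀ (not_lt.1 hcon)
    have h2 : c₀ ∘ ⇑(w * permOf (word (c.swap r).1)) = (c.swap r).1 := by
      rw [Equiv.Perm.coe_mul, ← Function.comp_assoc, hw, comp_permOf_word h₀]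
    have h3 := congrFun h2 (lo r)
    have h4 := congrFun h2 (hi r)
    rw [Function.comp_apply] at h3 h4
    rw [h3, h4] at h1
    simp only [Rearr.swap, Function.comp_apply, adjSwap_lo, adjSwap_hi] at h1
    exact not_lt_of_ge h1 hr

end arrangements

/-! ### Triangularity of the generic representation -/

section triangular

variable {Z : Type*} [Field Z] {K : Type*} [Field K] {E : Type*} [Ring E] [Algebra Z E]
  [Algebra K E] {n : ℕ} {ν : Multiset (Fin n)} (o : Orientation n) (k : Word ν)
  {s : Fin ν.card → Z} {c D : Fin ν.card → E}

/-- The generic representation of `H⁻(ν)`. -/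
def genericRep (K : Type*) [Field K] [Algebra K E] (hC : IsClifford s c D) :
    Alg K o ν →ₐ[K] Module.End K (GenericSpace E ν) :=
  Alg.lift (FreeAlgebra.lift K (genericGen K o k s c D)) (genericGen_rel hC)

variable (hC : IsClifford s c D)

theorem genericRep_e (i : Word ν) : genericRep o k K hC (e K o i) = actE K k i := by
  rw [genericRep, e, Alg.lift_mk, FreeAlgebra.lift_ι_apply]; rfl

theorem genericRep_y (r : Fin ν.card) : genericRep o k K hC (y K o r) = actY K k s c r := by
  rw [genericRep, y, Alg.lift_mk, FreeAlgebra.lift_ι_apply]; rfl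

theorem genericRep_tau (r : Fin (ν.card - 1)) :
    genericRep o k K hC (tau K o r) = actTau K o k s c D r := by
  rw [genericRep, tau, Alg.lift_mk, FreeAlgebra.lift_ι_apply]; rfl

/-- The product of the `τ_r` along a word. -/
def tauProd (K : Type*) [Field K] {n : ℕ} (o : Orientation n) {ν : Multiset (Fin n)}
    (L : List (Fin (ν.card - 1))) : Alg K o ν := (L.map (tau K o)).prod

theorem tauProd_nil : tauProd K o ([] : List (Fin (ν.card - 1))) = 1 := rfl

theorem tauProd_cons (r : Fin (ν.card - 1)) (L) :
    tauProd K o (r :: L) = tau K o r * tauProd K o L := List.prod_cons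

theorem tauProd_append (L L' : List (Fin (ν.card - 1))) :
    tauProd K o (L ++ L') = tauProd K o L * tauProd K o L' := by
  rw [tauProd, List.map_append, List.prod_append]; rfl

variable (K E) in
/-- The vectors that are supported on arrangements with less than `m` inversions. -/
def lowPart (ν : Multiset (Fin n)) (m : ℕ) : Submodule K (GenericSpace E ν) :=
  Finsupp.supported E K {w | inv w < m}

theorem single_mem_lowPart {m : ℕ} {w : Equiv.Perm (Fin ν.card)} (h : inv w < m) (x : E) :
    (Finsupp.single w x : GenericSpace E ν) ∈ lowPart K E ν m :=
  Finsupp.single_mem_supported K x h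

theorem coe_mul_adjSwap {d : ℕ} (w : Equiv.Perm (Fin d)) (r : Fin (d - 1)) :
    ⇑(w * adjSwap r) = w ∘ adjSwap r := rfl

theorem actTau_mem_lowPart {m : ℕ} {f : GenericSpace E ν} (hf : f ∈ lowPart K E ν m)
    (r : Fin (ν.card - 1)) : actTau K o k s c D r f ∈ lowPart K E ν (m + 1) := by
  rw [← Finsupp.sum_single f, map_finsuppSum]
  refine Submodule.sum_mem _ fun w hw => ?_
  have h1 : inv w < m := (Finsupp.mem_supported K f).1 hf hw
  change actTau K o k s c D r (Finsupp.single w (f w)) ∈ _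
  rw [actTau_single]
  refine Submodule.add_mem _ (single_mem_lowPart (by omega) _) (single_mem_lowPart ?_ _)
  have := inv_swap_le w r
  rw [coe_mul_adjSwap]
  omega

theorem inv_mul_permOf {d : ℕ} {w : Equiv.Perm (Fin d)} {L : List (Fin (d - 1))}
    (h : IsAscending w L) : inv ⇑(w * permOf L) = inv w + L.length := by
  induction L with
  | nil => rw [permOf, mul_one]; rfl
  | cons r L ih =>
    rw [permOf, ← mul_assoc, coe_mul_adjSwap, inv_swap_of_lt h.2, ih h.1, List.length_cons,
      add_assoc]

/-- Each ascending step adds one inversion through the exchanging part of `τ_r`, whose coefficient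
can be cancelled by `opS_mul_left_injective`. The part that fixes the arrangement, and everything
that arises from lower terms, stays strictly below the number of inversions of the end. -/
theorem tauProd_single {w : Equiv.Perm (Fin ν.card)} {L : List (Fin (ν.card - 1))}
    (h : IsAscending w L) : ∃ U : E →+ E, (∀ x, U x = 0 → x = 0) ∧ ∀ x,
      genericRep o k K hC (tauProd K o L) (Finsupp.single w x)
        - Finsupp.single (w * permOf L) (U x) ∈ lowPart K E ν (inv w + L.length) := by
  induction L with
  | nil =>
    refine ⟨AddMonoidHom.id E, fun _ h => h, fun x => ?_⟩
    rw [tauProd_nil, map_one, permOf, mul_one]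
    simp
  | cons r L ih =>
    obtain ⟨U, hU, hx⟩ := ih h.1
    have hne : (w * permOf L) (lo r) ≠ (w * permOf L) (hi r) := ne_of_lt h.2
    refine ⟨(AddMonoidHom.mulLeft (opS o k.1 s D ((w * permOf L) (lo r)) ((w * permOf L) (hi r)))).comp U,
      fun x hx => hU x (opS_mul_left_injective hC hne hx), fun x => ?_⟩
    have h1 := actTau_mem_lowPart o k (s := s) (c := c) (D := D) (hx x) r
    rw [map_sub, actTau_single] at h1
    rw [tauProd_cons, map_mul, genericRep_tau, Module.End.mul_apply, permOf, ← mul_assoc,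
      List.length_cons]
    have h2 := single_mem_lowPart (K := K) (ν := ν) (m := inv w + L.length + 1) (w := w * permOf L)
      (by rw [inv_mul_permOf h.1]; exact Nat.lt_succ_self _)
      (opB k.1 s c ((w * permOf L) (lo r)) ((w * permOf L) (hi r)) * U x)
    have h3 := Submodule.add_mem _ h1 h2
    refine Eq.mp (congrArg (· ∈ lowPart K E ν (inv w + L.length + 1)) ?_) h3
    change _ = _ - Finsupp.single _ (_ * U x)
    abel

/-- The leading terms of products of the `τ_r` along ascending words with distinct ends are
independent. -/
theorem eq_zero_of_sum_tauProd_single {Ω : Type*} (L : Ω → List (Fin (ν.card - 1)))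
    (hL : ∀ x, IsAscending 1 (L x)) (hinj : Function.Injective fun x => permOf (L x))
    (g : Ω →₀ E)
    (hg : g.sum (fun x a => genericRep o k K hC (tauProd K o (L x)) (Finsupp.single 1 a)) = 0) :
    g = 0 := by
  classical
  by_contra hne
  -- The longest word in the support is chosen: at its end only leading terms can contribute, and
  -- the ends are distinct.
  obtain ⟨x₀, hx₀, hmax⟩ := Finset.exists_max_image g.support (fun x => (L x).length)
    (Finsupp.support_nonempty_iff.2 hne)
  have h1 := congrArg (fun f : GenericSpace E ν => f (permOf (L x₀))) hg
  have hlen : ∀ x, inv ⇑(permOf (L x)) = (L x).length + inv ⇑(1 : Equiv.Perm (Fin ν.card)) := by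
    intro x
    have := inv_mul_permOf (hL x)
    rw [one_mul] at this
    omega
  have hcoef : ∀ x ∈ g.support, ∃ U : E →+ E, (∀ a, U a = 0 → a = 0) ∧
      (genericRep o k K hC (tauProd K o (L x)) (Finsupp.single 1 (g x))) (permOf (L x₀))
        = if x = x₀ then U (g x) else 0 := by
    intro x hx
    obtain ⟨U, hU, hx'⟩ := tauProd_single (K := K) o k hC (hL x)
    refine ⟨U, hU, ?_⟩
    have h2 := (Finsupp.mem_supported' K _).1 (hx' (g x)) (permOf (L x₀)) (by
      have := hmax x hx
      simp only [Set.mem_ofPred_eq, hlen]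
      omega)
    rw [Finsupp.sub_apply, sub_eq_zero, one_mul] at h2
    rw [h2, Finsupp.single_apply]
    exact if_congr hinj.eq_iff rfl rfl
  rw [Finsupp.sum, Finsupp.finsetSum_apply, Finset.sum_eq_single x₀] at h1
  · obtain ⟨U, hU, h2⟩ := hcoef x₀ hx₀
    rw [h2, if_pos rfl] at h1
    exact Finsupp.mem_support_iff.1 hx₀ (hU _ h1)
  · intro x hx hxne
    obtain ⟨U, hU, h2⟩ := hcoef x hx
    rw [h2, if_neg hxne]
  · intro h; exact absurd hx₀ h

end triangular

/-! ### Clifford elements from a Jordan–Wigner construction -/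

section jordanWigner

variable {Z : Type*} [Field Z] {d : ℕ} (s : Fin d → Z)

/-- The sign `(-1)^{#{t ∈ T, t < l}}`. -/
def jwSign (Z : Type*) [Field Z] {d : ℕ} (l : Fin d) (T : Finset (Fin d)) : Z :=
  (-1) ^ (T.filter (· < l)).card

theorem jwSign_mul_self (l : Fin d) (T : Finset (Fin d)) : jwSign Z l T * jwSign Z l T = 1 := by
  rw [jwSign, ← pow_add, ← two_mul, pow_mul]; simp

theorem symmDiff_singleton_of_mem {T : Finset (Fin d)} {m : Fin d} (h : m ∈ T) :
    symmDiff T {m} = T.erase m := by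
  ext x; simp only [Finset.mem_symmDiff, Finset.mem_singleton, Finset.mem_erase]
  constructor
  · rintro (⟨h1, h2⟩ | ⟨h1, h2⟩)
    · exact ⟨h2, h1⟩
    · exact absurd (h1 ▸ h) h2
  · rintro ⟨h1, h2⟩; exact Or.inl ⟨h2, h1⟩

theorem symmDiff_singleton_of_notMem {T : Finset (Fin d)} {m : Fin d} (h : m ∉ T) :
    symmDiff T {m} = insert m T := by
  ext x; simp only [Finset.mem_symmDiff, Finset.mem_singleton, Finset.mem_insert]
  constructor
  · rintro (⟨h1, h2⟩ | ⟨h1, h2⟩)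
    · exact Or.inr h1
    · exact Or.inl h1
  · rintro (h1 | h1)
    · exact Or.inr ⟨h1, h1 ▸ h⟩
    · exact Or.inl ⟨h1, fun e => h (e ▸ h1)⟩

theorem jwSign_symmDiff (l m : Fin d) (T : Finset (Fin d)) :
    jwSign Z l (symmDiff T {m}) = (if m < l then -1 else 1) * jwSign Z l T := by
  unfold jwSign
  by_cases hm : m ∈ T
  · rw [symmDiff_singleton_of_mem hm, Finset.filter_erase]
    split_ifs with h
    · have h1 : m ∈ T.filter (· < l) := Finset.mem_filter.2 ⟨hm, h⟩
      rw [← Finset.card_erase_add_one h1, pow_succ]; ring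
    · have h1 : m ∉ T.filter (· < l) := fun h1 => h (Finset.mem_filter.1 h1).2
      rw [Finset.erase_eq_of_notMem h1, one_mul]
  · rw [symmDiff_singleton_of_notMem hm, Finset.filter_insert]
    split_ifs with h
    · rw [Finset.card_insert_of_notMem (fun h1 => hm (Finset.mem_filter.1 h1).1), pow_succ]; ring
    · rw [one_mul]

theorem mem_symmDiff_singleton_of_ne {l m : Fin d} (h : l ≠ m) (T : Finset (Fin d)) :
    l ∈ symmDiff T {m} ↔ l ∈ T := by
  simp only [Finset.mem_symmDiff, Finset.mem_singleton]
  tauto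

theorem mem_symmDiff_singleton_self (l : Fin d) (T : Finset (Fin d)) :
    l ∈ symmDiff T {l} ↔ l ∉ T := by
  simp only [Finset.mem_symmDiff, Finset.mem_singleton]
  tauto

/-- The coefficients of `jwOp`. -/
def jwCoeff (ε : Z) (l : Fin d) (T : Finset (Fin d)) : Z :=
  jwSign Z l T * if l ∈ T then s l else ε

/-- The operator that adds `l` to a set, or removes it, with a sign. -/
def jwOp (ε : Z) (l : Fin d) : Module.End Z (Finset (Fin d) →₀ Z) :=
  Finsupp.lsum Z fun T => jwCoeff s ε l T • Finsupp.lsingle (symmDiff T {l})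

theorem jwOp_single (ε : Z) (l : Fin d) (T : Finset (Fin d)) (x : Z) :
    jwOp s ε l (Finsupp.single T x) = Finsupp.single (symmDiff T {l}) (jwCoeff s ε l T * x) := by
  rw [jwOp, Finsupp.lsum_single, LinearMap.smul_apply, Finsupp.lsingle_apply, Finsupp.smul_single,
    smul_eq_mul]

theorem jwOp_mul_jwOp_of_ne (ε ε' : Z) {l m : Fin d} (h : l ≠ m) :
    jwOp s ε l * jwOp s ε' m = -(jwOp s ε' m * jwOp s ε l) := by
  refine Finsupp.lhom_ext fun T x => ?_
  rw [LinearMap.neg_apply, Module.End.mul_apply, Module.End.mul_apply, jwOp_single, jwOp_single,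
    jwOp_single, jwOp_single, symmDiff_right_comm, ← Finsupp.single_neg]
  congr 1
  simp only [jwCoeff, jwSign_symmDiff, mem_symmDiff_singleton_of_ne h,
    mem_symmDiff_singleton_of_ne h.symm]
  rcases lt_or_gt_of_ne h with h1 | h1
  · rw [if_neg (not_lt_of_gt h1), if_pos h1]; ring
  · rw [if_neg (not_lt_of_gt h1), if_pos h1]; ring

/-- Exactly one of `T` and `T ∆ {l}` contains `l`, so one of the two factors contributes `s l` and
the other one its parameter; the signs agree, because removing or adding `l` does not change the
elements below `l`. For `ε = -ε'` the two orders of multiplication give opposite results, so `c l`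
and `D l` anticommute. -/
theorem jwOp_mul_jwOp_self_single (ε ε' : Z) (l : Fin d) (T : Finset (Fin d)) (x : Z) :
    (jwOp s ε l * jwOp s ε' l) (Finsupp.single T x)
      = Finsupp.single T ((if l ∈ T then ε else ε') * s l * x) := by
  rw [Module.End.mul_apply, jwOp_single, jwOp_single, symmDiff_symmDiff_cancel_right]
  congr 1
  simp only [jwCoeff, jwSign_symmDiff, mem_symmDiff_singleton_self, lt_irrefl, if_false, one_mul]
  have h := jwSign_mul_self (Z := Z) l T
  by_cases hl : l ∈ T
  · simp only [hl, not_true_eq_false, if_false, if_true]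
    linear_combination (ε * s l * x) * h
  · simp only [hl, not_false_eq_true, if_false, if_true]
    linear_combination (ε' * s l * x) * h

theorem isClifford_jwOp (h1 : ∀ l m, l ≠ m → s m - s l ≠ 0) (h2 : ∀ l m, l ≠ m → s m + s l ≠ 0) :
    IsClifford s (jwOp s 1) (jwOp s (-1)) where
  c_sq l := by
    refine Finsupp.lhom_ext fun T x => ?_
    rw [jwOp_mul_jwOp_self_single, LinearMap.smul_apply, Module.End.one_apply, Finsupp.smul_single]
    simp
  D_sq l := by
    refine Finsupp.lhom_ext fun T x => ?_
    rw [jwOp_mul_jwOp_self_single, LinearMap.smul_apply, Module.End.one_apply, Finsupp.smul_single]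
    simp
  c_c l m h := jwOp_mul_jwOp_of_ne s _ _ h
  D_D l m h := jwOp_mul_jwOp_of_ne s _ _ h
  D_c l m := by
    by_cases h : l = m
    · subst h
      refine Finsupp.lhom_ext fun T x => ?_
      rw [LinearMap.neg_apply, jwOp_mul_jwOp_self_single, jwOp_mul_jwOp_self_single,
        ← Finsupp.single_neg]
      congr 1
      split_ifs <;> ring
    · exact jwOp_mul_jwOp_of_ne s _ _ h
  sub_ne := h1
  add_ne := h2

theorem jwSign_of_forall_lt {l : Fin d} {T : Finset (Fin d)} (h : ∀ t ∈ T, l < t) :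
    jwSign Z l T = 1 := by
  rw [jwSign, Finset.filter_eq_empty_iff.2 fun t ht => not_lt_of_gt (h t ht)]
  simp

theorem jwOp_pow_single {l : Fin d} {T : Finset (Fin d)} (h : ∀ t ∈ T, l < t) (j : ℕ) (x : Z) :
    (jwOp s 1 l ^ j) (Finsupp.single T x)
      = Finsupp.single (if Odd j then insert l T else T) (s l ^ (j / 2) * x) := by
  have hl : l ∉ T := fun hl => lt_irrefl _ (h l hl)
  have hsq : ∀ q : ℕ, (jwOp s 1 l ^ (2 * q)) = s l ^ q • (1 : Module.End Z (Finset (Fin d) →₀ Z)) := by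
    intro q
    have h1 : jwOp s 1 l * jwOp s 1 l = s l • (1 : Module.End Z (Finset (Fin d) →₀ Z)) := by
      refine Finsupp.lhom_ext fun T x => ?_
      rw [jwOp_mul_jwOp_self_single, LinearMap.smul_apply, Module.End.one_apply,
        Finsupp.smul_single]
      simp
    rw [pow_mul, pow_two, h1, smul_pow, one_pow]
  rcases Nat.even_or_odd' j with ⟨q, rfl | rfl⟩
  · rw [if_neg (by simp), hsq, LinearMap.smul_apply, Module.End.one_apply, Finsupp.smul_single,
      Nat.mul_div_cancel_left _ two_pos, smul_eq_mul]
  · rw [if_pos (by simp), pow_succ, hsq, Module.End.mul_apply, jwOp_single,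
      LinearMap.smul_apply, Module.End.one_apply, Finsupp.smul_single,
      symmDiff_singleton_of_notMem hl, jwCoeff, jwSign_of_forall_lt h, if_neg hl, smul_eq_mul]
    congr 2
    · congr 1; omega
    · ring

variable {n : ℕ} (k : Fin d → Fin n)

/-- The product of the powers of the operators `Y_l` along a list. -/
def opYProd {Z E Λ : Type*} [Field Z] [Ring E] [Algebra Z E] {n : ℕ} (k : Λ → Fin n) (s : Λ → Z)
    (c : Λ → E) (γ : Λ → ℕ) (ℓ : List Λ) : E :=
  (ℓ.map fun l => opY k s c l ^ γ l).prod

/-- The exponent of `s_l` in a monomial in the operators `Y_l`. -/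
def sExponent (γ : Fin d → ℕ) (l : Fin d) : ℕ := if (k l).val + 1 = n then γ l / 2 else γ l

/-- The set of the `l` whose operators occur with an odd exponent. -/
def oddSet (γ : Fin d → ℕ) (ℓ : List (Fin d)) : Finset (Fin d) :=
  (ℓ.filter fun l => (k l).val + 1 = n ∧ Odd (γ l)).toFinset

/-- The factors act from the right and the list is increasing, so each `l` meets only sets of larger
elements and no signs occur. -/
theorem opYProd_single (γ : Fin d → ℕ) (ℓ : List (Fin d)) (hℓ : ℓ.Pairwise (· < ·)) :
    opYProd k s (jwOp s 1) γ ℓ (Finsupp.single ∅ 1)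
      = Finsupp.single (oddSet k γ ℓ) ((ℓ.map fun l => s l ^ sExponent k γ l).prod) := by
  induction ℓ with
  | nil => rfl
  | cons l ℓ ih =>
    rw [List.pairwise_cons] at hℓ
    have hlt : ∀ t ∈ oddSet k γ ℓ, l < t := by
      intro t ht
      rw [oddSet, List.mem_toFinset] at ht
      exact hℓ.1 t (List.mem_of_mem_filter ht)
    have h1 : opYProd k s (jwOp s 1) γ (l :: ℓ)
        = opY k s (jwOp s 1) l ^ γ l * opYProd k s (jwOp s 1) γ ℓ := List.prod_cons
    rw [h1, Module.End.mul_apply, ih hℓ.2, List.map_cons, List.prod_cons]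
    by_cases ho : (k l).val + 1 = n
    · rw [opY_of_odd ho, jwOp_pow_single s hlt, sExponent, if_pos ho]
      congr 1
      unfold oddSet
      by_cases hg : Odd (γ l)
      · rw [if_pos hg, List.filter_cons_of_pos (by simp [ho, hg]), List.toFinset_cons]
      · rw [if_neg hg, List.filter_cons_of_neg (by simp [hg])]
    · rw [opY_of_even ho, ← map_pow, Module.algebraMap_end_apply, Finsupp.smul_single, sExponent,
        if_neg ho, smul_eq_mul]
      congr 1
      unfold oddSet
      rw [List.filter_cons_of_neg (by simp [ho])]

end jordanWigner

/-! ### Generic scalars, and the independence of the monomials in the operators `Y_l`. -/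

section generic_scalars

variable (K : Type*) [Field K] (d : ℕ)

/-- The field of generic scalars. -/
abbrev GenericField : Type _ := FractionRing (MvPolynomial (Fin d) K)

/-- The generic scalars. -/
def genericScalar (l : Fin d) : GenericField K d :=
  algebraMap (MvPolynomial (Fin d) K) _ (MvPolynomial.X l)

/-- The algebra of operators that contains the Clifford elements. -/
abbrev GenericEnd : Type _ := Module.End (GenericField K d) (Finset (Fin d) →₀ GenericField K d)

theorem isClifford_generic : IsClifford (genericScalar K d) (jwOp (genericScalar K d) 1)
    (jwOp (genericScalar K d) (-1)) := by
  have hinj := IsFractionRing.injective (MvPolynomial (Fin d) K) (GenericField K d)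
  refine isClifford_jwOp _ (fun l m h => ?_) fun l m h => ?_
  · rw [sub_ne_zero]
    intro h1
    exact h (MvPolynomial.X_injective (hinj h1)).symm
  · unfold genericScalar
    rw [← map_add, map_ne_zero_iff _ hinj]
    intro h1
    -- The coefficient of `X_m` in `X_m + X_l` is `1`, so the sum is nonzero in every
    -- characteristic.
    have h2 := congrArg (MvPolynomial.coeff (Finsupp.single m 1)) h1
    have h3 : (Finsupp.single l 1 : Fin d →₀ ℕ) ≠ Finsupp.single m 1 := fun e =>
      h (Finsupp.single_left_injective one_ne_zero e)
    simp [MvPolynomial.coeff_X, h3] at h2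

/-- The monomials in the operators `Y_l` are independent. -/
theorem linearIndependent_opYProd {n : ℕ} (k : Fin d → Fin n) (ℓ : List (Fin d))
    (hℓ : ℓ.Pairwise (· < ·)) (hmem : ∀ l, l ∈ ℓ) :
    LinearIndependent K fun γ : Fin d → ℕ =>
      (opYProd k (genericScalar K d) (jwOp (genericScalar K d) 1) γ ℓ : GenericEnd K d) := by
  have hinj := IsFractionRing.injective (MvPolynomial (Fin d) K) (GenericField K d)
  have hmon : LinearIndependent K fun m : Fin d →₀ ℕ =>
      algebraMap (MvPolynomial (Fin d) K) (GenericField K d) (MvPolynomial.monomial m 1) := by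
    have h := (MvPolynomial.basisMonomials (Fin d) K).linearIndependent.map'
      (IsScalarTower.toAlgHom K (MvPolynomial (Fin d) K) (GenericField K d)).toLinearMap
      (LinearMap.ker_eq_bot.2 hinj)
    exact h
  have hsingle := Finsupp.linearIndependent_single (R := K) (ι := Finset (Fin d))
    (φ := fun _ => Fin d →₀ ℕ) (M := GenericField K d)
    (fun _ m => algebraMap (MvPolynomial (Fin d) K) (GenericField K d) (MvPolynomial.monomial m 1))
    fun _ => hmon
  -- For an odd letter the exponent of `s_l` gives the quotient of `γ l` by `2` and membership in
  -- `oddSet` gives the remainder, so `γ` can be recovered from the image of the vacuum.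
  have hcomp := hsingle.comp (fun γ : Fin d → ℕ => (⟨oddSet k γ ℓ,
    Finsupp.equivFunOnFinite.symm (sExponent k γ)⟩ : Σ _ : Finset (Fin d), Fin d →₀ ℕ)) (by
      intro γ γ' h
      simp only [Sigma.mk.injEq, heq_eq_eq, EmbeddingLike.apply_eq_iff_eq] at h
      funext l
      have h1 := congrFun h.2 l
      have h2 := Finset.ext_iff.1 h.1 l
      simp only [oddSet, List.mem_toFinset, List.mem_filter, hmem l, true_and,
        decide_eq_true_eq] at h2
      unfold sExponent at h1
      by_cases ho : (k l).val + 1 = n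
      · simp only [ho, true_and, if_true, Nat.odd_iff] at h1 h2
        omega
      · simpa [ho] using h1)
  have hnd : ℓ.Nodup := hℓ.imp fun h => ne_of_lt h
  let ev : GenericEnd K d →ₗ[K] (Finset (Fin d) →₀ GenericField K d) :=
    { toFun := fun f => f (Finsupp.single ∅ 1)
      map_add' := fun _ _ => rfl
      map_smul' := fun _ _ => rfl }
  refine LinearIndependent.of_comp ev ?_
  convert hcomp using 1
  funext γ
  refine (opYProd_single (genericScalar K d) k γ ℓ hℓ).trans ?_
  rw [Function.comp_apply]
  congr 1
  rw [← List.prod_toFinset _ hnd, Finset.eq_univ_of_forall (s := ℓ.toFinset) fun l =>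
    List.mem_toFinset.2 (hmem l), MvPolynomial.monomial_eq, map_one, one_mul,
    Finsupp.prod_fintype _ _ (fun _ => pow_zero _), map_prod]
  refine Finset.prod_congr rfl fun l _ => ?_
  rw [map_pow]
  rfl

end generic_scalars

/-! ### The grading of the algebra -/

section grading

variable (K : Type*) [Field K] {n : ℕ} (o : Orientation n) {ν : Multiset (Fin n)}

/-- The degree of `y_r e(𝐢)`. -/
def degY (r : Fin ν.card) (i : Word ν) : ℤ × ZMod 2 := (form (i.1 r) (i.1 r), par (i.1 r))

/-- The degree of `τ_r e(𝐢)`. -/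
def degTau (r : Fin (ν.card - 1)) (i : Word ν) : ℤ × ZMod 2 :=
  (-form (i.1 (lo r)) (i.1 (hi r)), par (i.1 (lo r)) * par (i.1 (hi r)))

theorem sum_e_mul (x : Alg K o ν) : ∑ i : Word ν, e K o i * x = x := by
  rw [← Finset.sum_mul, sum_e, one_mul]

theorem e_mul_of_ne {i j : Word ν} (h : i ≠ j) {x : Alg K o ν} (hx : e K o j * x = x) :
    e K o i * x = 0 := by
  rw [← hx, ← mul_assoc, e_mul_e, if_neg h, zero_mul]

theorem e_mul_e_self (i : Word ν) (x : Alg K o ν) : e K o i * (e K o i * x) = e K o i * x := by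
  rw [← mul_assoc, e_mul_e, if_pos rfl]

theorem e_mul_y_mul (r : Fin ν.card) {i : Word ν} {x : Alg K o ν} (hx : e K o i * x = x) :
    e K o i * (y K o r * x) = y K o r * x := by
  rw [← mul_assoc, ← y_mul_e, mul_assoc, hx]

theorem e_mul_tau_mul (r : Fin (ν.card - 1)) {i : Word ν} {x : Alg K o ν} (hx : e K o i * x = x) :
    e K o (i.swap r) * (tau K o r * x) = tau K o r * x := by
  rw [← mul_assoc, ← tau_mul_e, mul_assoc, hx]

/-- Left multiplication by `a`, with a shift of the degree that depends on the word. -/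
def shiftMul (δ : Word ν → ℤ × ZMod 2) (a : Alg K o ν) :
    Module.End K ((ℤ × ZMod 2) →₀ Alg K o ν) :=
  Finsupp.lsum K fun h => ∑ i : Word ν,
    Finsupp.lsingle (δ i + h) ∘ₗ LinearMap.mulLeft K (a * e K o i)

theorem shiftMul_single (δ : Word ν → ℤ × ZMod 2) (a : Alg K o ν) (h : ℤ × ZMod 2)
    (x : Alg K o ν) : shiftMul K o δ a (Finsupp.single h x)
      = ∑ i : Word ν, Finsupp.single (δ i + h) (a * (e K o i * x)) := by
  rw [shiftMul, Finsupp.lsum_single, LinearMap.sum_apply]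
  refine Finset.sum_congr rfl fun i _ => ?_
  simp [mul_assoc]

theorem shiftMul_single_of_e (δ : Word ν → ℤ × ZMod 2) (a : Alg K o ν) (h : ℤ × ZMod 2)
    {i : Word ν} {x : Alg K o ν} (hx : e K o i * x = x) :
    shiftMul K o δ a (Finsupp.single h x) = Finsupp.single (δ i + h) (a * x) := by
  rw [shiftMul_single, Finset.sum_eq_single i, hx]
  · intro j _ hj
    rw [e_mul_of_ne K o hj hx, mul_zero, Finsupp.single_zero]
  · simp

/-- The operators by which the generators act on shifted elements of the algebra. -/
def shiftGen : Gen ν → Module.End K ((ℤ × ZMod 2) →₀ Alg K o ν)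
  | .e i => shiftMul K o 0 (e K o i)
  | .y r => shiftMul K o (degY r) (y K o r)
  | .tau r => shiftMul K o (degTau r) (tau K o r)

theorem sum_single_e_mul (h : ℤ × ZMod 2) (x : Alg K o ν) :
    ∑ i : Word ν, Finsupp.single h (e K o i * x) = Finsupp.single h x := by
  conv_rhs => rw [← sum_e_mul K o x]
  exact (map_sum (Finsupp.singleAddHom h) _ _).symm

theorem zsmul_single_shift (a : ℤ) (h : ℤ × ZMod 2) (x : Alg K o ν) :
    a • (Finsupp.single h x : (ℤ × ZMod 2) →₀ Alg K o ν) = Finsupp.single h (a • x) := by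
  rw [Finsupp.smul_single]

theorem shiftMul_e (i : Word ν) (h : ℤ × ZMod 2) (x : Alg K o ν) :
    shiftMul K o 0 (e K o i) (Finsupp.single h x) = Finsupp.single h (e K o i * x) := by
  rw [shiftMul_single]
  simp only [Pi.zero_apply, zero_add]
  conv_rhs => rw [← sum_e_mul K o x, Finset.mul_sum]
  exact (map_sum (Finsupp.singleAddHom h) _ _).symm

theorem degY_swap_of_ne (r : Fin (ν.card - 1)) (s : Fin ν.card) (i : Word ν) (h : s ≠ lo r)
    (h' : s ≠ hi r) : degY s (i.swap r) = degY s i := by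
  simp only [degY, Word.swap, Function.comp_apply, Equiv.swap_apply_of_ne_of_ne h h']

theorem swap_lo (r : Fin (ν.card - 1)) (i : Word ν) : (i.swap r).1 (lo r) = i.1 (hi r) := by
  simp [Word.swap]

theorem swap_hi (r : Fin (ν.card - 1)) (i : Word ν) : (i.swap r).1 (hi r) = i.1 (lo r) := by
  simp [Word.swap]

theorem swap_of_ne (r : Fin (ν.card - 1)) (i : Word ν) {s : Fin ν.card} (h : s ≠ lo r)
    (h' : s ≠ hi r) : (i.swap r).1 s = i.1 s := by
  simp only [Word.swap, Function.comp_apply, Equiv.swap_apply_of_ne_of_ne h h']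

theorem degTau_swap_of_far (r s : Fin (ν.card - 1)) (i : Word ν)
    (h : r.val + 1 < s.val ∨ s.val + 1 < r.val) : degTau s (i.swap r) = degTau s i := by
  have h1 : lo s ≠ lo r := fun e => by have := congrArg Fin.val e; simp only [lo] at this; omega
  have h2 : lo s ≠ hi r := fun e => by have := congrArg Fin.val e; simp only [lo, hi] at this; omega
  have h3 : hi s ≠ lo r := fun e => by have := congrArg Fin.val e; simp only [lo, hi] at this; omega
  have h4 : hi s ≠ hi r := fun e => by have := congrArg Fin.val e; simp only [hi] at this; omega
  simp only [degTau, swap_of_ne r i h1 h2, swap_of_ne r i h3 h4]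

theorem form_self_of_odd {i : Fin n} (h : i.val + 1 = n) : form i i = 2 := by
  simp [form, symm, cartan, h]

theorem form_self_of_even {i : Fin n} (h : i.val + 1 ≠ n) : form i i = 4 := by
  simp [form, symm, cartan, h]

/-- Both terms of `Q_{ij}` have the same degree `(4, 0)`, whatever the parities of the letters; this
is what makes the relation for `τ_r²` homogeneous. -/
theorem two_div_symm_smul (i : Fin n) :
    (2 / symm i) • ((form i i, par i) : ℤ × ZMod 2) = (4, 0) := by
  unfold symm
  split_ifs with h
  · rw [form_self_of_odd h, par, if_pos h]; rfl
  · rw [form_self_of_even h, par, if_neg h]; rfl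

theorem form_of_adjacent {i j : Fin n} (h : Adjacent i j) : form i j = -2 := by
  have hne : i ≠ j := by
    rintro rfl
    simp [Adjacent] at h
  simp only [form, symm, cartan, hne, h, if_true, if_false]
  split_ifs <;> rfl

theorem form_of_far {i j : Fin n} (h : i ≠ j) (h' : ¬ Adjacent i j) : form i j = 0 := by
  simp [form, cartan, h, h']

/-- The second part is carried along for the induction: the shift of the degree is only known on
vectors of a fixed word, and `y_s` preserves the word. -/
theorem shiftMul_degY_pow (s : Fin ν.card) {i : Word ν} (m : ℕ) (h : ℤ × ZMod 2) {x : Alg K o ν}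
    (hx : e K o i * x = x) :
    (shiftMul K o (degY s) (y K o s) ^ m) (Finsupp.single h x)
      = Finsupp.single (m • degY s i + h) (y K o s ^ m * x)
    ∧ e K o i * (y K o s ^ m * x) = y K o s ^ m * x := by
  induction m with
  | zero => simp [hx]
  | succ m ih =>
    rw [pow_succ', Module.End.mul_apply, ih.1, shiftMul_single_of_e K o _ _ _ ih.2, pow_succ',
      mul_assoc]
    refine ⟨?_, e_mul_y_mul K o s ih.2⟩
    rw [succ_nsmul, ← add_assoc, add_comm (degY s i)]

theorem end_qPoly_apply {W : Type*} [AddCommGroup W] [Module K W] (i j : Fin n)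
    (u v : Module.End K W) (w : W) : qPoly o i j u v w =
      if i = j then 0 else if Adjacent i j then
        (-1 : ℤ) ^ o.d i j • ((u ^ (2 / symm i)) w - (v ^ (2 / symm j)) w) else w := by
  unfold qPoly
  split_ifs with h1 h2
  · rfl
  · rcases Nat.even_or_odd (o.d i j) with hd | hd
    · simp [hd.neg_one_pow]
    · simp [hd.neg_one_pow]
  · rfl

theorem qPoly_mul (i j : Fin n) {A : Type*} [Ring A] (u v w : A) : qPoly o i j u v * w =
      if i = j then 0 else if Adjacent i j then
        (-1 : ℤ) ^ o.d i j • ((u ^ (2 / symm i)) * w - (v ^ (2 / symm j)) * w) else w := by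
  unfold qPoly
  split_ifs with h1 h2
  · rw [zero_mul]
  · rcases Nat.even_or_odd (o.d i j) with hd | hd
    · simp [hd.neg_one_pow, sub_mul]
    · simp [hd.neg_one_pow, sub_mul]
  · rw [one_mul]

theorem end_braidTerm_apply {W : Type*} [AddCommGroup W] [Module K W] (i j k : Fin n)
    (u v : Module.End K W) (w : W) : braidTerm o i j k u v w =
      if i = k ∧ Adjacent i j then (if i.val + 1 ≠ n then (-1 : ℤ) ^ o.d i j • w
        else sgn (par j) • (-1 : ℤ) ^ o.d i j • (v w - u w)) else 0 := by
  unfold braidTerm qQuot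
  by_cases h1 : i = k
  · by_cases h2 : Adjacent i j
    · simp only [h1.symm, h2, and_self, if_true]
      rcases Nat.even_or_odd (o.d i j) with hd | hd
      · simp only [hd.neg_one_pow]; split_ifs <;> simp
      · simp only [hd.neg_one_pow]; split_ifs <;> simp
    · simp [h2]
  · simp [h1]

theorem braidTerm_mul (i j k : Fin n) {A : Type*} [Ring A] (u v w : A) :
    braidTerm o i j k u v * w =
      if i = k ∧ Adjacent i j then (if i.val + 1 ≠ n then (-1 : ℤ) ^ o.d i j • w
        else sgn (par j) • (-1 : ℤ) ^ o.d i j • (v * w - u * w)) else 0 := by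
  unfold braidTerm qQuot
  by_cases h1 : i = k
  · by_cases h2 : Adjacent i j
    · simp only [h1.symm, h2, and_self, if_true]
      rcases Nat.even_or_odd (o.d i j) with hd | hd
      · simp only [hd.neg_one_pow]; split_ifs <;> simp [sub_mul, mul_sub, mul_assoc]
      · simp only [hd.neg_one_pow]; split_ifs <;> simp [sub_mul, mul_sub, mul_assoc]
    · simp [h2]
  · simp [h1]

theorem degTau_swap (r : Fin (ν.card - 1)) (i : Word ν) : degTau r (i.swap r) = degTau r i := by
  simp only [degTau, swap_lo, swap_hi, form_comm (i.1 (hi r)), mul_comm (par (i.1 (hi r)))]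

theorem degTau_add_self (r : Fin (ν.card - 1)) (i : Word ν) :
    degTau r i + degTau r i = (-2 * form (i.1 (lo r)) (i.1 (hi r)), 0) := by
  refine Prod.ext ?_ ?_
  · simp only [degTau, Prod.fst_add]; ring
  · simp only [degTau, Prod.snd_add]
    generalize par (i.1 (lo r)) * par (i.1 (hi r)) = z
    revert z; decide

theorem degY_hi_eq (r : Fin (ν.card - 1)) (i : Word ν) (h : i.1 (lo r) = i.1 (hi r)) :
    degTau r i + degY (hi r) i = 0 := by
  refine Prod.ext ?_ ?_
  · simp [degTau, degY, h]
  · simp only [degTau, degY, h, Prod.snd_add, Prod.snd_zero]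
    generalize par (i.1 (hi r)) = z
    revert z; decide

/-- Each relation already holds in the algebra; what has to be compared are the shifts. So this is
the statement that the relations are homogeneous, where the degrees of `τ_r` and `y_r` are taken on
the word that has been reached. -/
theorem shiftGen_rel ⦃x x' : FreeAlgebra K (Gen ν)⦄ (hr : Rel K o ν x x') :
    FreeAlgebra.lift K (shiftGen K o) x = FreeAlgebra.lift K (shiftGen K o) x' := by
  refine Finsupp.lhom_ext fun h z => ?_
  cases hr with
  | e_mul i j =>
    simp only [map_mul, FreeAlgebra.lift_ι_apply, shiftGen, Module.End.mul_apply, shiftMul_e,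
      ← mul_assoc, e_mul_e]
    split_ifs
    · rw [FreeAlgebra.lift_ι_apply, shiftGen, shiftMul_e]
    · simp
  | e_sum =>
    simp only [map_sum, FreeAlgebra.lift_ι_apply, shiftGen, LinearMap.sum_apply, shiftMul_e,
      sum_single_e_mul, map_one, Module.End.one_apply]
  | y_e r i =>
    have hx := e_mul_e_self K o i z
    simp only [map_mul, FreeAlgebra.lift_ι_apply, shiftGen, Module.End.mul_apply, shiftMul_e]
    rw [shiftMul_single_of_e K o _ _ _ hx, shiftMul_single, map_sum]
    simp only [shiftMul_e]
    rw [Finset.sum_eq_single i]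
    · rw [← mul_assoc (e K o i) (y K o r), ← y_mul_e, mul_assoc, hx]
    · intro j _ hj
      rw [← mul_assoc (e K o i) (y K o r), ← y_mul_e, mul_assoc,
        e_mul_of_ne K o hj.symm (e_mul_e_self K o j z), mul_zero, Finsupp.single_zero]
    · simp
  | tau_e r i =>
    have hx := e_mul_e_self K o i z
    simp only [map_mul, FreeAlgebra.lift_ι_apply, shiftGen, Module.End.mul_apply, shiftMul_e]
    rw [shiftMul_single_of_e K o _ _ _ hx, shiftMul_single, map_sum]
    simp only [shiftMul_e]
    rw [Finset.sum_eq_single i]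
    · rw [← mul_assoc (e K o _) (tau K o r), ← tau_mul_e, mul_assoc, hx]
    · intro j _ hj
      rw [← mul_assoc (e K o _) (tau K o r), ← tau_mul_e, mul_assoc,
        e_mul_of_ne K o hj.symm (e_mul_e_self K o j z), mul_zero, Finsupp.single_zero]
    · simp
  | y_y r s i hrs =>
    have hx := e_mul_e_self K o i z
    simp only [map_mul, map_zsmul, FreeAlgebra.lift_ι_apply, shiftGen, Module.End.mul_apply,
      LinearMap.smul_apply, shiftMul_e, shiftMul_single_of_e K o _ _ _ hx,
      shiftMul_single_of_e K o _ _ _ (e_mul_y_mul K o _ hx), zsmul_single_shift]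
    have h1 := congrArg (· * z) (y_mul_y K o r s i hrs)
    simp only [smul_mul_assoc, mul_assoc] at h1
    rw [h1, add_left_comm]
  | tau_y r s i h1 h2 =>
    have hx := e_mul_e_self K o i z
    simp only [map_mul, map_zsmul, FreeAlgebra.lift_ι_apply, shiftGen, Module.End.mul_apply,
      LinearMap.smul_apply, shiftMul_e, shiftMul_single_of_e K o _ _ _ hx,
      shiftMul_single_of_e K o _ _ _ (e_mul_y_mul K o _ hx),
      shiftMul_single_of_e K o _ _ _ (e_mul_tau_mul K o _ hx), zsmul_single_shift]
    have h3 := congrArg (· * z) (tau_mul_y K o r s i h1 h2)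
    simp only [smul_mul_assoc, mul_assoc] at h3
    rw [h3, add_left_comm, degY_swap_of_ne r s i h1 h2, mul_assoc]
  | tau_tau r s i h1 =>
    have hx := e_mul_e_self K o i z
    simp only [map_mul, map_zsmul, FreeAlgebra.lift_ι_apply, shiftGen, Module.End.mul_apply,
      LinearMap.smul_apply, shiftMul_e, shiftMul_single_of_e K o _ _ _ hx,
      shiftMul_single_of_e K o _ _ _ (e_mul_tau_mul K o _ hx), zsmul_single_shift]
    have h3 := congrArg (· * z) (tau_mul_tau K o r s i h1)
    simp only [smul_mul_assoc, mul_assoc] at h3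
    rw [h3, add_left_comm, degTau_swap_of_far r s i h1, degTau_swap_of_far s r i h1.symm,
      mul_assoc, mul_assoc]
  | tau_y_hi r i =>
    have hx := e_mul_e_self K o i z
    have h0 : FreeAlgebra.lift K (shiftGen (ν := ν) K o) (if i.1 (lo r) = i.1 (hi r) then 1 else 0)
        = if i.1 (lo r) = i.1 (hi r) then 1 else 0 := by split_ifs <;> simp
    simp only [map_mul, map_add, h0, map_zsmul, FreeAlgebra.lift_ι_apply, shiftGen,
      Module.End.mul_apply,
      LinearMap.smul_apply, shiftMul_e, LinearMap.add_apply, shiftMul_single_of_e K o _ _ _ hx,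
      shiftMul_single_of_e K o _ _ _ (e_mul_y_mul K o _ hx),
      shiftMul_single_of_e K o _ _ _ (e_mul_tau_mul K o _ hx), zsmul_single_shift]
    have h3 := congrArg (· * z) (tau_mul_y_hi K o r i)
    simp only [smul_mul_assoc, mul_assoc, add_mul] at h3
    have hd : degY (lo r) (i.swap r) = degY (hi r) i := by simp only [degY, swap_lo]
    rw [h3, hd, Finsupp.single_add, ← add_assoc, ← add_assoc, add_comm (degY (hi r) i)]
    congr 1
    split_ifs with h4
    · rw [degY_hi_eq r i h4]; simp
    · simp
  | y_hi_tau r i =>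
    have hx := e_mul_e_self K o i z
    have h0 : FreeAlgebra.lift K (shiftGen (ν := ν) K o) (if i.1 (lo r) = i.1 (hi r) then 1 else 0)
        = if i.1 (lo r) = i.1 (hi r) then 1 else 0 := by split_ifs <;> simp
    simp only [map_mul, map_add, h0, map_zsmul, FreeAlgebra.lift_ι_apply, shiftGen,
      Module.End.mul_apply,
      LinearMap.smul_apply, shiftMul_e, LinearMap.add_apply, shiftMul_single_of_e K o _ _ _ hx,
      shiftMul_single_of_e K o _ _ _ (e_mul_y_mul K o _ hx),
      shiftMul_single_of_e K o _ _ _ (e_mul_tau_mul K o _ hx), zsmul_single_shift]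
    have h3 := congrArg (· * z) (y_hi_mul_tau K o r i)
    simp only [smul_mul_assoc, mul_assoc, add_mul] at h3
    have hd : degY (hi r) (i.swap r) = degY (lo r) i := by simp only [degY, swap_hi]
    rw [h3, hd, Finsupp.single_add, ← add_assoc, ← add_assoc, add_comm (degY (lo r) i)]
    congr 1
    split_ifs with h4
    · have h5 : degY (lo r) i = degY (hi r) i := by simp only [degY, h4]
      rw [h5, degY_hi_eq r i h4]; simp
    · simp
  | tau_sq r i =>
    have hx := e_mul_e_self K o i z
    have h1 := map_qPoly o (i.1 (lo r)) (i.1 (hi r))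
      (B := Module.End K ((ℤ × ZMod 2) →₀ Alg K o ν)) (FreeAlgebra.lift K (shiftGen K o) :
        FreeAlgebra K (Gen ν) →ₐ[K] Module.End K ((ℤ × ZMod 2) →₀ Alg K o ν)).toRingHom
      (FreeAlgebra.ι K (Gen.y (lo r))) (FreeAlgebra.ι K (Gen.y (hi r)))
    simp only [AlgHom.toRingHom_eq_coe, RingHom.coe_coe, FreeAlgebra.lift_ι_apply] at h1
    simp only [map_mul, h1, FreeAlgebra.lift_ι_apply, shiftGen,
      Module.End.mul_apply, shiftMul_e, end_qPoly_apply, shiftMul_single_of_e K o _ _ _ hx,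
      shiftMul_single_of_e K o _ _ _ (e_mul_tau_mul K o _ hx),
      (shiftMul_degY_pow K o _ _ _ hx).1]
    have h3 := congrArg (· * z) (tau_sq K o r i)
    simp only [mul_assoc] at h3
    rw [qPoly_mul] at h3
    rw [h3, degTau_swap, ← add_assoc, degTau_add_self]
    split_ifs with h4 h5
    · simp
    · rw [degY, degY, two_div_symm_smul, two_div_symm_smul, form_of_adjacent h5,
        ← Finsupp.single_sub, zsmul_single_shift]
      rfl
    · rw [form_of_far h4 h5, mul_zero]
      exact congrArg (Finsupp.single · _) (zero_add h)
  | braid r s hrs i =>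
    have hx := e_mul_e_self K o i z
    have h1 := map_braidTerm o (i.1 (lo r)) (i.1 (hi r)) (i.1 (hi s))
      (B := Module.End K ((ℤ × ZMod 2) →₀ Alg K o ν)) (FreeAlgebra.lift K (shiftGen K o) :
        FreeAlgebra K (Gen ν) →ₐ[K] Module.End K ((ℤ × ZMod 2) →₀ Alg K o ν)).toRingHom
      (FreeAlgebra.ι K (Gen.y (lo r))) (FreeAlgebra.ι K (Gen.y (hi s)))
    simp only [AlgHom.toRingHom_eq_coe, RingHom.coe_coe, FreeAlgebra.lift_ι_apply] at h1
    have ht := fun r s => e_mul_tau_mul K o s (e_mul_tau_mul K o r hx)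
    simp only [map_mul, map_sub, h1, FreeAlgebra.lift_ι_apply, shiftGen, LinearMap.sub_apply,
      Module.End.mul_apply, shiftMul_e, end_braidTerm_apply, shiftMul_single_of_e K o _ _ _ hx,
      shiftMul_single_of_e K o _ _ _ (e_mul_tau_mul K o _ hx),
      shiftMul_single_of_e K o _ _ _ (ht _ _)]
    have h3 := congrArg (· * z) (braid K o r s hrs i)
    simp only [mul_assoc, sub_mul] at h3
    rw [braidTerm_mul] at h3
    have hlo : lo s = hi r := Fin.ext (by simp only [lo, hi]; omega)
    have n1 : lo r ≠ lo s := fun e => by have := congrArg Fin.val e; simp only [lo] at this; omega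
    have n2 : lo r ≠ hi s := fun e => by
      have := congrArg Fin.val e; simp only [lo, hi] at this; omega
    have n3 : hi s ≠ lo r := n2.symm
    have n4 : hi s ≠ hi r := fun e => by have := congrArg Fin.val e; simp only [hi] at this; omega
    have n5 : hi r ≠ hi s := n4.symm
    have s1 : (i.swap s).1 (hi r) = i.1 (hi s) := by rw [← hlo, swap_lo]
    have s2 : ((i.swap s).swap r).1 (hi r) = i.1 (lo r) := by
      rw [swap_hi, swap_of_ne s i n1 n2]
    have s3 : ((i.swap s).swap r).1 (hi s) = i.1 (hi r) := by
      rw [swap_of_ne r _ n3 n4, swap_hi, hlo]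
    have s4 : (i.swap r).1 (hi s) = i.1 (hi s) := swap_of_ne r i n3 n4
    have s5 : ((i.swap r).swap s).1 (lo r) = i.1 (hi r) := by
      rw [swap_of_ne s _ n1 n2, swap_lo]
    have s6 : ((i.swap r).swap s).1 (hi r) = i.1 (hi s) := by
      rw [← hlo, swap_lo, s4]
    have s7 : (i.swap s).1 (lo r) = i.1 (lo r) := swap_of_ne s i n1 n2
    -- In both braid words each pair of the three letters crosses exactly once, so the degrees
    -- agree.
    have e1 : degTau s ((i.swap s).swap r) + (degTau r (i.swap s) + (degTau s i + h))
        = (-form (i.1 (lo r)) (i.1 (hi r)) - form (i.1 (lo r)) (i.1 (hi s))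
            - form (i.1 (hi r)) (i.1 (hi s)),
          par (i.1 (lo r)) * par (i.1 (hi r)) + par (i.1 (lo r)) * par (i.1 (hi s))
            + par (i.1 (hi r)) * par (i.1 (hi s))) + h := by
      rw [← add_assoc, ← add_assoc]
      congr 1
      simp only [degTau, hlo, s1, s2, s3, s7]
      refine Prod.ext ?_ ?_ <;> simp only [Prod.fst_add, Prod.snd_add] <;> ring
    have e2 : degTau r ((i.swap r).swap s) + (degTau s (i.swap r) + (degTau r i + h))
        = (-form (i.1 (lo r)) (i.1 (hi r)) - form (i.1 (lo r)) (i.1 (hi s))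
            - form (i.1 (hi r)) (i.1 (hi s)),
          par (i.1 (lo r)) * par (i.1 (hi r)) + par (i.1 (lo r)) * par (i.1 (hi s))
            + par (i.1 (hi r)) * par (i.1 (hi s))) + h := by
      rw [← add_assoc, ← add_assoc]
      congr 1
      simp only [degTau, hlo, s4, s5, s6, swap_hi]
      refine Prod.ext ?_ ?_ <;> simp only [Prod.fst_add, Prod.snd_add] <;> ring
    rw [e1, e2, ← Finsupp.single_sub, h3]
    -- If the outer letters are equal to `i` and adjacent to the middle one, the degree is `2 -
    -- (α_i, α_i) + 2`. This is `0` for even `i`, where the right-hand side is a constant, and `2`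
    -- for odd `i`, which is the degree of `y`.
    by_cases hc : i.1 (lo r) = i.1 (hi s) ∧ Adjacent (i.1 (lo r)) (i.1 (hi r))
    · rw [if_pos hc, if_pos hc, degY, degY, ← hc.1, form_comm (i.1 (hi r)), form_of_adjacent hc.2]
      have hp : par (i.1 (lo r)) * par (i.1 (hi r)) = 0 := by
        refine par_mul_par_of_ne fun e => ?_
        have := hc.2
        rw [e] at this
        simp [Adjacent] at this
      rw [mul_comm (par (i.1 (hi r))), hp]
      split_ifs with h4
      · rw [form_self_of_even h4, zsmul_single_shift]
        have : par (i.1 (lo r)) = 0 := if_neg h4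
        rw [this]
        congr 1
        refine Prod.ext ?_ ?_ <;> simp
      · rw [← Finsupp.single_sub, zsmul_single_shift, zsmul_single_shift,
          form_self_of_odd (not_not.1 h4)]
        have : par (i.1 (lo r)) = 1 := if_pos (not_not.1 h4)
        rw [this]
        congr 1
    · rw [if_neg hc, if_neg hc, Finsupp.single_zero]

/-- The representation of the algebra on shifted elements of itself that records degrees. -/
def shiftRep : Alg K o ν →ₐ[K] Module.End K ((ℤ × ZMod 2) →₀ Alg K o ν) :=
  Alg.lift (FreeAlgebra.lift K (shiftGen K o)) (shiftGen_rel K o)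

theorem shiftRep_single {a : Alg K o ν} {g : ℤ × ZMod 2} (ha : IsMonomial K o ν a g)
    (h : ℤ × ZMod 2) (x : Alg K o ν) :
    shiftRep K o a (Finsupp.single h x) = Finsupp.single (g + h) (a * x) := by
  have hg : ∀ z : Gen ν, shiftRep K o (Alg.mk K o ν (FreeAlgebra.ι K z)) = shiftGen K o z := by
    intro z
    rw [shiftRep, Alg.lift_mk, FreeAlgebra.lift_ι_apply]
  induction ha generalizing h x with
  | e i =>
    refine (LinearMap.congr_fun (hg (.e i)) _).trans ((shiftMul_e K o i h x).trans ?_)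
    rw [show ((0, 0) : ℤ × ZMod 2) = 0 from rfl, zero_add]
  | y r i =>
    rw [map_mul, y, e, hg, hg, Module.End.mul_apply, shiftGen, shiftGen, shiftMul_e,
      shiftMul_single_of_e K o _ _ _ (e_mul_e_self K o i x), mul_assoc]
    rfl
  | tau r i =>
    rw [map_mul, tau, e, hg, hg, Module.End.mul_apply, shiftGen, shiftGen, shiftMul_e,
      shiftMul_single_of_e K o _ _ _ (e_mul_e_self K o i x), mul_assoc]
    rfl
  | mul _ _ ih1 ih2 => rw [map_mul, Module.End.mul_apply, ih2, ih1, add_assoc, mul_assoc]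

/-- The decomposition of an element of the algebra in its homogeneous parts. -/
def parts : Alg K o ν →ₗ[K] (ℤ × ZMod 2) →₀ Alg K o ν where
  toFun a := shiftRep K o a (Finsupp.single 0 1)
  map_add' a b := by rw [map_add, LinearMap.add_apply]
  map_smul' t a := by rw [map_smul, LinearMap.smul_apply, RingHom.id_apply]

/-- This is the independence of the components: `component` is only a span of monomials, but the
algebra remembers the degree of each monomial through its action on `1` placed in degree zero. -/
theorem parts_of_mem {a : Alg K o ν} {g : ℤ × ZMod 2} (ha : a ∈ component K o ν g) :
    parts K o a = Finsupp.single g a := by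
  have h : component K o ν g ≤ LinearMap.eqLocus (parts K o) (Finsupp.lsingle g) := by
    refine Submodule.span_le.2 fun b hb => ?_
    change shiftRep K o b _ = Finsupp.single g b
    rw [shiftRep_single K o hb, add_zero, mul_one]
  exact h ha

theorem mul_mem_component {a b : Alg K o ν} {g h : ℤ × ZMod 2} (ha : a ∈ component K o ν g)
    (hb : b ∈ component K o ν h) : a * b ∈ component K o ν (g + h) := by
  induction ha using Submodule.span_induction with
  | mem a ha =>
    induction hb using Submodule.span_induction with
    | mem b hb => exact Submodule.subset_span (IsMonomial.mul ha hb)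
    | zero => rw [mul_zero]; exact zero_mem _
    | add x y _ _ hx hy => rw [mul_add]; exact add_mem hx hy
    | smul t x _ hx => rw [mul_smul_comm]; exact Submodule.smul_mem _ _ hx
  | zero => rw [zero_mul]; exact zero_mem _
  | add x y _ _ hx hy => rw [add_mul]; exact add_mem hx hy
  | smul t x _ hx => rw [smul_mul_assoc]; exact Submodule.smul_mem _ _ hx

theorem e_mem_component (i : Word ν) : e K o i ∈ component K o ν 0 :=
  Submodule.subset_span (IsMonomial.e i)

theorem one_mem_component : (1 : Alg K o ν) ∈ component K o ν 0 := by
  rw [← sum_e]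
  exact sum_mem fun i _ => e_mem_component K o i

theorem y_mul_e_mem_component (r : Fin ν.card) (i : Word ν) :
    y K o r * e K o i ∈ component K o ν (degY r i) :=
  Submodule.subset_span (IsMonomial.y r i)

theorem tau_mul_e_mem_component (r : Fin (ν.card - 1)) (i : Word ν) :
    tau K o r * e K o i ∈ component K o ν (degTau r i) :=
  Submodule.subset_span (IsMonomial.tau r i)

variable {K o} in
/-- A `K`-subspace that contains `1` and is stable under left multiplication by the generators is
the whole algebra. -/
theorem eq_top_of_mul_mem (S : Submodule K (Alg K o ν)) (h1 : 1 ∈ S)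
    (he : ∀ i, ∀ x ∈ S, e K o i * x ∈ S) (hy : ∀ r, ∀ x ∈ S, y K o r * x ∈ S)
    (ht : ∀ r, ∀ x ∈ S, tau K o r * x ∈ S) : S = ⊤ := by
  have key : ∀ z : FreeAlgebra K (Gen ν), ∀ x ∈ S, Alg.mk K o ν z * x ∈ S := by
    intro z
    induction z using FreeAlgebra.induction with
    | grade0 t =>
      intro x hx
      rw [AlgHom.commutes, ← Algebra.smul_def]
      exact S.smul_mem t hx
    | grade1 g =>
      intro x hx
      cases g with
      | e i => exact he i x hx
      | y r => exact hy r x hx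
      | tau r => exact ht r x hx
    | mul a b ha hb => intro x hx; rw [map_mul, mul_assoc]; exact ha _ (hb x hx)
    | add a b ha hb => intro x hx; rw [map_add, add_mul]; exact add_mem (ha x hx) (hb x hx)
  refine Submodule.eq_top_iff'.2 fun a => ?_
  obtain ⟨z, rfl⟩ := RingQuot.mkAlgHom_surjective K (Rel K o ν) a
  have := key z 1 h1
  rwa [mul_one] at this

/-- The generators `y_r` and `τ_r` are not homogeneous, but their products with the idempotents are,
so `1 = ∑ e(𝐢)` is inserted before they are applied. -/
theorem iSup_component : ⨆ g, component K o ν g = ⊤ := by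
  refine eq_top_of_mul_mem _ (Submodule.mem_iSup_of_mem 0 (one_mem_component K o)) ?_ ?_ ?_
  · intro i x hx
    induction hx using Submodule.iSup_induction' with
    | mem g x hx =>
      exact Submodule.mem_iSup_of_mem _ (mul_mem_component K o (e_mem_component K o i) hx)
    | zero => rw [mul_zero]; exact zero_mem _
    | add x y _ _ hx hy => rw [mul_add]; exact add_mem hx hy
  · intro r x hx
    rw [← sum_e_mul K o x, Finset.mul_sum]
    refine sum_mem fun i _ => ?_
    rw [← mul_assoc]
    induction hx using Submodule.iSup_induction' with
    | mem g x hx =>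
      exact Submodule.mem_iSup_of_mem _ (mul_mem_component K o (y_mul_e_mem_component K o r i) hx)
    | zero => rw [mul_zero]; exact zero_mem _
    | add x y _ _ hx hy => rw [mul_add]; exact add_mem hx hy
  · intro r x hx
    rw [← sum_e_mul K o x, Finset.mul_sum]
    refine sum_mem fun i _ => ?_
    rw [← mul_assoc]
    induction hx using Submodule.iSup_induction' with
    | mem g x hx =>
      exact Submodule.mem_iSup_of_mem _ (mul_mem_component K o (tau_mul_e_mem_component K o r i) hx)
    | zero => rw [mul_zero]; exact zero_mem _
    | add x y _ _ hx hy => rw [mul_add]; exact add_mem hx hy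

variable {K o} in
/-- To prove a closed property of all elements it suffices to consider homogeneous ones. -/
theorem homogeneous_induction {p : Alg K o ν → Prop} (hom : ∀ g, ∀ a ∈ component K o ν g, p a)
    (zero : p 0) (add : ∀ a b, p a → p b → p (a + b)) (a : Alg K o ν) : p a := by
  have ha : a ∈ ⨆ g, component K o ν g := by rw [iSup_component]; exact Submodule.mem_top
  induction ha using Submodule.iSup_induction' with
  | mem g x hx => exact hom g x hx
  | zero => exact zero
  | add x y _ _ hx hy => exact add _ _ hx hy

end grading

/-! ### A spanning theorem -/

/-- Equality of subspaces modulo `F` is carried by a linear map to equality modulo any subspace that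
contains the image of `F`. In this form one step of a rewriting is transported through a further
`τ_r`. -/
theorem map_sup_eq_of_sup_eq {K V W : Type*} [Field K] [AddCommGroup V] [Module K V]
    [AddCommGroup W] [Module K W] {A B F : Submodule K V} {F' : Submodule K W} (f : V →ₗ[K] W)
    (h : A ⊔ F = B ⊔ F) (hf : F.map f ≤ F') : A.map f ⊔ F' = B.map f ⊔ F' := by
  have h1 := congrArg (fun S => S.map f ⊔ F') h
  simp only [Submodule.map_sup, sup_assoc, sup_eq_right.2 hf] at h1
  exact h1

section spanning

variable {K : Type*} [Field K] {n : ℕ} {o : Orientation n} {ν : Multiset (Fin n)}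

/-- Stability under the idempotents `e(𝐢)`. -/
def IdempotentStable (Z : Submodule K (Alg K o ν)) : Prop :=
  ∀ i : Word ν, ∀ x ∈ Z, e K o i * x ∈ Z

/-- The subspace `a Z`. -/
def leftTranslate (a : Alg K o ν) (Z : Submodule K (Alg K o ν)) : Submodule K (Alg K o ν) :=
  Z.map (LinearMap.mulLeft K a)

theorem mul_mem_leftTranslate {a x : Alg K o ν} {Z : Submodule K (Alg K o ν)} (hx : x ∈ Z) :
    a * x ∈ leftTranslate a Z := ⟨x, hx, rfl⟩

theorem leftTranslate_le {a : Alg K o ν} {Z S : Submodule K (Alg K o ν)} :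
    leftTranslate a Z ≤ S ↔ ∀ x ∈ Z, a * x ∈ S := Submodule.map_le_iff_le_comap

theorem leftTranslate_mono {a : Alg K o ν} {Z S : Submodule K (Alg K o ν)} (h : Z ≤ S) :
    leftTranslate a Z ≤ leftTranslate a S := Submodule.map_mono h

theorem leftTranslate_mul (a b : Alg K o ν) (Z : Submodule K (Alg K o ν)) :
    leftTranslate (a * b) Z = leftTranslate a (leftTranslate b Z) := by
  rw [leftTranslate, LinearMap.mulLeft_mul, Submodule.map_comp]; rfl

theorem leftTranslate_one (Z : Submodule K (Alg K o ν)) : leftTranslate 1 Z = Z := by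
  rw [leftTranslate, LinearMap.mulLeft_one, Submodule.map_id]

theorem e_mul_tau (r : Fin (ν.card - 1)) (i : Word ν) :
    e K o i * tau K o r = tau K o r * e K o (i.swap r) := by
  rw [tau_mul_e, Word.swap_swap]

theorem IdempotentStable.leftTranslate_tau {Z : Submodule K (Alg K o ν)} (h : IdempotentStable Z)
    (r : Fin (ν.card - 1)) : IdempotentStable (leftTranslate (tau K o r) Z) := by
  rintro i _ ⟨x, hx, rfl⟩
  rw [LinearMap.mulLeft_apply, ← mul_assoc, e_mul_tau, mul_assoc]
  exact mul_mem_leftTranslate (h _ x hx)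

theorem IdempotentStable.leftTranslate_tauProd {Z : Submodule K (Alg K o ν)}
    (h : IdempotentStable Z) (L : List (Fin (ν.card - 1))) :
    IdempotentStable (leftTranslate (tauProd K o L) Z) := by
  induction L with
  | nil => rw [tauProd_nil, leftTranslate_one]; exact h
  | cons r L ih => rw [tauProd_cons, leftTranslate_mul]; exact ih.leftTranslate_tau r

/-- To prove `a x ∈ S` it suffices to consider `x = e(𝐢) x`. -/
theorem mul_mem_of_e {Z S : Submodule K (Alg K o ν)} (hZ : IdempotentStable Z) {a : Alg K o ν}
    (h : ∀ i, ∀ x ∈ Z, a * e K o i * x ∈ S) : leftTranslate a Z ≤ S := by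
  rw [leftTranslate_le]
  intro x hx
  rw [← sum_e_mul K o x, Finset.mul_sum]
  refine sum_mem fun i _ => ?_
  rw [← mul_assoc]
  exact h i x hx

theorem tau_tau_le {Z : Submodule K (Alg K o ν)} (hZ : IdempotentStable Z)
    {r s : Fin (ν.card - 1)} (h : r.val + 1 < s.val ∨ s.val + 1 < r.val) :
    leftTranslate (tau K o r) (leftTranslate (tau K o s) Z)
      ≤ leftTranslate (tau K o s) (leftTranslate (tau K o r) Z) := by
  rw [← leftTranslate_mul]
  refine mul_mem_of_e hZ fun i x hx => ?_
  rw [tau_mul_tau K o r s i h, smul_mul_assoc, mul_assoc (tau K o s * tau K o r),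
    mul_assoc (tau K o s)]
  exact zsmul_mem (mul_mem_leftTranslate (mul_mem_leftTranslate (hZ i x hx))) _

theorem tau_tau_eq {Z : Submodule K (Alg K o ν)} (hZ : IdempotentStable Z)
    {r s : Fin (ν.card - 1)} (h : r.val + 1 < s.val ∨ s.val + 1 < r.val) :
    leftTranslate (tau K o r) (leftTranslate (tau K o s) Z)
      = leftTranslate (tau K o s) (leftTranslate (tau K o r) Z) :=
  le_antisymm (tau_tau_le hZ h) (tau_tau_le hZ h.symm)

theorem pow_y_mul_mem {G : Submodule K (Alg K o ν)}
    (hG : ∀ p, ∀ x ∈ G, y K o p * x ∈ G) (p : Fin ν.card) (m : ℕ) {x : Alg K o ν} (hx : x ∈ G) :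
    y K o p ^ m * x ∈ G := by
  induction m with
  | zero => rwa [pow_zero, one_mul]
  | succ m ih => rw [pow_succ', mul_assoc]; exact hG p _ ih

/-- `τ_r²` is a polynomial in the `y`, and `G`, which will be a part of the filtration, is stable
under these. -/
theorem tau_sq_le {Z G : Submodule K (Alg K o ν)} (hZ : IdempotentStable Z) (hle : Z ≤ G)
    (hG : ∀ p, ∀ x ∈ G, y K o p * x ∈ G) (r : Fin (ν.card - 1)) :
    leftTranslate (tau K o r) (leftTranslate (tau K o r) Z) ≤ G := by
  rw [← leftTranslate_mul]
  refine mul_mem_of_e hZ fun i x hx => ?_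
  have hx' := hle (hZ i x hx)
  rw [tau_sq, mul_assoc, qPoly_mul]
  split_ifs
  · exact zero_mem _
  · exact zsmul_mem (sub_mem (pow_y_mul_mem hG _ _ hx') (pow_y_mul_mem hG _ _ hx')) _
  · exact hx'

theorem braidTerm_mul_mem {Z G : Submodule K (Alg K o ν)} (hle : Z ≤ G)
    (hG : ∀ p, ∀ x ∈ G, y K o p * x ∈ G) (i j k : Fin n) (p q : Fin ν.card) {x : Alg K o ν}
    (hx : x ∈ Z) : braidTerm o i j k (y K o p) (y K o q) * x ∈ G := by
  rw [braidTerm_mul]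
  split_ifs
  · exact zsmul_mem (hle hx) _
  · exact zsmul_mem (zsmul_mem (sub_mem (hG _ _ (hle hx)) (hG _ _ (hle hx))) _) _
  · exact zero_mem _

/-- On vectors of a fixed word, the difference of the two products is the right-hand side of the
braid relation, which is of degree at most one in the `y` and thus maps `Z` to `G`. So the braid
relation holds without correction modulo `G`. -/
theorem braid_sup_eq {Z G : Submodule K (Alg K o ν)} (hZ : IdempotentStable Z) (hle : Z ≤ G)
    (hG : ∀ p, ∀ x ∈ G, y K o p * x ∈ G) {r s : Fin (ν.card - 1)}
    (h : r.val + 1 = s.val ∨ s.val + 1 = r.val) :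
    leftTranslate (tau K o s) (leftTranslate (tau K o r) (leftTranslate (tau K o s) Z)) ⊔ G
      = leftTranslate (tau K o r) (leftTranslate (tau K o s) (leftTranslate (tau K o r) Z)) ⊔ G := by
  wlog h' : r.val + 1 = s.val generalizing r s
  · exact (this h.symm (h.resolve_left h')).symm
  have key : ∀ i, ∀ x ∈ Z, tau K o s * (tau K o r * (tau K o s * (e K o i * x)))
      - tau K o r * (tau K o s * (tau K o r * (e K o i * x))) ∈ G := by
    intro i x hx
    have h1 := congrArg (· * x) (braid K o r s h' i)
    simp only [mul_assoc, sub_mul] at h1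
    rw [h1]
    exact braidTerm_mul_mem hle hG _ _ _ _ _ (hZ i x hx)
  simp only [← leftTranslate_mul]
  refine le_antisymm (sup_le (mul_mem_of_e hZ fun i x hx => ?_) le_sup_right)
    (sup_le (mul_mem_of_e hZ fun i x hx => ?_) le_sup_right)
  · have h1 := Submodule.mem_sup_right
      (S := leftTranslate (tau K o r * (tau K o s * tau K o r)) Z) (key i x hx)
    have h2 := Submodule.mem_sup_left (T := G)
      (mul_mem_leftTranslate (a := tau K o r * (tau K o s * tau K o r)) (hZ i x hx))
    have h3 := add_mem h1 h2
    simpa only [mul_assoc, sub_add_cancel] using h3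
  · have h1 := Submodule.mem_sup_right
      (S := leftTranslate (tau K o s * (tau K o r * tau K o s)) Z) (key i x hx)
    have h2 := Submodule.mem_sup_left (T := G)
      (mul_mem_leftTranslate (a := tau K o s * (tau K o r * tau K o s)) (hZ i x hx))
    have h3 := sub_mem h2 h1
    simpa only [mul_assoc, sub_sub_cancel] using h3

theorem y_tau_le {Z S : Submodule K (Alg K o ν)} (hZ : IdempotentStable Z) (r : Fin (ν.card - 1))
    (h1 : Z ≤ S) (h2 : ∀ p, ∀ x ∈ Z, tau K o r * (y K o p * x) ∈ S) (p : Fin ν.card) :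
    leftTranslate (y K o p) (leftTranslate (tau K o r) Z) ≤ S := by
  rw [← leftTranslate_mul]
  refine mul_mem_of_e hZ fun i x hx => ?_
  have hx' := hZ i x hx
  have hsgn : ∀ (a : ZMod 2) (v : Alg K o ν), sgn a • (sgn a • v) = v := by
    intro a v
    rcases zmod_two_cases a with rfl | rfl <;> simp [sgn_zero, sgn_one]
  by_cases hlo : p = lo r
  · subst hlo
    -- For the lower place the defining relation reads `τ_r y_{r+1} = ± y_r τ_r + δ`; it is
    -- multiplied by its sign and solved for `y_r τ_r`.
    have h3 := congrArg (fun z => sgn (par (i.1 (lo r)) * par (i.1 (hi r))) • (z * x))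
      (tau_mul_y_hi K o r i)
    simp only [add_mul, smul_mul_assoc, smul_add, hsgn, mul_assoc] at h3
    rw [mul_assoc, mul_assoc, ← sub_eq_of_eq_add h3]
    refine sub_mem (zsmul_mem (h2 _ _ hx') _) (zsmul_mem ?_ _)
    split_ifs
    · rw [one_mul]; exact h1 hx'
    · rw [zero_mul]; exact zero_mem _
  · by_cases hhi : p = hi r
    · subst hhi
      rw [y_hi_mul_tau, mul_assoc, add_mul, smul_mul_assoc, mul_assoc]
      refine add_mem (zsmul_mem (h2 _ _ hx') _) ?_
      split_ifs
      · rw [one_mul]; exact h1 hx'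
      · rw [zero_mul]; exact zero_mem _
    · have h3 := congrArg (fun z => sgn (par (i.1 (lo r)) * par (i.1 (hi r)) * par (i.1 p)) •
        (z * x)) (tau_mul_y K o r p i hlo hhi)
      simp only [smul_mul_assoc, hsgn] at h3
      rw [← h3]
      refine zsmul_mem ?_ _
      rw [mul_assoc, mul_assoc]
      exact h2 _ _ hx'

variable {α : Type*} [LinearOrder α] {c₀ : Fin ν.card → α}

/-- The subspace `ρ_c X`, where `ρ_c` is the product of the `τ_r` along the canonical word of
`c`. -/
def arrPart (X : Submodule K (Alg K o ν)) (c : Fin ν.card → α) : Submodule K (Alg K o ν) :=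
  leftTranslate (tauProd K o (word c)) X

/-- The sum of the `ρ_c X` over the arrangements `c` with less than `m` inversions. -/
def arrFil (X : Submodule K (Alg K o ν)) (c₀ : Fin ν.card → α) (m : ℕ) :
    Submodule K (Alg K o ν) :=
  ⨆ c : Rearr c₀, ⨆ _ : inv c.1 < m, arrPart X c.1

theorem arrPart_le_arrFil {X : Submodule K (Alg K o ν)} (c : Rearr c₀) {m : ℕ}
    (h : inv c.1 < m) : arrPart X c.1 ≤ arrFil X c₀ m :=
  le_iSup₂_of_le c h le_rfl

theorem arrFil_mono {X : Submodule K (Alg K o ν)} {m m' : ℕ} (h : m ≤ m') :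
    arrFil X c₀ m ≤ arrFil X c₀ m' :=
  iSup₂_le fun c hc => arrPart_le_arrFil c (lt_of_lt_of_le hc h)

theorem arrPart_cons {X : Submodule K (Alg K o ν)} {c : Fin ν.card → α} {r : Fin (ν.card - 1)}
    (h : word c = r :: word (c ∘ adjSwap r)) :
    arrPart X c = leftTranslate (tau K o r) (arrPart X (c ∘ adjSwap r)) := by
  rw [arrPart, h, tauProd_cons, leftTranslate_mul]; rfl

/-- A subspace that is stable under the idempotents, the `y_r`, and the `τ_r` that fix a
monotone arrangement. -/
structure IsArrStable (X : Submodule K (Alg K o ν)) (c₀ : Fin ν.card → α) : Prop where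
  mono : Monotone c₀
  e_mem : IdempotentStable X
  y_mem : ∀ p, ∀ x ∈ X, y K o p * x ∈ X
  tau_mem : ∀ r, c₀ (lo r) = c₀ (hi r) → ∀ x ∈ X, tau K o r * x ∈ X

/-- How the generators act on the subspaces `ρ_c X` for `c` with `l` inversions. -/
structure ArrLevel (X : Submodule K (Alg K o ν)) (c₀ : Fin ν.card → α) (l : ℕ) : Prop where
  y_le : ∀ c : Rearr c₀, inv c.1 = l → ∀ p,
    leftTranslate (y K o p) (arrPart X c.1) ≤ arrFil X c₀ (l + 1)
  eq_le : ∀ c : Rearr c₀, inv c.1 = l → ∀ r, c.1 (lo r) = c.1 (hi r) →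
    leftTranslate (tau K o r) (arrPart X c.1) ≤ arrFil X c₀ (l + 1)
  gt_le : ∀ c : Rearr c₀, inv c.1 = l → ∀ r, c.1 (hi r) < c.1 (lo r) →
    leftTranslate (tau K o r) (arrPart X c.1) ≤ arrFil X c₀ (l + 1)
  lt_eq : ∀ c : Rearr c₀, inv c.1 = l → ∀ r, c.1 (lo r) < c.1 (hi r) →
    leftTranslate (tau K o r) (arrPart X c.1) ⊔ arrFil X c₀ (l + 1)
      = arrPart X (c.swap r).1 ⊔ arrFil X c₀ (l + 1)

theorem y_mul_mem_arrFil {X : Submodule K (Alg K o ν)} {l : ℕ}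
    (h : ∀ l' < l, ArrLevel X c₀ l') (p : Fin ν.card) (x : Alg K o ν) (hx : x ∈ arrFil X c₀ l) :
    y K o p * x ∈ arrFil X c₀ l := by
  have : leftTranslate (y K o p) (arrFil X c₀ l) ≤ arrFil X c₀ l := by
    conv_lhs => rw [arrFil, leftTranslate, Submodule.map_iSup]
    refine iSup_le fun c => ?_
    rw [Submodule.map_iSup]
    exact iSup_le fun hc => ((h _ hc).y_le c rfl p).trans (arrFil_mono hc)
  exact this (mul_mem_leftTranslate hx)

/-- A `τ_r` raises the number of inversions by at most one: only an ascent leads to a new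
arrangement, up to terms that are already known to lie in the filtration. -/
theorem tau_arrFil_le {X : Submodule K (Alg K o ν)} {l : ℕ}
    (h : ∀ l' < l, ArrLevel X c₀ l') (r : Fin (ν.card - 1)) :
    leftTranslate (tau K o r) (arrFil X c₀ l) ≤ arrFil X c₀ (l + 1) := by
  conv_lhs => rw [arrFil, leftTranslate, Submodule.map_iSup]
  refine iSup_le fun c => ?_
  rw [Submodule.map_iSup]
  refine iSup_le fun hc => ?_
  rcases lt_trichotomy (c.1 (lo r)) (c.1 (hi r)) with h1 | h1 | h1
  · refine le_sup_left.trans (((h _ hc).lt_eq c rfl r h1).le.trans (sup_le ?_ ?_))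
    · refine arrPart_le_arrFil (c.swap r) ?_
      have : inv (c.swap r).1 = inv c.1 + 1 := inv_swap_of_lt h1
      omega
    · exact arrFil_mono (by omega)
  · exact ((h _ hc).eq_le c rfl r h1).trans (arrFil_mono (by omega))
  · exact ((h _ hc).gt_le c rfl r h1).trans (arrFil_mono (by omega))

theorem IsArrStable.arrPart_stable {X : Submodule K (Alg K o ν)} (hX : IsArrStable X c₀)
    (c : Fin ν.card → α) : IdempotentStable (arrPart X c) :=
  hX.e_mem.leftTranslate_tauProd _

theorem adjacent_cases (r s : Fin (ν.card - 1)) : s = r ∨ (r.val + 1 < s.val ∨ s.val + 1 < r.val)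
    ∨ (r.val + 1 = s.val ∨ s.val + 1 = r.val) := by
  rw [Fin.ext_iff]; omega

theorem far_ne {d : ℕ} {r s : Fin (d - 1)} (h : r.val + 1 < s.val ∨ s.val + 1 < r.val) :
    lo s ≠ lo r ∧ lo s ≠ hi r ∧ hi s ≠ lo r ∧ hi s ≠ hi r := by
  simp only [ne_eq, Fin.ext_iff, lo, hi]; omega

theorem comp_adjSwap_of_far {d : ℕ} {β : Type*} (c : Fin d → β) {r s : Fin (d - 1)}
    (h : r.val + 1 < s.val ∨ s.val + 1 < r.val) :
    (c ∘ adjSwap r) (lo s) = c (lo s) ∧ (c ∘ adjSwap r) (hi s) = c (hi s) := by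
  obtain ⟨h1, h2, h3, h4⟩ := far_ne h
  exact ⟨congrArg c (adjSwap_of_ne h1 h2), congrArg c (adjSwap_of_ne h3 h4)⟩

theorem Rearr.swap_swap {d : ℕ} {β : Type*} [LinearOrder β] {b₀ : Fin d → β} (c : Rearr b₀) (r : Fin (d - 1)) :
    (c.swap r).swap r = c := Subtype.ext (comp_adjSwap_adjSwap _ _)

theorem sup_eq_of_sup_eq {β : Type*} [SemilatticeSup β] {A B F F' : β} (h : A ⊔ F = B ⊔ F)
    (hF : F ≤ F') : A ⊔ F' = B ⊔ F' := by
  rw [← sup_eq_right.2 hF, ← sup_assoc, ← sup_assoc, h]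

theorem comp_adjSwap_of_succ {d : ℕ} {β : Type*} (f : Fin d → β) {r s : Fin (d - 1)}
    (h : r.val + 1 = s.val) : lo s = hi r ∧ (f ∘ adjSwap r) (hi s) = f (hi s) ∧
      (f ∘ adjSwap r) (hi r) = f (lo r) ∧ (f ∘ adjSwap r) (lo r) = f (hi r) ∧
      (f ∘ adjSwap s) (hi s) = f (hi r) ∧ (f ∘ adjSwap s) (hi r) = f (hi s) ∧
      (f ∘ adjSwap s) (lo r) = f (lo r) := by
  have h1 : lo s = hi r := Fin.ext (by simp only [lo, hi]; omega)
  have n1 : lo r ≠ lo s := by simp only [ne_eq, Fin.ext_iff, lo]; omega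
  have n2 : lo r ≠ hi s := by simp only [ne_eq, Fin.ext_iff, lo, hi]; omega
  have n3 : hi s ≠ hi r := by simp only [ne_eq, Fin.ext_iff, hi]; omega
  refine ⟨h1, ?_, ?_, ?_, ?_, ?_, ?_⟩
  · exact congrArg f (adjSwap_of_ne n2.symm n3)
  · exact congrArg f (adjSwap_hi r)
  · exact congrArg f (adjSwap_lo r)
  · rw [← h1]; exact congrArg f (adjSwap_hi s)
  · rw [← h1]; exact congrArg f (adjSwap_lo s)
  · exact congrArg f (adjSwap_of_ne n1 n2)

/-- Descents at two adjacent positions mean that three consecutive letters are strictly decreasing,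
so one can continue to sort them in either order. -/
theorem descent_triple {d : ℕ} (f : Fin d → α) {r s : Fin (d - 1)}
    (h : r.val + 1 = s.val ∨ s.val + 1 = r.val) (hr : f (hi r) < f (lo r))
    (hs : f (hi s) < f (lo s)) : (f ∘ adjSwap r) (hi s) < (f ∘ adjSwap r) (lo s) ∧
      ((f ∘ adjSwap r) ∘ adjSwap s) (hi r) < ((f ∘ adjSwap r) ∘ adjSwap s) (lo r) := by
  rcases h with h | h
  · obtain ⟨a1, a2, a3, a4, a5, a6, a7⟩ := comp_adjSwap_of_succ f h
    obtain ⟨-, b2, b3, b4, b5, b6, b7⟩ := comp_adjSwap_of_succ (f ∘ adjSwap r) h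
    rw [a1] at hs
    rw [a1, b6, b7, a2, a3, a4]
    exact ⟨hs.trans hr, hs⟩
  · obtain ⟨a1, a2, a3, a4, a5, a6, a7⟩ := comp_adjSwap_of_succ f h
    obtain ⟨-, b2, b3, b4, b5, b6, b7⟩ := comp_adjSwap_of_succ (f ∘ adjSwap r) h
    rw [a1] at hr
    rw [a1, b2, b3, a5, a6, a7]
    exact ⟨hr.trans hs, hs⟩

/-- If two equal letters stand next to a third one that forms a descent with its neighbour, two
exchanges carry the third letter past both. The equal letters are then at the other pair of places.
-/
theorem eq_triple {d : ℕ} (f : Fin d → α) {r s : Fin (d - 1)}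
    (h : r.val + 1 = s.val ∨ s.val + 1 = r.val) (hr : f (lo r) = f (hi r))
    (hs : f (hi s) < f (lo s)) : (f ∘ adjSwap s) (hi r) < (f ∘ adjSwap s) (lo r) ∧
      ((f ∘ adjSwap s) ∘ adjSwap r) (lo s) = ((f ∘ adjSwap s) ∘ adjSwap r) (hi s) := by
  rcases h with h | h
  · obtain ⟨a1, a2, a3, a4, a5, a6, a7⟩ := comp_adjSwap_of_succ f h
    obtain ⟨-, b2, b3, b4, b5, b6, b7⟩ := comp_adjSwap_of_succ (f ∘ adjSwap s) h
    rw [a1] at hs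
    rw [a1, b2, b3, a5, a6, a7, hr]
    exact ⟨hs, rfl⟩
  · obtain ⟨a1, a2, a3, a4, a5, a6, a7⟩ := comp_adjSwap_of_succ f h
    obtain ⟨-, b2, b3, b4, b5, b6, b7⟩ := comp_adjSwap_of_succ (f ∘ adjSwap s) h
    rw [a1] at hr
    rw [a1, b6, b7, a2, a3, a4, ← hr]
    exact ⟨hs, rfl⟩

theorem comp_adjSwap_comm {d : ℕ} {β : Type*} (f : Fin d → β) {r s : Fin (d - 1)}
    (h : r.val + 1 < s.val ∨ s.val + 1 < r.val) :
    (f ∘ adjSwap r) ∘ adjSwap s = (f ∘ adjSwap s) ∘ adjSwap r := by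
  have h1 := congrArg (fun w : Equiv.Perm (Fin d) => f ∘ w) (adjSwap_comm h)
  exact h1

theorem comp_adjSwap_braid {d : ℕ} {β : Type*} (f : Fin d → β) {r s : Fin (d - 1)}
    (h : r.val + 1 = s.val ∨ s.val + 1 = r.val) :
    ((f ∘ adjSwap r) ∘ adjSwap s) ∘ adjSwap r = ((f ∘ adjSwap s) ∘ adjSwap r) ∘ adjSwap s := by
  rcases h with h | h
  · exact congrArg (fun w : Equiv.Perm (Fin d) => f ∘ w) (adjSwap_braid h)
  · exact (congrArg (fun w : Equiv.Perm (Fin d) => f ∘ w) (adjSwap_braid h)).symm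

theorem swap_lt_of_gt {d : ℕ} {f : Fin d → α} {r : Fin (d - 1)} (h : f (hi r) < f (lo r)) :
    (f ∘ adjSwap r) (lo r) < (f ∘ adjSwap r) (hi r) := by
  rw [Function.comp_apply, Function.comp_apply, adjSwap_lo, adjSwap_hi]; exact h

/-- The canonical word of `c` begins with a descent `s` that cannot be controlled, so an arbitrary
`τ_r` has to be compared with it. If `r` and `s` are far apart, they are commuted; if they are
adjacent, the braid relation is used modulo arrangements with fewer inversions. This plays the role
of Matsumoto's theorem: the subspaces `ρ_c X` do not depend on the reduced word modulo the lower
part of the filtration, even though the elements `ρ_c` do. -/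
theorem IsArrStable.arrLevel {X : Submodule K (Alg K o ν)} (hX : IsArrStable X c₀) (l : ℕ) :
    ArrLevel X c₀ l := by
  induction l using Nat.strong_induction_on with
  | _ l ih =>
  -- The filtration is indexed by a strict bound on inversions, so the step `l + 1` contains the
  -- arrangements with `l` inversions. By induction a `τ_r` raises the step by one.
  have hT : ∀ m m', m ≤ l → m < m' → ∀ r, leftTranslate (tau K o r) (arrFil X c₀ m)
      ≤ arrFil X c₀ m' := fun m m' hm hm' r =>
    (tau_arrFil_le (fun l' hl' => ih l' (by omega)) r).trans (arrFil_mono hm')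
  have hlt : ∀ c : Rearr c₀, ∀ m, inv c.1 < m → m ≤ l → ∀ r, c.1 (lo r) < c.1 (hi r) →
      leftTranslate (tau K o r) (arrPart X c.1) ⊔ arrFil X c₀ m
        = arrPart X (c.swap r).1 ⊔ arrFil X c₀ m := fun c m h1 h2 r hr =>
    sup_eq_of_sup_eq ((ih (inv c.1) (by omega)).lt_eq c rfl r hr) (arrFil_mono h1)
  -- Read backwards: any descent `r` of `c` may serve as the first letter of a word for `c`, modulo
  -- lower arrangements.
  have hlt' : ∀ c : Rearr c₀, ∀ m, inv c.1 ≤ m → m ≤ l → ∀ r, c.1 (hi r) < c.1 (lo r) →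
      leftTranslate (tau K o r) (arrPart X (c.swap r).1) ⊔ arrFil X c₀ m
        = arrPart X c.1 ⊔ arrFil X c₀ m := by
    intro c m h1 h2 r hr
    have h3 : inv (c.swap r).1 + 1 = inv c.1 := inv_swap_of_gt hr
    have h4 := hlt (c.swap r) m (by omega) h2 r (swap_lt_of_gt hr)
    rwa [Rearr.swap_swap] at h4
  have hy : ∀ m, m ≤ l → ∀ p, ∀ x ∈ arrFil X c₀ m, y K o p * x ∈ arrFil X c₀ m :=
    fun m hm => y_mul_mem_arrFil fun l' hl' => ih l' (by omega)
  have hst := hX.arrPart_stable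
  have hbase : ∀ c : Rearr c₀, Monotone c.1 → c = ⟨c₀, rfl⟩ ∧ arrPart X c.1 = X := by
    intro c hc
    refine ⟨Subtype.ext (eq_of_monotone_of_map_eq hc hX.mono c.2), ?_⟩
    rw [arrPart, word_of_monotone hc, tauProd_nil, leftTranslate_one]
  refine ⟨?_, ?_, ?_, ?_⟩
  · intro c hc p
    rcases monotone_or_word c.1 with hm | ⟨r, hr, hw⟩
    · refine le_trans ?_ (arrPart_le_arrFil c (by omega))
      rw [(hbase c hm).2, leftTranslate_le]
      exact hX.y_mem p
    · have h1 : inv (c.swap r).1 + 1 = inv c.1 := inv_swap_of_gt hr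
      rw [arrPart_cons hw]
      refine y_tau_le (hst _) r (arrPart_le_arrFil (c.swap r) (by omega)) (fun p x hx => ?_) p
      have h2 := (ih (inv (c.swap r).1) (by omega)).y_le (c.swap r) rfl p
        (mul_mem_leftTranslate hx)
      exact hT (inv (c.swap r).1 + 1) _ (by omega) (by omega) r (mul_mem_leftTranslate h2)
  · intro c hc r hr
    rcases monotone_or_word c.1 with hm | ⟨s, hs, hw⟩
    · refine le_trans ?_ (arrPart_le_arrFil c (by omega))
      rw [(hbase c hm).2, leftTranslate_le]
      rw [(hbase c hm).1] at hr
      exact hX.tau_mem r hr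
    · have h1 : inv (c.swap s).1 + 1 = inv c.1 := inv_swap_of_gt hs
      rw [arrPart_cons hw]
      rcases adjacent_cases r s with rfl | hfar | hadj
      · exact absurd hr.symm hs.ne
      · obtain ⟨f1, f2⟩ := comp_adjSwap_of_far c.1 hfar.symm
        refine (tau_tau_le (hst _) hfar).trans ?_
        refine (leftTranslate_mono ((ih (inv (c.swap s).1) (by omega)).eq_le (c.swap s) rfl r
          (f1.trans (hr.trans f2.symm)))).trans ?_
        exact hT _ _ (by omega) (by omega) s
      -- Here `τ_r ρ_c X` agrees with `τ_r τ_s τ_r ρ_z X`, hence by the braid relation with `τ_s τ_r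
      -- τ_s ρ_z X`, modulo lower terms, where `z` has two inversions less. In `z` the places of
      -- `τ_s` carry equal letters, so the innermost `τ_s` is absorbed by induction, and the two
      -- others raise the filtration by two.
      · obtain ⟨t1, t2⟩ := eq_triple c.1 hadj hr hs
        have h2 : inv ((c.swap s).swap r).1 + 1 = inv (c.swap s).1 := inv_swap_of_gt t1
        have e1 := map_sup_eq_of_sup_eq (LinearMap.mulLeft K (tau K o s))
          (hlt' (c.swap s) (l - 1) (by omega) (by omega) r t1) (hT (l - 1) l (by omega) (by omega) s)
        have e2 := map_sup_eq_of_sup_eq (LinearMap.mulLeft K (tau K o r)) e1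
          (hT l (l + 1) le_rfl (by omega) r)
        refine le_sup_left.trans (e2.symm.le.trans (sup_le ?_ le_rfl))
        have e3 := braid_sup_eq (hst ((c.swap s).swap r).1)
          (arrPart_le_arrFil ((c.swap s).swap r) (m := l) (by omega)) (hy l le_rfl) hadj
        refine le_sup_left.trans (e3.symm.le.trans (sup_le ?_ (arrFil_mono (by omega))))
        have e4 := (ih (inv ((c.swap s).swap r).1) (by omega)).eq_le ((c.swap s).swap r) rfl s t2
        exact (leftTranslate_mono ((leftTranslate_mono e4).trans
          (hT _ l (by omega) (by omega) r))).trans (hT l _ le_rfl (by omega) s)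
  · intro c hc r hr
    have h1 : inv (c.swap r).1 + 1 = inv c.1 := inv_swap_of_gt hr
    -- At a descent `ρ_c X` may be replaced by `τ_r ρ_{s_r c} X`, after which `τ_r²` is a polynomial
    -- in the `y`.
    have e1 := map_sup_eq_of_sup_eq (LinearMap.mulLeft K (tau K o r))
      (hlt' c l (by omega) le_rfl r hr) (hT l (l + 1) le_rfl (by omega) r)
    refine le_sup_left.trans (e1.symm.le.trans (sup_le ?_ le_rfl))
    exact (tau_sq_le (hst _) (arrPart_le_arrFil (c.swap r) (m := l) (by omega)) (hy l le_rfl)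
      r).trans (arrFil_mono (by omega))
  · intro c hc r hr
    have hcr : (c.swap r).1 (hi r) < (c.swap r).1 (lo r) := by
      change (c.1 ∘ adjSwap r) (hi r) < (c.1 ∘ adjSwap r) (lo r)
      rw [Function.comp_apply, Function.comp_apply, adjSwap_lo, adjSwap_hi]
      exact hr
    have hinv : inv (c.swap r).1 = inv c.1 + 1 := inv_swap_of_lt hr
    rcases monotone_or_word (c.swap r).1 with hm | ⟨s, hs, hw⟩
    · exact absurd hcr (not_lt_of_ge (hm (lo_lt_hi r).le))
    · rcases adjacent_cases r s with rfl | hfar | hadj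
      · rw [arrPart_cons hw]
        change _ = leftTranslate (tau K o s) (arrPart X ((c.swap s).swap s).1) ⊔ _
        rw [Rearr.swap_swap]
      · obtain ⟨f1, f2⟩ := comp_adjSwap_of_far c.1 hfar
        have hs' : c.1 (hi s) < c.1 (lo s) := by
          rw [← f1, ← f2]; exact hs
        obtain ⟨g1, g2⟩ := comp_adjSwap_of_far c.1 hfar.symm
        have h1 : inv (c.swap s).1 + 1 = inv c.1 := inv_swap_of_gt hs'
        have e1 := map_sup_eq_of_sup_eq (LinearMap.mulLeft K (tau K o r))
          (hlt' c l (by omega) le_rfl s hs') (hT l (l + 1) le_rfl (by omega) r)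
        have e2 := map_sup_eq_of_sup_eq (LinearMap.mulLeft K (tau K o s))
          (hlt (c.swap s) l (by omega) le_rfl r (by
            change (c.1 ∘ adjSwap s) (lo r) < (c.1 ∘ adjSwap s) (hi r)
            rw [g1, g2]; exact hr)) (hT l (l + 1) le_rfl (by omega) s)
        refine e1.symm.trans (Eq.trans ?_ (e2.trans ?_))
        · exact congrArg (· ⊔ arrFil X c₀ (l + 1)) (tau_tau_eq (hst _) hfar)
        · rw [arrPart_cons hw]
          have : ((c.swap s).swap r).1 = (c.swap r).1 ∘ adjSwap s :=
            (comp_adjSwap_comm c.1 hfar).symm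
          rw [this]; rfl
      -- The three letters of `c.swap r` are strictly decreasing. Both `τ_r ρ_c X` and `τ_s` applied
      -- to the part of the canonical predecessor are rewritten in terms of one arrangement `z`,
      -- three steps below `c.swap r`, and the two resulting words are the sides of the braid
      -- relation.
      · obtain ⟨a1, a2⟩ := descent_triple (c.swap r).1 hadj hcr hs
        obtain ⟨b1, b2⟩ := descent_triple (c.swap r).1 hadj.symm hs hcr
        have hc' : (c.swap r).1 ∘ adjSwap r = c.1 := comp_adjSwap_adjSwap _ _
        have hbr := comp_adjSwap_braid (c.swap r).1 hadj
        rw [hc'] at a1 a2 hbr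
        have i1 : inv (c.swap s).1 + 1 = inv c.1 := inv_swap_of_gt a1
        have i2 : inv ((c.swap s).swap r).1 + 1 = inv (c.swap s).1 := inv_swap_of_gt a2
        have i3 : inv ((c.swap r).swap s).1 + 1 = inv (c.swap r).1 := inv_swap_of_gt hs
        have i4 : inv (((c.swap r).swap s).swap r).1 + 1 = inv ((c.swap r).swap s).1 :=
          inv_swap_of_gt b1
        have hz : (((c.swap r).swap s).swap r).swap s = (c.swap s).swap r :=
          Subtype.ext hbr.symm
        have e1 := hlt' c l (by omega) le_rfl s a1
        have e2 := map_sup_eq_of_sup_eq (LinearMap.mulLeft K (tau K o s))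
          (hlt' (c.swap s) (l - 1) (by omega) (by omega) r a2) (hT (l - 1) l (by omega) (by omega) s)
        have e3 := map_sup_eq_of_sup_eq (LinearMap.mulLeft K (tau K o r)) (e2.trans e1)
          (hT l (l + 1) le_rfl (by omega) r)
        have f1 := hlt' ((c.swap r).swap s) l (by omega) le_rfl r b1
        have f2 := map_sup_eq_of_sup_eq (LinearMap.mulLeft K (tau K o r))
          (hlt' (((c.swap r).swap s).swap r) (l - 1) (by omega) (by omega) s b2)
          (hT (l - 1) l (by omega) (by omega) r)
        have f3 := map_sup_eq_of_sup_eq (LinearMap.mulLeft K (tau K o s)) (f2.trans f1)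
          (hT l (l + 1) le_rfl (by omega) s)
        rw [hz] at f3
        have g := sup_eq_of_sup_eq (braid_sup_eq (hst ((c.swap s).swap r).1)
          (arrPart_le_arrFil ((c.swap s).swap r) (m := l) (by omega)) (hy l le_rfl) hadj)
          (arrFil_mono (Nat.le_succ l))
        rw [arrPart_cons hw]
        exact e3.symm.trans (g.symm.trans f3)

/-- The sum of all `ρ_c X` is a left ideal. -/
theorem IsArrStable.mul_mem {X : Submodule K (Alg K o ν)} (hX : IsArrStable X c₀)
    (a x : Alg K o ν) (hx : x ∈ ⨆ c : Rearr c₀, arrPart X c.1) :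
    a * x ∈ ⨆ c : Rearr c₀, arrPart X c.1 := by
  have hle : ∀ m, arrFil X c₀ m ≤ ⨆ c : Rearr c₀, arrPart X c.1 := fun m =>
    iSup₂_le fun c _ => le_iSup (fun c : Rearr c₀ => arrPart X c.1) c
  have hstep : ∀ b : Alg K o ν, (∀ c : Rearr c₀, ∀ x ∈ arrPart X c.1,
      b * x ∈ ⨆ c : Rearr c₀, arrPart X c.1) → ∀ x ∈ ⨆ c : Rearr c₀, arrPart X c.1,
      b * x ∈ ⨆ c : Rearr c₀, arrPart X c.1 := by
    intro b hb
    rw [← leftTranslate_le, leftTranslate, Submodule.map_iSup]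
    exact iSup_le fun c => leftTranslate_le.2 (hb c)
  have htop := eq_top_of_mul_mem
    ((⨆ c : Rearr c₀, arrPart X c.1).comap (LinearMap.mulRight K x)) ?_ ?_ ?_ ?_
  · have ha : a ∈ (⨆ c : Rearr c₀, arrPart X c.1).comap (LinearMap.mulRight K x) := by
      rw [htop]; exact Submodule.mem_top
    exact ha
  · rw [Submodule.mem_comap, LinearMap.mulRight_apply, one_mul]; exact hx
  all_goals
    simp only [Submodule.mem_comap, LinearMap.mulRight_apply]
    intro i b hb
    rw [mul_assoc]
    refine hstep _ (fun c z hz => ?_) _ hb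
  · exact Submodule.mem_iSup_of_mem c (hX.arrPart_stable c.1 i z hz)
  · exact hle _ ((hX.arrLevel (inv c.1)).y_le c rfl i (mul_mem_leftTranslate hz))
  · rcases lt_trichotomy (c.1 (lo i)) (c.1 (hi i)) with h1 | h1 | h1
    · have h2 := (le_sup_left.trans ((hX.arrLevel (inv c.1)).lt_eq c rfl i h1).le)
        (mul_mem_leftTranslate hz)
      exact (sup_le (le_iSup (fun c : Rearr c₀ => arrPart X c.1) (c.swap i)) (hle _)) h2
    · exact hle _ ((hX.arrLevel (inv c.1)).eq_le c rfl i h1 (mul_mem_leftTranslate hz))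
    · exact hle _ ((hX.arrLevel (inv c.1)).gt_le c rfl i h1 (mul_mem_leftTranslate hz))

/-- The left ideal that `X` generates is the sum of the `ρ_c X`. -/
theorem IsArrStable.mem_iSup_of_mul {X : Submodule K (Alg K o ν)} (hX : IsArrStable X c₀)
    (a x : Alg K o ν) (hx : x ∈ X) : a * x ∈ ⨆ c : Rearr c₀, arrPart X c.1 := by
  refine hX.mul_mem a x (Submodule.mem_iSup_of_mem ⟨c₀, rfl⟩ ?_)
  rw [arrPart, word_of_monotone hX.mono, tauProd_nil, leftTranslate_one]
  exact hx

end spanning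

/-! ### Ordered monomials span -/

section pbw

variable (K : Type*) [Field K] {n : ℕ} (o : Orientation n) {ν : Multiset (Fin n)}

/-- The product of the powers of the `y_l` along a list. -/
def yProd (γ : Fin ν.card → ℕ) (ℓ : List (Fin ν.card)) : Alg K o ν :=
  (ℓ.map fun l => y K o l ^ γ l).prod

theorem yProd_cons (γ : Fin ν.card → ℕ) (l : Fin ν.card) (ℓ : List (Fin ν.card)) :
    yProd K o γ (l :: ℓ) = y K o l ^ γ l * yProd K o γ ℓ := List.prod_cons

theorem e_mul_pow_y_mul (r : Fin ν.card) (m : ℕ) {i : Word ν} {x : Alg K o ν}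
    (hx : e K o i * x = x) : e K o i * (y K o r ^ m * x) = y K o r ^ m * x := by
  induction m with
  | zero => rw [pow_zero, one_mul, hx]
  | succ m ih => rw [pow_succ', mul_assoc]; exact e_mul_y_mul K o r ih

theorem e_mul_yProd_mul (γ : Fin ν.card → ℕ) (ℓ : List (Fin ν.card)) {i : Word ν} {x : Alg K o ν}
    (hx : e K o i * x = x) : e K o i * (yProd K o γ ℓ * x) = yProd K o γ ℓ * x := by
  induction ℓ with
  | nil => simpa [yProd] using hx
  | cons l ℓ ih => rw [yProd_cons, mul_assoc]; exact e_mul_pow_y_mul K o l _ ih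

theorem y_mul_pow_y_mul {p l : Fin ν.card} (h : p ≠ l) (m : ℕ) {i : Word ν} {x : Alg K o ν}
    (hx : e K o i * x = x) :
    ∃ ε : ℤ, y K o p * (y K o l ^ m * x) = ε • (y K o l ^ m * (y K o p * x)) := by
  induction m with
  | zero => exact ⟨1, by simp⟩
  | succ m ih =>
    obtain ⟨ε, hε⟩ := ih
    refine ⟨sgn (par (i.1 p) * par (i.1 l)) * ε, ?_⟩
    have h1 := congrArg (· * (y K o l ^ m * x)) (y_mul_y K o p l i h)
    simp only [mul_assoc, smul_mul_assoc, e_mul_pow_y_mul K o l m hx] at h1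
    rw [pow_succ', mul_assoc, h1, hε, mul_smul_comm, smul_smul, mul_assoc]

theorem y_mul_yProd_mul (γ : Fin ν.card → ℕ) {ℓ : List (Fin ν.card)} (hℓ : ℓ.Nodup)
    {p : Fin ν.card} (hp : p ∈ ℓ) {i : Word ν} {x : Alg K o ν} (hx : e K o i * x = x) :
    ∃ ε : ℤ, y K o p * (yProd K o γ ℓ * x)
      = ε • (yProd K o (Function.update γ p (γ p + 1)) ℓ * x) := by
  induction ℓ with
  | nil => simp at hp
  | cons l ℓ ih =>
    rw [List.nodup_cons] at hℓ
    by_cases hpl : p = l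
    · subst hpl
      refine ⟨1, ?_⟩
      have h1 : yProd K o (Function.update γ p (γ p + 1)) ℓ = yProd K o γ ℓ := by
        unfold yProd
        refine congrArg List.prod (List.map_congr_left fun q hq => ?_)
        rw [Function.update_of_ne]
        rintro rfl
        exact hℓ.1 hq
      rw [yProd_cons, yProd_cons, h1, Function.update_self, pow_succ', one_smul]
      simp only [mul_assoc]
    · obtain ⟨ε, hε⟩ := ih hℓ.2 ((List.mem_cons.1 hp).resolve_left hpl)
      obtain ⟨ε', hε'⟩ := y_mul_pow_y_mul K o hpl (γ l) (e_mul_yProd_mul K o γ ℓ hx)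
      refine ⟨ε' * ε, ?_⟩
      rw [yProd_cons, yProd_cons, mul_assoc, hε', hε, mul_smul_comm, smul_smul,
        Function.update_of_ne (Ne.symm hpl), mul_assoc]

theorem pow_y_mul_e (r : Fin ν.card) (m : ℕ) (i : Word ν) :
    y K o r ^ m * e K o i = e K o i * y K o r ^ m :=
  Commute.pow_left (show Commute (y K o r) (e K o i) from y_mul_e K o r i) m

theorem yProd_mul_e (γ : Fin ν.card → ℕ) (ℓ : List (Fin ν.card)) (i : Word ν) :
    yProd K o γ ℓ * e K o i = e K o i * yProd K o γ ℓ := by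
  induction ℓ with
  | nil => simp [yProd]
  | cons l ℓ ih => rw [yProd_cons, mul_assoc, ih, ← mul_assoc, pow_y_mul_e, mul_assoc]

/-- The span of the ordered monomials in the `y_l`, multiplied by idempotents. -/
def ySpan (ν : Multiset (Fin n)) : Submodule K (Alg K o ν) :=
  Submodule.span K (Set.range fun x : (Fin ν.card → ℕ) × Word ν =>
    yProd K o x.1 (List.finRange ν.card) * e K o x.2)

/-- The identity colouring gives distinct colours to all places, so there is no condition on the
`τ_r`. Reordering the `y` costs only signs. -/
theorem isArrStable_ySpan : IsArrStable (ySpan K o ν) (id : Fin ν.card → Fin ν.card) where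
  mono := monotone_id
  e_mem i x hx := by
    have : leftTranslate (e K o i) (ySpan K o ν) ≤ ySpan K o ν := by
      rw [leftTranslate, ySpan, Submodule.map_span_le]
      rintro _ ⟨⟨γ, j⟩, rfl⟩
      rw [LinearMap.mulLeft_apply, ← mul_assoc, ← yProd_mul_e, mul_assoc, e_mul_e]
      split_ifs with h
      · exact Submodule.subset_span ⟨(γ, i), rfl⟩
      · rw [mul_zero]; exact zero_mem _
    exact this (mul_mem_leftTranslate hx)
  y_mem p x hx := by
    have : leftTranslate (y K o p) (ySpan K o ν) ≤ ySpan K o ν := by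
      rw [leftTranslate, ySpan, Submodule.map_span_le]
      rintro _ ⟨⟨γ, j⟩, rfl⟩
      obtain ⟨ε, hε⟩ := y_mul_yProd_mul K o γ (List.nodup_finRange _) (List.mem_finRange p)
        (i := j) (x := e K o j) (by rw [e_mul_e, if_pos rfl])
      rw [LinearMap.mulLeft_apply, hε]
      exact zsmul_mem (Submodule.subset_span
        (Set.mem_range.2 ⟨(Function.update γ p (γ p + 1), j), rfl⟩)) _
    exact this (mul_mem_leftTranslate hx)
  tau_mem r h := absurd h (lo_lt_hi r).ne

theorem one_mem_ySpan : (1 : Alg K o ν) ∈ ySpan K o ν := by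
  rw [← sum_e]
  refine sum_mem fun i _ => Submodule.subset_span ⟨(0, i), ?_⟩
  simp [yProd]

/-- The elements `ρ_c y^γ e(𝐢)`. -/
def pbw (x : Rearr (id : Fin ν.card → Fin ν.card) × (Fin ν.card → ℕ) × Word ν) : Alg K o ν :=
  tauProd K o (word x.1.1) * (yProd K o x.2.1 (List.finRange ν.card) * e K o x.2.2)

theorem span_pbw : Submodule.span K (Set.range (pbw K o (ν := ν))) = ⊤ := by
  refine Submodule.eq_top_iff'.2 fun a => ?_
  have h := (isArrStable_ySpan K o).mem_iSup_of_mul a 1 (one_mem_ySpan K o)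
  rw [mul_one] at h
  refine (?_ : (⨆ c : Rearr (id : Fin ν.card → Fin ν.card), arrPart (ySpan K o ν) c.1) ≤ _) h
  refine iSup_le fun c => ?_
  rw [arrPart, leftTranslate, ySpan, Submodule.map_span_le]
  rintro _ ⟨⟨γ, i⟩, rfl⟩
  exact Submodule.subset_span ⟨(c, γ, i), rfl⟩

end pbw

/-! ### The embeddings supercommute -/

namespace Block

variable (K : Type*) [Field K] {n : ℕ} (o : Orientation n) {κ ν : Multiset (Fin n)} {J : Type}
  [Fintype J] (b : Block κ ν J)

theorem hom_one : b.hom K o 1 = b.P K o := by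
  rw [← map_one (Alg.mk K o κ), hom_apply, map_one]; rfl

theorem P_mul_hom (x : Alg K o κ) : b.P K o * b.hom K o x = b.hom K o x := by
  rw [← hom_one, ← map_mul, one_mul]

theorem hom_y_mul_e (r : Fin κ.card) (i : Word κ) :
    b.hom K o (y K o r * e K o i) = y K o (b.yi r) * b.E K o i := by
  rw [map_mul, hom_y, hom_e, mul_assoc]
  exact congrArg _ (b.P_mul_E K o i)

theorem hom_tau_mul_e (r : Fin (κ.card - 1)) (i : Word κ) :
    b.hom K o (tau K o r * e K o i) = tau K o (b.ti r) * b.E K o i := by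
  rw [map_mul, hom_tau, hom_e, mul_assoc]
  exact congrArg _ (b.P_mul_E K o i)

end Block

section supercommutation

variable (K : Type*) [Field K] {n : ℕ} (o : Orientation n) {μ ν : Multiset (Fin n)}

theorem left_E_mul_right_E (i : Word μ) (j : Word ν) :
    (leftBlock μ ν).E K o i * (rightBlock μ ν).E K o j = e K o (i.concat j) := by
  change (∑ j' : Word ν, e K o (i.concat j')) * (∑ i' : Word μ, e K o (i'.concat j)) = _
  rw [Finset.sum_mul_sum, Finset.sum_eq_single j, Finset.sum_eq_single i]
  · rw [e_mul_e, if_pos rfl]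
  · intro i' _ hi'
    rw [e_mul_e, if_neg fun h => hi' (Word.concat_inj _ _ _ _ h).1.symm]
  · simp
  · intro j' _ hj'
    refine Finset.sum_eq_zero fun i' _ => ?_
    rw [e_mul_e, if_neg fun h => hj' (Word.concat_inj _ _ _ _ h).2]
  · simp

theorem right_E_mul_left_E (i : Word μ) (j : Word ν) :
    (rightBlock μ ν).E K o j * (leftBlock μ ν).E K o i = e K o (i.concat j) := by
  change (∑ i' : Word μ, e K o (i'.concat j)) * (∑ j' : Word ν, e K o (i.concat j')) = _
  rw [Finset.sum_mul_sum, Finset.sum_eq_single i, Finset.sum_eq_single j]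
  · rw [e_mul_e, if_pos rfl]
  · intro j' _ hj'
    rw [e_mul_e, if_neg fun h => hj' (Word.concat_inj _ _ _ _ h).2.symm]
  · simp
  · intro i' _ hi'
    refine Finset.sum_eq_zero fun j' _ => ?_
    rw [e_mul_e, if_neg fun h => hi' (Word.concat_inj _ _ _ _ h).1]
  · simp

theorem left_tau_mul_right_E (r : Fin (μ.card - 1)) (j : Word ν) :
    tau K o ((leftBlock μ ν).ti r) * (rightBlock μ ν).E K o j
      = (rightBlock μ ν).E K o j * tau K o ((leftBlock μ ν).ti r) := by
  change tau K o ((leftBlock μ ν).ti r) * (∑ i : Word μ, e K o (i.concat j))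
    = (∑ i : Word μ, e K o (i.concat j)) * _
  rw [Finset.mul_sum, Finset.sum_mul]
  refine Finset.sum_equiv (Function.Involutive.toPerm _ (Word.swap_swap r)) (by simp)
    fun i _ => ?_
  rw [tau_mul_e]
  exact congrArg (fun w => e K o w * _) ((leftBlock μ ν).ins_swap i j r).symm

theorem right_tau_mul_left_E (r : Fin (ν.card - 1)) (i : Word μ) :
    tau K o ((rightBlock μ ν).ti r) * (leftBlock μ ν).E K o i
      = (leftBlock μ ν).E K o i * tau K o ((rightBlock μ ν).ti r) := by
  change tau K o ((rightBlock μ ν).ti r) * (∑ j : Word ν, e K o (i.concat j))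
    = (∑ j : Word ν, e K o (i.concat j)) * _
  rw [Finset.mul_sum, Finset.sum_mul]
  refine Finset.sum_equiv (Function.Involutive.toPerm _ (Word.swap_swap r)) (by simp)
    fun j _ => ?_
  rw [tau_mul_e]
  exact congrArg (fun w => e K o w * _) ((rightBlock μ ν).ins_swap j i r).symm

/-- The idempotent of one block commutes with the generators of the other one. So both products
reduce to a relation on the single idempotent `e(𝐢𝐣)`, where the defining relation of the big
algebra gives the sign. -/
theorem supercommute_aux {u u' : Alg K o (μ + ν)} {i : Word μ} {j : Word ν} {ε : ℤ}
    (hu : u * (rightBlock μ ν).E K o j = (rightBlock μ ν).E K o j * u)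
    (hu' : u' * (leftBlock μ ν).E K o i = (leftBlock μ ν).E K o i * u')
    (h : u' * u * e K o (i.concat j) = ε • (u * u' * e K o (i.concat j))) :
    u' * (rightBlock μ ν).E K o j * (u * (leftBlock μ ν).E K o i)
      = ε • (u * (leftBlock μ ν).E K o i * (u' * (rightBlock μ ν).E K o j)) := by
  have h1 : u' * (rightBlock μ ν).E K o j * (u * (leftBlock μ ν).E K o i)
      = u' * u * e K o (i.concat j) := by
    rw [mul_assoc, ← mul_assoc _ u, ← hu, mul_assoc u, right_E_mul_left_E, mul_assoc]
  have h2 : u * (leftBlock μ ν).E K o i * (u' * (rightBlock μ ν).E K o j)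
      = u * u' * e K o (i.concat j) := by
    rw [mul_assoc, ← mul_assoc _ u', ← hu', mul_assoc u', left_E_mul_right_E, mul_assoc]
  rw [h1, h2, h]

theorem left_yi_ne_right_yi (r : Fin μ.card) (s : Fin ν.card) :
    (leftBlock μ ν).yi r ≠ (rightBlock μ ν).yi s := by
  have h := r.isLt
  simp only [ne_eq, Fin.ext_iff, Block.yi, leftBlock, rightBlock]
  omega

theorem sgn_mul_self_smul {V : Type*} [AddCommGroup V] (a : ZMod 2) (v : V) :
    sgn a • sgn a • v = v := by
  rcases zmod_two_cases a with rfl | rfl <;> simp [sgn_zero, sgn_one]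

theorem letter_left_yi (i : Word μ) (j : Word ν) (r : Fin μ.card) :
    (i.concat j).1 ((leftBlock μ ν).yi r) = i.1 r := (leftBlock μ ν).letter_yi r i j

theorem letter_right_yi (i : Word μ) (j : Word ν) (r : Fin ν.card) :
    (i.concat j).1 ((rightBlock μ ν).yi r) = j.1 r := (rightBlock μ ν).letter_yi r j i

theorem mul_mul_of_supercommute {A : Type*} [Ring A] {u v w : A} {p q r : ZMod 2}
    (h1 : v * u = sgn (p * r) • (u * v)) (h2 : w * u = sgn (q * r) • (u * w)) :
    v * w * u = sgn ((p + q) * r) • (u * (v * w)) := by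
  rw [mul_assoc, h2, mul_smul_comm, ← mul_assoc, h1, smul_mul_assoc, smul_smul, ← sgn_add,
    mul_assoc, ← add_mul, add_comm p]

/-- Generators of different blocks act on disjoint places, so only the supercommutation relations
among the defining ones occur. The sign of a product of monomials follows since parities add up. -/
theorem embRight_mul_embLeft_of_isMonomial {a : Alg K o μ} {b : Alg K o ν} {g h : ℤ × ZMod 2}
    (ha : IsMonomial K o μ a g) (hb : IsMonomial K o ν b h) :
    embRight K o μ ν b * embLeft K o μ ν a
      = sgn (h.2 * g.2) • (embLeft K o μ ν a * embRight K o μ ν b) := by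
  have hLe : ∀ i : Word μ, embLeft K o μ ν (e K o i) = 1 * (leftBlock μ ν).E K o i := fun i =>
    ((leftBlock μ ν).hom_e K o i).trans (one_mul _).symm
  have hRe : ∀ j : Word ν, embRight K o μ ν (e K o j) = 1 * (rightBlock μ ν).E K o j := fun j =>
    ((rightBlock μ ν).hom_e K o j).trans (one_mul _).symm
  have hLy := fun r (i : Word μ) => (leftBlock μ ν).hom_y_mul_e K o r i
  have hRy := fun r (i : Word ν) => (rightBlock μ ν).hom_y_mul_e K o r i
  have hLt := fun r (i : Word μ) => (leftBlock μ ν).hom_tau_mul_e K o r i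
  have hRt := fun r (i : Word ν) => (rightBlock μ ν).hom_tau_mul_e K o r i
  have hcom : ∀ x : Alg K o (μ + ν), (1 : Alg K o (μ + ν)) * x = x * 1 := fun x => by
    rw [one_mul, mul_one]
  induction ha generalizing b h with
  | e i =>
    induction hb with
    | e j => rw [hLe, hRe]; exact supercommute_aux K o (hcom _) (hcom _) (by simp [sgn_zero])
    | y s j =>
      rw [hLe, embRight, hRy]
      exact supercommute_aux K o (hcom _) (Block.y_mul_E _ _ _ _ _) (by simp [sgn_zero])
    | tau s j =>
      rw [hLe, embRight, hRt]
      exact supercommute_aux K o (hcom _) (right_tau_mul_left_E _ _ _ _) (by simp [sgn_zero])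
    | mul _ _ ih1 ih2 =>
      simp only [mul_zero, sgn_zero, one_smul] at ih1 ih2 ⊢
      rw [map_mul, mul_assoc, ih2, ← mul_assoc, ih1, mul_assoc]
  | y r i =>
    induction hb with
    | e j =>
      rw [hRe, embLeft, hLy]
      exact supercommute_aux K o (Block.y_mul_E _ _ _ _ _) (hcom _) (by simp [sgn_zero])
    | y s j =>
      rw [embLeft, embRight, hLy, hRy]
      refine supercommute_aux K o (Block.y_mul_E _ _ _ _ _) (Block.y_mul_E _ _ _ _ _) ?_
      rw [y_mul_y K o _ _ _ (left_yi_ne_right_yi r s).symm, letter_left_yi, letter_right_yi]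
    | tau s j =>
      rw [embLeft, embRight, hLy, hRt]
      refine supercommute_aux K o (Block.y_mul_E _ _ _ _ _) (right_tau_mul_left_E _ _ _ _) ?_
      rw [tau_mul_y K o _ _ _ (by rw [Block.lo_ti]; exact left_yi_ne_right_yi _ _)
        (by rw [Block.hi_ti]; exact left_yi_ne_right_yi _ _), Block.lo_ti, Block.hi_ti,
        letter_left_yi, letter_right_yi, letter_right_yi]
    | mul _ _ ih1 ih2 =>
      rw [map_mul]
      exact mul_mul_of_supercommute ih1 ih2
  | tau r i =>
    induction hb with
    | e j =>
      rw [hRe, embLeft, hLt]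
      exact supercommute_aux K o (left_tau_mul_right_E _ _ _ _) (hcom _) (by simp [sgn_zero])
    | y s j =>
      rw [embLeft, embRight, hLt, hRy]
      refine supercommute_aux K o (left_tau_mul_right_E _ _ _ _) (Block.y_mul_E _ _ _ _ _) ?_
      rw [tau_mul_y K o _ _ _ (by rw [Block.lo_ti]; exact (left_yi_ne_right_yi _ _).symm)
        (by rw [Block.hi_ti]; exact (left_yi_ne_right_yi _ _).symm), Block.lo_ti, Block.hi_ti,
        letter_left_yi, letter_left_yi, letter_right_yi,
        mul_comm (par (j.1 s)), sgn_mul_self_smul]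
    | tau s j =>
      rw [embLeft, embRight, hLt, hRt]
      refine supercommute_aux K o (left_tau_mul_right_E _ _ _ _) (right_tau_mul_left_E _ _ _ _) ?_
      rw [tau_mul_tau K o _ _ _ (by
        have h1 := r.isLt
        simp only [Block.ti, leftBlock, rightBlock]
        omega), Block.lo_ti, Block.hi_ti, Block.lo_ti, Block.hi_ti,
        letter_left_yi, letter_left_yi, letter_right_yi, letter_right_yi, mul_assoc (_ * _)]
    | mul _ _ ih1 ih2 =>
      rw [map_mul]
      exact mul_mul_of_supercommute ih1 ih2
  | mul _ _ ih1 ih2 =>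
    rw [map_mul, ← mul_assoc, ih1 hb, smul_mul_assoc, mul_assoc, ih2 hb, mul_smul_comm, smul_smul,
      ← sgn_add, ← mul_assoc, ← mul_add]
    rfl

theorem embRight_mul_embLeft {a : Alg K o μ} {b : Alg K o ν} {g h : ℤ × ZMod 2}
    (ha : a ∈ component K o μ g) (hb : b ∈ component K o ν h) :
    embRight K o μ ν b * embLeft K o μ ν a
      = sgn (h.2 * g.2) • (embLeft K o μ ν a * embRight K o μ ν b) := by
  induction ha using Submodule.span_induction with
  | mem a ha =>
    induction hb using Submodule.span_induction with
    | mem b hb => exact embRight_mul_embLeft_of_isMonomial K o ha hb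
    | zero => simp
    | add x y _ _ hx hy => rw [map_add, add_mul, mul_add, smul_add, hx, hy]
    | smul t x _ hx => rw [map_smul, smul_mul_assoc, mul_smul_comm, hx, smul_comm]
  | zero => simp
  | add x y _ _ hx hy => rw [map_add, add_mul, mul_add, smul_add, hx, hy]
  | smul t x _ hx => rw [map_smul, smul_mul_assoc, mul_smul_comm, hx, smul_comm]

theorem emb_mul_emb {a' a : Alg K o μ} {b' b : Alg K o ν} {g h : ℤ × ZMod 2}
    (ha : a ∈ component K o μ g) (hb : b' ∈ component K o ν h) :
    emb K o μ ν a' b' * emb K o μ ν a b = sgn (h.2 * g.2) • emb K o μ ν (a' * a) (b' * b) := by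
  rw [emb, emb, emb, mul_assoc, ← mul_assoc (embRight K o μ ν b'), embRight_mul_embLeft K o ha hb,
    smul_mul_assoc, mul_smul_comm, map_mul, map_mul]
  simp only [mul_assoc]

theorem idemp_mul_embLeft (a : Alg K o μ) :
    idemp K o μ ν * embLeft K o μ ν a = embLeft K o μ ν a := (leftBlock μ ν).P_mul_hom K o a

theorem idemp_mul_embRight (b : Alg K o ν) :
    idemp K o μ ν * embRight K o μ ν b = embRight K o μ ν b := by
  rw [← rightBlock_P]; exact (rightBlock μ ν).P_mul_hom K o b

theorem embRight_mul_idemp (b : Alg K o ν) :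
    embRight K o μ ν b * idemp K o μ ν = embRight K o μ ν b := by
  rw [← rightBlock_P]; exact (rightBlock μ ν).hom_mul_P K o b

theorem embLeft_one : embLeft K o μ ν 1 = idemp K o μ ν := (leftBlock μ ν).hom_one K o

theorem embRight_one : embRight K o μ ν 1 = idemp K o μ ν := by
  rw [← rightBlock_P]; exact (rightBlock μ ν).hom_one K o

theorem emb_one_right (a : Alg K o μ) : emb K o μ ν a 1 = embLeft K o μ ν a := by
  rw [emb, embRight_one, ← embLeft_one, ← map_mul, mul_one]

theorem emb_one_left (b : Alg K o ν) : emb K o μ ν 1 b = embRight K o μ ν b := by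
  rw [emb, embLeft_one, idemp_mul_embRight]

theorem emb_one_one : emb K o μ ν 1 1 = idemp K o μ ν := by rw [emb_one_right, embLeft_one]

theorem idemp_mul_emb (a : Alg K o μ) (b : Alg K o ν) :
    idemp K o μ ν * emb K o μ ν a b = emb K o μ ν a b := by
  rw [emb, ← mul_assoc, idemp_mul_embLeft]

theorem emb_mul_idemp (a : Alg K o μ) (b : Alg K o ν) :
    emb K o μ ν a b * idemp K o μ ν = emb K o μ ν a b := by
  rw [emb, mul_assoc, embRight_mul_idemp]

theorem emb_e_e (i : Word μ) (j : Word ν) :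
    emb K o μ ν (e K o i) (e K o j) = e K o (i.concat j) := by
  rw [emb, embLeft_e, embRight_e]
  exact left_E_mul_right_E K o i j

/-- The span of the image of the embedding. -/
def embSpan (μ ν : Multiset (Fin n)) : Submodule K (Alg K o (μ + ν)) :=
  Submodule.span K {x | ∃ a b, x = emb K o μ ν a b}

variable {K o} in
theorem emb_mem_embSpan (a : Alg K o μ) (b : Alg K o ν) : emb K o μ ν a b ∈ embSpan K o μ ν :=
  Submodule.subset_span ⟨a, b, rfl⟩

theorem emb_add_left (a a' : Alg K o μ) (b : Alg K o ν) :
    emb K o μ ν (a + a') b = emb K o μ ν a b + emb K o μ ν a' b := by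
  rw [emb, map_add, add_mul]; rfl

theorem emb_add_right (a : Alg K o μ) (b b' : Alg K o ν) :
    emb K o μ ν a (b + b') = emb K o μ ν a b + emb K o μ ν a b' := by
  rw [emb, map_add, mul_add]; rfl

theorem emb_smul_left (t : K) (a : Alg K o μ) (b : Alg K o ν) :
    emb K o μ ν (t • a) b = t • emb K o μ ν a b := by
  rw [emb, map_smul, smul_mul_assoc]; rfl

theorem emb_smul_right (t : K) (a : Alg K o μ) (b : Alg K o ν) :
    emb K o μ ν a (t • b) = t • emb K o μ ν a b := by
  rw [emb, map_smul, mul_smul_comm]; rfl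

variable (μ ν) in
/-- The embedding as a bilinear map. -/
def embBilin : Alg K o μ →ₗ[K] Alg K o ν →ₗ[K] Alg K o (μ + ν) :=
  LinearMap.mk₂ K (emb K o μ ν) (emb_add_left K o) (emb_smul_left K o) (emb_add_right K o)
    (emb_smul_right K o)

theorem emb_mul_emb_mem (a' a : Alg K o μ) (b' b : Alg K o ν) :
    emb K o μ ν a' b' * emb K o μ ν a b ∈ embSpan K o μ ν := by
  induction a using homogeneous_induction with
  | hom g a ha =>
    induction b' using homogeneous_induction with
    | hom h b' hb' =>
      rw [emb_mul_emb K o ha hb']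
      exact zsmul_mem (emb_mem_embSpan _ _) _
    | zero => rw [emb, map_zero, mul_zero, zero_mul]; exact zero_mem _
    | add x y hx hy => rw [emb_add_right, add_mul]; exact add_mem hx hy
  | zero => rw [emb, emb, map_zero, zero_mul, mul_zero]; exact zero_mem _
  | add x y hx hy => rw [emb_add_left, mul_add]; exact add_mem hx hy

theorem mul_mem_embSpan {x x' : Alg K o (μ + ν)} (hx : x ∈ embSpan K o μ ν)
    (hx' : x' ∈ embSpan K o μ ν) : x * x' ∈ embSpan K o μ ν := by
  induction hx using Submodule.span_induction with
  | mem x hx =>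
    obtain ⟨a, b, rfl⟩ := hx
    induction hx' using Submodule.span_induction with
    | mem x' hx' => obtain ⟨a', b', rfl⟩ := hx'; exact emb_mul_emb_mem K o _ _ _ _
    | zero => rw [mul_zero]; exact zero_mem _
    | add x y _ _ hx hy => rw [mul_add]; exact add_mem hx hy
    | smul t x _ hx => rw [mul_smul_comm]; exact Submodule.smul_mem _ _ hx
  | zero => rw [zero_mul]; exact zero_mem _
  | add x y _ _ hx hy => rw [add_mul]; exact add_mem hx hy
  | smul t x _ hx => rw [smul_mul_assoc]; exact Submodule.smul_mem _ _ hx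

theorem idemp_mul_of_mem_embSpan {x : Alg K o (μ + ν)} (hx : x ∈ embSpan K o μ ν) :
    idemp K o μ ν * x = x := by
  induction hx using Submodule.span_induction with
  | mem x hx => obtain ⟨a, b, rfl⟩ := hx; exact idemp_mul_emb K o a b
  | zero => rw [mul_zero]
  | add x y _ _ hx hy => rw [mul_add, hx, hy]
  | smul t x _ hx => rw [mul_smul_comm, hx]

/-- The image of the embedding is an algebra with identity `1_{μ,ν}`, so stability under left
multiplication by `u` only has to be tested on this idempotent. -/
theorem mul_mem_embSpan_of_mul_idemp {u x : Alg K o (μ + ν)}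
    (hu : u * idemp K o μ ν ∈ embSpan K o μ ν) (hx : x ∈ embSpan K o μ ν) :
    u * x ∈ embSpan K o μ ν := by
  rw [← idemp_mul_of_mem_embSpan K o hx, ← mul_assoc]
  exact mul_mem_embSpan K o hu hx

/-- The colouring of the places by the two blocks. -/
def blockColour (μ ν : Multiset (Fin n)) (x : Fin (μ + ν).card) : Bool := decide (μ.card ≤ x.val)

theorem yi_cases (x : Fin (μ + ν).card) :
    (∃ r, x = (leftBlock μ ν).yi r) ∨ ∃ r, x = (rightBlock μ ν).yi r := by
  have h := x.isLt
  have hc := Multiset.card_add μ ν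
  by_cases hx : x.val < μ.card
  · exact Or.inl ⟨⟨x.val, hx⟩, Fin.ext (Nat.zero_add _).symm⟩
  · refine Or.inr ⟨⟨x.val - μ.card, by omega⟩, Fin.ext ?_⟩
    simp only [Block.yi, rightBlock]
    omega

theorem ti_cases {r : Fin ((μ + ν).card - 1)}
    (h : blockColour μ ν (lo r) = blockColour μ ν (hi r)) :
    (∃ s, r = (leftBlock μ ν).ti s) ∨ ∃ s, r = (rightBlock μ ν).ti s := by
  have h1 := r.isLt
  have hc := Multiset.card_add μ ν
  have h2 : μ.card ≤ r.val ↔ μ.card ≤ r.val + 1 := decide_eq_decide.1 h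
  by_cases hr : r.val + 1 < μ.card
  · exact Or.inl ⟨⟨r.val, by omega⟩, Fin.ext (Nat.zero_add _).symm⟩
  · refine Or.inr ⟨⟨r.val - μ.card, by omega⟩, Fin.ext ?_⟩
    simp only [Block.ti, rightBlock]
    omega

theorem blockColour_monotone : Monotone (blockColour μ ν) := by
  intro x y hxy
  have : x.val ≤ y.val := hxy
  simp only [blockColour, Bool.le_iff_imp, decide_eq_true_eq]
  omega

theorem e_mul_idemp_mem (k : Word (μ + ν)) :
    e K o k * idemp K o μ ν ∈ embSpan K o μ ν := by
  rw [idemp, Finset.mul_sum]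
  refine sum_mem fun i _ => ?_
  rw [Finset.mul_sum]
  refine sum_mem fun j _ => ?_
  rw [e_mul_e]
  split_ifs with h
  · rw [h, ← emb_e_e]; exact emb_mem_embSpan _ _
  · exact zero_mem _

/-- A `τ_r` whose two places have the same colour belongs to one of the two blocks, so its product
with `1_{μ,ν}` is in the image of the embedding. The same is true of every `y_p`. -/
theorem isArrStable_embSpan : IsArrStable (embSpan K o μ ν) (blockColour μ ν) where
  mono := blockColour_monotone
  e_mem k x hx := mul_mem_embSpan_of_mul_idemp K o (e_mul_idemp_mem K o k) hx
  y_mem p x hx := by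
    refine mul_mem_embSpan_of_mul_idemp K o ?_ hx
    rcases yi_cases p with ⟨r, rfl⟩ | ⟨r, rfl⟩
    · rw [← leftBlock_P, ← Block.hom_y]
      exact emb_one_right K o (ν := ν) (y K o r) ▸ emb_mem_embSpan _ _
    · rw [← rightBlock_P, ← Block.hom_y]
      exact emb_one_left K o (μ := μ) (y K o r) ▸ emb_mem_embSpan _ _
  tau_mem r h x hx := by
    refine mul_mem_embSpan_of_mul_idemp K o ?_ hx
    rcases ti_cases h with ⟨s, rfl⟩ | ⟨s, rfl⟩
    · rw [← leftBlock_P, ← Block.hom_tau]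
      exact emb_one_right K o (ν := ν) (tau K o s) ▸ emb_mem_embSpan _ _
    · rw [← rightBlock_P, ← Block.hom_tau]
      exact emb_one_left K o (μ := μ) (tau K o s) ▸ emb_mem_embSpan _ _

theorem idemp_mem_embSpan : idemp K o μ ν ∈ embSpan K o μ ν := by
  rw [← emb_one_one]; exact emb_mem_embSpan _ _

end supercommutation

/-! ### Independence of the monomials -/

section independence

variable (K : Type*) [Field K] {n : ℕ} (o : Orientation n) {ν : Multiset (Fin n)}

theorem genericRep_yProd_single {Z E : Type*} [Field Z] [Ring E] [Algebra Z E] [Algebra K E]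
    (k : Word ν) {s : Fin ν.card → Z} {c D : Fin ν.card → E} (hC : IsClifford s c D)
    (γ : Fin ν.card → ℕ) (ℓ : List (Fin ν.card)) (x : E) :
    genericRep o k K hC (yProd K o γ ℓ) (Finsupp.single 1 x)
      = Finsupp.single 1 (opYProd k.1 s c γ ℓ * x) := by
  induction ℓ with
  | nil => simp [yProd, opYProd]
  | cons l ℓ ih =>
    have h : opYProd k.1 s c γ (l :: ℓ) = opY k.1 s c l ^ γ l * opYProd k.1 s c γ ℓ :=
      List.prod_cons
    rw [yProd_cons, map_mul, Module.End.mul_apply, ih, map_pow, genericRep_y, pow_actY_single, h,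
      mul_assoc]
    rfl

/-- By triangularity the map that sends `g` to the sum of the `τ_{L t}` applied to `g t`, placed at
the identity arrangement, is injective. It carries the independent family of the `f γ`, placed at
`t`, to the family in question. -/
theorem linearIndependent_genericRep {Z E T Γ : Type*} [Field Z] [Ring E] [Algebra Z E]
    [Algebra K E] (k : Word ν) {s : Fin ν.card → Z} {c D : Fin ν.card → E}
    (hC : IsClifford s c D) (L : T → List (Fin (ν.card - 1))) (hL : ∀ t, IsAscending 1 (L t))
    (hinj : Function.Injective fun t => permOf (L t)) {f : Γ → E} (hf : LinearIndependent K f) :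
    LinearIndependent K fun x : Σ _ : T, Γ =>
      (genericRep o k K hC (tauProd K o (L x.1)) (Finsupp.single 1 (f x.2)) :
        GenericSpace E ν) := by
  let Θ : (T →₀ E) →ₗ[K] GenericSpace E ν := Finsupp.lsum K fun t =>
    (genericRep o k K hC (tauProd K o (L t))).comp
      (Finsupp.lsingle (M := E) (R := K) (1 : Equiv.Perm (Fin ν.card)))
  have hΘ : LinearMap.ker Θ = ⊥ := by
    rw [LinearMap.ker_eq_bot']
    intro g hg
    exact eq_zero_of_sum_tauProd_single o k hC L hL hinj g hg
  have h3 := (Finsupp.linearIndependent_single (R := K) (ι := T) (φ := fun _ => Γ) (M := E)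
    (fun _ => f) fun _ => hf).map' Θ hΘ
  have h4 : (fun x : Σ _ : T, Γ =>
      (genericRep o k K hC (tauProd K o (L x.1)) (Finsupp.single 1 (f x.2)) :
        GenericSpace E ν)) = Θ ∘ fun x : Σ _ : T, Γ => Finsupp.single x.1 (f x.2) := by
    funext x
    change _ = Θ (Finsupp.single x.1 (f x.2))
    rw [Finsupp.lsum_single]
    rfl
  rw [h4]
  exact h3

/-- The generic representations for all words `k` are used simultaneously, on the identity
arrangement, whose word is `k`. The idempotent `e(𝐢)` kills this vector for all `k ≠ 𝐢`, so the
different words separate and each of them is treated by the previous lemma. -/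
theorem linearIndependent_tauProd_mul_of_isClifford {Z E T : Type*} [Field Z] [Ring E]
    [Algebra Z E] [Algebra K E] {s : Fin ν.card → Z} {c D : Fin ν.card → E}
    (hC : IsClifford s c D) (L : T → List (Fin (ν.card - 1)))
    (hL : ∀ t, IsAscending 1 (L t)) (hinj : Function.Injective fun t => permOf (L t))
    (ℓ : List (Fin ν.card))
    (hind : ∀ k : Word ν, LinearIndependent K fun γ => opYProd k.1 s c γ ℓ) :
    LinearIndependent K fun x : Σ _ : Word ν, Σ _ : T, (Fin ν.card → ℕ) =>
      tauProd K o (L x.2.1) * (yProd K o x.2.2 ℓ * e K o x.1) := by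
  have h1 := fun k : Word ν => linearIndependent_genericRep K o k hC L hL hinj (hind k)
  have h4 := Finsupp.linearIndependent_single (R := K) (ι := Word ν)
    (φ := fun _ => Σ _ : T, (Fin ν.card → ℕ)) (M := GenericSpace E ν) _ h1
  let ev : Alg K o ν →ₗ[K] (Word ν →₀ GenericSpace E ν) :=
    { toFun := fun a => Finsupp.equivFunOnFinite.symm fun k =>
        genericRep o k K hC a (Finsupp.single 1 1)
      map_add' := fun a b => by ext1 k; simp
      map_smul' := fun t a => by ext1 k; simp }
  refine LinearIndependent.of_comp ev ?_
  have h5 : (ev ∘ fun x : Σ _ : Word ν, Σ _ : T, (Fin ν.card → ℕ) =>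
      tauProd K o (L x.2.1) * (yProd K o x.2.2 ℓ * e K o x.1))
      = fun x : Σ _ : Word ν, Σ _ : T, (Fin ν.card → ℕ) => Finsupp.single x.1
        (genericRep o x.1 K hC (tauProd K o (L x.2.1))
          (Finsupp.single 1 (opYProd x.1.1 s c x.2.2 ℓ))) := by
    funext x
    ext1 k
    change genericRep o k K hC _ (Finsupp.single 1 1) = _
    rw [map_mul, map_mul, Module.End.mul_apply, Module.End.mul_apply, genericRep_e, actE_single,
      Finsupp.single_apply]
    by_cases hk : x.1 = k
    · subst hk
      rw [if_pos (show x.1.1 ∘ ⇑(1 : Equiv.Perm (Fin ν.card)) = x.1.1 from rfl), if_pos rfl,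
        genericRep_yProd_single, mul_one]
    · rw [if_neg hk, if_neg, map_zero, map_zero]
      intro h
      exact hk (Subtype.ext h.symm)
  rw [h5]
  exact h4

/-- Products of ordered monomials in the `y_l` with products of the `τ_r` along ascending words
with distinct ends are independent. -/
theorem linearIndependent_tauProd_mul {T : Type*} (L : T → List (Fin (ν.card - 1)))
    (hL : ∀ t, IsAscending 1 (L t)) (hinj : Function.Injective fun t => permOf (L t))
    (ℓ : List (Fin ν.card)) (hℓ : ℓ.Pairwise (· < ·)) (hmem : ∀ l, l ∈ ℓ) :
    LinearIndependent K fun x : Σ _ : Word ν, Σ _ : T, (Fin ν.card → ℕ) =>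
      tauProd K o (L x.2.1) * (yProd K o x.2.2 ℓ * e K o x.1) :=
  linearIndependent_tauProd_mul_of_isClifford K o (isClifford_generic K ν.card) L hL hinj ℓ
    fun k => linearIndependent_opYProd K ν.card k.1 ℓ hℓ hmem

end independence

/-! ### Reduced words and ordered monomials compatible with the two blocks. -/

section blocks

variable {n : ℕ} {μ κ ν : Multiset (Fin n)} {J : Type} (b : Block κ ν J)

theorem Block.yi_lt_yi {x x' : Fin κ.card} : b.yi x < b.yi x' ↔ x < x' := by
  simp only [Block.yi, Fin.lt_def]
  omega

theorem Block.permOf_map_yi (L : List (Fin (κ.card - 1))) (x : Fin κ.card) :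
    permOf (L.map b.ti) (b.yi x) = b.yi (permOf L x) := by
  induction L generalizing x with
  | nil => rfl
  | cons r L ih =>
    rw [List.map_cons, permOf, permOf, Equiv.Perm.mul_apply, Equiv.Perm.mul_apply, ← ih]
    congr 1
    simp only [adjSwap, Equiv.swap_apply_def, Block.lo_ti, Block.hi_ti]
    by_cases h1 : x = lo r
    · rw [if_pos h1, if_pos (by rw [h1])]
    · rw [if_neg h1, if_neg fun h => h1 (b.yi_inj h)]
      by_cases h2 : x = hi r
      · rw [if_pos h2, if_pos (by rw [h2])]
      · rw [if_neg h2, if_neg fun h => h2 (b.yi_inj h)]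

theorem Block.permOf_map_of_ne (L : List (Fin (κ.card - 1))) {x : Fin ν.card}
    (h : ∀ z, x ≠ b.yi z) : permOf (L.map b.ti) x = x := by
  induction L with
  | nil => rfl
  | cons r L ih =>
    rw [List.map_cons, permOf, Equiv.Perm.mul_apply, adjSwap_of_ne (h (lo r)) (h (hi r)), ih]

theorem Block.isAscending_map {w : Equiv.Perm (Fin ν.card)} (hw : ∀ x, w (b.yi x) = b.yi x)
    {L : List (Fin (κ.card - 1))} (hL : IsAscending 1 L) : IsAscending w (L.map b.ti) := by
  induction L with
  | nil => trivial
  | cons r L ih =>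
    refine ⟨ih hL.1, ?_⟩
    have h := hL.2
    rw [one_mul] at h
    change (w * permOf (L.map b.ti)) (lo (b.ti r)) < (w * permOf (L.map b.ti)) (hi (b.ti r))
    rw [Block.lo_ti, Block.hi_ti, Equiv.Perm.mul_apply, Equiv.Perm.mul_apply, permOf_map_yi,
      permOf_map_yi, hw, hw]
    exact b.yi_lt_yi.2 h

theorem permOf_word_injective {d : ℕ} :
    Function.Injective fun u : Rearr (id : Fin d → Fin d) => permOf (word u.1) := by
  intro u u' h
  have h1 := comp_permOf_word monotone_id u
  have h2 := comp_permOf_word monotone_id u'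
  simp only at h
  rw [h] at h1
  exact Subtype.ext (h1.symm.trans h2)

theorem blockColour_left (x : Fin μ.card) :
    blockColour μ ν ((leftBlock μ ν).yi x) = false := by
  have := x.isLt
  refine decide_eq_false ?_
  change ¬ μ.card ≤ 0 + x.val
  omega

theorem blockColour_right (x : Fin ν.card) :
    blockColour μ ν ((rightBlock μ ν).yi x) = true := by
  exact decide_eq_true (Nat.le_add_right _ _)

/-- The word of transpositions of a triple. -/
def tripleWord (t : Rearr (blockColour μ ν) × Rearr (id : Fin μ.card → Fin μ.card) ×
    Rearr (id : Fin ν.card → Fin ν.card)) : List (Fin ((μ + ν).card - 1)) :=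
  word t.1.1 ++ ((word t.2.1.1).map (leftBlock μ ν).ti ++ (word t.2.2.1).map (rightBlock μ ν).ti)

theorem permOf_blocks_left (L : List (Fin (μ.card - 1))) (L' : List (Fin (ν.card - 1)))
    (x : Fin μ.card) : permOf (L.map (leftBlock μ ν).ti ++ L'.map (rightBlock μ ν).ti)
      ((leftBlock μ ν).yi x) = (leftBlock μ ν).yi (permOf L x) := by
  rw [permOf_append, Equiv.Perm.mul_apply, Block.permOf_map_yi, Block.permOf_map_of_ne]
  exact fun z => left_yi_ne_right_yi _ _

theorem permOf_blocks_right (L : List (Fin (μ.card - 1))) (L' : List (Fin (ν.card - 1)))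
    (x : Fin ν.card) : permOf (L.map (leftBlock μ ν).ti ++ L'.map (rightBlock μ ν).ti)
      ((rightBlock μ ν).yi x) = (rightBlock μ ν).yi (permOf L' x) := by
  rw [permOf_append, Equiv.Perm.mul_apply, (leftBlock μ ν).permOf_map_of_ne L
    fun z => (left_yi_ne_right_yi _ _).symm, Block.permOf_map_yi]

theorem blockColour_comp_permOf (L : List (Fin (μ.card - 1))) (L' : List (Fin (ν.card - 1))) :
    blockColour μ ν ∘ permOf (L.map (leftBlock μ ν).ti ++ L'.map (rightBlock μ ν).ti)
      = blockColour μ ν := by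
  funext x
  rw [Function.comp_apply]
  rcases yi_cases x with ⟨r, rfl⟩ | ⟨r, rfl⟩
  · rw [permOf_blocks_left, blockColour_left, blockColour_left]
  · rw [permOf_blocks_right, blockColour_right, blockColour_right]

/-- The words inside the blocks are performed first and do not change the colours, so the word of
`c` stays ascending after them by `isAscending_word`. -/
theorem isAscending_tripleWord (t : Rearr (blockColour μ ν) ×
    Rearr (id : Fin μ.card → Fin μ.card) × Rearr (id : Fin ν.card → Fin ν.card)) :
    IsAscending 1 (tripleWord t) := by
  refine IsAscending.append (IsAscending.append ?_ ?_) ?_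
  · exact (rightBlock μ ν).isAscending_map (fun _ => rfl) (isAscending_word monotone_id rfl t.2.2)
  · refine (leftBlock μ ν).isAscending_map (fun x => ?_)
      (isAscending_word monotone_id rfl t.2.1)
    rw [one_mul, Block.permOf_map_of_ne]
    exact fun z => left_yi_ne_right_yi _ _
  · refine isAscending_word blockColour_monotone ?_ t.1
    rw [one_mul, blockColour_comp_permOf]

/-- The colours of the arrangement reached determine `c`, as permutations inside the blocks preserve
the initial colouring. After `c` has been cancelled, the restrictions to the two blocks give the
other two components. -/
theorem permOf_tripleWord_injective :
    Function.Injective fun t : Rearr (blockColour μ ν) × Rearr (id : Fin μ.card → Fin μ.card) ×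
      Rearr (id : Fin ν.card → Fin ν.card) => permOf (tripleWord t) := by
  rintro ⟨c, u, v⟩ ⟨c', u', v'⟩ h
  simp only [tripleWord] at h
  rw [permOf_append, permOf_append (word c'.1)] at h
  have hc : c = c' := by
    have h1 := congrArg (fun w : Equiv.Perm (Fin (μ + ν).card) => blockColour μ ν ∘ w) h
    simp only [Equiv.Perm.coe_mul, ← Function.comp_assoc, blockColour_comp_permOf] at h1
    rw [comp_permOf_word blockColour_monotone, comp_permOf_word blockColour_monotone] at h1
    exact Subtype.ext h1
  subst hc
  have h2 := mul_right_cancel h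
  have hu : u = u' := by
    refine permOf_word_injective (Equiv.ext fun x => ?_)
    have h3 := DFunLike.congr_fun h2 ((leftBlock μ ν).yi x)
    rw [permOf_blocks_left, permOf_blocks_left] at h3
    exact (leftBlock μ ν).yi_inj h3
  have hv : v = v' := by
    refine permOf_word_injective (Equiv.ext fun x => ?_)
    have h3 := DFunLike.congr_fun h2 ((rightBlock μ ν).yi x)
    rw [permOf_blocks_right, permOf_blocks_right] at h3
    exact (rightBlock μ ν).yi_inj h3
  rw [hu, hv]

variable (μ ν) in
/-- The places in increasing order, block by block. -/
def blockList : List (Fin (μ + ν).card) :=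
  (List.finRange μ.card).map (leftBlock μ ν).yi ++ (List.finRange ν.card).map (rightBlock μ ν).yi

theorem mem_blockList (x : Fin (μ + ν).card) : x ∈ blockList μ ν := by
  rw [blockList, List.mem_append]
  rcases yi_cases x with ⟨r, rfl⟩ | ⟨r, rfl⟩
  · exact Or.inl (List.mem_map_of_mem (List.mem_finRange r))
  · exact Or.inr (List.mem_map_of_mem (List.mem_finRange r))

theorem pairwise_blockList : (blockList μ ν).Pairwise (· < ·) := by
  rw [blockList, List.pairwise_append]
  refine ⟨?_, ?_, ?_⟩
  · exact List.Pairwise.map _ (fun _ _ h => (leftBlock μ ν).yi_lt_yi.2 h)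
      (List.pairwise_lt_finRange _)
  · exact List.Pairwise.map _ (fun _ _ h => (rightBlock μ ν).yi_lt_yi.2 h)
      (List.pairwise_lt_finRange _)
  · intro x hx x' hx'
    obtain ⟨r, -, rfl⟩ := List.mem_map.1 hx
    obtain ⟨s, -, rfl⟩ := List.mem_map.1 hx'
    have := r.isLt
    simp only [Block.yi, leftBlock, rightBlock, Fin.lt_def]
    omega

/-- Two families of exponents, joined. -/
def mergeExp (α : Fin μ.card → ℕ) (β : Fin ν.card → ℕ) (x : Fin (μ + ν).card) : ℕ :=
  Fin.append α β (Fin.cast (Multiset.card_add μ ν) x)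

theorem mergeExp_left (α : Fin μ.card → ℕ) (β : Fin ν.card → ℕ) (r : Fin μ.card) :
    mergeExp α β ((leftBlock μ ν).yi r) = α r := by
  have hk : Fin.cast (Multiset.card_add μ ν) ((leftBlock μ ν).yi r) = Fin.castAdd ν.card r :=
    Fin.ext (Nat.zero_add _)
  rw [mergeExp, hk, Fin.append_left]

theorem mergeExp_right (α : Fin μ.card → ℕ) (β : Fin ν.card → ℕ) (r : Fin ν.card) :
    mergeExp α β ((rightBlock μ ν).yi r) = β r := by
  have hk : Fin.cast (Multiset.card_add μ ν) ((rightBlock μ ν).yi r) = Fin.natAdd μ.card r := rfl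
  rw [mergeExp, hk, Fin.append_right]

variable (K : Type*) [Field K] (o : Orientation n)

theorem yProd_mergeExp (α : Fin μ.card → ℕ) (β : Fin ν.card → ℕ) :
    yProd K o (mergeExp α β) (blockList μ ν)
      = ((List.finRange μ.card).map fun r => y K o ((leftBlock μ ν).yi r) ^ α r).prod
        * ((List.finRange ν.card).map fun r => y K o ((rightBlock μ ν).yi r) ^ β r).prod := by
  rw [yProd, blockList, List.map_append, List.prod_append, List.map_map, List.map_map]
  simp only [Function.comp_def, mergeExp_left, mergeExp_right]

variable [Fintype J]

theorem Block.hom_tauProd (L : List (Fin (κ.card - 1))) :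
    b.hom K o (tauProd K o L) = tauProd K o (L.map b.ti) * b.P K o := by
  induction L with
  | nil => rw [tauProd_nil, hom_one, List.map_nil, tauProd_nil, one_mul]
  | cons r L ih =>
    rw [tauProd_cons, map_mul, hom_tau, mul_assoc, P_mul_hom, ih, List.map_cons, tauProd_cons,
      mul_assoc]

theorem Block.hom_yProd_mul_e (α : Fin κ.card → ℕ) (ℓ : List (Fin κ.card)) (i : Word κ) :
    b.hom K o (yProd K o α ℓ * e K o i)
      = (ℓ.map fun r => y K o (b.yi r) ^ α r).prod * b.E K o i := by
  induction ℓ with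
  | nil =>
    rw [yProd, List.map_nil, List.map_nil, List.prod_nil, List.prod_nil, one_mul, one_mul]
    exact b.hom_e K o i
  | cons r ℓ ih =>
    rw [yProd_cons, List.map_cons, List.prod_cons, mul_assoc, mul_assoc, ← ih]
    generalize yProd K o α ℓ * e K o i = x
    induction α r with
    | zero => rw [pow_zero, pow_zero, one_mul, one_mul]
    | succ m ihm =>
      rw [pow_succ', pow_succ', mul_assoc, mul_assoc, map_mul, ihm, hom_y, mul_assoc]
      congr 1
      rw [← mul_assoc, ← mul_one (b.P K o), mul_one (b.P K o)]
      have h : b.P K o * y K o (b.yi r) ^ m = y K o (b.yi r) ^ m * b.P K o :=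
        Commute.pow_right (show Commute (b.P K o) (y K o (b.yi r)) from b.P_mul_y K o _) m
      rw [h, mul_assoc, P_mul_hom]

/-- Only the existence of a degree matters here: it decides the sign when an element is moved past
the other block, and this sign is irrelevant for independence. -/
theorem exists_tauProd_mul_e_mem (L : List (Fin (κ.card - 1))) (i : Word κ) :
    (∃ g, tauProd K o L * e K o i ∈ component K o κ g) ∧
      ∃ i', tauProd K o L * e K o i = e K o i' * tauProd K o L := by
  induction L with
  | nil =>
    refine ⟨⟨0, ?_⟩, i, ?_⟩
    · rw [tauProd_nil, one_mul]; exact e_mem_component K o i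
    · rw [tauProd_nil, one_mul, mul_one]
  | cons r L ih =>
    obtain ⟨⟨g, hg⟩, i', hi'⟩ := ih
    refine ⟨⟨degTau r i' + g, ?_⟩, i'.swap r, ?_⟩
    · have h : tauProd K o (r :: L) * e K o i
          = tau K o r * e K o i' * (tauProd K o L * e K o i) := by
        rw [tauProd_cons, mul_assoc, mul_assoc]
        congr 1
        rw [hi', e_mul_e_self]
      rw [h]
      exact mul_mem_component K o (tau_mul_e_mem_component K o r i') hg
    · rw [tauProd_cons, mul_assoc, hi', ← mul_assoc, tau_mul_e, mul_assoc]

theorem exists_yProd_mul_e_mem (α : Fin κ.card → ℕ) (ℓ : List (Fin κ.card)) (i : Word κ) :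
    ∃ g, yProd K o α ℓ * e K o i ∈ component K o κ g := by
  have hpow : ∀ (l : Fin κ.card) (m : ℕ), ∃ g, y K o l ^ m * e K o i ∈ component K o κ g := by
    intro l m
    induction m with
    | zero => exact ⟨0, by rw [pow_zero, one_mul]; exact e_mem_component K o i⟩
    | succ m ih =>
      obtain ⟨g, hg⟩ := ih
      refine ⟨degY l i + g, ?_⟩
      have h : y K o l ^ (m + 1) * e K o i = y K o l * e K o i * (y K o l ^ m * e K o i) := by
        rw [pow_succ', mul_assoc, mul_assoc, pow_y_mul_e, e_mul_e_self]
      rw [h]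
      exact mul_mem_component K o (y_mul_e_mem_component K o l i) hg
  induction ℓ with
  | nil => exact ⟨0, by rw [yProd, List.map_nil, List.prod_nil, one_mul]; exact e_mem_component K o i⟩
  | cons l ℓ ih =>
    obtain ⟨g, hg⟩ := ih
    obtain ⟨g', hg'⟩ := hpow l (α l)
    refine ⟨g' + g, ?_⟩
    have h : yProd K o α (l :: ℓ) * e K o i
        = y K o l ^ α l * e K o i * (yProd K o α ℓ * e K o i) := by
      rw [yProd_cons, mul_assoc, mul_assoc, yProd_mul_e, e_mul_e_self]
    rw [h]
    exact mul_mem_component K o hg' hg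

theorem commute_pow_prod {A ι : Type*} [Ring A] (f : ι → A) (m : ι → ℕ) (ℓ : List ι) {x : A}
    (h : ∀ r, Commute x (f r)) : Commute x (ℓ.map fun r => f r ^ m r).prod := by
  refine Commute.list_prod_right _ _ fun z hz => ?_
  obtain ⟨r, -, rfl⟩ := List.mem_map.1 hz
  exact (h r).pow_right _

/-- The image of a product of two ordered monomials is an ordered monomial, up to sign. -/
theorem exists_sgn_emb_pbw (u : Rearr (id : Fin μ.card → Fin μ.card))
    (v : Rearr (id : Fin ν.card → Fin ν.card)) (α : Fin μ.card → ℕ) (β : Fin ν.card → ℕ)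
    (i : Word μ) (j : Word ν) : ∃ p : ZMod 2, emb K o μ ν (pbw K o (u, α, i)) (pbw K o (v, β, j))
      = sgn p • (tauProd K o ((word u.1).map (leftBlock μ ν).ti ++ (word v.1).map (rightBlock μ ν).ti)
        * (yProd K o (mergeExp α β) (blockList μ ν) * e K o (i.concat j))) := by
  obtain ⟨⟨g, hg⟩, -⟩ := exists_tauProd_mul_e_mem K o (word v.1) j
  obtain ⟨h, hh⟩ := exists_yProd_mul_e_mem K o α (List.finRange μ.card) i
  refine ⟨g.2 * h.2, ?_⟩
  have hs := embRight_mul_embLeft K o hh hg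
  have hs' := congrArg (fun x => sgn (g.2 * h.2) • x) hs
  simp only [sgn_mul_self_smul] at hs'
  -- An idempotent is inserted between the `τ` and the `y` of the right factor. Both parts become
  -- homogeneous, and the first one can be moved past the `y` of the left factor, so that all `τ`
  -- come before all `y`.
  have hv : pbw K o (v, β, j) = tauProd K o (word v.1) * e K o j *
      (yProd K o β (List.finRange ν.card) * e K o j) := by
    change tauProd K o (word v.1) * (yProd K o β (List.finRange ν.card) * e K o j) = _
    rw [mul_assoc, yProd_mul_e, e_mul_e_self]
  have hL := (leftBlock μ ν).hom_yProd_mul_e K o α (List.finRange μ.card) i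
  have hR := (rightBlock μ ν).hom_yProd_mul_e K o β (List.finRange ν.card) j
  have hu : pbw K o (u, α, i) = tauProd K o (word u.1) *
      (yProd K o α (List.finRange μ.card) * e K o i) := rfl
  rw [emb, hv, hu, map_mul (embLeft K o μ ν) (tauProd K o (word u.1)) _,
    map_mul (embRight K o μ ν) (tauProd K o (word v.1) * e K o j) _, mul_assoc,
    ← mul_assoc (embLeft K o μ ν (yProd K o _ _ * _)), ← hs', smul_mul_assoc, mul_smul_comm]
  congr 1
  have hEj : embRight K o μ ν (tauProd K o (word v.1) * e K o j)
      = tauProd K o ((word v.1).map (rightBlock μ ν).ti) * (rightBlock μ ν).E K o j := by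
    rw [map_mul, embRight, Block.hom_tauProd, Block.hom_e, mul_assoc]
    exact congrArg _ ((rightBlock μ ν).P_mul_E K o j)
  have hP : embLeft K o μ ν (tauProd K o (word u.1)) *
      embRight K o μ ν (tauProd K o (word v.1) * e K o j)
      = tauProd K o ((word u.1).map (leftBlock μ ν).ti) *
        embRight K o μ ν (tauProd K o (word v.1) * e K o j) := by
    rw [embLeft, Block.hom_tauProd, mul_assoc, leftBlock_P, idemp_mul_embRight]
  rw [mul_assoc (embRight K o μ ν (_ * _)), ← mul_assoc (embLeft K o μ ν _), hP, hEj]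
  rw [embLeft, embRight, hL, hR, yProd_mergeExp, tauProd_append]
  have c1 : Commute ((rightBlock μ ν).E K o j)
      ((List.finRange μ.card).map fun r => y K o ((leftBlock μ ν).yi r) ^ α r).prod :=
    commute_pow_prod _ _ _ fun r => ((rightBlock μ ν).y_mul_E K o _ j).symm
  have c2 : Commute ((leftBlock μ ν).E K o i)
      ((List.finRange ν.card).map fun r => y K o ((rightBlock μ ν).yi r) ^ β r).prod :=
    commute_pow_prod _ _ _ fun r => ((leftBlock μ ν).y_mul_E K o _ i).symm
  have c3 : Commute ((rightBlock μ ν).E K o j)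
      ((List.finRange ν.card).map fun r => y K o ((rightBlock μ ν).yi r) ^ β r).prod :=
    commute_pow_prod _ _ _ fun r => ((rightBlock μ ν).y_mul_E K o _ j).symm
  simp only [mul_assoc]
  congr 2
  rw [← mul_assoc, c1.eq, mul_assoc]
  congr 1
  rw [← mul_assoc ((leftBlock μ ν).E K o i), c2.eq, mul_assoc, left_E_mul_right_E, ← mul_assoc,
    c3.eq, mul_assoc, ← right_E_mul_left_E, ← mul_assoc ((rightBlock μ ν).E K o j), Block.E_mul_E,
    if_pos rfl]

end blocks

/-! ### The induced module as a sum of copies of the tensor product -/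

/-- Only spanning is required in the source. Thus independence of the ordered monomials of `H⁻(μ)`
and `H⁻(ν)` need not be known; independence in `H⁻(μ + ν)` suffices. -/
theorem injective_of_span_of_linearIndependent {K V W ι : Type*} [Field K] [AddCommGroup V]
    [Module K V] [AddCommGroup W] [Module K W] (f : V →ₗ[K] W) {v : ι → V}
    (hv : Submodule.span K (Set.range v) = ⊤) (h : LinearIndependent K (f ∘ v)) :
    Function.Injective f := by
  rw [← LinearMap.ker_eq_bot, LinearMap.ker_eq_bot']
  intro x hx
  have h1 : x ∈ Submodule.span K (Set.range v) := by rw [hv]; exact Submodule.mem_top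
  obtain ⟨g, rfl⟩ := (Finsupp.mem_span_range_iff_exists_finsupp).1 h1
  have h2 : Finsupp.linearCombination K (f ∘ v) g = 0 := by
    rw [← hx, map_finsuppSum, Finsupp.linearCombination_apply]
    exact Finsupp.sum_congr fun i _ => (map_smul f _ _).symm
  rw [linearIndependent_iff.1 h g h2, Finsupp.sum_zero_index]

section leftIdeal

variable (K : Type*) [Field K] {n : ℕ} (o : Orientation n) (μ ν : Multiset (Fin n))

/-- The map `(c, a ⊗ b) ↦ ρ_c (a ⊗ b)`. -/
def arrMap : (Rearr (blockColour μ ν) →₀ Alg K o μ ⊗[K] Alg K o ν) →ₗ[K] Alg K o (μ + ν) :=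
  Finsupp.lsum K fun c => LinearMap.mulLeft K (tauProd K o (word c.1)) ∘ₗ
    TensorProduct.lift (embBilin K o μ ν)

theorem arrMap_single (c : Rearr (blockColour μ ν)) (a : Alg K o μ) (b : Alg K o ν) :
    arrMap K o μ ν (Finsupp.single c (a ⊗ₜ b)) = tauProd K o (word c.1) * emb K o μ ν a b := by
  rw [arrMap, Finsupp.lsum_single, LinearMap.comp_apply, TensorProduct.lift.tmul]
  rfl

variable {K o μ ν} in
/-- Induction over the domain of `arrMap`. -/
theorem arr_induction {p : (Rearr (blockColour μ ν) →₀ Alg K o μ ⊗[K] Alg K o ν) → Prop}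
    (hom : ∀ c g h, ∀ a ∈ component K o μ g, ∀ b ∈ component K o ν h,
      p (Finsupp.single c (a ⊗ₜ b))) (zero : p 0) (add : ∀ x x', p x → p x' → p (x + x'))
    (x : Rearr (blockColour μ ν) →₀ Alg K o μ ⊗[K] Alg K o ν) : p x := by
  induction x using Finsupp.induction_linear with
  | zero => exact zero
  | add x x' hx hx' => exact add x x' hx hx'
  | single c t =>
    induction t with
    | zero => rw [Finsupp.single_zero]; exact zero
    | add t t' ht ht' => rw [Finsupp.single_add]; exact add _ _ ht ht'
    | tmul a b =>
      induction a using homogeneous_induction with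
      | zero => rw [TensorProduct.zero_tmul, Finsupp.single_zero]; exact zero
      | add a a' ha ha' =>
        rw [TensorProduct.add_tmul, Finsupp.single_add]; exact add _ _ ha ha'
      | hom g a ha =>
        induction b using homogeneous_induction with
        | zero => rw [TensorProduct.tmul_zero, Finsupp.single_zero]; exact zero
        | add b b' hb hb' =>
          rw [TensorProduct.tmul_add, Finsupp.single_add]; exact add _ _ hb hb'
        | hom h b hb => exact hom c g h a ha b hb

theorem emb_mem_leftIdeal (x : Alg K o (μ + ν)) (a : Alg K o μ) (b : Alg K o ν) :
    x * emb K o μ ν a b ∈ leftIdeal K o μ ν := by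
  rw [← emb_mul_idemp, ← mul_assoc]
  exact Ideal.mul_mem_left _ _ (Ideal.subset_span rfl)

theorem arrMap_mem (x) : arrMap K o μ ν x ∈ leftIdeal K o μ ν := by
  induction x using arr_induction with
  | hom c g h a ha b hb => rw [arrMap_single]; exact emb_mem_leftIdeal K o μ ν _ a b
  | zero => rw [map_zero]; exact zero_mem _
  | add x x' hx hx' => rw [map_add]; exact add_mem hx hx'

/-- The map `(c, a ⊗ b) ↦ ρ_c (a ⊗ b)` to the left ideal. -/
def arrMap' : (Rearr (blockColour μ ν) →₀ Alg K o μ ⊗[K] Alg K o ν) →ₗ[K] leftIdeal K o μ ν where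
  toFun x := ⟨arrMap K o μ ν x, arrMap_mem K o μ ν x⟩
  map_add' x x' := Subtype.ext (map_add _ _ _)
  map_smul' t x := Subtype.ext (map_smul _ _ _)

/-- The left ideal is generated by `1_{μ,ν}`, which lies in the image of the embedding, so the
spanning theorem for the two-coloured arrangements applies. -/
theorem arrMap_surjective : Function.Surjective (arrMap' K o μ ν) := by
  rintro ⟨h, hh⟩
  obtain ⟨a, rfl⟩ := Ideal.mem_span_singleton'.1 hh
  have h1 := (isArrStable_embSpan K o (μ := μ) (ν := ν)).mem_iSup_of_mul a _
    (idemp_mem_embSpan K o)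
  have h2 : (⨆ c : Rearr (blockColour μ ν), arrPart (embSpan K o μ ν) c.1)
      ≤ LinearMap.range (arrMap K o μ ν) := by
    refine iSup_le fun c => ?_
    rw [arrPart, leftTranslate, embSpan, Submodule.map_span_le]
    rintro _ ⟨a, b, rfl⟩
    exact ⟨_, arrMap_single K o μ ν c a b⟩
  obtain ⟨x, hx⟩ := h2 h1
  exact ⟨x, Subtype.ext hx⟩

theorem span_pbw_tmul_pbw : Submodule.span K (Set.range fun x : Rearr (blockColour μ ν) ×
    (Rearr (id : Fin μ.card → Fin μ.card) × (Fin μ.card → ℕ) × Word μ) ×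
    (Rearr (id : Fin ν.card → Fin ν.card) × (Fin ν.card → ℕ) × Word ν) =>
      (Finsupp.single x.1 (pbw K o x.2.1 ⊗ₜ[K] pbw K o x.2.2) :
        Rearr (blockColour μ ν) →₀ Alg K o μ ⊗[K] Alg K o ν)) = ⊤ := by
  have h1 : Submodule.span K (Set.image2 (fun a b => a ⊗ₜ[K] b) (Set.range (pbw K o (ν := μ)))
      (Set.range (pbw K o (ν := ν)))) = ⊤ := by
    rw [← TensorProduct.map₂_mk_top_top_eq_top, ← span_pbw, ← span_pbw, Submodule.map₂_span_span]
    rfl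
  refine Submodule.eq_top_iff'.2 fun x => ?_
  induction x using Finsupp.induction_linear with
  | zero => exact zero_mem _
  | add x x' hx hx' => exact add_mem hx hx'
  | single c t =>
    have ht : t ∈ (⊤ : Submodule K (Alg K o μ ⊗[K] Alg K o ν)) := Submodule.mem_top
    rw [← h1] at ht
    induction ht using Submodule.span_induction with
    | mem t ht =>
      obtain ⟨_, ⟨x, rfl⟩, _, ⟨x', rfl⟩, rfl⟩ := ht
      exact Submodule.subset_span ⟨(c, x, x'), rfl⟩
    | zero => rw [Finsupp.single_zero]; exact zero_mem _
    | add t t' _ _ ht ht' => rw [Finsupp.single_add]; exact add_mem ht ht'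
    | smul s t _ ht => rw [← Finsupp.smul_single]; exact Submodule.smul_mem _ _ ht

theorem mergeExp_injective {α α' : Fin μ.card → ℕ} {β β' : Fin ν.card → ℕ}
    (h : mergeExp α β = mergeExp α' β') : α = α' ∧ β = β' := by
  constructor
  · funext r; rw [← mergeExp_left α β r, h, mergeExp_left]
  · funext r; rw [← mergeExp_right α β r, h, mergeExp_right]

/-- The map sends the spanning family of pairs of ordered monomials, up to signs, to products of `τ`
along the words of triples with ordered monomials in the `y`. These words are ascending and have
distinct ends. -/
theorem arrMap_injective : Function.Injective (arrMap K o μ ν) := by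
  refine injective_of_span_of_linearIndependent _ (span_pbw_tmul_pbw K o μ ν) ?_
  have h1 := linearIndependent_tauProd_mul K o (ν := μ + ν) (tripleWord (μ := μ) (ν := ν))
    isAscending_tripleWord permOf_tripleWord_injective (blockList μ ν) pairwise_blockList
    mem_blockList
  have h2 := h1.comp (fun x : Rearr (blockColour μ ν) ×
    (Rearr (id : Fin μ.card → Fin μ.card) × (Fin μ.card → ℕ) × Word μ) ×
    (Rearr (id : Fin ν.card → Fin ν.card) × (Fin ν.card → ℕ) × Word ν) =>
      ⟨x.2.1.2.2.concat x.2.2.2.2, (x.1, x.2.1.1, x.2.2.1), mergeExp x.2.1.2.1 x.2.2.2.1⟩) (by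
    rintro ⟨c, ⟨u, α, i⟩, v, β, j⟩ ⟨c', ⟨u', α', i'⟩, v', β', j'⟩ h
    simp only [Sigma.mk.injEq, heq_eq_eq, Prod.mk.injEq] at h
    obtain ⟨hw, ⟨rfl, rfl, rfl⟩, hm⟩ := h
    obtain ⟨rfl, rfl⟩ := Word.concat_inj _ _ _ _ hw
    obtain ⟨rfl, rfl⟩ := mergeExp_injective μ ν hm
    rfl)
  choose p hp using fun x : Rearr (blockColour μ ν) ×
    (Rearr (id : Fin μ.card → Fin μ.card) × (Fin μ.card → ℕ) × Word μ) ×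
    (Rearr (id : Fin ν.card → Fin ν.card) × (Fin ν.card → ℕ) × Word ν) =>
      exists_sgn_emb_pbw K o x.2.1.1 x.2.2.1 x.2.1.2.1 x.2.2.2.1 x.2.1.2.2 x.2.2.2.2
  -- The signs are absorbed as units, since rescaling by units preserves independence.
  have h3 := h2.units_smul fun x => if p x = 0 then (1 : Kˣ) else -1
  convert h3 using 1
  funext x
  rw [Function.comp_apply, arrMap_single]
  refine (congrArg _ (hp x)).trans ?_
  rw [mul_smul_comm, ← mul_assoc, ← tauProd_append]
  change _ = (if p x = 0 then (1 : Kˣ) else -1) • (_ : Alg K o (μ + ν))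
  rcases zmod_two_cases (p x) with h | h
  · rw [h, if_pos rfl, sgn_zero, one_smul, one_smul]
    rfl
  · rw [h, if_neg one_ne_zero, sgn_one, neg_one_smul, Units.smul_def, Units.val_neg, Units.val_one,
      neg_one_smul]
    rfl
  rfl

/-- The left ideal as a sum of copies of the tensor product. -/
def arrEquiv : (Rearr (blockColour μ ν) →₀ Alg K o μ ⊗[K] Alg K o ν) ≃ₗ[K] leftIdeal K o μ ν :=
  LinearEquiv.ofBijective (arrMap' K o μ ν)
    ⟨fun _ _ h => arrMap_injective K o μ ν (congrArg Subtype.val h), arrMap_surjective K o μ ν⟩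

theorem arrEquiv_single (c : Rearr (blockColour μ ν)) (a : Alg K o μ) (b : Alg K o ν) :
    (arrEquiv K o μ ν (Finsupp.single c (a ⊗ₜ b)) : Alg K o (μ + ν))
      = tauProd K o (word c.1) * emb K o μ ν a b := arrMap_single K o μ ν c a b

/-- The element `ρ_c 1_{μ,ν}`. -/
def arrElt (c : Rearr (blockColour μ ν)) : leftIdeal K o μ ν :=
  arrEquiv K o μ ν (Finsupp.single c (1 ⊗ₜ 1))

theorem coe_arrElt (c : Rearr (blockColour μ ν)) :
    (arrElt K o μ ν c : Alg K o (μ + ν)) = tauProd K o (word c.1) * idemp K o μ ν := by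
  rw [arrElt, arrEquiv_single, emb_one_one]

theorem arrEquiv_single_eq (c : Rearr (blockColour μ ν)) (a : Alg K o μ) (b : Alg K o ν) :
    arrEquiv K o μ ν (Finsupp.single c (a ⊗ₜ b)) = rightMul K o μ ν (arrElt K o μ ν c) a b := by
  apply Subtype.ext
  rw [arrEquiv_single]
  change _ = (arrElt K o μ ν c : Alg K o (μ + ν)) * _
  rw [coe_arrElt, mul_assoc, idemp_mul_emb]

theorem rightMul_arrEquiv_single (c : Rearr (blockColour μ ν)) {a' a : Alg K o μ} {b' b : Alg K o ν}
    {g h : ℤ × ZMod 2} (ha : a ∈ component K o μ g) (hb : b' ∈ component K o ν h) :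
    rightMul K o μ ν (arrEquiv K o μ ν (Finsupp.single c (a' ⊗ₜ b'))) a b
      = sgn (h.2 * g.2) • arrEquiv K o μ ν (Finsupp.single c ((a' * a) ⊗ₜ (b' * b))) := by
  apply Subtype.ext
  change (arrEquiv K o μ ν (Finsupp.single c (a' ⊗ₜ b')) : Alg K o (μ + ν)) * _
    = sgn (h.2 * g.2) • (arrEquiv K o μ ν (Finsupp.single c ((a' * a) ⊗ₜ (b' * b))) : Alg K o (μ + ν))
  rw [arrEquiv_single, arrEquiv_single, mul_assoc, emb_mul_emb K o ha hb, mul_smul_comm]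

end leftIdeal

/-! ### The superalgebra action on `M ⊗ N` and its extension to the left ideal. -/

section parity

variable {K : Type*} [Field K] {G : Type*} [DecidableEq G] {V : Type*} [AddCommGroup V]
  [Module K V] {𝒱 : G → Submodule K V}

/-- A linear map can be prescribed by scalars on the components of a grading. -/
theorem exists_scalar_on_components (h : DirectSum.IsInternal 𝒱) (f : G → K) :
    ∃ φ : V →ₗ[K] V, ∀ g, ∀ v ∈ 𝒱 g, φ v = f g • v := by
  let E := LinearEquiv.ofBijective (DirectSum.coeLinearMap 𝒱) h
  refine ⟨(DirectSum.toModule K G V fun g => f g • (𝒱 g).subtype) ∘ₗ E.symm.toLinearMap,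
    fun g v hv => ?_⟩
  have h1 : E (DirectSum.lof K G (fun g => 𝒱 g) g ⟨v, hv⟩) = v :=
    DirectSum.coeLinearMap_lof 𝒱 g ⟨v, hv⟩
  have h2 : E.symm v = DirectSum.lof K G (fun g => 𝒱 g) g ⟨v, hv⟩ :=
    E.symm_apply_eq.2 h1.symm
  rw [LinearMap.comp_apply, LinearEquiv.coe_coe, h2, DirectSum.toModule_lof]
  rfl

theorem internal_induction (h : DirectSum.IsInternal 𝒱) {p : V → Prop}
    (hom : ∀ g, ∀ v ∈ 𝒱 g, p v) (zero : p 0) (add : ∀ v w, p v → p w → p (v + w)) (v : V) : p v := by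
  have hv : v ∈ ⨆ g, 𝒱 g := by rw [h.submodule_iSup_eq_top]; exact Submodule.mem_top
  induction hv using Submodule.iSup_induction' with
  | mem g x hx => exact hom g x hx
  | zero => exact zero
  | add x y _ _ hx hy => exact add _ _ hx hy

end parity

section induced

variable (K : Type*) [Field K] {n : ℕ} (o : Orientation n) (μ ν : Multiset (Fin n))

/-- The part of parity `ε` of an element of the algebra. -/
def parityPart {κ : Multiset (Fin n)} (ε : ZMod 2) : Alg K o κ →ₗ[K] Alg K o κ :=
  (Finsupp.lsum K fun g : ℤ × ZMod 2 =>
    if g.2 = ε then (LinearMap.id : Alg K o κ →ₗ[K] Alg K o κ) else 0) ∘ₗ parts K o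

theorem parityPart_of_mem {κ : Multiset (Fin n)} (ε : ZMod 2) {g : ℤ × ZMod 2} {b : Alg K o κ}
    (hb : b ∈ component K o κ g) : parityPart K o ε b = if g.2 = ε then b else 0 := by
  rw [parityPart, LinearMap.comp_apply, parts_of_mem K o hb, Finsupp.lsum_single]
  split_ifs <;> rfl

variable {M : Type*} [AddCommGroup M] [Module K M] [Module (Alg K o μ) M]
  [IsScalarTower K (Alg K o μ) M]
  {N : Type*} [AddCommGroup N] [Module K N] [Module (Alg K o ν) N]
  [IsScalarTower K (Alg K o ν) N]

variable (N) in
/-- The action of the tensor product of superalgebras on `M ⊗ N`, where `σ` is the parity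
involution of `M`. -/
def superAct (σ : M →ₗ[K] M) :
    Alg K o μ ⊗[K] Alg K o ν →ₗ[K] (M ⊗[K] N →ₗ[K] M ⊗[K] N) :=
  TensorProduct.homTensorHomMap (RingHom.id K) M N M N ∘ₗ
    TensorProduct.map (Algebra.lsmul K K M).toLinearMap
      ((Algebra.lsmul K K N).toLinearMap ∘ₗ parityPart K o 0)
  + TensorProduct.homTensorHomMap (RingHom.id K) M N M N ∘ₗ
    TensorProduct.map (LinearMap.mulRight K σ ∘ₗ (Algebra.lsmul K K M).toLinearMap)
      ((Algebra.lsmul K K N).toLinearMap ∘ₗ parityPart K o 1)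

theorem superAct_tmul {σ : M →ₗ[K] M} {ℳ : ℤ × ZMod 2 → Submodule K M}
    (hσ : ∀ g, ∀ m ∈ ℳ g, σ m = sgn g.2 • m) (a : Alg K o μ) {b : Alg K o ν} {g g' : ℤ × ZMod 2}
    (hb : b ∈ component K o ν g) {m : M} (hm : m ∈ ℳ g') (v : N) :
    superAct K o μ ν N σ (a ⊗ₜ b) (m ⊗ₜ v) = sgn (g.2 * g'.2) • ((a • m) ⊗ₜ[K] (b • v)) := by
  have h1 : superAct K o μ ν N σ (a ⊗ₜ b) (m ⊗ₜ v)
      = (a • m) ⊗ₜ[K] (parityPart K o 0 b • v) + (a • σ m) ⊗ₜ[K] (parityPart K o 1 b • v) := rfl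
  rw [h1, parityPart_of_mem K o 0 hb, parityPart_of_mem K o 1 hb, hσ g' m hm]
  have h2 : a • (sgn g'.2 • m) = sgn g'.2 • (a • m) := smul_comm _ _ _
  rw [h2]
  rcases zmod_two_cases g.2 with h | h
  · rw [h, if_pos rfl, if_neg (by decide), zero_mul, sgn_zero, one_smul, zero_smul,
      TensorProduct.tmul_zero, add_zero]
  · rw [h, if_neg (by decide), if_pos rfl, one_mul, zero_smul, TensorProduct.tmul_zero, zero_add,
      TensorProduct.smul_tmul']

theorem superAct_one {σ : M →ₗ[K] M} {ℳ : ℤ × ZMod 2 → Submodule K M}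
    (hℳ : DirectSum.IsInternal ℳ)
    (hσ : ∀ g, ∀ m ∈ ℳ g, σ m = sgn g.2 • m) (x : M ⊗[K] N) :
    superAct K o μ ν N σ (1 ⊗ₜ 1) x = x := by
  induction x with
  | zero => rw [map_zero]
  | add x y hx hy => rw [map_add, hx, hy]
  | tmul m v =>
    induction m using internal_induction hℳ with
    | hom g m hm =>
      rw [superAct_tmul K o μ ν hσ 1 (one_mem_component K o) hm]
      simp [sgn_zero]
    | zero => rw [TensorProduct.zero_tmul, map_zero]
    | add m m' h h' => rw [TensorProduct.add_tmul, map_add, h, h']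

variable (N) in
/-- The map `ρ_c (a ⊗ b) ⊗ x ↦ (c, (a ⊗ b) x)`. -/
def unfoldMap (σ : M →ₗ[K] M) :
    leftIdeal K o μ ν ⊗[K] (M ⊗[K] N) →ₗ[K] (Rearr (blockColour μ ν) →₀ M ⊗[K] N) :=
  TensorProduct.lift ((Finsupp.lsum K fun c =>
    (LinearMap.compRight K (Finsupp.lsingle (R := K) (M := M ⊗[K] N) c)) ∘ₗ superAct K o μ ν N σ) ∘ₗ
      (arrEquiv K o μ ν).symm.toLinearMap)

theorem unfoldMap_tmul (σ : M →ₗ[K] M) (c : Rearr (blockColour μ ν))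
    (t : Alg K o μ ⊗[K] Alg K o ν) (x : M ⊗[K] N) :
    unfoldMap K o μ ν N σ (arrEquiv K o μ ν (Finsupp.single c t) ⊗ₜ x)
      = Finsupp.single c (superAct K o μ ν N σ t x) := by
  rw [unfoldMap, TensorProduct.lift.tmul, LinearMap.comp_apply, LinearEquiv.coe_coe,
    LinearEquiv.symm_apply_apply, Finsupp.lsum_single]
  rfl

theorem rightMul_add (h h' : leftIdeal K o μ ν) (a : Alg K o μ) (b : Alg K o ν) :
    rightMul K o μ ν (h + h') a b = rightMul K o μ ν h a b + rightMul K o μ ν h' a b :=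
  Subtype.ext (add_mul _ _ _)

theorem rightMul_zero (a : Alg K o μ) (b : Alg K o ν) : rightMul K o μ ν 0 a b = 0 :=
  Subtype.ext (zero_mul _)

theorem rightMul_add_left (h : leftIdeal K o μ ν) (a a' : Alg K o μ) (b : Alg K o ν) :
    rightMul K o μ ν h (a + a') b = rightMul K o μ ν h a b + rightMul K o μ ν h a' b :=
  Subtype.ext ((congrArg _ (emb_add_left K o a a' b)).trans (mul_add _ _ _))

theorem rightMul_zero_left (h : leftIdeal K o μ ν) (b : Alg K o ν) :
    rightMul K o μ ν h 0 b = 0 := by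
  have := rightMul_add_left K o μ ν h 0 0 b
  rw [add_zero] at this
  exact left_eq_add.1 this

/-- This is the compatibility of the inverse map with the relations of the induced module. By
freeness the left ideal element may be taken as `ρ_c (a' ⊗ b')` with homogeneous `a'`, `b'`, and the
claim becomes associativity of the superalgebra action. -/
theorem unfoldMap_balanced {σ : M →ₗ[K] M} {ℳ : ℤ × ZMod 2 → Submodule K M}
    (hM : IsGradedModule o μ ℳ) (hσ : ∀ g, ∀ m ∈ ℳ g, σ m = sgn g.2 • m) {g g' : ℤ × ZMod 2}
    (h : leftIdeal K o μ ν) (a : Alg K o μ) {b : Alg K o ν} {m : M} (v : N)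
    (hb : b ∈ component K o ν g) (hm : m ∈ ℳ g') :
    unfoldMap K o μ ν N σ (rightMul K o μ ν h a b ⊗ₜ (m ⊗ₜ v))
      = sgn (g.2 * g'.2) • unfoldMap K o μ ν N σ (h ⊗ₜ ((a • m) ⊗ₜ (b • v))) := by
  obtain ⟨x, rfl⟩ := (arrEquiv K o μ ν).surjective h
  induction a using homogeneous_induction with
  | zero => simp [rightMul_zero_left]
  | add a a' ha ha' =>
    rw [rightMul_add_left, TensorProduct.add_tmul, map_add, ha, ha', add_smul,
      TensorProduct.add_tmul, TensorProduct.tmul_add, map_add, smul_add]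
  | hom ga a ha =>
    induction x using arr_induction with
    | zero => simp [rightMul_zero]
    | add x x' hx hx' =>
      rw [map_add, rightMul_add, TensorProduct.add_tmul, map_add, hx, hx',
        TensorProduct.add_tmul, map_add, smul_add]
    | hom c g₁ g₂ a' ha' b' hb' =>
      rw [rightMul_arrEquiv_single K o μ ν c ha hb', ← TensorProduct.smul_tmul', map_zsmul,
        unfoldMap_tmul, unfoldMap_tmul,
        superAct_tmul K o μ ν hσ _ (mul_mem_component K o hb' hb) hm,
        superAct_tmul K o μ ν hσ _ hb' (hM.smul_mem _ _ _ _ ha hm), mul_smul, mul_smul,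
        ← Finsupp.smul_single, ← Finsupp.smul_single, smul_smul (sgn _) (sgn _), ← sgn_add,
        smul_smul (sgn _) (sgn _), ← sgn_add]
      -- Both signs are the sum of the three contributions of moving `b'` past `a`, `b'` past `m`,
      -- and `b` past `m`.
      congr 2
      simp only [Prod.snd_add]
      ring

end induced

/-! ### The underlying space of the induced module -/

section induced

variable (K : Type*) [Field K] {n : ℕ} (o : Orientation n) (μ ν : Multiset (Fin n))
variable {M : Type*} [AddCommGroup M] [Module K M] [Module (Alg K o μ) M]
  [IsScalarTower K (Alg K o μ) M]
  {N : Type*} [AddCommGroup N] [Module K N] [Module (Alg K o ν) N]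
  [IsScalarTower K (Alg K o ν) N]

theorem smul_rightMul (a' : Alg K o (μ + ν)) (h : leftIdeal K o μ ν) (a : Alg K o μ)
    (b : Alg K o ν) : a' • rightMul K o μ ν h a b = rightMul K o μ ν (a' • h) a b :=
  Subtype.ext (mul_assoc _ _ _).symm

theorem unfoldMap_of_mem_balanced {σ : M →ₗ[K] M} {ℳ : ℤ × ZMod 2 → Submodule K M}
    (hM : IsGradedModule o μ ℳ) (hσ : ∀ g, ∀ m ∈ ℳ g, σ m = sgn g.2 • m)
    {x : leftIdeal K o μ ν ⊗[K] (M ⊗[K] N)} (hx : x ∈ balanced K o μ ν ℳ N) :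
    unfoldMap K o μ ν N σ x = 0 := by
  -- The relations generate a submodule over `H⁻(μ + ν)`, while the map is only `K`-linear, so the
  -- vanishing is proved for all multiples at once.
  have key : ∀ a' : Alg K o (μ + ν), unfoldMap K o μ ν N σ (a' • x) = 0 := by
    induction hx using Submodule.span_induction with
    | mem x hx =>
      obtain ⟨g, g', h, a, b, m, v, hb, hm, rfl⟩ := hx
      intro a'
      rw [smul_sub, smul_comm a' (sgn _), TensorProduct.smul_tmul', TensorProduct.smul_tmul',
        smul_rightMul, map_sub, map_zsmul, unfoldMap_balanced K o μ ν hM hσ _ a v hb hm, sub_self]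
    | zero => intro a'; rw [smul_zero, map_zero]
    | add x y _ _ hx hy => intro a'; rw [smul_add, map_add, hx, hy, add_zero]
    | smul a x _ hx => intro a'; rw [smul_smul]; exact hx _
  simpa using key 1

variable (N) in
/-- The map `(c, x) ↦ ρ_c 1_{μ,ν} ⊗ x` to the tensor product over the ground field. -/
def foldTensor (M : Type*) [AddCommGroup M] [Module K M] :
    (Rearr (blockColour μ ν) →₀ M ⊗[K] N) →ₗ[K] leftIdeal K o μ ν ⊗[K] (M ⊗[K] N) :=
  Finsupp.lsum K fun c => TensorProduct.mk K _ _ (arrElt K o μ ν c)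

theorem foldTensor_single (c : Rearr (blockColour μ ν)) (x : M ⊗[K] N) :
    foldTensor K o μ ν N M (Finsupp.single c x) = arrElt K o μ ν c ⊗ₜ x := by
  rw [foldTensor, Finsupp.lsum_single, TensorProduct.mk_apply]

theorem unfoldMap_foldTensor {σ : M →ₗ[K] M} {ℳ : ℤ × ZMod 2 → Submodule K M}
    (hM : IsGradedModule o μ ℳ) (hσ : ∀ g, ∀ m ∈ ℳ g, σ m = sgn g.2 • m)
    (x : Rearr (blockColour μ ν) →₀ M ⊗[K] N) :
    unfoldMap K o μ ν N σ (foldTensor K o μ ν N M x) = x := by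
  induction x using Finsupp.induction_linear with
  | zero => rw [map_zero, map_zero]
  | add x y hx hy => rw [map_add, map_add, hx, hy]
  | single c x =>
    rw [foldTensor_single, arrElt, unfoldMap_tmul, superAct_one K o μ ν hM.isInternal hσ]

/-- The map `(c, x) ↦ ρ_c 1_{μ,ν} ⊗ x` to the induced module. -/
def foldMap (ℳ : ℤ × ZMod 2 → Submodule K M) (N : Type*) [AddCommGroup N] [Module K N]
    [Module (Alg K o ν) N] : (Rearr (blockColour μ ν) →₀ M ⊗[K] N) →ₗ[K] Ind K o μ ν ℳ N :=
  ((balanced K o μ ν ℳ N).mkQ.restrictScalars K) ∘ₗ foldTensor K o μ ν N M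

theorem foldMap_single (ℳ : ℤ × ZMod 2 → Submodule K M) (c : Rearr (blockColour μ ν))
    (x : M ⊗[K] N) : foldMap K o μ ν ℳ N (Finsupp.single c x)
      = (balanced K o μ ν ℳ N).mkQ (arrElt K o μ ν c ⊗ₜ x) :=
  congrArg _ (foldTensor_single K o μ ν c x)

theorem mkQ_rightMul_tmul (ℳ : ℤ × ZMod 2 → Submodule K M) {g g' : ℤ × ZMod 2}
    (h : leftIdeal K o μ ν) (a : Alg K o μ) {b : Alg K o ν} {m : M} (v : N)
    (hb : b ∈ component K o ν g) (hm : m ∈ ℳ g') :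
    (balanced K o μ ν ℳ N).mkQ (rightMul K o μ ν h a b ⊗ₜ (m ⊗ₜ v))
      = sgn (g.2 * g'.2) • (balanced K o μ ν ℳ N).mkQ (h ⊗ₜ ((a • m) ⊗ₜ (b • v))) := by
  rw [← map_zsmul]
  exact (Submodule.Quotient.eq _).2 (Submodule.subset_span ⟨g, g', h, a, b, m, v, hb, hm, rfl⟩)

theorem mkQ_arrEquiv_tmul (ℳ : ℤ × ZMod 2 → Submodule K M) {g g' : ℤ × ZMod 2}
    (c : Rearr (blockColour μ ν)) (a : Alg K o μ) {b : Alg K o ν} {m : M} (v : N)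
    (hb : b ∈ component K o ν g) (hm : m ∈ ℳ g') :
    (balanced K o μ ν ℳ N).mkQ (arrEquiv K o μ ν (Finsupp.single c (a ⊗ₜ b)) ⊗ₜ (m ⊗ₜ v))
      = sgn (g.2 * g'.2) • foldMap K o μ ν ℳ N (Finsupp.single c ((a • m) ⊗ₜ (b • v))) := by
  rw [arrEquiv_single_eq, mkQ_rightMul_tmul K o μ ν ℳ _ a v hb hm, foldMap_single]

/-- `unfoldMap` is a left inverse on the level of tensors over `K` and vanishes on the relations.
The scalars `(-1)^{p(m)}` on the components of `M` provide the parity involution that it requires.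
-/
theorem foldMap_injective {ℳ : ℤ × ZMod 2 → Submodule K M} (hM : IsGradedModule o μ ℳ) :
    Function.Injective (foldMap K o μ ν ℳ N) := by
  obtain ⟨σ, hσ⟩ := exists_scalar_on_components hM.isInternal fun g => (sgn g.2 : K)
  have hσ' : ∀ g, ∀ m ∈ ℳ g, σ m = sgn g.2 • m := fun g m hm => by
    rw [hσ g m hm, Int.cast_smul_eq_zsmul]
  refine (injective_iff_map_eq_zero _).2 fun x hx => ?_
  have h1 : foldTensor K o μ ν N M x ∈ balanced K o μ ν ℳ N :=
    (Submodule.Quotient.mk_eq_zero _).1 hx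
  rw [← unfoldMap_foldTensor K o μ ν hM hσ' x]
  exact unfoldMap_of_mem_balanced K o μ ν hM hσ' h1

/-- Every element of the left ideal is a sum of terms `ρ_c (a ⊗ b)`, and the factor `a ⊗ b` is moved
to `M ⊗ N` by the relations, up to sign. -/
theorem foldMap_surjective {ℳ : ℤ × ZMod 2 → Submodule K M} (hM : IsGradedModule o μ ℳ) :
    Function.Surjective (foldMap K o μ ν ℳ N) := by
  intro q
  obtain ⟨t, rfl⟩ := Submodule.mkQ_surjective _ q
  change _ ∈ LinearMap.range (foldMap K o μ ν ℳ N)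
  induction t with
  | zero => rw [map_zero]; exact zero_mem _
  | add t t' ht ht' => rw [map_add]; exact add_mem ht ht'
  | tmul h x =>
    obtain ⟨h, rfl⟩ := (arrEquiv K o μ ν).surjective h
    induction x with
    | zero => rw [TensorProduct.tmul_zero, map_zero]; exact zero_mem _
    | add x x' hx hx' => rw [TensorProduct.tmul_add, map_add]; exact add_mem hx hx'
    | tmul m v =>
      induction m using internal_induction hM.isInternal with
      | zero => rw [TensorProduct.zero_tmul, TensorProduct.tmul_zero, map_zero]; exact zero_mem _
      | add m m' hm hm' =>
        rw [TensorProduct.add_tmul, TensorProduct.tmul_add, map_add]; exact add_mem hm hm'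
      | hom g' m hm =>
        induction h using arr_induction with
        | zero => rw [map_zero, TensorProduct.zero_tmul, map_zero]; exact zero_mem _
        | add h h' hh hh' =>
          rw [map_add, TensorProduct.add_tmul, map_add]; exact add_mem hh hh'
        | hom c g₁ g a ha b hb =>
          rw [mkQ_arrEquiv_tmul K o μ ν ℳ c a v hb hm]
          exact zsmul_mem (LinearMap.mem_range_self _ _) _

/-- The induced module is a sum of copies of `M ⊗ N`. -/
def foldEquiv {ℳ : ℤ × ZMod 2 → Submodule K M} (hM : IsGradedModule o μ ℳ) (N : Type*)
    [AddCommGroup N] [Module K N] [Module (Alg K o ν) N] [IsScalarTower K (Alg K o ν) N] :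
    (Rearr (blockColour μ ν) →₀ M ⊗[K] N) ≃ₗ[K] Ind K o μ ν ℳ N :=
  LinearEquiv.ofBijective (foldMap K o μ ν ℳ N)
    ⟨foldMap_injective K o μ ν hM, foldMap_surjective K o μ ν hM⟩

end induced

/-! ### Bases of homogeneous weight vectors -/

section graded

variable {K : Type*} [Field K] {V : Type*} [AddCommGroup V] [Module K V]

/-- A family of subspaces with compatible projections is independent. -/
theorem isInternal_of_projections {ι : Type*} [DecidableEq ι] {𝒜 : ι → Submodule K V}
    (p : ι → V →ₗ[K] V) (hp : ∀ x, ∀ v ∈ 𝒜 x, p x v = v)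
    (hp' : ∀ x y, y ≠ x → ∀ v ∈ 𝒜 y, p x v = 0) (h : ⨆ x, 𝒜 x = ⊤) :
    DirectSum.IsInternal 𝒜 := by
  refine (DirectSum.isInternal_submodule_iff_iSupIndep_and_iSup_eq_top 𝒜).2 ⟨fun x => ?_, h⟩
  refine Submodule.disjoint_def.2 fun v hv hv' => ?_
  have h1 : (⨆ y, ⨆ (_ : y ≠ x), 𝒜 y) ≤ LinearMap.ker (p x) :=
    iSup₂_le fun y hy v hv => hp' x y hy v hv
  rw [← hp x v hv]
  exact h1 hv'

/-- A basis indexed over degrees gives a grading. -/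
theorem isInternal_of_basis {ι G : Type*} [DecidableEq G] (b : Module.Basis ι K V) (d : ι → G) :
    DirectSum.IsInternal fun g => Submodule.span K (b '' {x | d x = g}) := by
  classical
  refine isInternal_of_projections
    (fun g => b.constr K fun x => if d x = g then b x else 0) ?_ ?_ ?_
  · intro g v hv
    induction hv using Submodule.span_induction with
    | mem v hv =>
      obtain ⟨x, hx, rfl⟩ := hv
      exact (b.constr_basis K _ x).trans (if_pos hx)
    | zero => rw [map_zero]
    | add v w _ _ hv hw => rw [map_add, hv, hw]
    | smul t v _ hv => rw [map_smul, hv]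
  · intro g g' hg v hv
    induction hv using Submodule.span_induction with
    | mem v hv =>
      obtain ⟨x, hx, rfl⟩ := hv
      rw [Module.Basis.constr_basis, if_neg]
      rintro rfl
      exact hg hx.symm
    | zero => rw [map_zero]
    | add v w _ _ hv hw => rw [map_add, hv, hw, add_zero]
    | smul t v _ hv => rw [map_smul, hv, smul_zero]
  · rw [eq_top_iff, ← b.span_eq, Submodule.span_le]
    rintro _ ⟨x, rfl⟩
    exact Submodule.mem_iSup_of_mem (d x) (Submodule.subset_span ⟨x, rfl, rfl⟩)

variable {n : ℕ} {o : Orientation n} {ν : Multiset (Fin n)} [Module (Alg K o ν) V]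
  [IsScalarTower K (Alg K o ν) V]

/-- The basis `b` consists of homogeneous weight vectors, with weights `w` and degrees `d`. -/
structure IsAdapted {β : Type*} (o : Orientation n) (𝒱 : ℤ × ZMod 2 → Submodule K V)
    [Module (Alg K o ν) V] (b : Module.Basis β K V) (w : β → Word ν) (d : β → ℤ × ZMod 2) :
    Prop where
  mem : ∀ x, b x ∈ 𝒱 (d x)
  smul_self : ∀ x, e K o (w x) • b x = b x

theorem e_smul_of_ne {i j : Word ν} (h : i ≠ j) {v : V} (hv : e K o j • v = v) :
    e K o i • v = 0 := by
  rw [← hv, smul_smul, e_mul_e, if_neg h, zero_smul]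

theorem e_smul_e_smul (i : Word ν) (v : V) : e K o i • e K o i • v = e K o i • v := by
  rw [smul_smul, e_mul_e, if_pos rfl]

theorem e_smul_mem {𝒱 : ℤ × ZMod 2 → Submodule K V} (hV : IsGradedModule o ν 𝒱) (i : Word ν)
    {g : ℤ × ZMod 2} {v : V} (hv : v ∈ 𝒱 g) : e K o i • v ∈ 𝒱 g := by
  have h := hV.smul_mem 0 g _ v (e_mem_component K o i) hv
  rwa [zero_add] at h

/-- The projections to the homogeneous parts of the weight spaces. -/
theorem exists_weight_projection {𝒱 : ℤ × ZMod 2 → Submodule K V} (hV : IsGradedModule o ν 𝒱)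
    (i : Word ν) (g : ℤ × ZMod 2) : ∃ p : V →ₗ[K] V,
      (∀ v ∈ 𝒱 g, e K o i • v = v → p v = v) ∧
      ∀ (j : Word ν) (h : ℤ × ZMod 2), (j, h) ≠ (i, g) → ∀ v ∈ 𝒱 h, e K o j • v = v → p v = 0 := by
  obtain ⟨φ, hφ⟩ := exists_scalar_on_components hV.isInternal fun h => if h = g then (1 : K) else 0
  refine ⟨Algebra.lsmul K K V (e K o i) ∘ₗ φ, fun v hv hi => ?_, fun j h hne v hv hj => ?_⟩
  · change e K o i • φ v = v
    rw [hφ g v hv, if_pos rfl, one_smul, hi]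
  · change e K o i • φ v = 0
    rw [hφ h v hv]
    by_cases hh : h = g
    · have hij : i ≠ j := by rintro rfl; exact hne (by rw [hh])
      rw [if_pos hh, one_smul, e_smul_of_ne hij hj]
    · rw [if_neg hh, zero_smul, smul_zero]

/-- The idempotents `e(𝐢)` have degree zero, are orthogonal and sum to `1`, so the weight spaces
refine the grading; bases of the pieces are put together. -/
theorem exists_isAdapted [Module.Finite K V] {𝒱 : ℤ × ZMod 2 → Submodule K V}
    (hV : IsGradedModule o ν 𝒱) : ∃ (β : Type) (_ : Fintype β) (b : Module.Basis β K V)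
      (w : β → Word ν) (d : β → ℤ × ZMod 2), IsAdapted o 𝒱 b w d := by
  let 𝒜 : Word ν × (ℤ × ZMod 2) → Submodule K V := fun x =>
    { carrier := {v | v ∈ 𝒱 x.2 ∧ e K o x.1 • v = v}
      add_mem' := fun ha hb => ⟨add_mem ha.1 hb.1, by rw [smul_add, ha.2, hb.2]⟩
      zero_mem' := ⟨zero_mem _, smul_zero _⟩
      smul_mem' := fun t v hv => ⟨Submodule.smul_mem _ t hv.1, by
        rw [smul_algebra_smul_comm, hv.2]⟩ }
  choose p hp hp' using fun x : Word ν × (ℤ × ZMod 2) => exists_weight_projection hV x.1 x.2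
  have hint : DirectSum.IsInternal 𝒜 := by
    refine isInternal_of_projections p (fun x v hv => hp x v hv.1 hv.2)
      (fun x y hy v hv => hp' x y.1 y.2 hy v hv.1 hv.2) (Submodule.eq_top_iff'.2 fun v => ?_)
    induction v using internal_induction hV.isInternal with
    | zero => exact zero_mem _
    | add v v' hv hv' => exact add_mem hv hv'
    | hom g v hv =>
      have h1 : v = ∑ i : Word ν, e K o i • v := by rw [← Finset.sum_smul, sum_e, one_smul]
      rw [h1]
      exact sum_mem fun i _ => Submodule.mem_iSup_of_mem (p := 𝒜) (i, g)
        ⟨e_smul_mem hV i hv, e_smul_e_smul i v⟩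
  let b := hint.collectedBasis fun x => Module.finBasis K (𝒜 x)
  have hb : ∀ x, b x ∈ 𝒜 x.1 := fun x => hint.collectedBasis_mem _ x
  have := Module.Finite.finite_basis b
  exact ⟨_, Fintype.ofFinite _, b, fun x => x.1.1, fun x => x.1.2, fun x => (hb x).1,
    fun x => (hb x).2⟩

/-- The projection to the piece of weight `i` and degree `g` fixes `v`, and it kills all basis
vectors that are not of this weight and degree. -/
theorem IsAdapted.mem_span {β : Type*} {𝒱 : ℤ × ZMod 2 → Submodule K V}
    (hV : IsGradedModule o ν 𝒱) {b : Module.Basis β K V} {w : β → Word ν} {d : β → ℤ × ZMod 2}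
    (hb : IsAdapted o 𝒱 b w d) {i : Word ν} {g : ℤ × ZMod 2} {v : V} (hv : v ∈ 𝒱 g)
    (hi : e K o i • v = v) : v ∈ Submodule.span K (b '' {x | w x = i ∧ d x = g}) := by
  obtain ⟨p, hp, hp'⟩ := exists_weight_projection hV i g
  rw [← hp v hv hi]
  have hv' : v ∈ Submodule.span K (Set.range b) := by rw [b.span_eq]; exact Submodule.mem_top
  clear hv hi
  induction hv' using Submodule.span_induction with
  | zero => rw [map_zero]; exact zero_mem _
  | smul t x _ hx => rw [map_smul]; exact Submodule.smul_mem _ t hx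
  | add v v' _ _ hv hv' => rw [map_add]; exact add_mem hv hv'
  | mem v hv =>
    obtain ⟨x, rfl⟩ := hv
    by_cases h : (w x, d x) = (i, g)
    · rw [Prod.mk.injEq] at h
      obtain ⟨rfl, rfl⟩ := h
      rw [hp _ (hb.mem x) (hb.smul_self x)]
      exact Submodule.subset_span ⟨x, ⟨rfl, rfl⟩, rfl⟩
    · rw [hp' _ _ h _ (hb.mem x) (hb.smul_self x)]
      exact zero_mem _

theorem IsAdapted.finrank_eq {β : Type*} [Fintype β] [DecidableEq β]
    {𝒱 : ℤ × ZMod 2 → Submodule K V}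
    (hV : IsGradedModule o ν 𝒱) {b : Module.Basis β K V} {w : β → Word ν} {d : β → ℤ × ZMod 2}
    (hb : IsAdapted o 𝒱 b w d) (i : Word ν) (g : ℤ × ZMod 2) :
    Module.finrank K (LinearMap.range (Algebra.lsmul K K V (e K o i)) ⊓ 𝒱 g : Submodule K V)
      = ∑ x, if w x = i ∧ d x = g then 1 else 0 := by
  have h1 : (LinearMap.range (Algebra.lsmul K K V (e K o i)) ⊓ 𝒱 g : Submodule K V)
      = Submodule.span K (Set.range fun x : {x // w x = i ∧ d x = g} => b x) := by
    refine le_antisymm ?_ (Submodule.span_le.2 ?_)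
    · rintro v ⟨⟨v', rfl⟩, hv⟩
      have h2 := hb.mem_span hV hv (e_smul_e_smul i v')
      rwa [Set.image_eq_range] at h2
    · rintro _ ⟨⟨x, rfl, rfl⟩, rfl⟩
      exact ⟨⟨b x, hb.smul_self x⟩, hb.mem x⟩
  have h3 : LinearIndependent K fun x : {x // w x = i ∧ d x = g} => b x :=
    b.linearIndependent.comp _ Subtype.val_injective
  rw [h1, finrank_span_eq_card h3, Fintype.card_subtype, Finset.card_filter]

/-- The signed power of `q` that belongs to a degree. -/
def weight (g : ℤ × ZMod 2) : RatFunc ℚ := (sgn g.2 : RatFunc ℚ) * (RatFunc.X : RatFunc ℚ) ^ g.1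

theorem weight_zero : weight 0 = 1 := by simp [weight, sgn]

theorem weight_add (g h : ℤ × ZMod 2) : weight (g + h) = weight g * weight h := by
  rw [weight, weight, weight, Prod.snd_add, Prod.fst_add, sgn_add, zpow_add₀ RatFunc.X_ne_zero,
    Int.cast_mul]
  ring

theorem IsAdapted.qdim_eq {β : Type*} [Fintype β] {𝒱 : ℤ × ZMod 2 → Submodule K V}
    (hV : IsGradedModule o ν 𝒱) {b : Module.Basis β K V} {w : β → Word ν} {d : β → ℤ × ZMod 2}
    (hb : IsAdapted o 𝒱 b w d) (i : Word ν) :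
    qdim 𝒱 (LinearMap.range (Algebra.lsmul K K V (e K o i)))
      = ∑ x, if w x = i then weight (d x) else 0 := by
  classical
  have h1 : ∀ k : ℤ,
      (((Module.finrank K (LinearMap.range (Algebra.lsmul K K V (e K o i)) ⊓ 𝒱 (k, 0) :
          Submodule K V) : ℤ)
        - (Module.finrank K (LinearMap.range (Algebra.lsmul K K V (e K o i)) ⊓ 𝒱 (k, 1) :
          Submodule K V) : ℤ) : ℤ) : RatFunc ℚ) * (RatFunc.X : RatFunc ℚ) ^ k
        = ∑ x, if k = (d x).1 then (if w x = i then weight (d x) else 0) else 0 := by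
    intro k
    rw [hb.finrank_eq hV, hb.finrank_eq hV]
    push_cast
    rw [← Finset.sum_sub_distrib, Finset.sum_mul]
    refine Finset.sum_congr rfl fun x _ => ?_
    by_cases hw : w x = i
    · by_cases hk : k = (d x).1
      · rcases zmod_two_cases (d x).2 with h | h
        · have h0 : d x = (k, 0) := Prod.ext hk.symm h
          simp [hw, h0, weight, sgn]
        · have h0 : d x = (k, 1) := Prod.ext hk.symm h
          simp [hw, h0, weight, sgn_one]
      · have h0 : d x ≠ (k, 0) := fun h => hk (by rw [h])
        have h1 : d x ≠ (k, 1) := fun h => hk (by rw [h])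
        simp [h0, h1, hk]
    · simp [hw]
  unfold qdim
  rw [finsum_congr h1, finsum_sum_comm]
  · refine Finset.sum_congr rfl fun x _ => ?_
    rw [finsum_eq_single _ (d x).1 fun k hk => if_neg hk, if_pos rfl]
  · intro x _
    refine (Set.finite_singleton (d x).1).subset fun k hk => ?_
    by_contra h
    exact hk (if_neg h)

theorem IsAdapted.character_eq {β : Type*} [Fintype β] {𝒱 : ℤ × ZMod 2 → Submodule K V}
    (hV : IsGradedModule o ν 𝒱) {b : Module.Basis β K V} {w : β → Word ν} {d : β → ℤ × ZMod 2}
    (hb : IsAdapted o 𝒱 b w d) :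
    character o ν 𝒱 = ∑ x, Finsupp.single (w x).toList (weight (d x)) := by
  unfold character
  simp_rw [hb.qdim_eq hV]
  have h : ∀ i : Word ν, (Finsupp.single i.toList (∑ x, if w x = i then weight (d x) else 0) :
      Shuffle n) = ∑ x, if w x = i then Finsupp.single (w x).toList (weight (d x)) else 0 := by
    intro i
    rw [Finsupp.single_finsetSum]
    refine Finset.sum_congr rfl fun x _ => ?_
    split_ifs with h
    · rw [h]
    · exact Finsupp.single_zero _
  rw [Finset.sum_congr rfl fun i _ => h i, Finset.sum_comm]
  refine Finset.sum_congr rfl fun x _ => ?_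
  rw [Finset.sum_ite_eq, if_pos (Finset.mem_univ _)]

end graded

/-! ### The grading of the induced module -/

section degrees

variable (K : Type*) [Field K] {n : ℕ} (o : Orientation n) {μ ν : Multiset (Fin n)}

/-- The degree of `τ_L e(𝐢)`. -/
def tauDeg : List (Fin (ν.card - 1)) → Word ν → ℤ × ZMod 2
  | [], _ => 0
  | r :: L, k => degTau r (k.rearrange (permOf L)) + tauDeg L k

theorem tauProd_mul_e_eq (L : List (Fin (ν.card - 1))) (k : Word ν) :
    tauProd K o L * e K o k = e K o (k.rearrange (permOf L)) * tauProd K o L := by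
  induction L with
  | nil =>
    rw [tauProd_nil, one_mul, mul_one]
    rfl
  | cons r L ih =>
    rw [tauProd_cons, mul_assoc, ih, ← mul_assoc, tau_mul_e, mul_assoc]
    rfl

theorem e_mul_tauProd_mul_e (L : List (Fin (ν.card - 1))) (k : Word ν) :
    e K o (k.rearrange (permOf L)) * (tauProd K o L * e K o k) = tauProd K o L * e K o k := by
  rw [tauProd_mul_e_eq, e_mul_e_self]

theorem tauProd_mul_e_mem_component (L : List (Fin (ν.card - 1))) (k : Word ν) :
    tauProd K o L * e K o k ∈ component K o ν (tauDeg L k) := by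
  induction L with
  | nil => rw [tauProd_nil, one_mul]; exact e_mem_component K o k
  | cons r L ih =>
    have h : tauProd K o (r :: L) * e K o k
        = tau K o r * e K o (k.rearrange (permOf L)) * (tauProd K o L * e K o k) := by
      rw [tauProd_cons, mul_assoc, mul_assoc, e_mul_tauProd_mul_e]
    rw [h]
    exact mul_mem_component K o (tau_mul_e_mem_component K o r _) ih

/-- The degree of a crossing of two coloured letters, which is counted when the colours are in
decreasing order. -/
def crossDeg (a b : Bool × Fin n) : ℤ × ZMod 2 :=
  if b.1 < a.1 then (-form a.2 b.2, par a.2 * par b.2) else 0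

/-- The coloured word that an arrangement of the colours leads to. -/
def colouredWord (c : Rearr (blockColour μ ν)) (k : Word (μ + ν)) (x : Fin (μ + ν).card) :
    Bool × Fin n := (c.1 x, (k.rearrange (permOf (word c.1))).1 x)

theorem colouredWord_swap (c : Rearr (blockColour μ ν)) (k : Word (μ + ν))
    (r : Fin ((μ + ν).card - 1)) (hw : word c.1 = r :: word (c.swap r).1) :
    colouredWord c k = colouredWord (c.swap r) k ∘ adjSwap r := by
  funext x
  simp only [colouredWord, Function.comp_apply, hw, permOf, Rearr.swap, Prod.mk.injEq,
    Equiv.swap_apply_self, true_and]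
  rfl

theorem colouredWord_base (k : Word (μ + ν)) (x : Fin (μ + ν).card) :
    colouredWord ⟨blockColour μ ν, rfl⟩ k x = (blockColour μ ν x, k.1 x) := by
  simp only [colouredWord, word_of_monotone blockColour_monotone, permOf]
  rfl

/-- Each letter of the canonical word exchanges two letters of different colours and so creates
exactly one new crossing. The degree thus depends only on the coloured word reached and not on the
chosen reduced word. -/
theorem tauDeg_word (c : Rearr (blockColour μ ν)) (k : Word (μ + ν)) :
    tauDeg (word c.1) k = pairSum crossDeg (colouredWord c k) := by
  refine word_induction blockColour_monotone
    (p := fun c => tauDeg (word c.1) k = pairSum crossDeg (colouredWord c k)) ?_ ?_ c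
  · rw [word_of_monotone blockColour_monotone, pairSum, Finset.sum_eq_zero]
    · rfl
    · intro p hp
      rw [colouredWord_base, colouredWord_base, crossDeg, if_neg]
      exact not_lt_of_ge (blockColour_monotone (Finset.mem_filter.1 hp).2.le)
  · intro c r hr hw ih
    have h1 := pairSum_swap crossDeg (colouredWord (c.swap r) k) r
    have hlo : (c.swap r).1 (lo r) = c.1 (hi r) := by simp [Rearr.swap]
    have hhi : (c.swap r).1 (hi r) = c.1 (lo r) := by simp [Rearr.swap]
    have h2 : crossDeg (colouredWord (c.swap r) k (lo r)) (colouredWord (c.swap r) k (hi r)) = 0 := by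
      rw [crossDeg, if_neg]
      simp only [colouredWord, hlo, hhi]
      exact not_lt_of_gt hr
    have h3 : crossDeg (colouredWord (c.swap r) k (hi r)) (colouredWord (c.swap r) k (lo r))
        = degTau r (k.rearrange (permOf (word (c.swap r).1))) := by
      rw [crossDeg, if_pos]
      · simp only [colouredWord, degTau]
        rw [form_comm, mul_comm]
      · simp only [colouredWord, hlo, hhi]
        exact hr
    rw [h2, h3, add_zero, ← colouredWord_swap c k r hw, ← ih] at h1
    rw [h1, hw, tauDeg, add_comm]

theorem Block.hom_mem_component {κ : Multiset (Fin n)} {J : Type} [Fintype J] (b : Block κ ν J)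
    {a : Alg K o κ} {g : ℤ × ZMod 2} (ha : a ∈ component K o κ g) :
    b.hom K o a ∈ component K o ν g := by
  induction ha using Submodule.span_induction with
  | zero => rw [map_zero]; exact zero_mem _
  | add a a' _ _ h h' => rw [map_add]; exact add_mem h h'
  | smul t a _ h => rw [map_smul]; exact Submodule.smul_mem _ t h
  | mem a ha =>
    induction ha with
    | e i => rw [hom_e]; exact sum_mem fun j _ => e_mem_component K o _
    | y r i =>
      rw [hom_y_mul_e, Block.E, Finset.mul_sum]
      refine sum_mem fun j _ => ?_
      have h := y_mul_e_mem_component K o (b.yi r) (b.ins i j)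
      rwa [degY, letter_yi] at h
    | tau r i =>
      rw [hom_tau_mul_e, Block.E, Finset.mul_sum]
      refine sum_mem fun j _ => ?_
      have h := tau_mul_e_mem_component K o (b.ti r) (b.ins i j)
      rwa [degTau, lo_ti, hi_ti, letter_yi, letter_yi] at h
    | mul _ _ h h' => rw [map_mul]; exact mul_mem_component K o h h'

theorem emb_mem_component {a : Alg K o μ} {b : Alg K o ν} {g h : ℤ × ZMod 2}
    (ha : a ∈ component K o μ g) (hb : b ∈ component K o ν h) :
    emb K o μ ν a b ∈ component K o (μ + ν) (g + h) :=
  mul_mem_component K o ((leftBlock μ ν).hom_mem_component K o ha)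
    ((rightBlock μ ν).hom_mem_component K o hb)

theorem emb_e_mul_e_mul (i : Word μ) (j : Word ν) {a : Alg K o μ} {b : Alg K o ν} {g : ℤ × ZMod 2}
    (ha : a ∈ component K o μ g) : e K o (i.concat j) * emb K o μ ν a b
      = emb K o μ ν (e K o i * a) (e K o j * b) := by
  rw [← emb_e_e, emb_mul_emb K o ha (e_mem_component K o j)]
  simp [sgn_zero]

variable (μ ν) in
/-- The span of the homogeneous elements `ρ_c (a ⊗ b)` of a given degree. -/
def arrComponent (g : ℤ × ZMod 2) : Submodule K (leftIdeal K o μ ν) :=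
  Submodule.span K {x | ∃ (c : Rearr (blockColour μ ν)) (i : Word μ) (j : Word ν)
    (ga gb : ℤ × ZMod 2) (a : Alg K o μ) (b : Alg K o ν), a ∈ component K o μ ga ∧
    b ∈ component K o ν gb ∧ e K o i * a = a ∧ e K o j * b = b ∧
    tauDeg (word c.1) (i.concat j) + ga + gb = g ∧
    x = arrEquiv K o μ ν (Finsupp.single c (a ⊗ₜ b))}

theorem mem_component_of_mem_arrComponent {g : ℤ × ZMod 2} {x : leftIdeal K o μ ν}
    (hx : x ∈ arrComponent K o μ ν g) : x.1 ∈ component K o (μ + ν) g := by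
  induction hx using Submodule.span_induction with
  | zero => exact zero_mem _
  | add a a' _ _ h h' => exact add_mem h h'
  | smul t a _ h => exact Submodule.smul_mem _ t h
  | mem x hx =>
    obtain ⟨c, i, j, ga, gb, a, b, ha, hb, hia, hjb, rfl, rfl⟩ := hx
    rw [arrEquiv_single, ← hia, ← hjb, ← emb_e_mul_e_mul K o i j ha, ← e_mul_e_self, ← mul_assoc,
      add_assoc]
    refine mul_mem_component K o (tauProd_mul_e_mem_component K o _ _) ?_
    rw [emb_e_mul_e_mul K o i j ha, hia, hjb]
    exact emb_mem_component K o ha hb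

theorem e_mul_mem_component (i : Word ν) {a : Alg K o ν} {g : ℤ × ZMod 2}
    (ha : a ∈ component K o ν g) : e K o i * a ∈ component K o ν g := by
  have h := mul_mem_component K o (e_mem_component K o i) ha
  rwa [zero_add] at h

theorem iSup_arrComponent : ⨆ g, arrComponent K o μ ν g = ⊤ := by
  refine Submodule.eq_top_iff'.2 fun x => ?_
  obtain ⟨x, rfl⟩ := (arrEquiv K o μ ν).surjective x
  induction x using arr_induction with
  | zero => rw [map_zero]; exact zero_mem _
  | add x x' hx hx' => rw [map_add]; exact add_mem hx hx'
  | hom c g h a ha b hb =>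
    have h1 : a ⊗ₜ[K] b = ∑ i : Word μ, ∑ j : Word ν, (e K o i * a) ⊗ₜ[K] (e K o j * b) := by
      simp_rw [← TensorProduct.tmul_sum, sum_e_mul, ← TensorProduct.sum_tmul, sum_e_mul]
    rw [h1, Finsupp.single_finsetSum, map_sum]
    refine sum_mem fun i _ => ?_
    rw [Finsupp.single_finsetSum, map_sum]
    exact sum_mem fun j _ => Submodule.mem_iSup_of_mem _ (Submodule.subset_span
      ⟨c, i, j, g, h, _, _, e_mul_mem_component K o i ha, e_mul_mem_component K o j hb,
        by rw [← mul_assoc, e_mul_e, if_pos rfl], by rw [← mul_assoc, e_mul_e, if_pos rfl], rfl, rfl⟩)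

/-- The terms `ρ_c (a ⊗ b)` with homogeneous entries of fixed weights span the left ideal, and their
degrees are known. Since the components of the algebra are independent, a homogeneous element is
equal to its part of the right degree in such a decomposition. -/
theorem mem_arrComponent {g : ℤ × ZMod 2} {x : leftIdeal K o μ ν}
    (hx : x.1 ∈ component K o (μ + ν) g) : x ∈ arrComponent K o μ ν g := by
  have h1 : x ∈ ⨆ g, arrComponent K o μ ν g := by rw [iSup_arrComponent]; exact Submodule.mem_top
  obtain ⟨f, hf, hs⟩ := (Submodule.mem_iSup_iff_exists_finsupp _ _).1 h1
  have h2 : parts K o x.1 = f.sum fun h z => Finsupp.single h z.1 := by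
    rw [← hs, Finsupp.sum, Finsupp.sum, AddSubmonoidClass.coe_finsetSum, map_sum]
    exact Finset.sum_congr rfl fun h _ =>
      parts_of_mem K o (mem_component_of_mem_arrComponent K o (hf h))
  rw [parts_of_mem K o hx] at h2
  have h3 := congrArg (fun z => z g) h2
  simp only [Finsupp.single_eq_same] at h3
  have h4 : x = f g := by
    apply Subtype.ext
    rw [h3, Finsupp.sum, Finsupp.finsetSum_apply]
    by_cases hg : g ∈ f.support
    · rw [Finset.sum_eq_single g, Finsupp.single_eq_same]
      · intro h _ hne; rw [Finsupp.single_eq_of_ne (by tauto)]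
      · intro h; exact absurd hg h
    · rw [Finset.sum_eq_zero, Finsupp.notMem_support_iff.1 hg]
      · rfl
      · intro h hh; rw [Finsupp.single_eq_of_ne]; rintro rfl; exact hg hh
  rw [h4]
  exact hf g

end degrees

section induced

variable {K : Type*} [Field K] {n : ℕ} {o : Orientation n} {μ ν : Multiset (Fin n)}
variable {M : Type*} [AddCommGroup M] [Module K M] [Module (Alg K o μ) M]
  [IsScalarTower K (Alg K o μ) M]
  {N : Type*} [AddCommGroup N] [Module K N] [Module (Alg K o ν) N]
  [IsScalarTower K (Alg K o ν) N]
  {ℳ : ℤ × ZMod 2 → Submodule K M} {𝒩 : ℤ × ZMod 2 → Submodule K N}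

theorem coe_rightMul_arrElt_e (c : Rearr (blockColour μ ν)) (i : Word μ) (j : Word ν) :
    (rightMul K o μ ν (arrElt K o μ ν c) (e K o i) (e K o j) : Alg K o (μ + ν))
      = tauProd K o (word c.1) * e K o (i.concat j) := by
  change (arrElt K o μ ν c : Alg K o (μ + ν)) * _ = _
  rw [coe_arrElt, mul_assoc, idemp_mul_emb, emb_e_e]

/-- The element `ρ_c 1_{μ,ν}` has in general neither a degree nor a word. On weight vectors it may
be replaced by `ρ_c e(𝐢𝐣)`, which has both. -/
theorem foldMap_single_eq {g : ℤ × ZMod 2} (c : Rearr (blockColour μ ν)) {i : Word μ} {j : Word ν}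
    {m : M} {v : N} (hm : m ∈ ℳ g) (him : e K o i • m = m) (hjv : e K o j • v = v) :
    foldMap K o μ ν ℳ N (Finsupp.single c (m ⊗ₜ v)) = (balanced K o μ ν ℳ N).mkQ
      (rightMul K o μ ν (arrElt K o μ ν c) (e K o i) (e K o j) ⊗ₜ (m ⊗ₜ v)) := by
  rw [mkQ_rightMul_tmul K o μ ν ℳ _ _ v (e_mem_component K o j) hm, him, hjv, foldMap_single,
    Prod.snd_zero, zero_mul, sgn_zero, one_smul]

theorem foldMap_single_mem {g h : ℤ × ZMod 2} (c : Rearr (blockColour μ ν)) {i : Word μ}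
    {j : Word ν} {m : M} {v : N} (hm : m ∈ ℳ g) (hv : v ∈ 𝒩 h) (him : e K o i • m = m)
    (hjv : e K o j • v = v) : foldMap K o μ ν ℳ N (Finsupp.single c (m ⊗ₜ v)) ∈
      indGrading K o μ ν ℳ 𝒩 (tauDeg (word c.1) (i.concat j) + g + h) := by
  refine Submodule.subset_span ⟨_, g, h, _, m, v, rfl, ?_, hm, hv, foldMap_single_eq c hm him hjv⟩
  rw [coe_rightMul_arrElt_e]
  exact tauProd_mul_e_mem_component K o _ _

theorem e_smul_foldMap_single {g : ℤ × ZMod 2} (c : Rearr (blockColour μ ν)) {i : Word μ}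
    {j : Word ν} {m : M} {v : N} (hm : m ∈ ℳ g) (him : e K o i • m = m)
    (hjv : e K o j • v = v) :
    e K o ((i.concat j).rearrange (permOf (word c.1))) •
      foldMap K o μ ν ℳ N (Finsupp.single c (m ⊗ₜ v))
        = foldMap K o μ ν ℳ N (Finsupp.single c (m ⊗ₜ v)) := by
  rw [foldMap_single_eq c hm him hjv, ← map_smul, TensorProduct.smul_tmul']
  congr 2
  apply Subtype.ext
  change _ * (rightMul K o μ ν (arrElt K o μ ν c) (e K o i) (e K o j) : Alg K o (μ + ν)) = _
  rw [coe_rightMul_arrElt_e, e_mul_tauProd_mul_e]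

/-- The basis of the induced module that comes from bases of the two factors. -/
def indBasis (hM : IsGradedModule o μ ℳ) {β γ : Type*} (b : Module.Basis β K M)
    (b' : Module.Basis γ K N) :
    Module.Basis (Σ _ : Rearr (blockColour μ ν), β × γ) K (Ind K o μ ν ℳ N) :=
  (Finsupp.basis fun _ => b.tensorProduct b').map (foldEquiv K o μ ν hM N)

theorem indBasis_apply (hM : IsGradedModule o μ ℳ) {β γ : Type*} (b : Module.Basis β K M)
    (b' : Module.Basis γ K N) (z : Σ _ : Rearr (blockColour μ ν), β × γ) :
    indBasis hM b b' z = foldMap K o μ ν ℳ N (Finsupp.single z.1 (b z.2.1 ⊗ₜ b' z.2.2)) := by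
  rw [indBasis, Module.Basis.map_apply, Finsupp.coe_basis]
  change foldMap K o μ ν ℳ N (Finsupp.single z.1 (b.tensorProduct b' z.2)) = _
  rw [Module.Basis.tensorProduct_apply']

/-- The weights of the basis of the induced module. -/
def indWeight {β γ : Type*} (w : β → Word μ) (w' : γ → Word ν)
    (z : Σ _ : Rearr (blockColour μ ν), β × γ) : Word (μ + ν) :=
  ((w z.2.1).concat (w' z.2.2)).rearrange (permOf (word z.1.1))

/-- The degrees of the basis of the induced module. -/
def indDeg {β γ : Type*} (w : β → Word μ) (w' : γ → Word ν) (d : β → ℤ × ZMod 2)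
    (d' : γ → ℤ × ZMod 2) (z : Σ _ : Rearr (blockColour μ ν), β × γ) : ℤ × ZMod 2 :=
  tauDeg (word z.1.1) ((w z.2.1).concat (w' z.2.2)) + d z.2.1 + d' z.2.2

variable {β γ : Type*} {b : Module.Basis β K M} {b' : Module.Basis γ K N} {w : β → Word μ}
  {w' : γ → Word ν} {d : β → ℤ × ZMod 2} {d' : γ → ℤ × ZMod 2}

theorem isAdapted_indBasis (hM : IsGradedModule o μ ℳ) (hb : IsAdapted o ℳ b w d)
    (hb' : IsAdapted o 𝒩 b' w' d') :
    IsAdapted o (indGrading K o μ ν ℳ 𝒩) (indBasis hM b b') (indWeight w w')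
      (indDeg w w' d d') where
  mem z := by
    rw [indBasis_apply]
    exact foldMap_single_mem z.1 (hb.mem _) (hb'.mem _) (hb.smul_self _) (hb'.smul_self _)
  smul_self z := by
    rw [indBasis_apply]
    exact e_smul_foldMap_single z.1 (hb.mem _) (hb.smul_self _) (hb'.smul_self _)

theorem foldMap_single_mem_span (hM : IsGradedModule o μ ℳ) (hN : IsGradedModule o ν 𝒩)
    (hb : IsAdapted o ℳ b w d) (hb' : IsAdapted o 𝒩 b' w' d') (c : Rearr (blockColour μ ν))
    {i : Word μ} {j : Word ν} {g h : ℤ × ZMod 2} {m : M} {v : N} (hm : m ∈ ℳ g) (hv : v ∈ 𝒩 h)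
    (him : e K o i • m = m) (hjv : e K o j • v = v) :
    foldMap K o μ ν ℳ N (Finsupp.single c (m ⊗ₜ v)) ∈ Submodule.span K (indBasis hM b b' ''
      {z | indDeg w w' d d' z = tauDeg (word c.1) (i.concat j) + g + h}) := by
  have h1 := hb.mem_span hM hm him
  have h2 := hb'.mem_span hN hv hjv
  clear hm hv him hjv
  induction h1 using Submodule.span_induction with
  | zero => simp
  | add m m' _ _ hm hm' =>
    rw [TensorProduct.add_tmul, Finsupp.single_add, map_add]; exact add_mem hm hm'
  | smul t m _ hm =>
    rw [← TensorProduct.smul_tmul', ← Finsupp.smul_single, map_smul]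
    exact Submodule.smul_mem _ t hm
  | mem m hm =>
    obtain ⟨x, ⟨rfl, rfl⟩, rfl⟩ := hm
    induction h2 using Submodule.span_induction with
    | zero => simp
    | add m m' _ _ hm hm' =>
      rw [TensorProduct.tmul_add, Finsupp.single_add, map_add]; exact add_mem hm hm'
    | smul t m _ hm =>
      rw [TensorProduct.tmul_smul, ← Finsupp.smul_single, map_smul]
      exact Submodule.smul_mem _ t hm
    | mem v hv =>
      obtain ⟨y, ⟨rfl, rfl⟩, rfl⟩ := hv
      exact Submodule.subset_span ⟨⟨c, x, y⟩, rfl, indBasis_apply hM b b' _⟩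

/-- The grading of `M ∘ N` is defined by all homogeneous elements of the left ideal. By
`mem_arrComponent` these reduce to the `ρ_c (a ⊗ b)`; once `a` and `b` have acted on `m` and `v`,
the result is a combination of basis vectors of the same degree. That the components form a direct
sum is then a property of bases. -/
theorem indGrading_eq_span (hM : IsGradedModule o μ ℳ) (hN : IsGradedModule o ν 𝒩)
    (hb : IsAdapted o ℳ b w d) (hb' : IsAdapted o 𝒩 b' w' d') (g : ℤ × ZMod 2) :
    indGrading K o μ ν ℳ 𝒩 g
      = Submodule.span K (indBasis hM b b' '' {z | indDeg w w' d d' z = g}) := by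
  refine le_antisymm (Submodule.span_le.2 ?_) (Submodule.span_le.2 ?_)
  · rintro _ ⟨g₁, g₂, g₃, h, m, v, rfl, hh, hm, hv, rfl⟩
    have h1 := mem_arrComponent K o hh
    change (balanced K o μ ν ℳ N).mkQ _ ∈ Submodule.span K _
    clear hh
    induction h1 using Submodule.span_induction with
    | zero => rw [TensorProduct.zero_tmul, map_zero]; exact zero_mem _
    | add h h' _ _ ih ih' => rw [TensorProduct.add_tmul, map_add]; exact add_mem ih ih'
    | smul t h _ ih =>
      rw [← TensorProduct.smul_tmul']
      have h2 : (balanced K o μ ν ℳ N).mkQ (t • (h ⊗ₜ[K] (m ⊗ₜ[K] v)))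
          = t • (balanced K o μ ν ℳ N).mkQ (h ⊗ₜ[K] (m ⊗ₜ[K] v)) := rfl
      rw [h2]
      exact Submodule.smul_mem _ t ih
    | mem h hh =>
      obtain ⟨c, i, j, ga, gb, a, b, ha, hb0, hia, hjb, rfl, rfl⟩ := hh
      rw [mkQ_arrEquiv_tmul K o μ ν ℳ c a v hb0 hm]
      refine zsmul_mem ?_ _
      have h3 := foldMap_single_mem_span hM hN hb hb' c (i := i) (j := j)
        (hM.smul_mem _ _ _ _ ha hm) (hN.smul_mem _ _ _ _ hb0 hv)
        (by rw [smul_smul, hia]) (by rw [smul_smul, hjb])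
      have h4 : tauDeg (word c.1) (i.concat j) + ga + gb + g₂ + g₃
          = tauDeg (word c.1) (i.concat j) + (ga + g₂) + (gb + g₃) := by abel
      rw [h4]
      exact h3
  · rintro _ ⟨z, rfl, rfl⟩
    exact (isAdapted_indBasis hM hb hb').mem z

theorem isGradedModule_indGrading (hM : IsGradedModule o μ ℳ) (hN : IsGradedModule o ν 𝒩)
    (hb : IsAdapted o ℳ b w d) (hb' : IsAdapted o 𝒩 b' w' d') :
    IsGradedModule o (μ + ν) (indGrading K o μ ν ℳ 𝒩) where
  isInternal := by
    rw [funext (indGrading_eq_span hM hN hb hb')]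
    exact isInternal_of_basis _ _
  smul_mem g h a x ha hx := by
    induction hx using Submodule.span_induction with
    | zero => rw [smul_zero]; exact zero_mem _
    | add x y _ _ hx hy => rw [smul_add]; exact add_mem hx hy
    | smul t x _ hx => rw [smul_comm]; exact Submodule.smul_mem _ t hx
    | mem x hx =>
      obtain ⟨g₁, g₂, g₃, z, m, v, rfl, hz, hm, hv, rfl⟩ := hx
      refine Submodule.subset_span ⟨g + g₁, g₂, g₃, a • z, m, v, ?_, ?_, hm, hv, ?_⟩
      · abel
      · exact mul_mem_component K o ha hz
      · rw [← TensorProduct.smul_tmul', map_smul]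

end induced

/-! ### Shuffles as coloured words -/

section letters

variable {α : Type*}

/-- The letters of a given colour in a coloured word. -/
def letters (t : Bool) (L : List (Bool × α)) : List α := (L.filter fun z => z.1 == t).map Prod.snd

theorem letters_cons (t : Bool) (z : Bool × α) (L : List (Bool × α)) :
    letters t (z :: L) = if z.1 = t then z.2 :: letters t L else letters t L := by
  unfold letters
  split_ifs with h <;> simp [h]

theorem letters_append (t : Bool) (L L' : List (Bool × α)) :
    letters t (L ++ L') = letters t L ++ letters t L' := by
  simp [letters]

theorem letters_reverse (t : Bool) (L : List (Bool × α)) :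
    letters t L.reverse = (letters t L).reverse := by
  simp [letters]

theorem letters_map (t s : Bool) (l : List α) :
    letters t (l.map (Prod.mk s)) = if s = t then l else [] := by
  induction l with
  | nil => simp [letters]
  | cons a l ih =>
    rw [List.map_cons, letters_cons, ih]
    split_ifs <;> rfl

theorem eq_map_of_letters_eq_nil {t : Bool} {L : List (Bool × α)} (h : letters t L = []) :
    L = (letters (!t) L).map (Prod.mk (!t)) := by
  induction L with
  | nil => rfl
  | cons z L ih =>
    obtain ⟨s, a⟩ := z
    rw [letters_cons] at h
    split_ifs at h with h1
    have h2 : s = !t := Bool.eq_not.2 h1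
    rw [letters_cons, if_pos h2, List.map_cons, ← ih h, h2]

theorem perm_map_fst (L : List (Bool × α)) : (L.map Prod.fst).Perm
    (List.replicate (letters false L).length false ++
      List.replicate (letters true L).length true) := by
  induction L with
  | nil => simp [letters]
  | cons z L ih =>
    obtain ⟨s, a⟩ := z
    cases s
    · simpa [letters_cons, List.replicate_succ] using ih
    · simp only [letters_cons, List.map_cons, if_true, List.length_cons, List.replicate_succ]
      exact (ih.cons true).trans List.perm_middle.symm

/-- The colours say at each place from which of the two lists the next letter is taken. -/
theorem ext_of_letters {L L' : List (Bool × α)} (h : L.map Prod.fst = L'.map Prod.fst)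
    (ht : ∀ t, letters t L = letters t L') : L = L' := by
  induction L generalizing L' with
  | nil =>
    symm
    simpa using h.symm
  | cons z L ih =>
    cases L' with
    | nil => simp at h
    | cons z' L' =>
      obtain ⟨s, a⟩ := z
      obtain ⟨s', a'⟩ := z'
      simp only [List.map_cons, List.cons.injEq] at h
      obtain ⟨rfl, h⟩ := h
      have h1 := ht s
      rw [letters_cons, letters_cons, if_pos rfl, if_pos rfl, List.cons.injEq] at h1
      have h3 : a = a' := h1.1
      have h4 : L = L' := ih h fun t => ?_
      · rw [h3, h4]
      by_cases hs : s = t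
      · rw [← hs]; exact h1.2
      · have h2 := ht t
        rwa [letters_cons, letters_cons, if_neg hs, if_neg hs] at h2

theorem length_letters (L : List (Bool × α)) :
    L.length = (letters false L).length + (letters true L).length := by
  have h := (perm_map_fst L).length_eq
  simpa using h

/-- Two functions that differ by the exchange of two adjacent places. -/
theorem exists_ofFn_eq_of_exchange {β : Type*} (r : ℕ) {d : ℕ} (h : r + 1 < d) (f g : Fin d → β)
    (h0 : g ⟨r, by omega⟩ = f ⟨r + 1, h⟩) (h1 : g ⟨r + 1, h⟩ = f ⟨r, by omega⟩)
    (h2 : ∀ x : Fin d, x.val ≠ r → x.val ≠ r + 1 → g x = f x) :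
    ∃ A B : List β, List.ofFn f = A ++ f ⟨r, by omega⟩ :: f ⟨r + 1, h⟩ :: B ∧
      List.ofFn g = A ++ f ⟨r + 1, h⟩ :: f ⟨r, by omega⟩ :: B := by
  induction r generalizing d with
  | zero =>
    obtain ⟨d, rfl⟩ : ∃ d', d = d' + 2 := ⟨d - 2, by omega⟩
    refine ⟨[], List.ofFn fun x : Fin d => f x.succ.succ, ?_, ?_⟩
    · rw [List.ofFn_succ, List.ofFn_succ]; rfl
    · rw [List.ofFn_succ, List.ofFn_succ]
      have h3 : (fun x : Fin d => g x.succ.succ) = fun x => f x.succ.succ := by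
        funext x; exact h2 _ (by simp) (by simp)
      rw [h3, List.nil_append]
      exact congrArg₂ _ h0 (congrArg₂ _ h1 rfl)
  | succ r ih =>
    obtain ⟨d, rfl⟩ : ∃ d', d = d' + 1 := ⟨d - 1, by omega⟩
    obtain ⟨A, B, hA, hB⟩ := ih (by omega) (fun x => f x.succ) (fun x => g x.succ) h0 h1
      (fun x hx hx' => h2 _ (by simpa using hx) (by simpa using hx'))
    refine ⟨f 0 :: A, B, ?_, ?_⟩
    · rw [List.ofFn_succ, hA]; rfl
    · rw [List.ofFn_succ, hB, h2 0 (by simp) (by simp)]; rfl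

/-- At most one of the two exchanged letters has the colour `t`, so the order of the letters of this
colour does not change. -/
theorem letters_ofFn_adjSwap {d : ℕ} (f : Fin d → Bool × α) (r : Fin (d - 1))
    (h : (f (lo r)).1 ≠ (f (hi r)).1) (t : Bool) :
    letters t (List.ofFn (f ∘ adjSwap r)) = letters t (List.ofFn f) := by
  have hr := r.isLt
  obtain ⟨A, B, hA, hB⟩ := exists_ofFn_eq_of_exchange r.val (by omega) f (f ∘ adjSwap r)
    (congrArg f (adjSwap_lo r)) (congrArg f (adjSwap_hi r)) (fun x hx hx' => congrArg f
      (adjSwap_of_ne (fun h => hx (congrArg Fin.val h)) fun h => hx' (congrArg Fin.val h)))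
  change (f ⟨r.val, _⟩).1 ≠ (f ⟨r.val + 1, _⟩).1 at h
  rw [hA, hB, letters_append, letters_append, letters_cons, letters_cons, letters_cons,
    letters_cons]
  split_ifs with h1 h2 <;> first | rfl | exact absurd (by simp_all) h

end letters

section shuffles

variable {n : ℕ}

/-- The degree of a coloured word that is given in reversed order. -/
def listDeg : List (Bool × Fin n) → ℤ × ZMod 2
  | [] => 0
  | t :: L => listDeg L + (L.map (crossDeg · t)).sum

theorem pairSum_succ {G α : Type*} [AddCommMonoid G] (F : α → α → G) {d : ℕ} (f : Fin (d + 1) → α) :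
    pairSum F f = pairSum F (fun x : Fin d => f x.castSucc)
      + ∑ x : Fin d, F (f x.castSucc) (f (Fin.last d)) := by
  simp only [pairSum, Finset.sum_filter, Fintype.sum_prod_type, Fin.sum_univ_castSucc,
    Fin.castSucc_lt_castSucc_iff, Fin.castSucc_lt_last, if_true, lt_irrefl, if_false, add_zero,
    Finset.sum_add_distrib]
  simp [not_lt_of_gt (Fin.castSucc_lt_last _)]

/-- The head of the reversed list is the last letter, and the recursion adds its crossings with all
letters before it. -/
theorem listDeg_reverse_ofFn {d : ℕ} (f : Fin d → Bool × Fin n) :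
    listDeg (List.ofFn f).reverse = pairSum crossDeg f := by
  induction d with
  | zero => simp [listDeg, pairSum]
  | succ d ih =>
    rw [pairSum_succ, List.ofFn_succ', List.concat_eq_append, List.reverse_concat, listDeg, ih, List.map_reverse,
      List.sum_reverse, List.map_ofFn, List.sum_ofFn]
    rfl

theorem crossDeg_of_le {a b : Bool × Fin n} (h : a.1 ≤ b.1) : crossDeg a b = 0 :=
  if_neg (not_lt_of_ge h)

theorem listDeg_map (t : Bool) (l : List (Fin n)) : listDeg (l.map (Prod.mk t)) = 0 := by
  induction l with
  | nil => rfl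
  | cons a l ih =>
    rw [List.map_cons, listDeg, ih, zero_add, List.sum_eq_zero]
    intro z hz
    simp only [List.map_map, List.mem_map, Function.comp_apply] at hz
    obtain ⟨x, -, rfl⟩ := hz
    exact crossDeg_of_le le_rfl

theorem listDeg_true_cons (i : Fin n) (L : List (Bool × Fin n)) :
    listDeg ((true, i) :: L) = listDeg L := by
  rw [listDeg, List.sum_eq_zero, add_zero]
  intro z hz
  obtain ⟨x, -, rfl⟩ := List.mem_map.1 hz
  exact crossDeg_of_le le_top

/-- A new last letter of the second word crosses exactly the letters of the first word that precede
it. The sum of these degrees is the exponent and the sign of `shuffleCoeff`. -/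
theorem sum_crossDeg_false (j : Fin n) (L : List (Bool × Fin n)) :
    (L.map (crossDeg · (false, j))).sum = (-wform (letters true L) j, wpar (letters true L) * par j) := by
  induction L with
  | nil =>
    simp only [letters, wform, wpar, List.map_nil, List.filter_nil, List.sum_nil, neg_zero, zero_mul]
    rfl
  | cons z L ih =>
    obtain ⟨s, a⟩ := z
    rw [List.map_cons, List.sum_cons, ih, letters_cons]
    cases s
    · rw [crossDeg_of_le (a := (false, a)) (b := (false, j)) le_rfl, zero_add, if_neg (by simp)]
    · rw [if_pos rfl]
      simp only [crossDeg, Bool.false_lt_true, if_true, wform, wpar, List.map_cons, List.sum_cons,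
        Prod.mk_add_mk, Prod.mk.injEq]
      constructor <;> ring

theorem shuffleCoeff_reverse (x : List (Fin n)) (j : Fin n) :
    shuffleCoeff x.reverse j = weight (-wform x j, wpar x * par j) := by
  simp only [shuffleCoeff, weight, wpar, wform, List.map_reverse, List.sum_reverse]

/-- The coloured words with given letters of the two colours. -/
def colourings : List (Fin n) → List (Fin n) → Finset (List (Bool × Fin n))
  | [], y => {y.map (Prod.mk false)}
  | i :: x, [] => {(i :: x).map (Prod.mk true)}
  | i :: x, j :: y => (colourings x (j :: y)).image (List.cons (true, i))
      ∪ (colourings (i :: x) y).image (List.cons (false, j))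
  termination_by x y => x.length + y.length

theorem mem_colourings (x y : List (Fin n)) (L : List (Bool × Fin n)) :
    L ∈ colourings x y ↔ letters true L = x ∧ letters false L = y := by
  induction x, y using colourings.induct generalizing L with
  | case1 y =>
    rw [colourings, Finset.mem_singleton]
    constructor
    · rintro rfl; simp [letters_map]
    · rintro ⟨h, rfl⟩; exact eq_map_of_letters_eq_nil h
  | case2 i x =>
    rw [colourings, Finset.mem_singleton]
    constructor
    · rintro rfl; simp only [letters_map]; simp
    · rintro ⟨h, h'⟩; rw [← h]; exact eq_map_of_letters_eq_nil h'
  | case3 i x j y ih ih' =>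
    rw [colourings, Finset.mem_union, Finset.mem_image, Finset.mem_image]
    constructor
    · rintro (⟨L, hL, rfl⟩ | ⟨L, hL, rfl⟩)
      · rw [ih] at hL; simp [letters_cons, hL]
      · rw [ih'] at hL; simp [letters_cons, hL]
    · rintro ⟨h, h'⟩
      cases L with
      | nil => simp [letters] at h
      | cons z L =>
        obtain ⟨s, a⟩ := z
        rw [letters_cons] at h h'
        cases s
        · simp only [if_true, List.cons.injEq, Bool.false_eq_true, if_false] at h h'
          exact Or.inr ⟨L, (ih' L).2 ⟨h, h'.2⟩, by rw [h'.1]⟩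
        · simp only [if_true, List.cons.injEq, Bool.true_eq_false, if_false] at h h'
          exact Or.inl ⟨L, (ih L).2 ⟨h.2, h'⟩, by rw [h.1]⟩

theorem snoc_sum_single {ι : Type*} (s : Finset ι) (f : ι → List (Fin n)) (a : ι → RatFunc ℚ)
    (i : Fin n) : snoc (∑ x ∈ s, Finsupp.single (f x) (a x)) i
      = ∑ x ∈ s, Finsupp.single (f x ++ [i]) (a x) := by
  rw [snoc, Finsupp.mapDomain_finsetSum]
  simp only [Finsupp.mapDomain_single]

/-- The recursion splits according to the colour of the last letter. A last letter of the first
word, which is coloured `true`, crosses nothing. A last letter of the second word comes after the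
whole first word and gives the factor of the recursion. -/
theorem shuffleRev_eq_sum (x y : List (Fin n)) : shuffleRev x y
    = ∑ L ∈ colourings x y, Finsupp.single (L.map Prod.snd).reverse (weight (listDeg L)) := by
  induction x, y using colourings.induct with
  | case1 y =>
    rw [colourings, Finset.sum_singleton, listDeg_map, weight_zero, shuffleRev]
    simp [Function.comp_def]
  | case2 i x =>
    rw [colourings, Finset.sum_singleton, listDeg_map, weight_zero, shuffleRev]
    simp [Function.comp_def]
  | case3 i x j y ih ih' =>
    rw [colourings, Finset.sum_union, Finset.sum_image (List.cons_injective.injOn),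
      Finset.sum_image (List.cons_injective.injOn), shuffleRev, ih, ih', snoc_sum_single,
      snoc_sum_single, Finset.smul_sum]
    · congr 1
      · refine Finset.sum_congr rfl fun L _ => ?_
        rw [listDeg_true_cons, List.map_cons, List.reverse_cons]
      · have hco : shuffleCoeff (x.reverse ++ [i]) j
            = weight (-wform (i :: x) j, wpar (i :: x) * par j) := by
          rw [← List.reverse_cons, shuffleCoeff_reverse]
        refine Finset.sum_congr rfl fun L hL => ?_
        rw [listDeg, sum_crossDeg_false, ((mem_colourings _ _ _).1 hL).1, List.map_cons,
          List.reverse_cons, Finsupp.smul_single, hco, weight_add, smul_eq_mul,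
          mul_comm, List.reverse_cons]
    · rw [Finset.disjoint_left]
      rintro L hL hL'
      obtain ⟨L, -, rfl⟩ := Finset.mem_image.1 hL
      obtain ⟨L', -, h⟩ := Finset.mem_image.1 hL'
      simp at h

variable {μ ν : Multiset (Fin n)}

theorem ofFn_colouredWord_base (i : Word μ) (j : Word ν) :
    List.ofFn (colouredWord ⟨blockColour μ ν, rfl⟩ (i.concat j))
      = i.toList.map (Prod.mk false) ++ j.toList.map (Prod.mk true) := by
  refine List.ext_getElem ?_ fun k h1 h2 => ?_
  · simp [Word.toList]
  · rw [List.length_ofFn] at h1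
    rw [List.getElem_ofFn, colouredWord_base]
    by_cases hk : k < μ.card
    · rw [List.getElem_append_left (by simpa [Word.toList] using hk), Word.concat_left _ _ _ hk]
      simp [blockColour, hk, Word.toList]
    · rw [List.getElem_append_right (by simpa [Word.toList] using hk), Word.concat_right _ _ _
        (by simpa using hk) (by rw [Multiset.card_add] at h1; simp only []; omega)]
      simp only [not_lt] at hk
      simp [blockColour, hk, Word.toList]

/-- Along the canonical word only letters of different colours are exchanged, so the two words are
never changed internally. Therefore the result is a shuffle of `𝐢` and `𝐣`. -/
theorem letters_colouredWord (c : Rearr (blockColour μ ν)) (i : Word μ) (j : Word ν) (t : Bool) :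
    letters t (List.ofFn (colouredWord c (i.concat j)))
      = if t then j.toList else i.toList := by
  refine word_induction blockColour_monotone (p := fun c => letters t
    (List.ofFn (colouredWord c (i.concat j))) = if t then j.toList else i.toList) ?_ ?_ c
  · rw [ofFn_colouredWord_base, letters_append, letters_map, letters_map]
    cases t <;> simp
  · intro c r hr hw ih
    rw [colouredWord_swap c _ r hw, letters_ofFn_adjSwap, ih]
    simp only [colouredWord, Rearr.swap, Function.comp_apply, adjSwap_lo, adjSwap_hi]
    exact hr.ne

theorem exists_ofFn_eq {α : Type*} {d : ℕ} {l : List α} (h : l.length = d) :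
    ∃ f : Fin d → α, List.ofFn f = l := by
  subst h
  exact ⟨l.get, List.ofFn_get l⟩

theorem map_fst_ofFn_colouredWord (c : Rearr (blockColour μ ν)) (k : Word (μ + ν)) :
    (List.ofFn (colouredWord c k)).map Prod.fst = List.ofFn c.1 := by
  rw [List.map_ofFn]; rfl

/-- The shuffle product of two words as a sum over the arrangements of the two blocks. -/
theorem wordShuffle_eq_sum (i : Word μ) (j : Word ν) : wordShuffle j.toList i.toList
    = ∑ c : Rearr (blockColour μ ν), Finsupp.single
        ((i.concat j).rearrange (permOf (word c.1))).toList
        (weight (tauDeg (word c.1) (i.concat j))) := by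
  rw [wordShuffle, shuffleRev_eq_sum]
  symm
  -- The bijection sends `c` to the coloured word it leads to, reversed as in the recursion; `c` can
  -- be read off from its colours.
  refine Finset.sum_bij (fun c _ => (List.ofFn (colouredWord c (i.concat j))).reverse) ?_ ?_ ?_ ?_
  · intro c _
    rw [mem_colourings, letters_reverse, letters_reverse, letters_colouredWord,
      letters_colouredWord]
    exact ⟨rfl, rfl⟩
  · intro c _ c' _ h
    have h1 := congrArg (List.map Prod.fst) (List.reverse_injective h)
    rw [map_fst_ofFn_colouredWord, map_fst_ofFn_colouredWord] at h1
    exact Subtype.ext (List.ofFn_injective h1)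
  · intro L hL
    rw [mem_colourings] at hL
    have hl : ∀ t, letters t L.reverse = if t then j.toList else i.toList := by
      intro t
      rw [letters_reverse]
      cases t
      · rw [hL.2, List.reverse_reverse]; rfl
      · rw [hL.1, List.reverse_reverse]; rfl
    have hlen : (L.reverse.map Prod.fst).length = (μ + ν).card := by
      rw [List.length_map, length_letters, hl, hl, Multiset.card_add]
      simp [Word.toList]
    obtain ⟨f, hf⟩ := exists_ofFn_eq hlen
    -- The number of places of each colour is the length of the corresponding word, so the colours
    -- of `L` are a rearrangement of the block colouring.
    have hc : Finset.univ.val.map f = Finset.univ.val.map (blockColour μ ν) := by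
      obtain ⟨c₀, h₀⟩ : ∃ c₀ : Rearr (blockColour μ ν), c₀.1 = blockColour μ ν := ⟨⟨_, rfl⟩, rfl⟩
      rw [Fin.univ_val_map, Fin.univ_val_map, Multiset.coe_eq_coe, hf, ← h₀,
        ← map_fst_ofFn_colouredWord c₀ (i.concat j)]
      refine (perm_map_fst _).trans ((perm_map_fst _).trans ?_).symm
      rw [letters_colouredWord, letters_colouredWord, hl, hl]
    obtain ⟨c, rfl⟩ : ∃ c : Rearr (blockColour μ ν), c.1 = f := ⟨⟨f, hc⟩, rfl⟩
    refine ⟨c, Finset.mem_univ _, ?_⟩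
    rw [List.reverse_eq_iff]
    refine ext_of_letters ?_ fun t => ?_
    · rw [map_fst_ofFn_colouredWord, hf]
    · rw [letters_colouredWord, hl]
  · intro c _
    rw [List.map_reverse, List.reverse_reverse, List.map_ofFn, listDeg_reverse_ofFn, tauDeg_word]
    rfl

theorem sum_single_shuffle {β γ : Type*} [Fintype β] [Fintype γ] (u : β → List (Fin n))
    (v : γ → List (Fin n)) (a : β → RatFunc ℚ) (b : γ → RatFunc ℚ) :
    shuffle (∑ x, Finsupp.single (u x) (a x)) (∑ y, Finsupp.single (v y) (b y))
      = ∑ x, ∑ y, (a x * b y) • wordShuffle (u x) (v y) := by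
  have h1 : ∀ (w : List (Fin n)) (t : RatFunc ℚ),
      ((∑ y, Finsupp.single (v y) (b y)).sum fun y s => (t * s) • wordShuffle w y)
        = ∑ y, (t * b y) • wordShuffle w (v y) := by
    intro w t
    rw [← Finsupp.sum_finsetSum_index (by simp) (by intros; rw [mul_add, add_smul])]
    exact Finset.sum_congr rfl fun y _ => Finsupp.sum_single_index (by simp)
  rw [shuffle, ← Finsupp.sum_finsetSum_index]
  · refine Finset.sum_congr rfl fun x _ => ?_
    rw [Finsupp.sum_single_index, h1]
    rw [h1]; simp
  · intro w; rw [h1]; simp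
  · intro w t t'
    rw [h1, h1, h1, ← Finset.sum_add_distrib]
    exact Finset.sum_congr rfl fun y _ => by rw [add_mul, add_smul]

end shuffles

end SpinHecke

end

/-! ### Finiteness, grading and character of the induced module. -/

theorem proposition2p3 {K : Type*} [Field K] (hK : ringChar K ≠ 2) {n : ℕ} (hn : 1 ≤ n)
    (o : SpinHecke.Orientation n) (μ ν : Multiset (Fin n))
    {M : Type*} [AddCommGroup M] [Module K M] [Module (SpinHecke.Alg K o μ) M]
    [IsScalarTower K (SpinHecke.Alg K o μ) M] [Module.Finite K M]
    (ℳ : ℤ × ZMod 2 → Submodule K M) (hM : SpinHecke.IsGradedModule o μ ℳ)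
    {N : Type*} [AddCommGroup N] [Module K N] [Module (SpinHecke.Alg K o ν) N]
    [IsScalarTower K (SpinHecke.Alg K o ν) N] [Module.Finite K N]
    (𝒩 : ℤ × ZMod 2 → Submodule K N) (hN : SpinHecke.IsGradedModule o ν 𝒩) :
    Module.Finite K (SpinHecke.Ind K o μ ν ℳ N) ∧
    SpinHecke.IsGradedModule o (μ + ν) (SpinHecke.indGrading K o μ ν ℳ 𝒩) ∧
    SpinHecke.character o (μ + ν) (SpinHecke.indGrading K o μ ν ℳ 𝒩) =
      SpinHecke.shuffle (SpinHecke.character o ν 𝒩) (SpinHecke.character o μ ℳ) := by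
  obtain ⟨β, _, b, w, d, hb⟩ := SpinHecke.exists_isAdapted hM
  obtain ⟨γ, _, b', w', d', hb'⟩ := SpinHecke.exists_isAdapted hN
  have hI := SpinHecke.isGradedModule_indGrading hM hN hb hb'
  refine ⟨Module.Finite.of_basis (SpinHecke.indBasis hM b b'), hI, ?_⟩
  -- All three characters become sums over adapted bases. It remains to compare the terms for each
  -- `c` and each pair of basis vectors, where the weight of a sum of degrees is the product of the
  -- weights.
  rw [(SpinHecke.isAdapted_indBasis hM hb hb').character_eq hI, hb.character_eq hM,
    hb'.character_eq hN, SpinHecke.sum_single_shuffle, Fintype.sum_sigma, Finset.sum_comm]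
  simp_rw [SpinHecke.wordShuffle_eq_sum, Finset.smul_sum, Finsupp.smul_single]
  rw [Fintype.sum_prod_type_right]
  refine Finset.sum_congr rfl fun y _ => Finset.sum_congr rfl fun x _ =>
    Finset.sum_congr rfl fun c _ => ?_
  simp only [SpinHecke.indWeight, SpinHecke.indDeg, SpinHecke.weight_add, smul_eq_mul]
  congr 1
  ring
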